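/- For integers $k,n\ge 1$ let $d_k(n)$ be the number of ways of writing $n$ as a product of $k$ factors. For $h\ge1$ and real $x\ge 1$ put $$\Delta_k(x,h)=\sum_{n\le x}d_k(n)d_k(n+h)-\int_0^x\mathfrak S_k(y,h)\,dy,\qquad \mathfrak S_k(y,h)=\sum_{q=1}^\infty\frac{c_q(h)}{q^2}\,Q_k(y,q)^2,$$ where $c_q(h)=\sum_{d\mid(h,q)}d\,\mu(q/d)$ is the Ramanujan sum, $$Q_k(y,q)=\operatorname*{Res}_{s=1}\Big(\zeta(s)^kA_k(s,q)(y/q)^{s-1}\Big),\quad A_k(s,q)=\sum_{d\mid q}\frac{\mu(d)}{\varphi(d)}d^s\sum_{e\mid d}\frac{\mu(e)}{e^s}\,g_k\Big(s,\frac{qe}{d}\Big),$$ $$g_k(s,m)=\prod_{p^\alpha\| m,\ \alpha\ge1}(1-p^{-s})^k\sum_{j\ge0}\frac{d_k(p^{j+\alpha})}{p^{js}}.$$ (The integral is $x\,P_{2k-2}(\log x;h)$, with $P_{2k-2}$ a polynomial of degree $2k-2$ in $\log x$ whose coefficients depend on $k$ and $h$; it is the expected main term.) For $\eta>0$, $T>0$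 and $0<M<M'\le 2M$ let $$G_k^{(\eta)}(M,M';T)=\sup_{M\le x\le M',\ 1\le t\le M^{1+\eta}/T}\Big|\sum_{h\le t}\Delta_k(x,h)\Big|.$$ (i) Let $k\ge3$ be an integer. Suppose that for every $\varepsilon>0$ there is $\eta\in(0,\varepsilon]$ such that for every $A>0$ there are constants $C,T_0$ with $$G_k^{(\eta)}(M,M';T)\le C\,T^{\varepsilon}M^{1+\varepsilon}\qquad\text{whenever } T\ge T_0,\ T^{1+\eta}\le M\le A\,T^{k/2},\ M<M'\le2M.$$ Then, for every $\varepsilon>0$, $\int_0^T|\zeta(\tfrac12+it)|^{2k}\,dt\ll_{k,\varepsilon}T^{1+\varepsilon}$ as $T\to\infty$. (ii) Suppose that for some $\delta>0$ and every $\varepsilon>0$ one has, for all sufficiently large $x$, $\sum_{h\le H}\Delta_3(x,h)\ll_\varepsilon Hx^{2/3+\varepsilon}$ uniformly for $1\le H\le x^{1/3+\delta}$. Then, for every $\varepsilon>0$, $\int_0^T|\zeta(\tfrac12+it)|^{6}\,dt\ll_{\varepsilon}T^{1+\varepsilon}$ as $T\to\infty$. -/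

import Mathlib

open Filter Asymptotics

open scoped Topology

noncomputable section

namespace DivisorMoment

/-- The general divisor function `d_k(n)`, the number of ways to write `n` as a product of `k`
factors: the `k`-fold Dirichlet power of the constant function `1`, so that
`ζ(s)^k = ∑ d_k(n) n^{-s}` for `Re s > 1`. -/
def dk (k n : ℕ) : ℕ := (ArithmeticFunction.zeta ^ k : ArithmeticFunction ℕ) n

/-- The Ramanujan sum `c_q(h) = ∑_{d ∣ (h, q)} d μ(q / d)`. -/
def ramanujanSum (q h : ℕ) : ℤ :=
  ∑ d ∈ (Nat.gcd h q).divisors, (d : ℤ) * ArithmeticFunction.moebius (q / d)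

/-- The local factors
`g_k(s, q) = ∏_{p ∣ q} (1 - p^{-s})^k ∑_{j ≥ 0} d_k(p^{j + α_p}) p^{-js}`, where `p^{α_p} ∥ q`. -/
def localFactor (k : ℕ) (s : ℂ) (q : ℕ) : ℂ :=
  ∏ p ∈ q.primeFactors,
    (1 - (p : ℂ) ^ (-s)) ^ k *
      ∑' j : ℕ, (dk k (p ^ (j + q.factorization p)) : ℂ) * (p : ℂ) ^ (-((j : ℂ) * s))

/-- The arithmetic factor
`A_k(s, q) = ∑_{d ∣ q} (μ(d) / φ(d)) d^s ∑_{e ∣ d} μ(e) e^{-s} g_k(s, q e / d)`.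
For `(a, q) = 1` the additively twisted series `∑ d_k(n) e(a n / q) n^{-s}` has the same polar part
at `s = 1` as `ζ(s)^k A_k(s, q) q^{-s}`. -/
def arithFactor (k : ℕ) (s : ℂ) (q : ℕ) : ℂ :=
  ∑ d ∈ q.divisors,
    ((ArithmeticFunction.moebius d : ℤ) : ℂ) / (Nat.totient d : ℂ) * (d : ℂ) ^ s *
      ∑ e ∈ d.divisors,
        ((ArithmeticFunction.moebius e : ℤ) : ℂ) * (e : ℂ) ^ (-s) * localFactor k s (q * e / d)

/-- `Q_k(x, q) = Res_{s = 1} ζ(s)^k A_k(s, q) (x / q)^{s - 1}`, written as a contour integral over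
a circle around the only pole `s = 1` in `Re s > 0`. It is a real polynomial in `log x`
of degree at most `k - 1`, with coefficients depending on `q`. -/
def Q (k : ℕ) (x : ℝ) (q : ℕ) : ℝ :=
  ((2 * (Real.pi : ℂ) * Complex.I)⁻¹ *
    circleIntegral
      (fun s : ℂ => riemannZeta s ^ k * arithFactor k s q * ((x / q : ℝ) : ℂ) ^ (s - 1))
      1 (1 / 8)).re

/-- The singular series `𝔖_k(x, h) = ∑_{q ≥ 1} c_q(h) q^{-2} Q_k(x, q)^2`, a polynomial of degree
`2k - 2` in `log x`. -/
def singularSeries (k : ℕ) (x : ℝ) (h : ℕ) : ℝ :=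
  ∑' q : ℕ, if q = 0 then 0 else (ramanujanSum q h : ℝ) / (q : ℝ) ^ 2 * Q k x q ^ 2

/-- The main term `x P_{2k-2}(log x; h) = ∫_0^x 𝔖_k(y, h) dy` of the additive divisor problem. -/
def mainTerm (k : ℕ) (x : ℝ) (h : ℕ) : ℝ :=
  ∫ y in (0 : ℝ)..x, singularSeries k y h

/-- The error term of the general additive divisor problem,
`Δ_k(x, h) = ∑_{n ≤ x} d_k(n) d_k(n + h) - x P_{2k-2}(log x; h)`. -/
def Delta (k : ℕ) (x : ℝ) (h : ℕ) : ℝ :=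
  (∑ n ∈ Finset.Icc 1 ⌊x⌋₊, (dk k n : ℝ) * (dk k (n + h) : ℝ)) - mainTerm k x h

/-- The sum `∑_{1 ≤ h ≤ t} Δ_k(x, h)` over the shift parameter. -/
def shiftSum (k : ℕ) (x t : ℝ) : ℝ :=
  ∑ h ∈ Finset.Icc 1 ⌊t⌋₊, Delta k x h

/-- `G_k(M; T) = sup_{M ≤ x ≤ M', 1 ≤ t ≤ M^{1+η}/T} |∑_{h ≤ t} Δ_k(x, h)|`, a supremum in
`[0, ∞]`. -/
def G (k : ℕ) (η M M' T : ℝ) : ENNReal :=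
  ⨆ x ∈ Set.Icc M M', ⨆ t ∈ Set.Icc (1 : ℝ) (M ^ (1 + η) / T), ENNReal.ofReal |shiftSum k x t|

/-- The bound `G_k(M; T) ≪_{k,ε} T^{a+ε} M^{b+ε}` for `M < M' ≤ 2M`, `T^{1+ε} ≤ M ≪ T^{k/2}`.
The `ε` in the bound is an arbitrary positive number, and the `ε` (here `η`) that occurs in the
ranges may be any positive number up to that size; `M ≪ T^{k/2}` means `M ≤ A T^{k/2}` with an
arbitrary fixed `A`. -/
def ShiftBound (k : ℕ) (a b : ℝ) : Prop :=
  ∀ ε : ℝ, 0 < ε → ∃ η : ℝ, 0 < η ∧ η ≤ ε ∧ ∀ A : ℝ, 0 < A →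
    ∃ C : ℝ, ∀ᶠ T : ℝ in atTop, ∀ M M' : ℝ,
      T ^ (1 + η) ≤ M → M ≤ A * T ^ ((k : ℝ) / 2) → M < M' → M' ≤ 2 * M →
        G k η M M' T ≤ ENNReal.ofReal (C * T ^ (a + ε) * M ^ (b + ε))

/-- The conjectural bound `∑_{h ≤ H} Δ_3(x, h) ≪_ε H x^{2/3+ε}` for `1 ≤ H ≤ x^{1/3+δ}`,
for some `δ > 0`. -/
def TernaryShiftConjecture : Prop :=
  ∃ δ : ℝ, 0 < δ ∧ ∀ ε : ℝ, 0 < ε → ∃ C : ℝ, ∀ᶠ x : ℝ in atTop, ∀ H : ℝ,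
    1 ≤ H → H ≤ x ^ (1 / 3 + δ) → |shiftSum 3 x H| ≤ C * H * x ^ (2 / 3 + ε)

/-- `∫_0^T |ζ(1/2 + it)|^{2k} dt ≪_{k,ε} T^{1+ε}` for every `ε > 0`. -/
def MomentBound (k : ℕ) : Prop :=
  ∀ ε : ℝ, 0 < ε →
    (fun T : ℝ => ∫ t in (0 : ℝ)..T, ‖riemannZeta (1 / 2 + (t : ℂ) * Complex.I)‖ ^ (2 * k))
      =O[atTop] fun T : ℝ => T ^ (1 + ε)

end DivisorMoment

end

/-! The moment is first bounded on a line `σ = 1/2 + δ` slightly right of the critical line. There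
`ζ(s)^k` is approximated by the smoothed Dirichlet polynomial `dirPoly` of length about `Y = T^(k/2
+ η/8)`. By Mellin inversion with the kernel `exp(w²)/w`, the difference `ζ^k - dirPoly` is an
integral over `Re w = -2δ`, up to small errors. The functional equation reflects the point `1/2 - δ
+ it` back to the same line `1/2 + δ` at a cost `|t|^δ` per factor. So the mean square of the
difference is at most `Y^(-4δ) T^(2kδ) = T^(-δη/2)` times the very moment in question. A bound `T^μ`
for the moment therefore improves to `T^(μ - δη/2)`, provided that the mean square of `dirPoly` is
under control; finitely many rounds, starting from the trivial exponent `2k + 1`, reach `1 + O(ε)`.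

The mean square of `dirPoly` is taken against `wt T t = (t/T)² exp(-(t/T)²)`. Its diagonal is `T` up
to a small power. The off-diagonal part is a sum over shifts `h` of correlations of `d_k` with a
smooth weight. On dyadic blocks, partial summation in `n` and `h` brings in the averages of `Δ_k(x,
h)` over `h`, which the hypothesis bounds, and leaves the singular series. Averaging Ramanujan sums
over `h` removes every modulus `q > 1` up to a small error, and `q = 1` leaves `Q_k(x, 1)²` times
the integral of the weight over `h`. Because `wt` vanishes at `t = 0`, the order-one part of that
integral vanishes; the next part is `-√π/T` times an explicit expression, which an integration by
parts turns into a positive quantity, `mainMass / T`. It is at least of order `Y^(1-2δ)/T`, which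
exceeds `T` for large `k`.

This main term is removed by comparing two lengths. The polynomials of lengths `Y` and `32Y`
approximate the same `ζ^k`, so their mean squares agree within constant factors and small errors.
But `mainMass` grows by at least `32^(1-2δ) ≥ 16` between the two, more than those factors allow, so
`mainMass / T` is itself bounded by the errors. The carrying results are
`exists_abs_integral_sub_mainMass_le`, `exists_norm_zeta_pow_sub_dirPoly_sq_le`, `mainMass_scale`
and `ShiftBound.exists_hasMoment_max`.

A last contour argument moves from `1/2 + δ` to the critical line with a loss `T^(2kδ)`, and `δ` is
taken small. For part (ii), the constraint `M ≪ T^(3/2)` gives `M^(2/3) ≪ T`, so the ternary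
conjecture implies the hypothesis of (i) for `k = 3`. -/

noncomputable section

namespace DivisorMoment

/-! ### Size of `d_k` and its Dirichlet series. -/

theorem dk_succ (k n : ℕ) : dk (k + 1) n = ∑ d ∈ n.divisors, dk k d := by
  unfold dk
  rw [pow_succ, ArithmeticFunction.mul_zeta_apply]

theorem dk_le_card_divisors_pow (k n : ℕ) (hn : n ≠ 0) :
    dk k n ≤ n.divisors.card ^ k := by
  induction k generalizing n with
  | zero =>
    simp only [dk, pow_zero, ArithmeticFunction.one_apply]
    split_ifs <;> simp
  | succ k ih =>
    rw [dk_succ]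
    calc ∑ d ∈ n.divisors, dk k d ≤ ∑ d ∈ n.divisors, n.divisors.card ^ k := by
          refine Finset.sum_le_sum fun d hd => ?_
          have hd' := Nat.dvd_of_mem_divisors hd
          refine (ih d (Nat.pos_of_mem_divisors hd).ne').trans ?_
          exact Nat.pow_le_pow_left (Finset.card_le_card (Nat.divisors_subset_of_dvd hn hd')) k
      _ = _ := by simp [pow_succ, mul_comm]

/-- Growth of the divisor function on prime powers. -/
theorem exists_add_one_le_rpow {ε : ℝ} (hε : 0 < ε) :
    ∃ C : ℝ, 1 ≤ C ∧ ∀ a : ℕ, (a + 1 : ℝ) ≤ C * (2 : ℝ) ^ (ε * a) := by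
  have hl : 0 < Real.log 2 := Real.log_pos (by norm_num)
  refine ⟨1 + 1 / (ε * Real.log 2), by have : 0 < 1 / (ε * Real.log 2) := by positivity
                                       linarith, fun a => ?_⟩
  have h1 : 1 + Real.log 2 * (ε * a) ≤ (2 : ℝ) ^ (ε * a) := by
    rw [Real.rpow_def_of_pos (by norm_num)]
    linarith [Real.add_one_le_exp (Real.log 2 * (ε * a))]
  have h2 : (0 : ℝ) < 1 / (ε * Real.log 2) := by positivity
  have h3 : (0 : ℝ) ≤ Real.log 2 * (ε * a) := by positivity
  calc (a + 1 : ℝ) ≤ (1 + 1 / (ε * Real.log 2)) * (1 + Real.log 2 * (ε * a)) := by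
        have : 1 / (ε * Real.log 2) * (Real.log 2 * (ε * a)) = a := by field_simp
        nlinarith
    _ ≤ _ := by gcongr

/-- In the product over `p^a ∥ n`, a prime `p ≥ 2^(1/ε)` satisfies `a + 1 ≤ 2^a ≤ p^(εa)` at no
cost. Each smaller prime costs one factor `C`, and there are at most `P` of them. -/
theorem card_divisors_le_rpow {ε : ℝ} (hε : 0 < ε) :
    ∃ C : ℝ, 1 ≤ C ∧ ∀ n : ℕ, n ≠ 0 → (n.divisors.card : ℝ) ≤ C * (n : ℝ) ^ ε := by
  obtain ⟨C, hC, hCa⟩ := exists_add_one_le_rpow hε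
  obtain ⟨P, hP⟩ : ∃ P : ℕ, (2 : ℝ) ^ (1 / ε) ≤ P := exists_nat_ge _
  refine ⟨C ^ P, one_le_pow₀ hC, fun n hn => ?_⟩
  have hcard : (n.divisors.card : ℝ) = ∏ p ∈ n.primeFactors, ((n.factorization p : ℝ) + 1) := by
    rw [Nat.card_divisors hn]; push_cast; rfl
  have hnn : (n : ℝ) ^ ε = ∏ p ∈ n.primeFactors, ((p : ℝ) ^ (ε * n.factorization p)) := by
    conv_lhs => rw [← Nat.prod_factorization_pow_eq_self hn]
    rw [Finsupp.prod, Nat.support_factorization, Nat.cast_prod,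
      ← Real.finsetProd_rpow _ _ (fun i _ => by positivity)]
    refine Finset.prod_congr rfl fun p hp => ?_
    rw [Nat.cast_pow, ← Real.rpow_natCast, ← Real.rpow_mul (by positivity), mul_comm]
  have key : ∀ p ∈ n.primeFactors, ((n.factorization p : ℝ) + 1) ≤
      (if p < P then C else 1) * (p : ℝ) ^ (ε * n.factorization p) := by
    intro p hp
    have hp2 : (2 : ℝ) ≤ p := by exact_mod_cast (Nat.prime_of_mem_primeFactors hp).two_le
    set a := n.factorization p
    split_ifs with h
    · refine (hCa a).trans ?_
      gcongr
    · have h1 : (P : ℝ) ≤ p := by exact_mod_cast not_lt.mp h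
      have h2 : (2 : ℝ) ≤ (p : ℝ) ^ ε := by
        calc (2 : ℝ) = ((2 : ℝ) ^ (1 / ε)) ^ ε := by
              rw [← Real.rpow_mul (by norm_num), one_div_mul_cancel hε.ne', Real.rpow_one]
          _ ≤ (p : ℝ) ^ ε := by
              apply Real.rpow_le_rpow (by positivity) (hP.trans h1) hε.le
      rw [one_mul, Real.rpow_mul (by positivity), Real.rpow_natCast]
      calc (a : ℝ) + 1 ≤ 2 ^ a := by
            exact_mod_cast Nat.lt_two_pow_self (n := a)
        _ ≤ _ := by gcongr
  rw [hcard, hnn]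
  refine (Finset.prod_le_prod (fun _ _ => by positivity) key).trans ?_
  rw [Finset.prod_mul_distrib]
  gcongr
  rw [Finset.prod_ite]
  simp only [Finset.prod_const, one_pow, mul_one]
  refine pow_le_pow_right₀ hC ?_
  calc _ ≤ (Finset.range P).card := Finset.card_le_card fun p hp => by
        simpa using (Finset.mem_filter.mp hp).2
    _ = P := by simp

theorem card_divisors_pow_le_rpow (k : ℕ) {ε : ℝ} (hε : 0 < ε) :
    ∃ C : ℝ, 1 ≤ C ∧ ∀ n : ℕ, n ≠ 0 → (n.divisors.card : ℝ) ^ k ≤ C * (n : ℝ) ^ ε := by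
  obtain ⟨C, hC, h⟩ := card_divisors_le_rpow (ε := ε / (k + 1)) (by positivity)
  refine ⟨C ^ k, one_le_pow₀ hC, fun n hn => ?_⟩
  have hn1 : (1 : ℝ) ≤ n := by exact_mod_cast Nat.one_le_iff_ne_zero.mpr hn
  calc (n.divisors.card : ℝ) ^ k ≤ (C * (n : ℝ) ^ (ε / (k + 1))) ^ k := by
        gcongr; exact h n hn
    _ = C ^ k * (n : ℝ) ^ (ε / (k + 1) * k) := by
        rw [mul_pow, ← Real.rpow_natCast ((n : ℝ) ^ _), ← Real.rpow_mul (by positivity)]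
    _ ≤ C ^ k * (n : ℝ) ^ ε := by
        have : ε / (k + 1) * k ≤ ε := by
          rw [div_mul_eq_mul_div, div_le_iff₀ (by positivity)]
          nlinarith
        gcongr

theorem dk_le_rpow (k : ℕ) {ε : ℝ} (hε : 0 < ε) :
    ∃ C : ℝ, 1 ≤ C ∧ ∀ n : ℕ, n ≠ 0 → (dk k n : ℝ) ≤ C * (n : ℝ) ^ ε := by
  obtain ⟨C, hC, h⟩ := card_divisors_pow_le_rpow k hε
  refine ⟨C, hC, fun n hn => le_trans ?_ (h n hn)⟩
  exact_mod_cast dk_le_card_divisors_pow k n hn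

theorem dk_zero_right (k : ℕ) : dk k 0 = 0 := by simp [dk]

theorem LSeriesHasSum_dk (k : ℕ) {s : ℂ} (hs : 1 < s.re) :
    LSeriesHasSum (fun n => (dk k n : ℂ)) s (riemannZeta s ^ k) := by
  induction k with
  | zero =>
    have : (fun n => (dk 0 n : ℂ)) = fun n => (LSeries.delta n) := by
      ext n
      simp [dk, LSeries.delta, ArithmeticFunction.one_apply]
    rw [this, pow_zero]
    rw [LSeriesHasSum]
    convert hasSum_ite_eq 1 (1 : ℂ) using 2 with n
    by_cases hn : n = 0
    · simp [hn]
    · rw [LSeries.term_of_ne_zero hn]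
      by_cases h1 : n = 1 <;> simp [LSeries.delta, h1]
  | succ k ih =>
    have := LSeriesHasSum.convolution ih (ArithmeticFunction.LSeriesHasSum_zeta hs)
    rw [pow_succ]
    convert this using 1
    ext n
    have h2 : ((dk (k + 1) n : ℕ) : ℂ) = ∑ d ∈ n.divisors, (dk k d : ℂ) := by
      rw [dk_succ]; push_cast; rfl
    rw [h2, LSeries.convolution_def, ← Nat.sum_divisorsAntidiagonal (fun d _ => (dk k d : ℂ))]
    refine Finset.sum_congr rfl fun p hp => ?_
    have : p.2 ≠ 0 := (Nat.right_ne_zero_of_mem_divisorsAntidiagonal hp)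
    simp [ArithmeticFunction.zeta_apply, this]

/-! ### The local factors and `A_k(s, q)` near `s = 1`. -/

theorem dk_prime_pow_le (k m : ℕ) {p : ℕ} (hp : p.Prime) : dk k (p ^ m) ≤ (m + 1) ^ k := by
  refine (dk_le_card_divisors_pow k _ (pow_ne_zero _ hp.ne_zero)).trans ?_
  rw [Nat.divisors_prime_pow hp]
  simp

/-- The common majorant of all local series: `2^(-1/2)` is the largest value of `p^(-Re s)` over
primes `p` and `Re s ≥ 1/2`. -/
theorem summable_add_one_pow_mul_geometric (k : ℕ) :
    Summable fun j : ℕ => ((j : ℝ) + 1) ^ k * ((2 : ℝ) ^ (-(1 / 2) : ℝ)) ^ j := by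
  set r := (2 : ℝ) ^ (-(1 / 2) : ℝ) with hr
  have hr0 : 0 < r := by positivity
  have hr1 : r < 1 := Real.rpow_lt_one_of_one_lt_of_neg (by norm_num) (by norm_num)
  have h := summable_pow_mul_geometric_of_norm_lt_one (R := ℝ) k (r := r)
    (by rwa [Real.norm_of_nonneg hr0.le])
  have h2 := ((summable_nat_add_iff 1).mpr h).mul_left r⁻¹
  refine h2.congr fun j => ?_
  push_cast
  rw [pow_succ r]
  field_simp

theorem norm_natCast_cpow_neg_le_one {p : ℕ} (hp : p ≠ 0) {s : ℂ} (hs : 0 ≤ s.re) :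
    ‖(p : ℂ) ^ (-s)‖ ≤ 1 := by
  rw [Complex.norm_natCast_cpow_of_pos (Nat.pos_of_ne_zero hp)]
  refine Real.rpow_le_one_of_one_le_of_nonpos ?_ (by simpa using hs)
  exact_mod_cast Nat.one_le_iff_ne_zero.mpr hp

theorem norm_localFactor_term_le (k : ℕ) {p : ℕ} (hp : p.Prime) (α j : ℕ) {s : ℂ}
    (hs : 1 / 2 ≤ s.re) :
    ‖(dk k (p ^ (j + α)) : ℂ) * (p : ℂ) ^ (-((j : ℂ) * s))‖ ≤
      ((α : ℝ) + 1) ^ k * (((j : ℝ) + 1) ^ k * ((2 : ℝ) ^ (-(1 / 2) : ℝ)) ^ j) := by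
  rw [norm_mul, Complex.norm_natCast, ← mul_assoc, ← mul_pow]
  gcongr
  · calc (dk k (p ^ (j + α)) : ℝ) ≤ ((j + α + 1 : ℕ) : ℝ) ^ k := by
          exact_mod_cast dk_prime_pow_le k _ hp
      _ ≤ _ := by
          gcongr
          push_cast
          nlinarith [(Nat.cast_nonneg α : (0 : ℝ) ≤ α), (Nat.cast_nonneg j : (0 : ℝ) ≤ j)]
  · rw [Complex.norm_natCast_cpow_of_pos hp.pos, ← Real.rpow_natCast, ← Real.rpow_mul (by norm_num)]
    have h2 : (2 : ℝ) ≤ p := by exact_mod_cast hp.two_le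
    have hj : (0 : ℝ) ≤ j := Nat.cast_nonneg j
    calc (p : ℝ) ^ (-((j : ℂ) * s)).re = (p : ℝ) ^ (-((j : ℝ) * s.re)) := by simp
      _ ≤ (p : ℝ) ^ (-(1 / 2) * (j : ℝ)) := by
          apply Real.rpow_le_rpow_of_exponent_le (by linarith)
          nlinarith
      _ ≤ _ := by
          apply Real.rpow_le_rpow_of_nonpos (by norm_num) h2
          linarith

theorem differentiableOn_localFactor (k q : ℕ) :
    DifferentiableOn ℂ (fun s => localFactor k s q) {s | 1 / 2 < s.re} := by
  have ho : IsOpen {s : ℂ | 1 / 2 < s.re} := isOpen_lt continuous_const Complex.continuous_re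
  unfold localFactor
  refine DifferentiableOn.fun_finsetProd fun p hp => ?_
  have hpp := Nat.prime_of_mem_primeFactors hp
  have hp0 : (p : ℂ) ≠ 0 := by exact_mod_cast hpp.ne_zero
  refine DifferentiableOn.mul ?_ ?_
  · refine Differentiable.differentiableOn fun s => ?_
    refine DifferentiableAt.pow (DifferentiableAt.const_sub ?_ _) _
    exact DifferentiableAt.const_cpow (by fun_prop) (Or.inl hp0)
  · refine Complex.differentiableOn_tsum_of_summable_norm
      ((summable_add_one_pow_mul_geometric k).mul_left _) (fun j => ?_) ho
      (fun j s hs => norm_localFactor_term_le k hpp _ j (le_of_lt hs))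
    refine Differentiable.differentiableOn fun s => ?_
    exact (DifferentiableAt.const_cpow (by fun_prop) (Or.inl hp0)).const_mul _

theorem differentiableOn_arithFactor (k q : ℕ) :
    DifferentiableOn ℂ (fun s => arithFactor k s q) {s | 1 / 2 < s.re} := by
  unfold arithFactor
  refine DifferentiableOn.fun_sum fun d hd => ?_
  have hd0 : (d : ℂ) ≠ 0 := by exact_mod_cast (Nat.pos_of_mem_divisors hd).ne'
  refine DifferentiableOn.mul ?_ (DifferentiableOn.fun_sum fun e he => ?_)
  · refine Differentiable.differentiableOn fun s => ?_
    exact (DifferentiableAt.const_cpow (by fun_prop) (Or.inl hd0)).const_mul _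
  · have he0 : (e : ℂ) ≠ 0 := by exact_mod_cast (Nat.pos_of_mem_divisors he).ne'
    refine DifferentiableOn.mul ?_ (differentiableOn_localFactor k _)
    refine Differentiable.differentiableOn fun s => ?_
    exact (DifferentiableAt.const_cpow (by fun_prop) (Or.inl he0)).const_mul _

theorem exists_norm_localFactor_le (k : ℕ) :
    ∃ K : ℕ, ∀ q : ℕ, q ≠ 0 → ∀ s : ℂ, 1 / 2 ≤ s.re →
      ‖localFactor k s q‖ ≤ (q.divisors.card : ℝ) ^ K := by
  set c := ∑' j : ℕ, ((j : ℝ) + 1) ^ k * ((2 : ℝ) ^ (-(1 / 2) : ℝ)) ^ j with hc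
  have hc0 : 0 ≤ c := tsum_nonneg fun j => by positivity
  -- Since `α + 1 ≥ 2` at each prime of `q`, the constant `2^k * c` per prime is at most `(α +
  -- 1)^K`, so that the product over primes stays a power of the number of divisors.
  obtain ⟨K, hK⟩ := pow_unbounded_of_one_lt (2 ^ k * c) (one_lt_two)
  refine ⟨k + K, fun q hq s hs => ?_⟩
  have hcard : (q.divisors.card : ℝ) = ∏ p ∈ q.primeFactors, ((q.factorization p : ℝ) + 1) := by
    rw [Nat.card_divisors hq]; push_cast; rfl
  rw [localFactor, norm_prod, hcard, ← Finset.prod_pow]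
  refine Finset.prod_le_prod (fun _ _ => norm_nonneg _) fun p hp => ?_
  have hpp := Nat.prime_of_mem_primeFactors hp
  set α := q.factorization p
  have hα : 1 ≤ α := (hpp.dvd_iff_one_le_factorization hq).mp (Nat.dvd_of_mem_primeFactors hp)
  have hα' : (2 : ℝ) ≤ (α : ℝ) + 1 := by
    have : (1 : ℝ) ≤ α := by exact_mod_cast hα
    linarith
  rw [norm_mul, norm_pow]
  have h1 : ‖1 - (p : ℂ) ^ (-s)‖ ≤ 2 := by
    refine (norm_sub_le _ _).trans ?_
    have := norm_natCast_cpow_neg_le_one hpp.ne_zero (s := s) (by linarith)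
    rw [norm_one]; linarith
  have h2 : ‖∑' j : ℕ, (dk k (p ^ (j + α)) : ℂ) * (p : ℂ) ^ (-((j : ℂ) * s))‖ ≤
      ((α : ℝ) + 1) ^ k * c := by
    rw [hc, ← tsum_mul_left]
    exact tsum_of_norm_bounded ((summable_add_one_pow_mul_geometric k).mul_left _).hasSum
      fun j => norm_localFactor_term_le k hpp α j hs
  calc _ ≤ 2 ^ k * (((α : ℝ) + 1) ^ k * c) := by gcongr
    _ = ((α : ℝ) + 1) ^ k * (2 ^ k * c) := by ring
    _ ≤ ((α : ℝ) + 1) ^ k * 2 ^ K := by gcongr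
    _ ≤ ((α : ℝ) + 1) ^ k * ((α : ℝ) + 1) ^ K := by gcongr
    _ = _ := by rw [pow_add]

theorem le_totient_mul_card_divisors (d : ℕ) : d ≤ Nat.totient d * d.divisors.card := by
  rcases Nat.eq_zero_or_pos d with rfl | hd
  · simp
  calc d = ∑ c ∈ d.divisors, Nat.totient c := (Nat.sum_totient d).symm
    _ ≤ ∑ c ∈ d.divisors, Nat.totient d := Finset.sum_le_sum fun c hc =>
        Nat.le_of_dvd (Nat.totient_pos.mpr hd) (Nat.totient_dvd_of_dvd (Nat.dvd_of_mem_divisors hc))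
    _ = _ := by simp [mul_comm]

theorem norm_moebius_le_one (d : ℕ) : ‖((ArithmeticFunction.moebius d : ℤ) : ℂ)‖ ≤ 1 := by
  rw [Complex.norm_intCast]
  exact_mod_cast ArithmeticFunction.abs_moebius_le_one

/-- Each of the three factors `q^ε` has its own source: `|d^s| ≤ d q^ε`, the local factor, and the
cube of the divisor function. That cube comes from the sums over `d` and over `e` and from `d /
φ(d)`. -/
theorem exists_norm_arithFactor_le (k : ℕ) {ε : ℝ} (hε : 0 < ε) (hε' : ε ≤ 1 / 2) :
    ∃ C : ℝ, 0 ≤ C ∧ ∀ q : ℕ, q ≠ 0 → ∀ s : ℂ, ‖s - 1‖ ≤ ε →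
      ‖arithFactor k s q‖ ≤ C * (q : ℝ) ^ (3 * ε) := by
  obtain ⟨K, hK⟩ := exists_norm_localFactor_le k
  obtain ⟨C₁, hC₁, h₁⟩ := card_divisors_pow_le_rpow K hε
  obtain ⟨C₂, hC₂, h₂⟩ := card_divisors_pow_le_rpow 3 hε
  refine ⟨C₁ * C₂, by positivity, fun q hq s hs => ?_⟩
  have hre : |s.re - 1| ≤ ε := by
    have := (Complex.abs_re_le_norm (s - 1)).trans hs
    simpa using this
  rw [abs_le] at hre
  have hs2 : 1 / 2 ≤ s.re := by linarith
  have hq1 : (1 : ℝ) ≤ q := by exact_mod_cast Nat.one_le_iff_ne_zero.mpr hq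
  set D : ℝ := (q.divisors.card : ℝ)
  have hD : 0 ≤ D := by positivity
  have inner : ∀ d ∈ q.divisors, ‖∑ e ∈ d.divisors,
        ((ArithmeticFunction.moebius e : ℤ) : ℂ) * (e : ℂ) ^ (-s) * localFactor k s (q * e / d)‖ ≤
        D * (C₁ * (q : ℝ) ^ ε) := by
    intro d hd
    have hdq := Nat.dvd_of_mem_divisors hd
    have hd0 : 0 < d := Nat.pos_of_mem_divisors hd
    refine (norm_sum_le _ _).trans ?_
    calc _ ≤ ∑ e ∈ d.divisors, C₁ * (q : ℝ) ^ ε := by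
          refine Finset.sum_le_sum fun e he => ?_
          have he0 : 0 < e := Nat.pos_of_mem_divisors he
          have hed : e ≤ d := Nat.divisor_le he
          have hne : q * e / d ≠ 0 := by
            have : d ≤ q * e := (Nat.le_of_dvd (Nat.pos_of_ne_zero hq) hdq).trans
              (Nat.le_mul_of_pos_right _ he0)
            exact (Nat.div_pos this hd0).ne'
          have hle : q * e / d ≤ q := Nat.div_le_of_le_mul (by
            rw [mul_comm d]; exact Nat.mul_le_mul_left _ hed)
          rw [norm_mul, norm_mul]
          have a1 := norm_moebius_le_one e
          have a2 := norm_natCast_cpow_neg_le_one he0.ne' (s := s) (by linarith)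
          have a3 : ‖localFactor k s (q * e / d)‖ ≤ C₁ * (q : ℝ) ^ ε := by
            refine (hK _ hne s hs2).trans ((h₁ _ hne).trans ?_)
            gcongr
          calc _ ≤ 1 * 1 * (C₁ * (q : ℝ) ^ ε) := by gcongr
            _ = _ := by ring
      _ = (d.divisors.card : ℝ) * (C₁ * (q : ℝ) ^ ε) := by simp
      _ ≤ _ := by
          gcongr
          exact Nat.cast_le.mpr (Finset.card_le_card (Nat.divisors_subset_of_dvd hq hdq))
  rw [arithFactor]
  refine (norm_sum_le _ _).trans ?_
  calc _ ≤ ∑ d ∈ q.divisors, (D * (q : ℝ) ^ ε) * (D * (C₁ * (q : ℝ) ^ ε)) := by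
        refine Finset.sum_le_sum fun d hd => ?_
        have hdq := Nat.dvd_of_mem_divisors hd
        have hd0 : 0 < d := Nat.pos_of_mem_divisors hd
        have hd1 : (1 : ℝ) ≤ d := by exact_mod_cast hd0
        have hφ : (0 : ℝ) < Nat.totient d := by exact_mod_cast Nat.totient_pos.mpr hd0
        rw [norm_mul]
        refine mul_le_mul ?_ (inner d hd) (norm_nonneg _) (by positivity)
        rw [norm_mul, norm_div, Complex.norm_natCast, Complex.norm_natCast_cpow_of_pos hd0]
        have b1 : (d : ℝ) ^ s.re ≤ d * (q : ℝ) ^ ε := by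
          calc (d : ℝ) ^ s.re ≤ (d : ℝ) ^ (1 + ε) :=
                Real.rpow_le_rpow_of_exponent_le hd1 (by linarith)
            _ = d * (d : ℝ) ^ ε := by rw [Real.rpow_add (by linarith), Real.rpow_one]
            _ ≤ _ := by
                gcongr
                exact_mod_cast Nat.divisor_le hd
        have b2 : (d : ℝ) / Nat.totient d ≤ D := by
          rw [div_le_iff₀ hφ]
          have h3 : (d : ℝ) ≤ Nat.totient d * d.divisors.card := by
            exact_mod_cast le_totient_mul_card_divisors d
          have h4 : (d.divisors.card : ℝ) ≤ D := by
            exact Nat.cast_le.mpr (Finset.card_le_card (Nat.divisors_subset_of_dvd hq hdq))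
          nlinarith
        calc _ ≤ 1 / (Nat.totient d : ℝ) * (d * (q : ℝ) ^ ε) := by
              gcongr
              exact norm_moebius_le_one d
          _ = d / Nat.totient d * (q : ℝ) ^ ε := by ring
          _ ≤ _ := by gcongr
    _ = C₁ * D ^ 3 * (q : ℝ) ^ (ε + ε) := by
        rw [Real.rpow_add (by linarith)]
        simp only [Finset.sum_const, nsmul_eq_mul]
        ring
    _ ≤ C₁ * (C₂ * (q : ℝ) ^ ε) * (q : ℝ) ^ (ε + ε) := by
        gcongr
        exact h₂ q hq
    _ = _ := by
        have h3 : (q : ℝ) ^ (3 * ε) = (q : ℝ) ^ ε * (q : ℝ) ^ (ε + ε) := by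
          rw [← Real.rpow_add (by linarith)]
          ring_nf
        rw [h3]
        ring

/-! ### `Q_k(x, q)` as a polynomial in `log (x / q)`, and its size. -/

/-- The holomorphic part `(s - 1)^k ζ(s)^k A_k(s, q)`. -/
def zetaArith (k q : ℕ) (s : ℂ) : ℂ := riemannZeta₁ s ^ k * arithFactor k s q

theorem differentiableOn_zetaArith (k q : ℕ) :
    DifferentiableOn ℂ (zetaArith k q) {s | 1 / 2 < s.re} :=
  (differentiable_riemannZeta₁.pow k).differentiableOn.mul (differentiableOn_arithFactor k q)

/-- Coefficients of `Q_k(x, q)` as a polynomial in `log (x / q)`. -/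
def Qcoeff (k q i : ℕ) : ℝ :=
  ((k - 1).choose i : ℝ) / ((k - 1).factorial : ℝ) * (iteratedDeriv i (zetaArith k q) 1).re

theorem iteratedDeriv_cexp_mul_sub (L : ℂ) (m : ℕ) :
    iteratedDeriv m (fun s : ℂ => Complex.exp (L * (s - 1))) =
      fun s => L ^ m * Complex.exp (L * (s - 1)) := by
  induction m with
  | zero => simp
  | succ m ih =>
    rw [iteratedDeriv_succ, ih]
    ext s
    have : HasDerivAt (fun s : ℂ => L ^ m * Complex.exp (L * (s - 1)))
        (L ^ m * (Complex.exp (L * (s - 1)) * (L * 1))) s :=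
      ((((hasDerivAt_id s).sub_const 1).const_mul L).cexp).const_mul _
    rw [this.deriv]
    ring

theorem closedBall_subset_half_plane {r : ℝ} (hr : r < 1 / 2) :
    Metric.closedBall (1 : ℂ) r ⊆ {s | 1 / 2 < s.re} := by
  intro s hs
  have h1 : ‖s - 1‖ ≤ r := by simpa [dist_eq_norm] using hs
  have h2 := (Complex.abs_re_le_norm (s - 1)).trans h1
  simp only [Complex.sub_re, Complex.one_re] at h2
  rw [abs_le] at h2
  show 1 / 2 < s.re
  linarith

/-- The integrand has a pole of order `k` at `1`, so Cauchy's formula gives a derivative of order `k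
- 1`, which Leibniz' rule expands. The powers of `log (x / q)` are real, so the real part falls on
the coefficients only. -/
theorem Q_eq_sum (k : ℕ) (hk : 1 ≤ k) {x : ℝ} (hx : 0 < x) {q : ℕ} (hq : q ≠ 0) :
    Q k x q = ∑ i ∈ Finset.range k, Qcoeff k q i * Real.log (x / q) ^ (k - 1 - i) := by
  have hxq : 0 < x / q := by positivity
  set L := Real.log (x / q) with hL
  have hball := closedBall_subset_half_plane (r := 1 / 8) (by norm_num)
  have hd : DifferentiableOn ℂ (fun s => zetaArith k q s * Complex.exp (L * (s - 1)))
      (Metric.closedBall 1 (1 / 8)) :=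
    ((differentiableOn_zetaArith k q).mono hball).mul
      (Differentiable.differentiableOn (by fun_prop))
  have hint := DifferentiableOn.circleIntegral_one_div_sub_center_pow_smul
    (by norm_num : (0 : ℝ) < 1 / 8) (k - 1) hd
  have hcongr : circleIntegral
      (fun s : ℂ => riemannZeta s ^ k * arithFactor k s q * ((x / q : ℝ) : ℂ) ^ (s - 1))
      1 (1 / 8) = ∮ z in C(1, 1 / 8), (1 / (z - 1) ^ (k - 1 + 1)) •
        (zetaArith k q z * Complex.exp (L * (z - 1))) := by
    refine circleIntegral.integral_congr (by norm_num) fun z hz => ?_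
    have hz1 : z ≠ 1 := by
      rintro rfl
      simp at hz
    have hz2 : z - 1 ≠ 0 := sub_ne_zero.mpr hz1
    simp only [zetaArith, smul_eq_mul]
    rw [riemannZeta_eq_inv_sub_mul hz1, Nat.sub_add_cancel hk,
      Complex.cpow_def_of_ne_zero (by exact_mod_cast hxq.ne'), ← Complex.ofReal_log hxq.le, ← hL]
    rw [mul_pow, inv_pow, one_div]
    ring
  have hF : ContDiffAt ℂ ((k - 1 : ℕ) : WithTop ℕ∞) (zetaArith k q) 1 := by
    have ho : IsOpen {s : ℂ | 1 / 2 < s.re} := isOpen_lt continuous_const Complex.continuous_re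
    exact ((differentiableOn_zetaArith k q).analyticAt
      (ho.mem_nhds (by norm_num))).contDiffAt
  have hE : ContDiffAt ℂ ((k - 1 : ℕ) : WithTop ℕ∞) (fun s => Complex.exp (L * (s - 1))) 1 := by
    fun_prop
  rw [Q, hcongr, hint]
  have hmul := iteratedDeriv_mul hF hE
  have hmul' : iteratedDeriv (k - 1) (fun s => zetaArith k q s * Complex.exp (L * (s - 1))) 1 =
      ∑ i ∈ Finset.range k, ((k - 1).choose i : ℂ) * iteratedDeriv i (zetaArith k q) 1 *
        (L : ℂ) ^ (k - 1 - i) := by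
    refine hmul.trans ?_
    rw [Nat.sub_add_cancel hk]
    refine Finset.sum_congr rfl fun i _ => ?_
    rw [iteratedDeriv_cexp_mul_sub]
    simp
  rw [hmul', smul_eq_mul, ← mul_assoc]
  have h2 : (2 * (Real.pi : ℂ) * Complex.I)⁻¹ *
      (2 * Real.pi * Complex.I / (k - 1).factorial) = ((1 / ((k - 1).factorial : ℝ) : ℝ) : ℂ) := by
    have := Complex.two_pi_I_ne_zero
    push_cast
    field_simp
  rw [h2, Complex.re_ofReal_mul, Complex.re_sum, Finset.mul_sum]
  refine Finset.sum_congr rfl fun i _ => ?_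
  rw [← Complex.ofReal_pow, Complex.re_mul_ofReal, ← Complex.ofReal_natCast, Complex.re_ofReal_mul,
    Qcoeff]
  ring

theorem localFactor_one (k : ℕ) (s : ℂ) : localFactor k s 1 = 1 := by simp [localFactor]

/-- This is the leading coefficient of `Q_k(x, 1)`; its positivity is what later makes the
off-diagonal main term positive. -/
theorem Qcoeff_one_zero (k : ℕ) : Qcoeff k 1 0 = 1 / ((k - 1).factorial : ℝ) := by
  simp [Qcoeff, zetaArith, arithFactor, localFactor_one]

theorem exists_abs_Qcoeff_le (k : ℕ) {ε : ℝ} (hε : 0 < ε) :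
    ∃ C : ℝ, 0 ≤ C ∧ ∀ q : ℕ, q ≠ 0 → ∀ i < k, |Qcoeff k q i| ≤ C * (q : ℝ) ^ ε := by
  -- Cauchy's estimate on this circle costs `q^(3r) ≤ q^ε`; the cap `1/4` keeps the circle in the
  -- half-plane of holomorphy.
  set r := min (ε / 3) (1 / 4) with hr
  have hr0 : 0 < r := by positivity
  have hr2 : r ≤ 1 / 4 := min_le_right _ _
  obtain ⟨C₁, hC₁, h₁⟩ := exists_norm_arithFactor_le k hr0 (by linarith)
  obtain ⟨B, hB⟩ := (isCompact_closedBall (1 : ℂ) 1).exists_bound_of_continuousOn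
    differentiable_riemannZeta₁.continuous.continuousOn
  have hB0 : 0 ≤ B := (norm_nonneg _).trans (hB 1 (by simp))
  refine ⟨∑ i ∈ Finset.range k, ((k - 1).choose i : ℝ) / ((k - 1).factorial : ℝ) *
    (i.factorial * (B ^ k * C₁) / r ^ i), by positivity, fun q hq i hi => ?_⟩
  have hq1 : (1 : ℝ) ≤ q := by exact_mod_cast Nat.one_le_iff_ne_zero.mpr hq
  have hball := closedBall_subset_half_plane (r := r) (by linarith)
  have hd : DiffContOnCl ℂ (zetaArith k q) (Metric.ball 1 r) :=
    ((differentiableOn_zetaArith k q).mono hball).diffContOnCl_ball (subset_refl _)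
  have hcau := Complex.norm_iteratedDeriv_le_of_forall_mem_sphere_norm_le (C :=
      B ^ k * (C₁ * (q : ℝ) ^ (3 * r))) i hr0 hd (by
    intro z hz
    have hz' : ‖z - 1‖ ≤ r := by rw [← dist_eq_norm]; exact (Metric.mem_sphere.mp hz).le
    rw [zetaArith, norm_mul, norm_pow]
    gcongr
    · apply hB
      rw [Metric.mem_closedBall, dist_eq_norm]
      linarith
    · exact h₁ q hq z hz')
  rw [Qcoeff, abs_mul, abs_of_nonneg (by positivity : (0 : ℝ) ≤
    ((k - 1).choose i : ℝ) / ((k - 1).factorial : ℝ)), Finset.sum_mul]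
  refine le_trans ?_ (Finset.single_le_sum (f := fun i => ((k - 1).choose i : ℝ) /
    ((k - 1).factorial : ℝ) * (i.factorial * (B ^ k * C₁) / r ^ i) * (q : ℝ) ^ ε)
    (fun i _ => by positivity) (Finset.mem_range.mpr hi))
  rw [mul_assoc]
  gcongr
  refine (Complex.abs_re_le_norm _).trans (hcau.trans ?_)
  have : (q : ℝ) ^ (3 * r) ≤ (q : ℝ) ^ ε := by
    apply Real.rpow_le_rpow_of_exponent_le hq1
    have := min_le_left (ε / 3) (1 / 4)
    linarith
  calc _ = i.factorial * (B ^ k * C₁) / r ^ i * (q : ℝ) ^ (3 * r) := by ring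
    _ ≤ _ := by gcongr

theorem exists_one_add_log_pow_le (m : ℕ) {ε : ℝ} (hε : 0 < ε) :
    ∃ C : ℝ, 1 ≤ C ∧ ∀ x : ℝ, 1 ≤ x → (1 + Real.log x) ^ m ≤ C * x ^ ε := by
  set ε' := ε / (m + 1) with hε'
  have h0 : 0 < ε' := by positivity
  refine ⟨(1 + 1 / ε') ^ m, one_le_pow₀ (by
    have : 0 < 1 / ε' := by positivity
    linarith), fun x hx => ?_⟩
  have hx0 : 0 ≤ x := by linarith
  have hlog : 0 ≤ Real.log x := Real.log_nonneg hx
  have h1 : 1 + Real.log x ≤ (1 + 1 / ε') * x ^ ε' := by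
    have h2 := Real.log_le_rpow_div hx0 h0
    have h3 : 1 ≤ x ^ ε' := Real.one_le_rpow hx h0.le
    calc 1 + Real.log x ≤ x ^ ε' + x ^ ε' / ε' := by linarith
      _ = _ := by ring
  calc (1 + Real.log x) ^ m ≤ ((1 + 1 / ε') * x ^ ε') ^ m := by gcongr
    _ = (1 + 1 / ε') ^ m * x ^ (ε' * m) := by
        rw [mul_pow, ← Real.rpow_natCast (x ^ ε'), ← Real.rpow_mul hx0]
    _ ≤ _ := by
        have : ε' * m ≤ ε := by
          rw [hε', div_mul_eq_mul_div, div_le_iff₀ (by positivity)]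
          nlinarith
        gcongr

theorem exists_abs_Q_le (k : ℕ) (hk : 1 ≤ k) {ε : ℝ} (hε : 0 < ε) :
    ∃ C : ℝ, 0 ≤ C ∧ ∀ q : ℕ, q ≠ 0 → ∀ x : ℝ, 0 < x →
      |Q k x q| ≤ C * (q : ℝ) ^ ε * (1 + |Real.log x|) ^ k := by
  obtain ⟨C₁, hC₁, h₁⟩ := exists_abs_Qcoeff_le k (half_pos hε)
  obtain ⟨C₂, hC₂, h₂⟩ := exists_one_add_log_pow_le k (half_pos hε)
  refine ⟨k * (C₁ * C₂), by positivity, fun q hq x hx => ?_⟩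
  have hq1 : (1 : ℝ) ≤ q := by exact_mod_cast Nat.one_le_iff_ne_zero.mpr hq
  have hlq : 0 ≤ Real.log q := Real.log_nonneg hq1
  have hL : |Real.log (x / q)| ≤ (1 + Real.log q) * (1 + |Real.log x|) := by
    rw [Real.log_div hx.ne' (by positivity)]
    refine (abs_sub _ _).trans ?_
    rw [abs_of_nonneg hlq]
    nlinarith [abs_nonneg (Real.log x)]
  have hbase : 1 ≤ (1 + Real.log q) * (1 + |Real.log x|) :=
    one_le_mul_of_one_le_of_one_le (by linarith) (by linarith [abs_nonneg (Real.log x)])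
  rw [Q_eq_sum k hk hx hq]
  refine (Finset.abs_sum_le_sum_abs _ _).trans ?_
  calc _ ≤ ∑ i ∈ Finset.range k, C₁ * C₂ * (q : ℝ) ^ ε * (1 + |Real.log x|) ^ k := by
        refine Finset.sum_le_sum fun i hi => ?_
        rw [abs_mul, abs_pow]
        calc _ ≤ (C₁ * (q : ℝ) ^ (ε / 2)) * ((1 + Real.log q) * (1 + |Real.log x|)) ^ k := by
              refine mul_le_mul (h₁ q hq i (Finset.mem_range.mp hi)) ?_ (by positivity)
                (by positivity)
              refine (pow_le_pow_left₀ (abs_nonneg _) hL _).trans ?_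
              exact pow_le_pow_right₀ hbase (by omega)
          _ ≤ (C₁ * (q : ℝ) ^ (ε / 2)) * ((C₂ * (q : ℝ) ^ (ε / 2)) * (1 + |Real.log x|) ^ k) := by
              rw [mul_pow]
              gcongr
              exact h₂ q hq1
          _ = _ := by
              have : (q : ℝ) ^ ε = (q : ℝ) ^ (ε / 2) * (q : ℝ) ^ (ε / 2) := by
                rw [← Real.rpow_add (by linarith)]; ring_nf
              rw [this]; ring
    _ = _ := by simp; ring

theorem continuousOn_Q (k : ℕ) (hk : 1 ≤ k) {q : ℕ} (hq : q ≠ 0) :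
    ContinuousOn (fun x => Q k x q) (Set.Ioi 0) := by
  have hq0 : (q : ℝ) ≠ 0 := by exact_mod_cast hq
  refine ContinuousOn.congr (f := fun x => ∑ i ∈ Finset.range k,
    Qcoeff k q i * Real.log (x / q) ^ (k - 1 - i)) ?_ fun x hx => Q_eq_sum k hk hx hq
  refine continuousOn_finsetSum _ fun i _ => ContinuousOn.mul continuousOn_const
    (ContinuousOn.pow (ContinuousOn.log (by fun_prop) fun x hx => ?_) _)
  exact div_ne_zero (ne_of_gt hx) hq0

/-! ### Convergence of the singular series and differentiability of the main term. -/

theorem abs_ramanujanSum_le (q h : ℕ) (hh : h ≠ 0) : |(ramanujanSum q h : ℝ)| ≤ (h : ℝ) * h := by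
  rw [ramanujanSum]
  push_cast
  refine (Finset.abs_sum_le_sum_abs _ _).trans ?_
  have hsub : (Nat.gcd h q).divisors ⊆ h.divisors :=
    Nat.divisors_subset_of_dvd hh (Nat.gcd_dvd_left h q)
  calc _ ≤ ∑ d ∈ (Nat.gcd h q).divisors, (h : ℝ) := by
        refine Finset.sum_le_sum fun d hd => ?_
        rw [abs_mul, Nat.abs_cast]
        have h1 : |((ArithmeticFunction.moebius (q / d) : ℤ) : ℝ)| ≤ 1 := by
          exact_mod_cast ArithmeticFunction.abs_moebius_le_one
        have h2 : (d : ℝ) ≤ h := by exact_mod_cast Nat.divisor_le (hsub hd)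
        nlinarith [abs_nonneg ((ArithmeticFunction.moebius (q / d) : ℤ) : ℝ)]
    _ = ((Nat.gcd h q).divisors.card : ℝ) * h := by simp
    _ ≤ _ := by
        gcongr
        exact (Finset.card_le_card hsub).trans (Nat.card_divisors_le_self h)

/-- The terms of the singular series. -/
def singularTerm (k : ℕ) (x : ℝ) (h q : ℕ) : ℝ :=
  if q = 0 then 0 else (ramanujanSum q h : ℝ) / (q : ℝ) ^ 2 * Q k x q ^ 2

/-- The crude factor `h * h` is harmless here: the bound serves convergence and continuity for one
`h` at a time. The exponent is `3/2 = 2 - 2 * (1/4)`. -/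
theorem exists_abs_singularTerm_le (k : ℕ) (hk : 1 ≤ k) :
    ∃ C : ℝ, 0 ≤ C ∧ ∀ h : ℕ, h ≠ 0 → ∀ x : ℝ, 0 < x → ∀ q : ℕ,
      |singularTerm k x h q| ≤
        C * (h * h) * (1 + |Real.log x|) ^ (2 * k) * (1 / (q : ℝ) ^ (3 / 2 : ℝ)) := by
  obtain ⟨C, hC, hQ⟩ := exists_abs_Q_le k hk (ε := 1 / 4) (by norm_num)
  refine ⟨C ^ 2, by positivity, fun h hh x hx q => ?_⟩
  rw [singularTerm]
  split_ifs with hq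
  · rw [abs_zero]; positivity
  have hq0 : (0 : ℝ) < q := by exact_mod_cast Nat.pos_of_ne_zero hq
  rw [abs_mul, abs_div, abs_pow, abs_pow, Nat.abs_cast]
  calc _ ≤ (h * h : ℝ) / (q : ℝ) ^ 2 * (C * (q : ℝ) ^ (1 / 4 : ℝ) * (1 + |Real.log x|) ^ k) ^ 2 := by
        gcongr
        · exact abs_ramanujanSum_le q h hh
        · exact hQ q hq x hx
    _ = C ^ 2 * (h * h) * (1 + |Real.log x|) ^ (2 * k) *
          ((q : ℝ) ^ (1 / 4 : ℝ) * (q : ℝ) ^ (1 / 4 : ℝ) / (q : ℝ) ^ 2) := by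
        rw [pow_mul']; ring
    _ = _ := by
        congr 1
        rw [← Real.rpow_add hq0, ← Real.rpow_natCast, ← Real.rpow_sub hq0, one_div (_ ^ _),
          ← Real.rpow_neg hq0.le]
        norm_num

theorem summable_one_div_rpow : Summable fun q : ℕ => 1 / (q : ℝ) ^ (3 / 2 : ℝ) :=
  Real.summable_one_div_nat_rpow.mpr (by norm_num)

theorem hasSum_singularSeries (k : ℕ) (hk : 1 ≤ k) {h : ℕ} (hh : h ≠ 0) {x : ℝ} (hx : 0 < x) :
    HasSum (singularTerm k x h) (singularSeries k x h) := by
  obtain ⟨C, hC, hb⟩ := exists_abs_singularTerm_le k hk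
  exact (Summable.of_norm_bounded (summable_one_div_rpow.mul_left _)
    fun q => hb h hh x hx q).hasSum

theorem exists_abs_singularSeries_le (k : ℕ) (hk : 1 ≤ k) {h : ℕ} (hh : h ≠ 0) :
    ∃ C : ℝ, 0 ≤ C ∧ ∀ x : ℝ, 0 < x →
      |singularSeries k x h| ≤ C * (1 + |Real.log x|) ^ (2 * k) := by
  obtain ⟨C, hC, hb⟩ := exists_abs_singularTerm_le k hk
  refine ⟨C * (h * h) * ∑' q : ℕ, 1 / (q : ℝ) ^ (3 / 2 : ℝ),
    mul_nonneg (by positivity) (tsum_nonneg fun q => by positivity), fun x hx => ?_⟩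
  have := tsum_of_norm_bounded (f := singularTerm k x h)
    (summable_one_div_rpow.mul_left _).hasSum fun q => hb h hh x hx q
  rw [tsum_mul_left] at this
  refine this.trans (le_of_eq ?_)
  ring

theorem continuousOn_singularSeries (k : ℕ) (hk : 1 ≤ k) {h : ℕ} (hh : h ≠ 0) :
    ContinuousOn (fun x => singularSeries k x h) (Set.Ioi 0) := by
  obtain ⟨C, hC, hb⟩ := exists_abs_singularTerm_le k hk
  intro x hx
  have hx : 0 < x := hx
  refine ContinuousAt.continuousWithinAt ?_
  have hI : Set.Icc (x / 2) (2 * x) ∈ 𝓝 x := Icc_mem_nhds (by linarith) (by linarith)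
  refine ContinuousOn.continuousAt (s := Set.Icc (x / 2) (2 * x)) ?_ hI
  refine continuousOn_tsum (f := fun (q : ℕ) x => singularTerm k x h q)
    (u := fun q : ℕ => C * (h * h) * (1 + (|Real.log (x / 2)| + |Real.log (2 * x)|)) ^ (2 * k) *
      (1 / (q : ℝ) ^ (3 / 2 : ℝ))) (fun q => ?_) (summable_one_div_rpow.mul_left _)
      fun q y hy => (hb h hh y (by linarith [hy.1]) q).trans ?_
  · by_cases hq : q = 0
    · simp only [singularTerm, hq, if_true]; exact continuousOn_const
    · simp only [singularTerm, hq, if_false]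
      refine ContinuousOn.mul continuousOn_const (ContinuousOn.pow
        ((continuousOn_Q k hk hq).mono fun y hy => ?_) 2)
      exact lt_of_lt_of_le (by linarith) hy.1
  · have hy0 : 0 < y := by linarith [hy.1]
    have h1 : Real.log (x / 2) ≤ Real.log y := Real.log_le_log (by linarith) hy.1
    have h2 : Real.log y ≤ Real.log (2 * x) := Real.log_le_log hy0 hy.2
    have h3 : |Real.log y| ≤ |Real.log (x / 2)| + |Real.log (2 * x)| := by
      rw [abs_le]
      constructor
      · linarith [neg_abs_le (Real.log (x / 2)), abs_nonneg (Real.log (2 * x))]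
      · linarith [le_abs_self (Real.log (2 * x)), abs_nonneg (Real.log (x / 2))]
    gcongr

theorem intervalIntegrable_singularSeries (k : ℕ) (hk : 1 ≤ k) {h : ℕ} (hh : h ≠ 0) {b : ℝ}
    (hb : 0 ≤ b) :
    IntervalIntegrable (fun x => singularSeries k x h) MeasureTheory.volume 0 b := by
  obtain ⟨C, hC, hS⟩ := exists_abs_singularSeries_le k hk hh
  obtain ⟨D, hD, hlog⟩ := exists_one_add_log_pow_le (2 * k) (ε := 1 / 2) (by norm_num)
  -- Powers of `log x` blow up at `0` as well as at infinity, so the integrable majorant needs both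
  -- exponents.
  have hint : IntervalIntegrable (fun x : ℝ => C * (D * (x ^ (1 / 2 : ℝ) + x ^ (-(1 / 2) : ℝ))))
      MeasureTheory.volume 0 b :=
    (((intervalIntegral.intervalIntegrable_rpow' (by norm_num)).add
      (intervalIntegral.intervalIntegrable_rpow' (by norm_num))).const_mul D).const_mul C
  refine hint.mono_fun ?_ ?_
  · rw [Set.uIoc_of_le hb]
    refine ContinuousOn.aestronglyMeasurable ?_ measurableSet_Ioc
    exact (continuousOn_singularSeries k hk hh).mono fun x hx => hx.1
  · rw [Set.uIoc_of_le hb]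
    filter_upwards [MeasureTheory.ae_restrict_mem measurableSet_Ioc] with x hx
    have hx0 : 0 < x := hx.1
    rw [Real.norm_eq_abs, Real.norm_of_nonneg (by positivity)]
    refine (hS x hx0).trans ?_
    gcongr
    rcases le_total 1 x with h1 | h1
    · rw [abs_of_nonneg (Real.log_nonneg h1)]
      refine (hlog x h1).trans ?_
      gcongr
      linarith [Real.rpow_nonneg hx0.le (-(1 / 2))]
    · rw [abs_of_nonpos (Real.log_nonpos hx0.le h1), ← Real.log_inv]
      refine (hlog x⁻¹ ((one_le_inv₀ hx0).mpr h1)).trans ?_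
      gcongr
      rw [Real.inv_rpow hx0.le, ← Real.rpow_neg hx0.le]
      linarith [Real.rpow_nonneg hx0.le (1 / 2)]

theorem hasDerivAt_mainTerm (k : ℕ) (hk : 1 ≤ k) {h : ℕ} (hh : h ≠ 0) {x : ℝ} (hx : 0 < x) :
    HasDerivAt (fun y => mainTerm k y h) (singularSeries k x h) x := by
  have hc := continuousOn_singularSeries k hk hh
  refine intervalIntegral.integral_hasDerivAt_right
    (intervalIntegrable_singularSeries k hk hh hx.le) ?_ (hc.continuousAt (Ioi_mem_nhds hx))
  exact hc.stronglyMeasurableAtFilter isOpen_Ioi x hx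

/-! ### Averages of the singular series over the shift. -/

/-- A right-endpoint Riemann sum of step `d`: each complete cell errs by at most `B₁ d²`, and the
incomplete last cell is shorter than `d`. -/
theorem abs_mul_sum_sub_integral_le {g : ℝ → ℝ} {B B₁ : ℝ} {H : ℕ}
    (hB : ∀ u ∈ Set.Icc (0 : ℝ) H, |g u| ≤ B)
    (hB₁ : ∀ u ∈ Set.Icc (0 : ℝ) H, ∀ v ∈ Set.Icc (0 : ℝ) H, |g u - g v| ≤ B₁ * |u - v|)
    (hB0 : 0 ≤ B₁) {d : ℕ} (hd : 0 < d) :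
    |(d : ℝ) * ∑ l ∈ Finset.range (H / d), g (d * (l + 1 : ℕ)) - ∫ u in (0 : ℝ)..H, g u| ≤
      d * (B + B₁ * H) := by
  have hd' : (0 : ℝ) < d := by exact_mod_cast hd
  have hcont : ContinuousOn g (Set.Icc 0 (H : ℝ)) := by
    have : LipschitzOnWith ⟨B₁, hB0⟩ g (Set.Icc 0 (H : ℝ)) :=
      LipschitzOnWith.of_dist_le_mul fun u hu v hv => hB₁ u hu v hv
    exact this.continuousOn
  set m := H / d with hm
  have hmd : m * d ≤ H := Nat.div_mul_le_self H d
  have hmd' : (m : ℝ) * d ≤ H := by exact_mod_cast hmd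
  have hlt : (H : ℝ) < m * d + d := by exact_mod_cast Nat.lt_div_mul_add hd
  have hint : ∀ a b : ℝ, 0 ≤ a → a ≤ b → b ≤ H →
      IntervalIntegrable g MeasureTheory.volume a b := fun a b ha hab hb =>
    (hcont.mono (by rw [Set.uIcc_of_le hab]; exact Set.Icc_subset_Icc ha hb)).intervalIntegrable
  have hle : ∀ l < m, ((l : ℝ) + 1) * d ≤ H := fun l hl => by
    have : (l : ℝ) + 1 ≤ m := by exact_mod_cast hl
    nlinarith
  have hsplit : ∫ u in (0 : ℝ)..H, g u =
      (∑ l ∈ Finset.range m, ∫ u in ((l : ℝ) * d)..(((l + 1 : ℕ) : ℝ) * d), g u) +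
        ∫ u in ((m : ℝ) * d)..H, g u := by
    rw [intervalIntegral.sum_integral_adjacent_intervals (a := fun l : ℕ => (l : ℝ) * d)]
    · simp only [Nat.cast_zero, zero_mul]
      rw [intervalIntegral.integral_add_adjacent_intervals]
      · exact hint _ _ le_rfl (by positivity) hmd'
      · exact hint _ _ (by positivity) hmd' le_rfl
    · intro l hl
      push_cast
      exact hint _ _ (by positivity) (by nlinarith) (hle l hl)
  have htail : |∫ u in ((m : ℝ) * d)..H, g u| ≤ B * d := by
    have := intervalIntegral.norm_integral_le_of_norm_le_const (f := g) (a := (m : ℝ) * d)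
      (b := H) (C := B) (fun u hu => by
        rw [Set.uIoc_of_le hmd'] at hu
        exact hB u ⟨le_trans (by positivity) hu.1.le, hu.2⟩)
    refine this.trans ?_
    have hB' : 0 ≤ B := (abs_nonneg _).trans (hB 0 ⟨le_rfl, by positivity⟩)
    rw [abs_of_nonneg (by linarith)]
    gcongr
    linarith
  have hpiece : ∀ l ∈ Finset.range m,
      |(d : ℝ) * g (d * (l + 1 : ℕ)) - ∫ u in ((l : ℝ) * d)..(((l + 1 : ℕ) : ℝ) * d), g u| ≤
        B₁ * d * d := by
    intro l hl
    have hl := hle l (Finset.mem_range.mp hl)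
    have hle' : (l : ℝ) * d ≤ ((l + 1 : ℕ) : ℝ) * d := by push_cast; nlinarith
    have h1 : (d : ℝ) * g (d * (l + 1 : ℕ)) =
        ∫ u in ((l : ℝ) * d)..(((l + 1 : ℕ) : ℝ) * d), g (d * (l + 1 : ℕ)) := by
      rw [intervalIntegral.integral_const, smul_eq_mul]
      push_cast
      ring
    rw [h1, ← intervalIntegral.integral_sub intervalIntegrable_const
      (hint _ _ (by positivity) hle' (by push_cast; exact hl))]
    have := intervalIntegral.norm_integral_le_of_norm_le_const (a := (l : ℝ) * d)
      (b := ((l + 1 : ℕ) : ℝ) * d) (C := B₁ * d)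
      (f := fun u => g (d * (l + 1 : ℕ)) - g u) (fun u hu => by
        rw [Set.uIoc_of_le hle'] at hu
        have hu1 := hu.1
        have hu2 := hu.2
        push_cast at hu2 ⊢
        have hld : 0 ≤ (l : ℝ) * d := by positivity
        refine (hB₁ _ ⟨by positivity, by linarith⟩ u ⟨by linarith, by linarith⟩).trans ?_
        gcongr
        rw [abs_of_nonneg (by linarith)]
        linarith)
    refine this.trans (le_of_eq ?_)
    push_cast
    rw [abs_of_nonneg (by linarith)]
    ring
  rw [hsplit, Finset.mul_sum, ← sub_sub, ← Finset.sum_sub_distrib]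
  refine (abs_sub _ _).trans ?_
  calc _ ≤ m * (B₁ * d * d) + B * d := by
        gcongr
        refine (Finset.abs_sum_le_sum_abs _ _).trans ?_
        refine (Finset.sum_le_sum hpiece).trans ?_
        simp
    _ = B₁ * d * (m * d) + B * d := by ring
    _ ≤ B₁ * d * H + B * d := by gcongr
    _ = _ := by ring

theorem sum_filter_dvd (g : ℕ → ℝ) (H : ℕ) {d : ℕ} (hd : 0 < d) :
    ∑ h ∈ Finset.Icc 1 H, (if d ∣ h then g h else 0) =
      ∑ l ∈ Finset.range (H / d), g (d * (l + 1)) := by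
  rw [← Finset.sum_filter]
  symm
  refine Finset.sum_bij (fun l _ => d * (l + 1)) ?_ ?_ ?_ ?_
  · intro l hl
    have hl : l + 1 ≤ H / d := Finset.mem_range.mp hl
    refine Finset.mem_filter.mpr ⟨Finset.mem_Icc.mpr ⟨Nat.mul_pos hd (Nat.succ_pos _), ?_⟩,
      Dvd.intro _ rfl⟩
    rw [mul_comm]
    exact (Nat.le_div_iff_mul_le hd).mp hl
  · intro a _ b _ hab
    have := Nat.eq_of_mul_eq_mul_left hd hab
    omega
  · intro h hh
    obtain ⟨h1, c, rfl⟩ := Finset.mem_filter.mp hh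
    have h1 := Finset.mem_Icc.mp h1
    have hc : 0 < c := Nat.pos_of_ne_zero fun h0 => by simp [h0] at h1
    refine ⟨c - 1, Finset.mem_range.mpr ?_, by rw [Nat.sub_add_cancel hc]⟩
    have : c ≤ H / d := (Nat.le_div_iff_mul_le hd).mpr (by rw [mul_comm]; exact h1.2)
    omega
  · intros; rfl

theorem sum_ramanujanSum_mul (g : ℕ → ℝ) (H : ℕ) {q : ℕ} (hq : q ≠ 0) :
    ∑ h ∈ Finset.Icc 1 H, (ramanujanSum q h : ℝ) * g h =
      ∑ d ∈ q.divisors, ((ArithmeticFunction.moebius (q / d) : ℤ) : ℝ) *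
        (d * ∑ l ∈ Finset.range (H / d), g (d * (l + 1))) := by
  have h1 : ∀ h ∈ Finset.Icc 1 H, (ramanujanSum q h : ℝ) * g h =
      ∑ d ∈ q.divisors, ((ArithmeticFunction.moebius (q / d) : ℤ) : ℝ) *
        (d * (if d ∣ h then g h else 0)) := by
    intro h hh
    have hh0 : h ≠ 0 := by have := (Finset.mem_Icc.mp hh).1; omega
    have : (Nat.gcd h q).divisors = q.divisors.filter (· ∣ h) := by
      ext d
      simp only [Nat.mem_divisors, Finset.mem_filter, Nat.dvd_gcd_iff]
      have : Nat.gcd h q ≠ 0 := fun h0 => hq (Nat.eq_zero_of_gcd_eq_zero_right h0)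
      tauto
    rw [ramanujanSum, this, Finset.sum_filter]
    push_cast
    rw [Finset.sum_mul]
    refine Finset.sum_congr rfl fun d _ => ?_
    split_ifs <;> ring
  rw [Finset.sum_congr rfl h1, Finset.sum_comm]
  refine Finset.sum_congr rfl fun d hd => ?_
  rw [← Finset.mul_sum, ← Finset.mul_sum, sum_filter_dvd g H (Nat.pos_of_mem_divisors hd)]

theorem sum_moebius_div (q : ℕ) :
    ∑ d ∈ q.divisors, ((ArithmeticFunction.moebius (q / d) : ℤ) : ℝ) = if q = 1 then 1 else 0 := by
  rw [Nat.sum_div_divisors q (fun d => ((ArithmeticFunction.moebius d : ℤ) : ℝ))]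
  have := ArithmeticFunction.coe_mul_zeta_apply (f := ArithmeticFunction.moebius) (x := q)
  rw [ArithmeticFunction.moebius_mul_coe_zeta, ArithmeticFunction.one_apply] at this
  have h2 : ((∑ d ∈ q.divisors, ArithmeticFunction.moebius d : ℤ) : ℝ) =
    ((if q = 1 then 1 else 0 : ℤ) : ℝ) := by rw [this]
  push_cast at h2
  exact h2

/-- Opening the Ramanujan sum, every divisor `d` of `q` contributes `μ(q/d)` times about the same
integral, and `∑ μ(q/d)` vanishes unless `q = 1`. -/
theorem abs_sum_ramanujanSum_sub_le {g : ℝ → ℝ} {B B₁ : ℝ} {H : ℕ} (hH : 1 ≤ H)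
    (hB : ∀ u ∈ Set.Icc (0 : ℝ) H, |g u| ≤ B)
    (hB₁ : ∀ u ∈ Set.Icc (0 : ℝ) H, ∀ v ∈ Set.Icc (0 : ℝ) H, |g u - g v| ≤ B₁ * |u - v|)
    (hB0 : 0 ≤ B₁) {q : ℕ} (hq : q ≠ 0) :
    |∑ h ∈ Finset.Icc 1 H, (ramanujanSum q h : ℝ) * g h -
        (if q = 1 then ∫ u in (0 : ℝ)..H, g u else 0)| ≤
      q.divisors.card * min (q : ℝ) H * (B + B₁ * H) := by
  have hB' : 0 ≤ B := (abs_nonneg _).trans (hB 0 ⟨le_rfl, by positivity⟩)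
  have hμ : ∀ d : ℕ, |((ArithmeticFunction.moebius (q / d) : ℤ) : ℝ)| ≤ 1 := fun d => by
    exact_mod_cast ArithmeticFunction.abs_moebius_le_one
  have hsum := sum_ramanujanSum_mul (fun n => g n) H hq
  have hH' : (1 : ℝ) ≤ H := by exact_mod_cast hH
  have hfirst : |∑ h ∈ Finset.Icc 1 H, (ramanujanSum q h : ℝ) * g h -
        (if q = 1 then ∫ u in (0 : ℝ)..H, g u else 0)| ≤
      q.divisors.card * (q : ℝ) * (B + B₁ * H) := by
    have h2 : (if q = 1 then ∫ u in (0 : ℝ)..H, g u else 0) = ∑ d ∈ q.divisors,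
        ((ArithmeticFunction.moebius (q / d) : ℤ) : ℝ) * ∫ u in (0 : ℝ)..H, g u := by
      rw [← Finset.sum_mul, sum_moebius_div q]
      split_ifs <;> simp
    rw [hsum, h2, ← Finset.sum_sub_distrib]
    refine (Finset.abs_sum_le_sum_abs _ _).trans ?_
    calc _ ≤ ∑ d ∈ q.divisors, (q : ℝ) * (B + B₁ * H) := by
          refine Finset.sum_le_sum fun d hd => ?_
          rw [← mul_sub, abs_mul]
          have h3 := abs_mul_sum_sub_integral_le hB hB₁ hB0 (Nat.pos_of_mem_divisors hd)
          have h4 : (d : ℝ) ≤ q := by exact_mod_cast Nat.divisor_le hd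
          push_cast at h3 ⊢
          calc _ ≤ 1 * ((d : ℝ) * (B + B₁ * H)) := by
                gcongr
                exact hμ d
            _ ≤ _ := by rw [one_mul]; gcongr
      _ = _ := by simp; ring
  by_cases hq1 : q = 1
  · subst hq1
    have : min ((1 : ℕ) : ℝ) H = (1 : ℕ) := min_eq_left (by simpa using hH')
    rw [this]
    exact hfirst
  -- For `q > H` the Riemann sums are no longer accurate, but each has only `H / d` terms, so the
  -- trivial bound `H * B` replaces `q` by `H`.
  · rcases le_total (q : ℝ) H with h | h
    · rw [min_eq_left h]; exact hfirst
    · rw [min_eq_right h, if_neg hq1, sub_zero, hsum]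
      refine (Finset.abs_sum_le_sum_abs _ _).trans ?_
      calc _ ≤ ∑ d ∈ q.divisors, (H : ℝ) * B := by
            refine Finset.sum_le_sum fun d hd => ?_
            have hd0 : 0 < d := Nat.pos_of_mem_divisors hd
            rw [abs_mul, abs_mul, Nat.abs_cast]
            calc _ ≤ 1 * ((d : ℝ) * ((H / d : ℕ) * B)) := by
                  gcongr
                  · exact hμ d
                  · refine (Finset.abs_sum_le_sum_abs _ _).trans ?_
                    refine (Finset.sum_le_sum (g := fun _ => B) fun l hl => ?_).trans (by simp)
                    refine hB _ ⟨by positivity, ?_⟩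
                    have hl : l + 1 ≤ H / d := Finset.mem_range.mp hl
                    have := (Nat.le_div_iff_mul_le hd0).mp hl
                    rw [mul_comm] at this
                    exact_mod_cast this
              _ = ((H / d * d : ℕ) : ℝ) * B := by push_cast; ring
              _ ≤ _ := by
                  gcongr
                  exact Nat.div_mul_le_self H d
        _ = q.divisors.card * (H : ℝ) * B := by simp; ring
        _ ≤ _ := by
            gcongr
            have : 0 ≤ B₁ * H := by positivity
            linarith

/-- Only the modulus `q = 1` survives the average over `h`, and the error is uniform in `H` up to
`H^θ`. The test function `g` will be the pair weight as a function of the shift. -/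
theorem exists_abs_sum_singularSeries_sub_le (k : ℕ) (hk : 1 ≤ k) {θ : ℝ} (hθ : 0 < θ)
    (hθ1 : θ ≤ 1) :
    ∃ C : ℝ, 0 ≤ C ∧ ∀ x : ℝ, 1 ≤ x → ∀ (H : ℕ), 1 ≤ H → ∀ (g : ℝ → ℝ) (B B₁ : ℝ), 0 ≤ B₁ →
      (∀ u ∈ Set.Icc (0 : ℝ) H, |g u| ≤ B) →
      (∀ u ∈ Set.Icc (0 : ℝ) H, ∀ v ∈ Set.Icc (0 : ℝ) H, |g u - g v| ≤ B₁ * |u - v|) →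
      |∑ h ∈ Finset.Icc 1 H, singularSeries k x h * g h - Q k x 1 ^ 2 * ∫ u in (0 : ℝ)..H, g u| ≤
        C * (H : ℝ) ^ θ * (1 + Real.log x) ^ (2 * k) * (B + B₁ * H) := by
  obtain ⟨C₁, hC₁, hQ⟩ := exists_abs_Q_le k hk (ε := θ / 6) (by positivity)
  obtain ⟨C₂, hC₂, hdiv⟩ := card_divisors_le_rpow (ε := θ / 6) (by positivity)
  have hsummable : Summable fun q : ℕ => 1 / (q : ℝ) ^ (1 + θ / 2) :=
    Real.summable_one_div_nat_rpow.mpr (by linarith)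
  refine ⟨C₁ ^ 2 * C₂ * ∑' q : ℕ, 1 / (q : ℝ) ^ (1 + θ / 2),
    mul_nonneg (by positivity) (tsum_nonneg fun q => by positivity),
    fun x hx H hH g B B₁ hB0 hB hB₁ => ?_⟩
  have hx0 : 0 < x := by linarith
  have hH' : (1 : ℝ) ≤ H := by exact_mod_cast hH
  have hB' : 0 ≤ B := (abs_nonneg _).trans (hB 0 ⟨le_rfl, by positivity⟩)
  have hlog : 0 ≤ Real.log x := Real.log_nonneg hx
  have h1 : HasSum (fun q => ∑ h ∈ Finset.Icc 1 H, singularTerm k x h q * g h)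
      (∑ h ∈ Finset.Icc 1 H, singularSeries k x h * g h) :=
    hasSum_sum fun h hh => (hasSum_singularSeries k hk
      (by have := (Finset.mem_Icc.mp hh).1; omega) hx0).mul_right (g h)
  have h2 := h1.sub (hasSum_ite_eq 1 (Q k x 1 ^ 2 * ∫ u in (0 : ℝ)..H, g u))
  rw [← h2.tsum_eq]
  have hbound : ∀ q : ℕ, ‖(∑ h ∈ Finset.Icc 1 H, singularTerm k x h q * g h) -
      (if q = 1 then Q k x 1 ^ 2 * ∫ u in (0 : ℝ)..H, g u else 0)‖ ≤
      C₁ ^ 2 * C₂ * (H : ℝ) ^ θ * (1 + Real.log x) ^ (2 * k) * (B + B₁ * H) *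
        (1 / (q : ℝ) ^ (1 + θ / 2)) := by
    intro q
    rw [Real.norm_eq_abs]
    by_cases hq : q = 0
    · simp only [hq, singularTerm, if_true, zero_mul, Finset.sum_const_zero]
      simp
      positivity
    have hq0 : (0 : ℝ) < q := by exact_mod_cast Nat.pos_of_ne_zero hq
    have heq : (∑ h ∈ Finset.Icc 1 H, singularTerm k x h q * g h) -
      (if q = 1 then Q k x 1 ^ 2 * ∫ u in (0 : ℝ)..H, g u else 0) =
      Q k x q ^ 2 / (q : ℝ) ^ 2 * (∑ h ∈ Finset.Icc 1 H, (ramanujanSum q h : ℝ) * g h -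
        (if q = 1 then ∫ u in (0 : ℝ)..H, g u else 0)) := by
      rw [mul_sub, Finset.mul_sum]
      congr 1
      · refine Finset.sum_congr rfl fun h _ => ?_
        simp only [singularTerm, hq, if_false]
        ring
      · split_ifs with hq1
        · subst hq1; simp
        · simp
    rw [heq, abs_mul, abs_of_nonneg (by positivity : 0 ≤ Q k x q ^ 2 / (q : ℝ) ^ 2)]
    have h3 := abs_sum_ramanujanSum_sub_le hH hB hB₁ hB0 hq
    have h4 : Q k x q ^ 2 ≤ (C₁ * (q : ℝ) ^ (θ / 6) * (1 + Real.log x) ^ k) ^ 2 := by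
      rw [← sq_abs]
      have := hQ q hq x hx0
      rw [abs_of_nonneg hlog] at this
      gcongr
    -- This interpolation makes the series over `q` converge: with the three factors `q^(θ/6)` and
    -- the `q^(-2)` of the singular series, the total exponent is `-1 - θ/2`.
    have h5 : min (q : ℝ) H ≤ (q : ℝ) ^ (1 - θ) * (H : ℝ) ^ θ := by
      have hm : 0 < min (q : ℝ) H := lt_min hq0 (by linarith)
      calc min (q : ℝ) H = (min (q : ℝ) H) ^ (1 - θ) * (min (q : ℝ) H) ^ θ := by
            rw [← Real.rpow_add hm]; simp
        _ ≤ _ := mul_le_mul (Real.rpow_le_rpow hm.le (min_le_left _ _) (by linarith))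
            (Real.rpow_le_rpow hm.le (min_le_right _ _) hθ.le) (by positivity) (by positivity)
    calc _ ≤ (C₁ * (q : ℝ) ^ (θ / 6) * (1 + Real.log x) ^ k) ^ 2 / (q : ℝ) ^ 2 *
          ((C₂ * (q : ℝ) ^ (θ / 6)) * ((q : ℝ) ^ (1 - θ) * (H : ℝ) ^ θ) * (B + B₁ * H)) := by
          gcongr
          refine h3.trans ?_
          gcongr
          exact hdiv q hq
      _ = C₁ ^ 2 * C₂ * (H : ℝ) ^ θ * (1 + Real.log x) ^ (2 * k) * (B + B₁ * H) *
          ((q : ℝ) ^ (θ / 6) * (q : ℝ) ^ (θ / 6) * (q : ℝ) ^ (θ / 6) * (q : ℝ) ^ (1 - θ) /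
            (q : ℝ) ^ 2) := by rw [pow_mul']; ring
      _ = _ := by
          congr 1
          rw [← Real.rpow_add hq0, ← Real.rpow_add hq0, ← Real.rpow_add hq0, ← Real.rpow_natCast,
            ← Real.rpow_sub hq0, one_div, ← Real.rpow_neg hq0.le]
          congr 1
          push_cast
          ring
  have := tsum_of_norm_bounded (hsummable.mul_left _).hasSum hbound
  rw [tsum_mul_left] at this
  refine this.trans (le_of_eq ?_)
  ring

/-! ### Partial summation in `n` and in `h`. -/

/-- Abel summation: one `BΓ` comes from the last weight, and another from the total variation of the
weights, which is at most `B`. -/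
theorem abs_sum_mul_le_of_partial_sums {a ω : ℕ → ℝ} {B Γ : ℝ} {H : ℕ} (hH : 1 ≤ H) (hB : 0 ≤ B)
    (ha : ∀ t, 1 ≤ t → t ≤ H → |∑ h ∈ Finset.Icc 1 t, a h| ≤ Γ) (hω : |ω H| ≤ B)
    (hω' : ∀ h, 1 ≤ h → h < H → |ω (h + 1) - ω h| ≤ B / H) :
    |∑ h ∈ Finset.Icc 1 H, a h * ω h| ≤ 2 * B * Γ := by
  have hΓ : 0 ≤ Γ := (abs_nonneg _).trans (ha 1 le_rfl hH)
  have key : ∑ h ∈ Finset.Icc 1 H, a h * ω h = (∑ h ∈ Finset.Icc 1 H, a h) * ω H -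
      ∑ t ∈ Finset.Ico 1 H, (∑ h ∈ Finset.Icc 1 t, a h) * (ω (t + 1) - ω t) := by
    clear ha hω hω'
    induction H, hH using Nat.le_induction with
    | base => simp
    | succ n hn ih =>
      rw [Finset.sum_Icc_succ_top (by omega), ih, Finset.sum_Icc_succ_top (by omega),
        Finset.sum_Ico_succ_top hn]
      ring
  have hH0 : (0 : ℝ) < H := by exact_mod_cast hH
  rw [key]
  refine (abs_sub _ _).trans ?_
  have h1 : |(∑ h ∈ Finset.Icc 1 H, a h) * ω H| ≤ Γ * B := by
    rw [abs_mul]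
    exact mul_le_mul (ha H hH le_rfl) hω (abs_nonneg _) hΓ
  have h2 : |∑ t ∈ Finset.Ico 1 H, (∑ h ∈ Finset.Icc 1 t, a h) * (ω (t + 1) - ω t)| ≤ Γ * B := by
    refine (Finset.abs_sum_le_sum_abs _ _).trans ?_
    calc _ ≤ ∑ t ∈ Finset.Ico 1 H, Γ * (B / H) := by
          refine Finset.sum_le_sum fun t ht => ?_
          obtain ⟨h3, h4⟩ := Finset.mem_Ico.mp ht
          rw [abs_mul]
          exact mul_le_mul (ha t h3 h4.le) (hω' t h3 h4) (abs_nonneg _) hΓ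
      _ = ((H - 1 : ℕ) : ℝ) * (Γ * (B / H)) := by simp
      _ ≤ (H : ℝ) * (Γ * (B / H)) := by
          gcongr
          omega
      _ = _ := by field_simp
  linarith

theorem shiftSum_natCast (k : ℕ) (x : ℝ) (t : ℕ) :
    shiftSum k x t = ∑ h ∈ Finset.Icc 1 t, Delta k x h := by
  rw [shiftSum, Nat.floor_natCast]

/-- Abel summation of the arithmetic sum and integration by parts of the main term have the same
shape, so their difference involves only `Δ_k`. Integrability is recorded because the sum over `h`
will be moved inside the integral. -/
theorem sum_mul_sub_integral_eq (k : ℕ) (hk : 1 ≤ k) {M M' : ℝ} (hM : 0 < M) (hMM : M ≤ M')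
    {h : ℕ} (hh : h ≠ 0) {ω ω' : ℝ → ℝ} (hω : ∀ x ∈ Set.Icc M M', HasDerivAt ω (ω' x) x)
    (hc : ContinuousOn ω' (Set.Icc M M')) :
    IntervalIntegrable (fun x => ω' x * Delta k x h) MeasureTheory.volume M M' ∧
    ∑ n ∈ Finset.Ioc ⌊M⌋₊ ⌊M'⌋₊, (dk k n : ℝ) * (dk k (n + h) : ℝ) * ω n -
      ∫ x in M..M', singularSeries k x h * ω x =
      Delta k M' h * ω M' - Delta k M h * ω M - ∫ x in M..M', ω' x * Delta k x h := by
  set c : ℕ → ℝ := fun n => (dk k n : ℝ) * (dk k (n + h) : ℝ) with hcdef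
  -- The Abel formula sums from `0` and `Delta` from `1`; `d_k(0) = 0` reconciles them.
  have hc0 : c 0 = 0 := by simp [hcdef, dk_zero_right]
  have hcs : ∀ m : ℕ, ∑ n ∈ Finset.Icc 0 m, c n = ∑ n ∈ Finset.Icc 1 m, c n := fun m => by
    rw [Finset.Icc_eq_cons_Ioc (Nat.zero_le m), Finset.sum_cons, hc0, zero_add]
    rfl
  have hderiv : ∀ x ∈ Set.Icc M M', deriv ω x = ω' x := fun x hx => (hω x hx).deriv
  have hint' : MeasureTheory.IntegrableOn ω' (Set.Icc M M') := hc.integrableOn_Icc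
  have hint : MeasureTheory.IntegrableOn (deriv ω) (Set.Icc M M') :=
    hint'.congr_fun (fun x hx => (hderiv x hx).symm) measurableSet_Icc
  have habel := sum_mul_eq_sub_sub_integral_mul c hM.le hMM
    (fun t ht => (hω t ht).differentiableAt) hint
  have hu : Set.uIcc M M' = Set.Icc M M' := Set.uIcc_of_le hMM
  have hparts := intervalIntegral.integral_deriv_mul_eq_sub (a := M) (b := M')
    (u := fun x => mainTerm k x h) (v := ω) (u' := fun x => singularSeries k x h) (v' := ω')
    (fun x hx => hasDerivAt_mainTerm k hk hh (by rw [hu] at hx; linarith [hx.1]))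
    (fun x hx => hω x (hu ▸ hx))
    (ContinuousOn.intervalIntegrable ((continuousOn_singularSeries k hk hh).mono fun x hx => by
      rw [hu] at hx; exact lt_of_lt_of_le hM hx.1))
    (ContinuousOn.intervalIntegrable (hu ▸ hc))
  have hcm : ContinuousOn (fun x => mainTerm k x h) (Set.Icc M M') := fun x hx =>
    (hasDerivAt_mainTerm k hk hh (lt_of_lt_of_le hM hx.1)).continuousAt.continuousWithinAt
  have hi1 : IntervalIntegrable (fun x => singularSeries k x h * ω x) MeasureTheory.volume M M' := by
    refine ContinuousOn.intervalIntegrable (hu ▸ ContinuousOn.mul ?_ ?_)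
    · exact (continuousOn_singularSeries k hk hh).mono fun x hx => lt_of_lt_of_le hM hx.1
    · exact fun x hx => (hω x hx).continuousAt.continuousWithinAt
  have hi2 : IntervalIntegrable (fun x => mainTerm k x h * ω' x) MeasureTheory.volume M M' :=
    ContinuousOn.intervalIntegrable (hu ▸ hcm.mul hc)
  rw [intervalIntegral.integral_add hi1 hi2] at hparts
  have hi3 : IntervalIntegrable (fun x => ω' x * ∑ n ∈ Finset.Icc 0 ⌊x⌋₊, c n)
      MeasureTheory.volume M M' := by
    rw [intervalIntegrable_iff_integrableOn_Icc_of_le hMM]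
    exact integrableOn_mul_sum_Icc c hM.le hint'
  have hDelta : ∀ x, Delta k x h = (∑ n ∈ Finset.Icc 0 ⌊x⌋₊, c n) - mainTerm k x h := fun x => by
    rw [Delta, hcs]
  have hi4 : IntervalIntegrable (fun x => ω' x * mainTerm k x h) MeasureTheory.volume M M' := by
    exact hi2.congr fun x _ => mul_comm _ _
  have hfun : (fun x => ω' x * Delta k x h) = fun x => ω' x * ∑ n ∈ Finset.Icc 0 ⌊x⌋₊, c n -
      ω' x * mainTerm k x h := by
    ext x; rw [hDelta]; ring
  rw [hfun]
  refine ⟨hi3.sub hi4, ?_⟩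
  rw [intervalIntegral.integral_sub hi3 hi4, hDelta, hDelta]
  have h5 : ∑ n ∈ Finset.Ioc ⌊M⌋₊ ⌊M'⌋₊, c n * ω n = ω M' * ∑ n ∈ Finset.Icc 0 ⌊M'⌋₊, c n -
      ω M * ∑ n ∈ Finset.Icc 0 ⌊M⌋₊, c n - ∫ x in M..M', ω' x * ∑ n ∈ Finset.Icc 0 ⌊x⌋₊, c n := by
    have h6 : ∫ x in M..M', ω' x * ∑ n ∈ Finset.Icc 0 ⌊x⌋₊, c n =
        ∫ x in Set.Ioc M M', deriv ω x * ∑ n ∈ Finset.Icc 0 ⌊x⌋₊, c n := by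
      rw [intervalIntegral.integral_of_le hMM]
      refine MeasureTheory.setIntegral_congr_fun measurableSet_Ioc fun x hx => ?_
      rw [hderiv x ⟨hx.1.le, hx.2⟩]
    rw [h6, ← habel]
    exact Finset.sum_congr rfl fun n _ => mul_comm _ _
  rw [h5]
  have h7 : ∫ x in M..M', ω' x * mainTerm k x h = ∫ x in M..M', mainTerm k x h * ω' x :=
    intervalIntegral.integral_congr fun x _ => mul_comm _ _
  rw [h7]
  linarith

/-- Summation by parts in `n` leaves `Δ_k(x, h)` against the weight and its `x`-derivative;
summation by parts in `h` then turns these into `shiftSum`. Two endpoints and one integral each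
contribute `2BΓ`. -/
theorem abs_block_sub_le (k : ℕ) (hk : 1 ≤ k) {M M' : ℝ} (hM : 0 < M) (hMM : M ≤ M')
    (hM2 : M' ≤ 2 * M) {H : ℕ} (hH : 1 ≤ H) {Γ B : ℝ} (hB : 0 ≤ B)
    (hΓ : ∀ x ∈ Set.Icc M M', ∀ t : ℕ, 1 ≤ t → t ≤ H → |shiftSum k x t| ≤ Γ)
    {W W₁ : ℝ → ℕ → ℝ}
    (hW : ∀ h, 1 ≤ h → h ≤ H → ∀ x ∈ Set.Icc M M', HasDerivAt (fun y => W y h) (W₁ x h) x)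
    (hWc : ∀ h, 1 ≤ h → h ≤ H → ContinuousOn (fun x => W₁ x h) (Set.Icc M M'))
    (hb : ∀ x ∈ Set.Icc M M', |W x H| ≤ B)
    (hb' : ∀ x ∈ Set.Icc M M', ∀ h, 1 ≤ h → h < H → |W x (h + 1) - W x h| ≤ B / H)
    (hb₁ : ∀ x ∈ Set.Icc M M', |W₁ x H| ≤ B / M)
    (hb₁' : ∀ x ∈ Set.Icc M M', ∀ h, 1 ≤ h → h < H → |W₁ x (h + 1) - W₁ x h| ≤ B / M / H) :
    |∑ h ∈ Finset.Icc 1 H, ∑ n ∈ Finset.Ioc ⌊M⌋₊ ⌊M'⌋₊,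
        (dk k n : ℝ) * (dk k (n + h) : ℝ) * W n h -
      ∑ h ∈ Finset.Icc 1 H, ∫ x in M..M', singularSeries k x h * W x h| ≤ 6 * B * Γ := by
  have hpt : ∀ h ∈ Finset.Icc 1 H, _ := fun h hh =>
    sum_mul_sub_integral_eq k hk hM hMM (h := h)
      (by have := (Finset.mem_Icc.mp hh).1; omega)
      (hW h (Finset.mem_Icc.mp hh).1 (Finset.mem_Icc.mp hh).2)
      (hWc h (Finset.mem_Icc.mp hh).1 (Finset.mem_Icc.mp hh).2)
  have hΓ0 : 0 ≤ Γ := (abs_nonneg _).trans (hΓ M ⟨le_rfl, hMM⟩ 1 le_rfl hH)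
  rw [← Finset.sum_sub_distrib, Finset.sum_congr rfl fun h hh => (hpt h hh).2,
    Finset.sum_sub_distrib, Finset.sum_sub_distrib,
    ← intervalIntegral.integral_finsetSum fun h hh => (hpt h hh).1]
  have hend : ∀ x ∈ Set.Icc M M', |∑ h ∈ Finset.Icc 1 H, Delta k x h * W x h| ≤ 2 * B * Γ :=
    fun x hx => abs_sum_mul_le_of_partial_sums hH hB
      (fun t h1 h2 => by rw [← shiftSum_natCast]; exact hΓ x hx t h1 h2) (hb x hx) (hb' x hx)
  have hmid : |∫ x in M..M', ∑ h ∈ Finset.Icc 1 H, W₁ x h * Delta k x h| ≤ 2 * B * Γ := by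
    have := intervalIntegral.norm_integral_le_of_norm_le_const (a := M) (b := M')
      (C := 2 * (B / M) * Γ) (f := fun x => ∑ h ∈ Finset.Icc 1 H, W₁ x h * Delta k x h)
      (fun x hx => by
        rw [Set.uIoc_of_le hMM] at hx
        have hx : x ∈ Set.Icc M M' := ⟨hx.1.le, hx.2⟩
        rw [Real.norm_eq_abs]
        simp only [mul_comm (W₁ _ _)]
        exact abs_sum_mul_le_of_partial_sums hH (by positivity)
          (fun t h1 h2 => by rw [← shiftSum_natCast]; exact hΓ x hx t h1 h2) (hb₁ x hx)
          (hb₁' x hx))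
    refine this.trans ?_
    rw [abs_of_nonneg (by linarith)]
    calc 2 * (B / M) * Γ * (M' - M) ≤ 2 * (B / M) * Γ * M := by
          gcongr
          linarith
      _ = _ := by field_simp
  have e1 := hend M' ⟨hMM, le_rfl⟩
  have e2 := hend M ⟨le_rfl, hMM⟩
  refine (abs_sub _ _).trans ?_
  have := abs_sub (∑ h ∈ Finset.Icc 1 H, Delta k M' h * W M' h)
    (∑ h ∈ Finset.Icc 1 H, Delta k M h * W M h)
  linarith

/-! ### The Gaussian cutoff and its derivatives. -/

/-- The probability density `e^{-l²/4} / (2√π)`. -/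
def gaussDens (l : ℝ) : ℝ := (2 * √Real.pi)⁻¹ * Real.exp (-(1 / 4) * l ^ 2)

/-- The tail integral of `gaussDens`, a smooth cutoff on the logarithmic scale. -/
def gaussTail (l : ℝ) : ℝ := ∫ t in Set.Ioi l, gaussDens t

theorem gaussDens_pos (l : ℝ) : 0 < gaussDens l := by unfold gaussDens; positivity

theorem integrable_gaussDens : MeasureTheory.Integrable gaussDens :=
  (integrable_exp_neg_mul_sq (by norm_num : (0 : ℝ) < 1 / 4)).const_mul _

theorem integral_gaussDens : ∫ l, gaussDens l = 1 := by
  unfold gaussDens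
  rw [MeasureTheory.integral_const_mul, integral_gaussian,
    show Real.pi / (1 / 4) = 2 ^ 2 * Real.pi by ring, Real.sqrt_mul (by positivity),
    Real.sqrt_sq (by norm_num)]
  have : √Real.pi ≠ 0 := by positivity
  field_simp

theorem sqrt_pi_le_two : √Real.pi ≤ 2 := by
  rw [Real.sqrt_le_left (by norm_num)]
  linarith [Real.pi_le_four]

theorem one_le_sqrt_pi : 1 ≤ √Real.pi := by
  rw [Real.one_le_sqrt]
  linarith [Real.pi_gt_three]

theorem gaussDens_le (l : ℝ) : gaussDens l ≤ 1 / 2 := by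
  unfold gaussDens
  have h1 : (2 * √Real.pi)⁻¹ ≤ 1 / 2 := by
    rw [inv_le_comm₀ (by positivity) (by norm_num)]
    linarith [one_le_sqrt_pi]
  have h2 : Real.exp (-(1 / 4) * l ^ 2) ≤ 1 := by
    rw [Real.exp_le_one_iff]; nlinarith [sq_nonneg l]
  nlinarith [Real.exp_pos (-(1 / 4) * l ^ 2)]

theorem gaussTail_nonneg (l : ℝ) : 0 ≤ gaussTail l :=
  MeasureTheory.integral_nonneg fun t => (gaussDens_pos t).le

theorem gaussTail_eq (l : ℝ) : gaussTail l = gaussTail 0 - ∫ t in (0 : ℝ)..l, gaussDens t := by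
  have := intervalIntegral.integral_Ioi_sub_Ioi' (a := 0) (b := l)
    integrable_gaussDens.integrableOn integrable_gaussDens.integrableOn
  unfold gaussTail
  linarith

theorem continuous_gaussDens : Continuous gaussDens := by
  unfold gaussDens
  fun_prop

theorem hasDerivAt_gaussTail (l : ℝ) : HasDerivAt gaussTail (-gaussDens l) l := by
  have h : gaussTail = fun l => gaussTail 0 - ∫ t in (0 : ℝ)..l, gaussDens t := by
    ext l; exact gaussTail_eq l
  rw [h]
  exact (continuous_gaussDens.integral_hasStrictDerivAt 0 l).hasDerivAt.const_sub _

theorem hasDerivAt_gaussDens (l : ℝ) : HasDerivAt gaussDens (-(l / 2) * gaussDens l) l := by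
  unfold gaussDens
  have := ((((hasDerivAt_id l).pow 2).const_mul (-(1 / 4) : ℝ)).exp).const_mul (2 * √Real.pi)⁻¹
  refine this.congr_deriv ?_
  simp
  ring

theorem gaussTail_le_one (l : ℝ) : gaussTail l ≤ 1 := by
  rw [← integral_gaussDens]
  exact MeasureTheory.setIntegral_le_integral integrable_gaussDens
    (Eventually.of_forall fun t => (gaussDens_pos t).le)

theorem gaussTail_antitone : Antitone gaussTail :=
  antitone_of_hasDerivAt_nonpos hasDerivAt_gaussTail
    fun l => by simpa using (gaussDens_pos l).le

theorem gaussTail_zero : gaussTail 0 = 1 / 2 := by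
  have h1 : gaussTail 0 = ∫ t in Set.Iic (0 : ℝ), gaussDens t := by
    have := integral_comp_neg_Iic (0 : ℝ) gaussDens
    rw [neg_zero] at this
    rw [gaussTail, ← this]
    simp [gaussDens]
  have h2 := MeasureTheory.integral_add_compl (measurableSet_Ioi (a := (0 : ℝ))) integrable_gaussDens
  rw [integral_gaussDens, Set.compl_Ioi] at h2
  rw [← h1] at h2
  change gaussTail 0 + gaussTail 0 = 1 at h2
  linarith

theorem half_le_gaussTail {l : ℝ} (hl : l ≤ 0) : 1 / 2 ≤ gaussTail l := by
  rw [← gaussTail_zero]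
  exact gaussTail_antitone hl

/-- Exponential tilting: for `t > l`, the density at `t` is at most `exp(A² - A l)` times the
density translated by `2A`, whose total mass is `1`. The parameter `A` is free, so the cutoff decays
faster than any power of `x / Y`. -/
theorem gaussTail_le_exp {A : ℝ} (hA : 0 ≤ A) (l : ℝ) :
    gaussTail l ≤ Real.exp (A ^ 2 - A * l) := by
  have h1 : MeasureTheory.Integrable fun t => gaussDens (t - 2 * A) :=
    integrable_gaussDens.comp_sub_right _
  have h2 : ∫ t, gaussDens (t - 2 * A) = 1 := by
    rw [MeasureTheory.integral_sub_right_eq_self gaussDens, integral_gaussDens]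
  calc gaussTail l ≤ ∫ t in Set.Ioi l, Real.exp (A ^ 2 - A * l) * gaussDens (t - 2 * A) := by
        refine MeasureTheory.setIntegral_mono_on integrable_gaussDens.integrableOn
          (h1.const_mul _).integrableOn measurableSet_Ioi fun t ht => ?_
        have ht : l < t := ht
        unfold gaussDens
        rw [mul_left_comm, ← Real.exp_add]
        gcongr
        nlinarith
    _ ≤ ∫ t, Real.exp (A ^ 2 - A * l) * gaussDens (t - 2 * A) :=
        MeasureTheory.setIntegral_le_integral (h1.const_mul _)
          (Eventually.of_forall fun t => mul_nonneg (Real.exp_pos _).le (gaussDens_pos _).le)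
    _ = _ := by rw [MeasureTheory.integral_const_mul, h2, mul_one]

theorem abs_mul_exp_neg_sq_le (l : ℝ) : |l| * Real.exp (-(1 / 4) * l ^ 2) ≤ 1 := by
  have h := Real.add_one_le_exp ((1 / 4) * l ^ 2)
  have h2 : |l| ≤ Real.exp ((1 / 4) * l ^ 2) := by
    have : 0 ≤ (|l| / 2 - 1) ^ 2 := sq_nonneg _
    have h3 := sq_abs l
    nlinarith
  rw [neg_mul, Real.exp_neg, ← div_eq_mul_inv, div_le_one (Real.exp_pos _)]
  exact h2

theorem abs_half_mul_gaussDens_le (l : ℝ) : |l / 2 * gaussDens l| ≤ 1 / 4 := by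
  have h1 : (2 * √Real.pi)⁻¹ ≤ 1 / 2 := by
    rw [inv_le_comm₀ (by positivity) (by norm_num)]
    linarith [one_le_sqrt_pi]
  have h2 : 0 < (2 * √Real.pi)⁻¹ := by positivity
  have := abs_mul_exp_neg_sq_le l
  rw [abs_mul, abs_of_pos (gaussDens_pos l), abs_div, abs_two, gaussDens]
  calc _ = (2 * √Real.pi)⁻¹ / 2 * (|l| * Real.exp (-(1 / 4) * l ^ 2)) := by ring
    _ ≤ (1 / 2) / 2 * 1 := by gcongr
    _ = _ := by norm_num

/-- The smooth weight `x^{-σ}` cut off at `Y`. -/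
def cut (σ Y x : ℝ) : ℝ := x ^ (-σ) * gaussTail (Real.log x - Real.log Y)

/-- First derivative of `cut`. -/
def cut₁ (σ Y x : ℝ) : ℝ :=
  -(x ^ (-σ - 1) * (σ * gaussTail (Real.log x - Real.log Y) + gaussDens (Real.log x - Real.log Y)))

/-- Second derivative of `cut`. -/
def cut₂ (σ Y x : ℝ) : ℝ :=
  x ^ (-σ - 2) * ((σ + 1) * (σ * gaussTail (Real.log x - Real.log Y) +
    gaussDens (Real.log x - Real.log Y)) + σ * gaussDens (Real.log x - Real.log Y) +
    (Real.log x - Real.log Y) / 2 * gaussDens (Real.log x - Real.log Y))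

theorem hasDerivAt_cut (σ Y : ℝ) {x : ℝ} (hx : 0 < x) :
    HasDerivAt (cut σ Y) (cut₁ σ Y x) x := by
  have h1 := Real.hasDerivAt_rpow_const (p := -σ) (Or.inl hx.ne')
  have h2 := (hasDerivAt_gaussTail (Real.log x - Real.log Y)).comp x
    ((Real.hasDerivAt_log hx.ne').sub_const (Real.log Y))
  refine (h1.mul h2).congr_deriv ?_
  have h3 : x ^ (-σ) = x ^ (-σ - 1) * x := by
    rw [Real.rpow_sub_one hx.ne']; field_simp
  simp only [Function.comp_apply, cut₁]
  rw [h3]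
  field_simp
  ring

theorem hasDerivAt_cut₁ (σ Y : ℝ) {x : ℝ} (hx : 0 < x) :
    HasDerivAt (cut₁ σ Y) (cut₂ σ Y x) x := by
  have h1 := Real.hasDerivAt_rpow_const (p := -σ - 1) (Or.inl hx.ne')
  have hl := (Real.hasDerivAt_log hx.ne').sub_const (Real.log Y)
  have h2 := (hasDerivAt_gaussTail (Real.log x - Real.log Y)).comp x hl
  have h3 := (hasDerivAt_gaussDens (Real.log x - Real.log Y)).comp x hl
  refine (h1.mul ((h2.const_mul σ).add h3)).neg.congr_deriv ?_
  have h4 : x ^ (-σ - 1) = x ^ (-σ - 2) * x := by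
    rw [← Real.rpow_add_one hx.ne']; ring_nf
  have h5 : -σ - 1 - 1 = -σ - 2 := by ring
  simp only [Function.comp_apply, cut₂, Pi.add_apply, h5]
  rw [h4]
  field_simp
  ring

theorem cut_nonneg (σ Y : ℝ) {x : ℝ} (hx : 0 < x) : 0 ≤ cut σ Y x :=
  mul_nonneg (by positivity) (gaussTail_nonneg _)

theorem abs_cut_le (σ Y : ℝ) {x : ℝ} (hx : 0 < x) : |cut σ Y x| ≤ x ^ (-σ) := by
  rw [abs_of_nonneg (cut_nonneg σ Y hx)]
  exact mul_le_of_le_one_right (by positivity) (gaussTail_le_one _)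

theorem abs_cut₁_le {σ : ℝ} (hσ : 0 ≤ σ) (hσ1 : σ ≤ 1) (Y : ℝ) {x : ℝ} (hx : 0 < x) :
    |cut₁ σ Y x| ≤ 2 * x ^ (-σ - 1) := by
  set l := Real.log x - Real.log Y with hl
  have h1 := gaussTail_nonneg l
  have h2 := gaussTail_le_one l
  have h3 := gaussDens_pos l
  have h4 := gaussDens_le l
  have h5 : 0 < x ^ (-σ - 1) := by positivity
  rw [cut₁, abs_neg, abs_mul, abs_of_pos h5, ← hl, abs_of_nonneg (by positivity), mul_comm 2]
  gcongr
  nlinarith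

theorem abs_cut₂_le {σ : ℝ} (hσ : 0 ≤ σ) (hσ1 : σ ≤ 1) (Y : ℝ) {x : ℝ} (hx : 0 < x) :
    |cut₂ σ Y x| ≤ 4 * x ^ (-σ - 2) := by
  set l := Real.log x - Real.log Y with hl
  have h1 := gaussTail_nonneg l
  have h2 := gaussTail_le_one l
  have h3 := gaussDens_pos l
  have h4 := gaussDens_le l
  have h5 : 0 < x ^ (-σ - 2) := by positivity
  have h6 := abs_le.mp (abs_half_mul_gaussDens_le l)
  rw [cut₂, abs_mul, abs_of_pos h5, ← hl, mul_comm 4]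
  gcongr
  have h7 : 0 ≤ σ * gaussTail l + gaussDens l := by positivity
  have h8 : σ * gaussTail l + gaussDens l ≤ 3 / 2 := by nlinarith
  have h9 : 0 ≤ σ * gaussDens l := by positivity
  have h10 : σ * gaussDens l ≤ 1 / 2 := by nlinarith
  have h11 : 0 ≤ (σ + 1) * (σ * gaussTail l + gaussDens l) := by positivity
  have h12 : (σ + 1) * (σ * gaussTail l + gaussDens l) ≤ 3 := by nlinarith
  rw [abs_le]
  constructor <;> linarith

/-! ### The transform of the weight in `t`, and the weight of a pair `(n, n + h)`. -/

/-- The Fourier transform of `τ² e^{-τ²}`. -/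
def ker (v : ℝ) : ℝ := √Real.pi * ((1 / 2 - v ^ 2 / 4) * Real.exp (-(1 / 4) * v ^ 2))

/-- First derivative of `ker`. -/
def ker₁ (v : ℝ) : ℝ := √Real.pi * ((-(3 / 4) * v + v ^ 3 / 8) * Real.exp (-(1 / 4) * v ^ 2))

/-- Second derivative of `ker`. -/
def ker₂ (v : ℝ) : ℝ :=
  √Real.pi * ((-(3 / 4) + 3 / 4 * v ^ 2 - v ^ 4 / 16) * Real.exp (-(1 / 4) * v ^ 2))

theorem hasDerivAt_exp_neg_sq (v : ℝ) : HasDerivAt (fun v : ℝ => Real.exp (-(1 / 4) * v ^ 2))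
    (-(v / 2) * Real.exp (-(1 / 4) * v ^ 2)) v := by
  refine ((((hasDerivAt_id v).pow 2).const_mul (-(1 / 4) : ℝ)).exp).congr_deriv ?_
  simp
  ring

theorem hasDerivAt_ker (v : ℝ) : HasDerivAt ker (ker₁ v) v := by
  have h1 : HasDerivAt (fun v : ℝ => 1 / 2 - v ^ 2 / 4) (-(v / 2)) v := by
    refine ((((hasDerivAt_id v).pow 2).div_const 4).const_sub (1 / 2)).congr_deriv ?_
    simp; ring
  refine ((h1.mul (hasDerivAt_exp_neg_sq v)).const_mul _).congr_deriv ?_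
  simp only [ker₁]
  ring

theorem hasDerivAt_ker₁ (v : ℝ) : HasDerivAt ker₁ (ker₂ v) v := by
  have h1 : HasDerivAt (fun v : ℝ => -(3 / 4) * v + v ^ 3 / 8) (-(3 / 4) + 3 / 8 * v ^ 2) v := by
    refine (((hasDerivAt_id v).const_mul (-(3 / 4) : ℝ)).add
      (((hasDerivAt_id v).pow 3).div_const 8)).congr_deriv ?_
    simp; ring
  refine ((h1.mul (hasDerivAt_exp_neg_sq v)).const_mul _).congr_deriv ?_
  simp only [ker₂]
  ring

theorem abs_poly_mul_exp_le {p v : ℝ} (hp : |p| ≤ 2 + v ^ 2 + v ^ 4 / 16) :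
    |√Real.pi * (p * Real.exp (-(1 / 4) * v ^ 2))| ≤ 40 * Real.exp (-(1 / 8) * v ^ 2) := by
  have h1 : Real.exp (-(1 / 4) * v ^ 2) =
      Real.exp (-(1 / 8) * v ^ 2) * (Real.exp (1 / 8 * v ^ 2))⁻¹ := by
    rw [← Real.exp_neg, ← Real.exp_add]; ring_nf
  have h2 : 1 + 1 / 8 * v ^ 2 + (1 / 8 * v ^ 2) ^ 2 / 2 ≤ Real.exp (1 / 8 * v ^ 2) :=
    Real.quadratic_le_exp_of_nonneg (by positivity)
  have h3 : 2 + v ^ 2 + v ^ 4 / 16 ≤ 20 * Real.exp (1 / 8 * v ^ 2) := by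
    nlinarith [sq_nonneg v, sq_nonneg (v ^ 2)]
  have hE := Real.exp_pos (1 / 8 * v ^ 2)
  rw [abs_mul, abs_mul, Real.abs_exp, abs_of_nonneg (Real.sqrt_nonneg _), h1]
  calc _ ≤ 2 * ((20 * Real.exp (1 / 8 * v ^ 2)) *
        (Real.exp (-(1 / 8) * v ^ 2) * (Real.exp (1 / 8 * v ^ 2))⁻¹)) := by
        gcongr
        · exact sqrt_pi_le_two
        · exact hp.trans h3
    _ = _ := by field_simp; norm_num

theorem abs_ker_le (v : ℝ) : |ker v| ≤ 40 * Real.exp (-(1 / 8) * v ^ 2) := by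
  refine abs_poly_mul_exp_le (abs_le.mpr ⟨?_, ?_⟩) <;> nlinarith [sq_nonneg v, sq_nonneg (v ^ 2)]

theorem abs_ker₁_le (v : ℝ) : |ker₁ v| ≤ 40 * Real.exp (-(1 / 8) * v ^ 2) := by
  refine abs_poly_mul_exp_le (abs_le.mpr ⟨?_, ?_⟩) <;>
  nlinarith [sq_nonneg v, sq_nonneg (v ^ 2), sq_nonneg (v - 1), sq_nonneg (v + 1),
    sq_nonneg (v ^ 2 - v), sq_nonneg (v ^ 2 + v)]

theorem abs_ker₂_le (v : ℝ) : |ker₂ v| ≤ 40 * Real.exp (-(1 / 8) * v ^ 2) := by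
  refine abs_poly_mul_exp_le (abs_le.mpr ⟨?_, ?_⟩) <;> nlinarith [sq_nonneg v, sq_nonneg (v ^ 2)]

theorem exp_neg_sq_le_one (v : ℝ) : Real.exp (-(1 / 8) * v ^ 2) ≤ 1 := by
  rw [Real.exp_le_one_iff]; nlinarith [sq_nonneg v]

/-- The weight of the pair `(x, x + h)` in the smoothed mean square. -/
def pairWeight (σ Y T x h : ℝ) : ℝ :=
  T * (cut σ Y x * cut σ Y (x + h) * ker (T * (Real.log (x + h) - Real.log x)))

/-- The derivative of `pairWeight` in `x`. -/
def pairWeight₁ (σ Y T x h : ℝ) : ℝ :=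
  T * (cut₁ σ Y x * cut σ Y (x + h) * ker (T * (Real.log (x + h) - Real.log x)) +
    cut σ Y x * cut₁ σ Y (x + h) * ker (T * (Real.log (x + h) - Real.log x)) +
    cut σ Y x * cut σ Y (x + h) * (ker₁ (T * (Real.log (x + h) - Real.log x)) *
      (T * ((x + h)⁻¹ - x⁻¹))))

/-- The derivative of `pairWeight` in `h`. -/
def pairWeightH (σ Y T x h : ℝ) : ℝ :=
  T * (cut σ Y x * (cut₁ σ Y (x + h) * ker (T * (Real.log (x + h) - Real.log x)) +
    cut σ Y (x + h) * (ker₁ (T * (Real.log (x + h) - Real.log x)) * (T * (x + h)⁻¹))))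

/-- The mixed second derivative of `pairWeight`. -/
def pairWeight₁H (σ Y T x h : ℝ) : ℝ :=
  T * (cut₁ σ Y x * (cut₁ σ Y (x + h) * ker (T * (Real.log (x + h) - Real.log x)) +
      cut σ Y (x + h) * (ker₁ (T * (Real.log (x + h) - Real.log x)) * (T * (x + h)⁻¹))) +
    cut σ Y x * (cut₂ σ Y (x + h) * ker (T * (Real.log (x + h) - Real.log x)) +
      cut₁ σ Y (x + h) * (ker₁ (T * (Real.log (x + h) - Real.log x)) * (T * (x + h)⁻¹))) +
    cut σ Y x * (cut₁ σ Y (x + h) * (ker₁ (T * (Real.log (x + h) - Real.log x)) *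
        (T * ((x + h)⁻¹ - x⁻¹))) +
      cut σ Y (x + h) * (ker₂ (T * (Real.log (x + h) - Real.log x)) * (T * (x + h)⁻¹) *
        (T * ((x + h)⁻¹ - x⁻¹)) + ker₁ (T * (Real.log (x + h) - Real.log x)) *
        (T * (-((x + h) ^ 2)⁻¹)))))

theorem hasDerivAt_pairWeight (σ Y T : ℝ) {x h : ℝ} (hx : 0 < x) (hh : 0 ≤ h) :
    HasDerivAt (fun x => pairWeight σ Y T x h) (pairWeight₁ σ Y T x h) x := by
  have hy : 0 < x + h := by linarith
  have h1 := hasDerivAt_cut σ Y hx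
  have h2 := (hasDerivAt_cut σ Y hy).comp_add_const x h
  have h3 := (((Real.hasDerivAt_log hy.ne').comp_add_const x h).sub
    (Real.hasDerivAt_log hx.ne')).const_mul T
  have h4 := (hasDerivAt_ker (T * (Real.log (x + h) - Real.log x))).comp x h3
  refine (((h1.mul h2).mul h4).const_mul T).congr_deriv ?_
  simp only [pairWeight₁, Function.comp_apply, Pi.mul_apply, Pi.sub_apply]
  ring

theorem hasDerivAt_pairWeight_shift (σ Y T : ℝ) {x h : ℝ} (hx : 0 < x) (hh : 0 ≤ h) :
    HasDerivAt (fun h => pairWeight σ Y T x h) (pairWeightH σ Y T x h) h := by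
  have hy : 0 < x + h := by linarith
  have h2 := (hasDerivAt_cut σ Y hy).comp_const_add x h
  have h3 := (((Real.hasDerivAt_log hy.ne').comp_const_add x h).sub_const (Real.log x)).const_mul T
  have h4 := (hasDerivAt_ker (T * (Real.log (x + h) - Real.log x))).comp h h3
  refine (((h2.const_mul (cut σ Y x)).mul h4).const_mul T).congr_deriv ?_
  simp only [pairWeightH, Function.comp_apply]
  ring

theorem hasDerivAt_pairWeight₁_shift (σ Y T : ℝ) {x h : ℝ} (hx : 0 < x) (hh : 0 ≤ h) :
    HasDerivAt (fun h => pairWeight₁ σ Y T x h) (pairWeight₁H σ Y T x h) h := by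
  have hy : 0 < x + h := by linarith
  have h2 := (hasDerivAt_cut σ Y hy).comp_const_add x h
  have h2' := (hasDerivAt_cut₁ σ Y hy).comp_const_add x h
  have h3 := (((Real.hasDerivAt_log hy.ne').comp_const_add x h).sub_const (Real.log x)).const_mul T
  have h4 := (hasDerivAt_ker (T * (Real.log (x + h) - Real.log x))).comp h h3
  have h4' := (hasDerivAt_ker₁ (T * (Real.log (x + h) - Real.log x))).comp h h3
  have h5 := (((hasDerivAt_inv hy.ne').comp_const_add x h).sub_const (x⁻¹)).const_mul T
  have h6 := (((h2.const_mul (cut₁ σ Y x)).mul h4).add ((h2'.const_mul (cut σ Y x)).mul h4)).add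
    ((h2.const_mul (cut σ Y x)).mul (h4'.mul h5))
  refine (h6.const_mul T).congr_deriv ?_
  simp only [pairWeight₁H, Function.comp_apply, Pi.mul_apply]
  ring

theorem abs_mul_le_of_le {a b A B : ℝ} (ha : |a| ≤ A) (hb : |b| ≤ B) : |a * b| ≤ A * B := by
  rw [abs_mul]
  exact mul_le_mul ha hb (abs_nonneg _) ((abs_nonneg _).trans ha)

theorem abs_add_le_of_le {a b A B : ℝ} (ha : |a| ≤ A) (hb : |b| ≤ B) : |a + b| ≤ A + B :=
  (abs_add_le _ _).trans (add_le_add ha hb)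

-- The bounds are arranged as input for `abs_block_sub_le`. A derivative in `x` costs `P / M`, as
-- the argument of the kernel varies by `T h / (x (x + h)) ≤ P / M`; a derivative in `h` costs `T /
-- M ≤ P / H`. No bound depends on `Y`.
set_option maxHeartbeats 1000000 in
theorem pairWeight_bounds {σ : ℝ} (hσ : 1 / 2 ≤ σ) (hσ1 : σ ≤ 1) (Y : ℝ) {T P M H x h : ℝ}
    (hT : 1 ≤ T) (hP : 1 ≤ P) (hM : 1 ≤ M) (hH : 0 < H) (hTH : T * H ≤ P * M) (hx : M ≤ x)
    (hh : 0 ≤ h) (hhH : h ≤ H) :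
    |pairWeight σ Y T x h| ≤ 2000 * T * P ^ 2 / M ∧
    |pairWeight₁ σ Y T x h| ≤ 2000 * T * P ^ 2 / M / M ∧
    |pairWeightH σ Y T x h| ≤ 2000 * T * P ^ 2 / M / H ∧
    |pairWeight₁H σ Y T x h| ≤ 2000 * T * P ^ 2 / M / M / H := by
  have hM0 : 0 < M := by linarith
  have hx0 : 0 < x := by linarith
  have hy0 : 0 < x + h := by linarith
  have hxy : M ≤ x + h := by linarith
  set m := M ^ (-(1 / 2) : ℝ) with hm
  have hm0 : 0 < m := by positivity
  have hm2 : m * m = M⁻¹ := by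
    rw [hm, ← Real.rpow_add hM0, ← Real.rpow_neg_one]; norm_num
  have hpow : ∀ y, M ≤ y → y ^ (-σ) ≤ m := fun y hy => by
    calc y ^ (-σ) ≤ y ^ (-(1 / 2) : ℝ) :=
          Real.rpow_le_rpow_of_exponent_le (by linarith) (by linarith)
      _ ≤ _ := Real.rpow_le_rpow_of_nonpos hM0 hy (by norm_num)
  have hinv : ∀ y, M ≤ y → y⁻¹ ≤ M⁻¹ := fun y hy => inv_anti₀ hM0 hy
  have hpow1 : ∀ y, M ≤ y → y ^ (-σ - 1) ≤ m * M⁻¹ := fun y hy => by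
    rw [Real.rpow_sub_one (by linarith), div_eq_mul_inv]
    exact mul_le_mul (hpow y hy) (hinv y hy) (by rw [inv_nonneg]; linarith) hm0.le
  have hpow2 : ∀ y, M ≤ y → y ^ (-σ - 2) ≤ m * M⁻¹ * M⁻¹ := fun y hy => by
    rw [show -σ - 2 = -σ - 1 - 1 by ring, Real.rpow_sub_one (by linarith), div_eq_mul_inv]
    exact mul_le_mul (hpow1 y hy) (hinv y hy) (by rw [inv_nonneg]; linarith) (by positivity)
  have hσ0 : 0 ≤ σ := by linarith
  have a0 := (abs_cut_le σ Y hx0).trans (hpow x hx)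
  have a1 : |cut₁ σ Y x| ≤ 2 * (m * M⁻¹) :=
    (abs_cut₁_le hσ0 hσ1 Y hx0).trans (by linarith [hpow1 x hx])
  have b0 := (abs_cut_le σ Y hy0).trans (hpow _ hxy)
  have b1 : |cut₁ σ Y (x + h)| ≤ 2 * (m * M⁻¹) :=
    (abs_cut₁_le hσ0 hσ1 Y hy0).trans (by linarith [hpow1 _ hxy])
  have b2 : |cut₂ σ Y (x + h)| ≤ 4 * (m * M⁻¹ * M⁻¹) :=
    (abs_cut₂_le hσ0 hσ1 Y hy0).trans (by linarith [hpow2 _ hxy])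
  set v := T * (Real.log (x + h) - Real.log x)
  have f0 : |ker v| ≤ 40 := (abs_ker_le v).trans (by linarith [exp_neg_sq_le_one v])
  have f1 : |ker₁ v| ≤ 40 := (abs_ker₁_le v).trans (by linarith [exp_neg_sq_le_one v])
  have f2 : |ker₂ v| ≤ 40 := (abs_ker₂_le v).trans (by linarith [exp_neg_sq_le_one v])
  have hT' : |T| ≤ T := (abs_of_nonneg (by linarith)).le
  have hyi : |(x + h)⁻¹| ≤ M⁻¹ := by
    rw [abs_of_pos (by positivity)]; exact hinv _ hxy
  have u0 : |T * (x + h)⁻¹| ≤ T * M⁻¹ := abs_mul_le_of_le hT' hyi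
  have u1 : |T * (-((x + h) ^ 2)⁻¹)| ≤ T * (M⁻¹ * M⁻¹) := by
    refine abs_mul_le_of_le hT' ?_
    rw [abs_neg, sq, mul_inv]
    exact abs_mul_le_of_le hyi hyi
  have z0 : |T * ((x + h)⁻¹ - x⁻¹)| ≤ P * M⁻¹ := by
    have h1 : (x + h)⁻¹ - x⁻¹ = -(h * (x⁻¹ * (x + h)⁻¹)) := by field_simp; ring
    rw [h1, abs_mul, abs_neg, abs_of_nonneg (by linarith : 0 ≤ T),
      abs_of_nonneg (by positivity)]
    calc T * (h * (x⁻¹ * (x + h)⁻¹)) ≤ T * (H * (M⁻¹ * M⁻¹)) := by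
          have := hinv x hx
          have := hinv _ hxy
          gcongr
      _ = (T * H) * (M⁻¹ * M⁻¹) := by ring
      _ ≤ (P * M) * (M⁻¹ * M⁻¹) := by gcongr
      _ = _ := by field_simp
  have hT0 : 0 < T := by linarith
  have hP0 : 0 < P := by linarith
  have hTP : T / M ≤ P / H := by rw [div_le_div_iff₀ hM0 hH]; linarith
  have hPP : P ≤ P ^ 2 := by nlinarith
  refine ⟨?_, ?_, ?_, ?_⟩
  · refine (abs_mul_le_of_le hT' (abs_mul_le_of_le (abs_mul_le_of_le a0 b0) f0)).trans ?_
    calc T * (m * m * 40) = 40 * T * 1 / M := by rw [hm2]; ring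
      _ ≤ _ := by
          gcongr
          · norm_num
          · nlinarith
  · refine (abs_mul_le_of_le hT' (abs_add_le_of_le (abs_add_le_of_le
      (abs_mul_le_of_le (abs_mul_le_of_le a1 b0) f0)
      (abs_mul_le_of_le (abs_mul_le_of_le a0 b1) f0))
      (abs_mul_le_of_le (abs_mul_le_of_le a0 b0) (abs_mul_le_of_le f1 z0)))).trans ?_
    calc _ = T * (160 + 40 * P) * (m * m) * M⁻¹ := by ring
      _ = T * (160 + 40 * P) / M / M := by rw [hm2]; ring
      _ ≤ T * (2000 * P ^ 2) / M / M := by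
          gcongr
          nlinarith
      _ = _ := by ring
  · refine (abs_mul_le_of_le hT' (abs_mul_le_of_le a0 (abs_add_le_of_le (abs_mul_le_of_le b1 f0)
      (abs_mul_le_of_le b0 (abs_mul_le_of_le f1 u0))))).trans ?_
    calc _ = T * (80 + 40 * T) * (m * m) * M⁻¹ := by ring
      _ = (80 + 40 * T) * T / M / M := by rw [hm2]; ring
      _ ≤ (120 * T) * T / M / M := by gcongr; linarith
      _ = 120 * T / M * (T / M) := by ring
      _ ≤ 120 * T / M * (P / H) := by gcongr
      _ = 120 * T * P / M / H := by ring
      _ ≤ _ := by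
          gcongr
          norm_num
  · refine (abs_mul_le_of_le hT' (abs_add_le_of_le (abs_add_le_of_le
      (abs_mul_le_of_le a1 (abs_add_le_of_le (abs_mul_le_of_le b1 f0)
        (abs_mul_le_of_le b0 (abs_mul_le_of_le f1 u0))))
      (abs_mul_le_of_le a0 (abs_add_le_of_le (abs_mul_le_of_le b2 f0)
        (abs_mul_le_of_le b1 (abs_mul_le_of_le f1 u0)))))
      (abs_mul_le_of_le a0 (abs_add_le_of_le (abs_mul_le_of_le b1 (abs_mul_le_of_le f1 z0))
        (abs_mul_le_of_le b0 (abs_add_le_of_le (abs_mul_le_of_le (abs_mul_le_of_le f2 u0) z0)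
          (abs_mul_le_of_le f1 u1))))))).trans ?_
    calc _ = T * (320 + 200 * T + 80 * P + 40 * T * P) * (m * m) * (M⁻¹ * M⁻¹) := by ring
      _ = T * (320 + 200 * T + 80 * P + 40 * T * P) / M / M / M := by rw [hm2]; ring
      _ ≤ T * (640 * T * P) / M / M / M := by
          gcongr
          have e1 : T ≤ T * P := le_mul_of_one_le_right hT0.le hP
          have e2 : P ≤ T * P := le_mul_of_one_le_left hP0.le hT
          linarith
      _ = 640 * T * P / M / M * (T / M) := by ring
      _ ≤ 640 * T * P / M / M * (P / H) := by gcongr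
      _ = 640 * T * P ^ 2 / M / M / H := by ring
      _ ≤ _ := by
          gcongr
          norm_num

/-! ### The integral of the pair weight over the shift. -/

theorem abs_taylor_remainder_le {γ γ₁ γ₂ : ℝ → ℝ} (h₁ : ∀ u, HasDerivAt γ (γ₁ u) u)
    (h₂ : ∀ u, HasDerivAt γ₁ (γ₂ u) u) {B U : ℝ} (hB : ∀ u ∈ Set.Icc 0 U, |γ₂ u| ≤ B) {u : ℝ}
    (hu : u ∈ Set.Icc 0 U) : |γ u - γ 0 - u * γ₁ 0| ≤ B * u ^ 2 := by
  have hB0 : 0 ≤ B := (abs_nonneg _).trans (hB u hu)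
  have key : ∀ v ∈ Set.Icc 0 u, |γ₁ v - γ₁ 0| ≤ B * u := fun v hv => by
    have := (convex_Icc 0 u).norm_image_sub_le_of_norm_hasDerivWithin_le (f := γ₁) (C := B)
      (fun w _ => (h₂ w).hasDerivWithinAt) (fun w hw => hB w ⟨hw.1, hw.2.trans hu.2⟩)
      ⟨le_rfl, hu.1⟩ hv
    refine this.trans ?_
    rw [sub_zero, Real.norm_of_nonneg hv.1]
    gcongr
    exact hv.2
  have := (convex_Icc 0 u).norm_image_sub_le_of_norm_hasDerivWithin_le
    (f := fun v => γ v - v * γ₁ 0) (f' := fun v => γ₁ v - 1 * γ₁ 0) (C := B * u)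
    (fun w _ => ((h₁ w).sub ((hasDerivAt_id w).mul_const _)).hasDerivWithinAt)
    (fun w hw => by rw [one_mul]; exact key w hw) ⟨le_rfl, hu.1⟩ ⟨hu.1, le_rfl⟩
  simp only [zero_mul, sub_zero, Real.norm_eq_abs, abs_of_nonneg hu.1] at this
  calc _ = |γ u - u * γ₁ 0 - γ 0| := by ring_nf
    _ ≤ _ := this.trans (le_of_eq (by ring))

/-- The antiderivative vanishes both at `0` and at infinity, which reflects the double zero of `t²
exp(-t²)` at `t = 0`. Hence the term of order one leaves nothing but an exponentially small
quantity. -/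
theorem integral_mul_ker (T U : ℝ) : ∫ u in (0 : ℝ)..U, T * ker (T * u) =
    √Real.pi * (T * U / 2) * Real.exp (-(1 / 4) * (T * U) ^ 2) := by
  have h : ∀ v : ℝ, HasDerivAt (fun v : ℝ => √Real.pi * (v / 2) * Real.exp (-(1 / 4) * v ^ 2))
      (ker v) v := fun v => by
    refine ((((hasDerivAt_id v).div_const 2).const_mul _).mul
      (hasDerivAt_exp_neg_sq v)).congr_deriv ?_
    simp only [ker, id]
    ring
  have hk : Continuous ker := continuous_iff_continuousAt.mpr fun v => (hasDerivAt_ker v).continuousAt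
  rw [intervalIntegral.integral_eq_sub_of_hasDerivAt (f := fun u =>
    √Real.pi * (T * u / 2) * Real.exp (-(1 / 4) * (T * u) ^ 2))]
  · simp
  · intro u _
    refine ((h (T * u)).comp u ((hasDerivAt_id u).const_mul T)).congr_deriv ?_
    ring
  · exact (by fun_prop : Continuous fun u => T * ker (T * u)).intervalIntegrable _ _

/-- Here the antiderivative does not vanish at `0`; its value `√π` there is the source of the main
term `-√π / T`. -/
theorem integral_mul_id_ker {T : ℝ} (hT : 0 < T) (U : ℝ) :
    ∫ u in (0 : ℝ)..U, T * ker (T * u) * u =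
    T⁻¹ * (√Real.pi * ((T * U) ^ 2 / 2 + 1) * Real.exp (-(1 / 4) * (T * U) ^ 2) - √Real.pi) := by
  have h : ∀ v : ℝ, HasDerivAt
      (fun v : ℝ => √Real.pi * (v ^ 2 / 2 + 1) * Real.exp (-(1 / 4) * v ^ 2)) (v * ker v) v :=
      fun v => by
    refine ((((((hasDerivAt_id v).pow 2).div_const 2).add_const 1).const_mul _).mul
      (hasDerivAt_exp_neg_sq v)).congr_deriv ?_
    simp only [ker, id]
    simp
    ring
  have hk : Continuous ker := continuous_iff_continuousAt.mpr fun v => (hasDerivAt_ker v).continuousAt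
  rw [intervalIntegral.integral_eq_sub_of_hasDerivAt (f := fun u =>
    T⁻¹ * (√Real.pi * ((T * u) ^ 2 / 2 + 1) * Real.exp (-(1 / 4) * (T * u) ^ 2)))]
  · simp; ring
  · intro u _
    refine (((h (T * u)).comp u ((hasDerivAt_id u).const_mul T)).const_mul T⁻¹).congr_deriv ?_
    field_simp
  · exact (by fun_prop : Continuous fun u => T * ker (T * u) * u).intervalIntegrable _ _

theorem integral_sq_mul_abs_ker_le {T : ℝ} (hT : 0 < T) {U : ℝ} (hU : 0 ≤ U) :
    ∫ u in (0 : ℝ)..U, |T * ker (T * u)| * u ^ 2 ≤ 1000 * T⁻¹ ^ 2 := by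
  have hk : Continuous ker := continuous_iff_continuousAt.mpr fun v => (hasDerivAt_ker v).continuousAt
  have hcont : Continuous fun u : ℝ =>
      120 * T⁻¹ ^ 2 * (T * (T * u * Real.exp (-(1 / 16) * (T * u) ^ 2))) := by fun_prop
  have hle : ∀ u ∈ Set.Icc 0 U, |T * ker (T * u)| * u ^ 2 ≤
      120 * T⁻¹ ^ 2 * (T * (T * u * Real.exp (-(1 / 16) * (T * u) ^ 2))) := by
    intro u hu
    set v := T * u with hv
    have hv0 : 0 ≤ v := mul_nonneg hT.le hu.1
    have huv : u = T⁻¹ * v := by rw [hv]; field_simp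
    have h1 : Real.exp (-(1 / 8) * v ^ 2) =
      Real.exp (-(1 / 16) * v ^ 2) * (Real.exp (1 / 16 * v ^ 2))⁻¹ := by
      rw [← Real.exp_neg, ← Real.exp_add]; ring_nf
    have h2 : v ≤ 3 * Real.exp (1 / 16 * v ^ 2) := by
      have := Real.add_one_le_exp (1 / 16 * v ^ 2)
      nlinarith [sq_nonneg (v - 4)]
    have hE := Real.exp_pos (1 / 16 * v ^ 2)
    have h3 : v * (Real.exp (1 / 16 * v ^ 2))⁻¹ ≤ 3 := by
      rw [← div_eq_mul_inv, div_le_iff₀ hE]; exact h2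
    rw [abs_mul, abs_of_pos hT]
    calc T * |ker v| * u ^ 2 ≤ T * (40 * Real.exp (-(1 / 8) * v ^ 2)) * u ^ 2 := by
          gcongr
          exact abs_ker_le v
      _ = 40 * T⁻¹ ^ 2 * (T * (v * Real.exp (-(1 / 16) * v ^ 2))) *
          (v * (Real.exp (1 / 16 * v ^ 2))⁻¹) := by rw [huv, h1]; ring
      _ ≤ 40 * T⁻¹ ^ 2 * (T * (v * Real.exp (-(1 / 16) * v ^ 2))) * 3 := by gcongr
      _ = _ := by ring
  refine (intervalIntegral.integral_mono_on hU
    (Continuous.intervalIntegrable (by fun_prop) _ _) (hcont.intervalIntegrable _ _) hle).trans ?_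
  rw [intervalIntegral.integral_eq_sub_of_hasDerivAt (f := fun u =>
    120 * T⁻¹ ^ 2 * (-8 * Real.exp (-(1 / 16) * (T * u) ^ 2)))]
  · simp only [mul_zero, ne_eq, OfNat.ofNat_ne_zero, not_false_eq_true, zero_pow, Real.exp_zero]
    have : 0 < T⁻¹ ^ 2 := by positivity
    have := Real.exp_pos (-(1 / 16) * (T * U) ^ 2)
    nlinarith
  · intro u _
    have h1 := ((((hasDerivAt_id u).const_mul T).pow 2).const_mul (-(1 / 16) : ℝ)).exp
    refine ((h1.const_mul (-8 : ℝ)).const_mul (120 * T⁻¹ ^ 2)).congr_deriv ?_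
    simp only [Pi.pow_apply, id, Nat.cast_ofNat, Nat.add_one_sub_one, pow_one, mul_one]
    ring
  · exact hcont.intervalIntegrable _ _

/-- The weight in the logarithmic variable. -/
theorem hasDerivAt_cut_exp (σ Y : ℝ) {x : ℝ} (hx : 0 < x) (u : ℝ) :
    HasDerivAt (fun u => cut σ Y (x * Real.exp u) * Real.exp u)
      (Real.exp u * (cut σ Y (x * Real.exp u) +
        x * Real.exp u * cut₁ σ Y (x * Real.exp u))) u := by
  have hy : 0 < x * Real.exp u := by positivity
  have h1 := (hasDerivAt_cut σ Y hy).comp u ((Real.hasDerivAt_exp u).const_mul x)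
  refine (h1.mul (Real.hasDerivAt_exp u)).congr_deriv ?_
  simp only [Function.comp_apply]
  ring

theorem hasDerivAt_cut_exp₁ (σ Y : ℝ) {x : ℝ} (hx : 0 < x) (u : ℝ) :
    HasDerivAt (fun u => Real.exp u * (cut σ Y (x * Real.exp u) +
        x * Real.exp u * cut₁ σ Y (x * Real.exp u)))
      (Real.exp u * (cut σ Y (x * Real.exp u) +
        3 * (x * Real.exp u * cut₁ σ Y (x * Real.exp u)) +
        (x * Real.exp u) ^ 2 * cut₂ σ Y (x * Real.exp u))) u := by
  have hy : 0 < x * Real.exp u := by positivity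
  have he := (Real.hasDerivAt_exp u).const_mul x
  have h1 := (hasDerivAt_cut σ Y hy).comp u he
  have h2 := (hasDerivAt_cut₁ σ Y hy).comp u he
  refine ((Real.hasDerivAt_exp u).mul (h1.add (he.mul h2))).congr_deriv ?_
  simp only [Function.comp_apply, Pi.add_apply, Pi.mul_apply]
  ring

theorem abs_cut_exp₂_le {σ : ℝ} (hσ : 0 ≤ σ) (hσ1 : σ ≤ 1) (Y : ℝ) {y : ℝ} (hy : 0 < y) :
    |cut σ Y y + 3 * (y * cut₁ σ Y y) + y ^ 2 * cut₂ σ Y y| ≤ 11 * y ^ (-σ) := by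
  have h0 := abs_cut_le σ Y hy
  have h1 := abs_cut₁_le hσ hσ1 Y hy
  have h2 := abs_cut₂_le hσ hσ1 Y hy
  have e1 : y * y ^ (-σ - 1) = y ^ (-σ) := by
    rw [Real.rpow_sub_one hy.ne']; field_simp
  have e2 : y ^ 2 * y ^ (-σ - 2) = y ^ (-σ) := by
    rw [show -σ - 2 = -σ - 1 - 1 by ring, Real.rpow_sub_one hy.ne', Real.rpow_sub_one hy.ne']
    field_simp
  have h1' : |y * cut₁ σ Y y| ≤ 2 * y ^ (-σ) := by
    rw [abs_mul, abs_of_pos hy, ← e1]; nlinarith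
  have h2' : |y ^ 2 * cut₂ σ Y y| ≤ 4 * y ^ (-σ) := by
    rw [abs_mul, abs_of_pos (by positivity : 0 < y ^ 2), ← e2]
    have : 0 < y ^ 2 := by positivity
    nlinarith
  have h3 : |3 * (y * cut₁ σ Y y)| ≤ 3 * (2 * y ^ (-σ)) := by
    rw [abs_mul, abs_of_pos (by norm_num : (0 : ℝ) < 3)]; linarith
  refine (abs_add_le_of_le (abs_add_le_of_le h0 h3) h2').trans (le_of_eq (by ring))

-- In the logarithmic variable the kernel is concentrated on `u ≪ 1/T`, so the cutoff is expanded to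
-- second order at `u = 0`. The constant term is exponentially small, the linear term gives `-√π/T`,
-- and the remainder is `O(T⁻²)`.
set_option maxHeartbeats 1000000 in
theorem abs_integral_pairWeight_add_le {σ : ℝ} (hσ : 1 / 2 ≤ σ) (hσ1 : σ ≤ 1) (Y : ℝ) {T x H : ℝ}
    (hT : 1 ≤ T) (hx : 0 < x) (hH0 : 0 ≤ H) (hH : H ≤ 2 * x) :
    |(∫ h in (0 : ℝ)..H, pairWeight σ Y T x h) +
        √Real.pi / T * (x * cut σ Y x * (cut σ Y x + x * cut₁ σ Y x))| ≤
      40000 * x ^ (1 - 2 * σ) *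
        (T⁻¹ ^ 2 + Real.exp (-(1 / 8) * (T * (Real.log (x + H) - Real.log x)) ^ 2)) := by
  have hT0 : 0 < T := by linarith
  set U := Real.log (x + H) - Real.log x with hU
  have hU0 : 0 ≤ U := sub_nonneg.mpr (Real.log_le_log hx (by linarith))
  have hxH : 0 < x + H := by linarith
  have hexpU : x * Real.exp U = x + H := by
    rw [hU, Real.exp_sub, Real.exp_log hxH, Real.exp_log hx]; field_simp
  have hexpU3 : Real.exp U ≤ 3 := by
    have : x * Real.exp U ≤ x * 3 := by rw [hexpU]; linarith
    exact le_of_mul_le_mul_left this hx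
  set γ : ℝ → ℝ := fun u => cut σ Y (x * Real.exp u) * Real.exp u with hγ
  set γ₁ : ℝ → ℝ := fun u => Real.exp u * (cut σ Y (x * Real.exp u) +
        x * Real.exp u * cut₁ σ Y (x * Real.exp u)) with hγ₁
  have hk : Continuous ker := continuous_iff_continuousAt.mpr fun v => (hasDerivAt_ker v).continuousAt
  have hγc : Continuous γ := continuous_iff_continuousAt.mpr
    fun u => (hasDerivAt_cut_exp σ Y hx u).continuousAt
  have hxσ : x ^ (1 - 2 * σ) = x * (x ^ (-σ) * x ^ (-σ)) := by
    rw [← Real.rpow_add hx, mul_comm x, ← Real.rpow_add_one hx.ne']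
    ring_nf
  -- The substitution `h = x (exp u - 1)`, under which `log (x + h) - log x` becomes `u`.
  have hsub : ∫ h in (0 : ℝ)..H, pairWeight σ Y T x h =
      x * cut σ Y x * ∫ u in (0 : ℝ)..U, T * ker (T * u) * γ u := by
    have h1 := intervalIntegral.integral_comp_mul_deriv' (a := 0) (b := U)
      (f := fun u => x * Real.exp u - x) (f' := fun u => x * Real.exp u)
      (g := fun h => pairWeight σ Y T x h)
      (fun u _ => (((Real.hasDerivAt_exp u).const_mul x).sub_const x))
      (by fun_prop)
      (fun h hh => by
        obtain ⟨u, hu, rfl⟩ := hh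
        rw [Set.uIcc_of_le hU0] at hu
        refine (hasDerivAt_pairWeight_shift σ Y T hx ?_).continuousAt.continuousWithinAt
        nlinarith [Real.one_le_exp hu.1])
    simp only [Real.exp_zero, mul_one, sub_self, hexpU, add_sub_cancel_left] at h1
    rw [← h1, ← intervalIntegral.integral_const_mul]
    refine intervalIntegral.integral_congr fun u _ => ?_
    simp only [Function.comp_apply, pairWeight, hγ, add_sub_cancel]
    rw [Real.log_mul hx.ne' (Real.exp_pos u).ne', Real.log_exp, add_sub_cancel_left]
    ring
  have hsplit : ∫ u in (0 : ℝ)..U, T * ker (T * u) * γ u =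
      γ 0 * (∫ u in (0 : ℝ)..U, T * ker (T * u)) + γ₁ 0 * (∫ u in (0 : ℝ)..U, T * ker (T * u) * u) +
        ∫ u in (0 : ℝ)..U, T * ker (T * u) * (γ u - γ 0 - u * γ₁ 0) := by
    rw [← intervalIntegral.integral_const_mul, ← intervalIntegral.integral_const_mul,
      ← intervalIntegral.integral_add, ← intervalIntegral.integral_add]
    · refine intervalIntegral.integral_congr fun u _ => ?_
      ring
    all_goals exact Continuous.intervalIntegrable (by fun_prop) _ _
  have hrem : |∫ u in (0 : ℝ)..U, T * ker (T * u) * (γ u - γ 0 - u * γ₁ 0)| ≤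
      33 * x ^ (-σ) * (1000 * T⁻¹ ^ 2) := by
    have h1 : ∀ u ∈ Set.Icc 0 U, ‖T * ker (T * u) * (γ u - γ 0 - u * γ₁ 0)‖ ≤
        33 * x ^ (-σ) * (|T * ker (T * u)| * u ^ 2) := by
      intro u hu
      have := abs_taylor_remainder_le (hasDerivAt_cut_exp σ Y hx) (hasDerivAt_cut_exp₁ σ Y hx)
        (B := 33 * x ^ (-σ)) (fun w hw => by
          have hy : 0 < x * Real.exp w := by positivity
          rw [abs_mul, Real.abs_exp]
          have h3 := abs_cut_exp₂_le (by linarith) hσ1 Y hy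
          have h4 : (x * Real.exp w) ^ (-σ) ≤ x ^ (-σ) := by
            apply Real.rpow_le_rpow_of_nonpos hx _ (by linarith)
            nlinarith [Real.one_le_exp hw.1]
          have h5 : Real.exp w ≤ 3 := (Real.exp_le_exp.mpr hw.2).trans hexpU3
          calc _ ≤ 3 * (11 * x ^ (-σ)) := by gcongr; exact h3.trans (by gcongr)
            _ = _ := by ring) hu
      rw [norm_mul, Real.norm_eq_abs, Real.norm_eq_abs]
      calc _ ≤ |T * ker (T * u)| * (33 * x ^ (-σ) * u ^ 2) := by gcongr
        _ = _ := by ring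
    refine (intervalIntegral.norm_integral_le_of_norm_le hU0 (g := fun u =>
      33 * x ^ (-σ) * (|T * ker (T * u)| * u ^ 2)) (MeasureTheory.ae_of_all _ fun u hu =>
        h1 u ⟨hu.1.le, hu.2⟩) (Continuous.intervalIntegrable (by fun_prop) _ _)).trans ?_
    rw [intervalIntegral.integral_const_mul]
    gcongr
    exact integral_sq_mul_abs_ker_le hT0 hU0
  set E := Real.exp (-(1 / 8) * (T * U) ^ 2) with hE
  have hE0 : 0 < E := Real.exp_pos _
  have hEsq : Real.exp (-(1 / 4) * (T * U) ^ 2) = E * E := by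
    rw [hE, ← Real.exp_add]; ring_nf
  have hv0 : 0 ≤ T * U := by positivity
  have hEv : (1 + (T * U) ^ 2) * E ≤ 8 := by
    have h1 := Real.add_one_le_exp (1 / 8 * (T * U) ^ 2)
    have h2 : E = (Real.exp (1 / 8 * (T * U) ^ 2))⁻¹ := by rw [hE, ← Real.exp_neg]; ring_nf
    rw [h2, ← div_eq_mul_inv, div_le_iff₀ (Real.exp_pos _)]
    linarith
  have hγ0 : γ 0 = cut σ Y x := by simp [hγ]
  have hγ₁0 : γ₁ 0 = cut σ Y x + x * cut₁ σ Y x := by simp [hγ₁]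
  have hb0 : |γ 0| ≤ x ^ (-σ) := hγ0 ▸ abs_cut_le σ Y hx
  have hb1 : |γ₁ 0| ≤ 3 * x ^ (-σ) := by
    rw [hγ₁0]
    have h1 := abs_cut₁_le (by linarith) hσ1 Y hx
    have e1 : x * x ^ (-σ - 1) = x ^ (-σ) := by
      rw [Real.rpow_sub_one hx.ne']; field_simp
    have h1' : |x * cut₁ σ Y x| ≤ 2 * x ^ (-σ) := by
      rw [abs_mul, abs_of_pos hx, ← e1]; nlinarith
    refine (abs_add_le_of_le (abs_cut_le σ Y hx) h1').trans (le_of_eq (by ring))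
  have hI1 : |√Real.pi * (T * U / 2) * (E * E)| ≤ 8 * E := by
    rw [abs_of_nonneg (by positivity)]
    calc √Real.pi * (T * U / 2) * (E * E) ≤ 2 * (T * U / 2) * (E * E) := by
          gcongr; exact sqrt_pi_le_two
      _ = (T * U) * E * E := by ring
      _ ≤ 8 * E := by
          gcongr
          nlinarith [sq_nonneg (T * U - 1)]
  have hI2 : |T⁻¹ * (√Real.pi * ((T * U) ^ 2 / 2 + 1) * (E * E))| ≤ 16 * E := by
    rw [abs_of_nonneg (by positivity)]
    have hTi : T⁻¹ ≤ 1 := inv_le_one_of_one_le₀ hT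
    calc _ ≤ 1 * (2 * ((T * U) ^ 2 / 2 + 1) * (E * E)) := by
          gcongr; exact sqrt_pi_le_two
      _ = ((T * U) ^ 2 + 2) * E * E := by ring
      _ ≤ 16 * E := by
          gcongr
          nlinarith [sq_nonneg (T * U)]
  have hxs : 0 < x ^ (-σ) := by positivity
  have heq : (∫ h in (0 : ℝ)..H, pairWeight σ Y T x h) +
        √Real.pi / T * (x * cut σ Y x * (cut σ Y x + x * cut₁ σ Y x)) =
      x * cut σ Y x * (γ 0 * (√Real.pi * (T * U / 2) * (E * E)) +
        γ₁ 0 * (T⁻¹ * (√Real.pi * ((T * U) ^ 2 / 2 + 1) * (E * E))) +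
        ∫ u in (0 : ℝ)..U, T * ker (T * u) * (γ u - γ 0 - u * γ₁ 0)) := by
    rw [hsub, hsplit, integral_mul_ker, integral_mul_id_ker hT0, hEsq, ← hγ₁0]
    ring
  rw [heq, hxσ]
  refine (abs_mul_le_of_le (abs_mul_le_of_le (abs_of_pos hx).le (abs_cut_le σ Y hx))
    (abs_add_le_of_le (abs_add_le_of_le (abs_mul_le_of_le hb0 hI1) (abs_mul_le_of_le hb1 hI2))
      hrem)).trans ?_
  calc _ = x * (x ^ (-σ) * x ^ (-σ)) * (56 * E + 33000 * T⁻¹ ^ 2) := by ring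
    _ ≤ x * (x ^ (-σ) * x ^ (-σ)) * (40000 * (T⁻¹ ^ 2 + E)) := by
        gcongr
        have : 0 < T⁻¹ ^ 2 := by positivity
        linarith
    _ = _ := by ring

/-! ### The off-diagonal main term: positivity, growth and scaling. -/

open Polynomial in
/-- The polynomial with `Q_k(x, 1) = Qpoly (log x)`. -/
def Qpoly (k : ℕ) : Polynomial ℝ := ∑ i ∈ Finset.range k, C (Qcoeff k 1 i) * X ^ (k - 1 - i)

theorem Q_one_eq (k : ℕ) (hk : 1 ≤ k) {x : ℝ} (hx : 0 < x) :
    Q k x 1 = (Qpoly k).eval (Real.log x) := by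
  rw [Q_eq_sum k hk hx one_ne_zero, Qpoly, Polynomial.eval_finsetSum]
  simp

theorem natDegree_Qpoly_le (k : ℕ) : (Qpoly k).natDegree ≤ k - 1 := by
  refine Polynomial.natDegree_sum_le_of_forall_le _ _ fun i _ => ?_
  exact (Polynomial.natDegree_C_mul_X_pow_le _ _).trans (by omega)

theorem coeff_Qpoly (k : ℕ) (hk : 1 ≤ k) : 0 < (Qpoly k).coeff (k - 1) := by
  rw [Qpoly, Polynomial.finsetSum_coeff, Finset.sum_eq_single 0]
  · rw [Nat.sub_zero, Polynomial.coeff_C_mul_X_pow, if_pos rfl, Qcoeff_one_zero]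
    positivity
  · intro i hi hi0
    have := Finset.mem_range.mp hi
    rw [Polynomial.coeff_C_mul_X_pow, if_neg (by omega)]
  · intro h
    exact absurd (Finset.mem_range.mpr (by omega)) h

theorem natDegree_Qpoly (k : ℕ) (hk : 1 ≤ k) : (Qpoly k).natDegree = k - 1 :=
  le_antisymm (natDegree_Qpoly_le k)
    (Polynomial.le_natDegree_of_ne_zero (coeff_Qpoly k hk).ne')

theorem derivative_natDegree_leadingCoeff {P : Polynomial ℝ} (hd : 0 < P.natDegree)
    (hl : 0 < P.leadingCoeff) :
    P.derivative.natDegree = P.natDegree - 1 ∧ 0 < P.derivative.leadingCoeff := by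
  have hc : 0 < P.derivative.coeff (P.natDegree - 1) := by
    rw [Polynomial.coeff_derivative, Nat.sub_add_cancel hd]
    exact mul_pos hl (by positivity)
  have hn : P.derivative.natDegree = P.natDegree - 1 :=
    le_antisymm (Polynomial.natDegree_derivative_le P)
      (Polynomial.le_natDegree_of_ne_zero hc.ne')
  exact ⟨hn, by rw [Polynomial.leadingCoeff, hn]; exact hc⟩

theorem tendsto_eval_atTop {P : Polynomial ℝ} (hd : 0 < P.natDegree) (hl : 0 < P.leadingCoeff) :
    Tendsto (fun x => P.eval x) atTop atTop :=
  P.tendsto_atTop_of_leadingCoeff_nonneg (Polynomial.natDegree_pos_iff_degree_pos.mp hd) hl.le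

/-- The product of `Qpoly` with its derivative. -/
def QQpoly (k : ℕ) : Polynomial ℝ := Qpoly k * (Qpoly k).derivative

/-- The polynomial and its derivative have positive leading coefficients, and hence so do their
product and the derivative of that product, all of positive degree. -/
theorem exists_QQpoly_monotoneOn (k : ℕ) (hk : 3 ≤ k) :
    ∃ L : ℝ, (∀ l, L ≤ l → 1 ≤ (QQpoly k).eval l) ∧
      MonotoneOn (fun l => (QQpoly k).eval l) (Set.Ici L) := by
  have hdeg := natDegree_Qpoly k (by omega)
  have hlead : 0 < (Qpoly k).leadingCoeff := by
    rw [Polynomial.leadingCoeff, hdeg]; exact coeff_Qpoly k (by omega)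
  obtain ⟨h1, h2⟩ := derivative_natDegree_leadingCoeff (by omega) hlead
  have hQd : (QQpoly k).natDegree = (k - 1) + (k - 1 - 1) := by
    rw [QQpoly, Polynomial.natDegree_mul (Polynomial.leadingCoeff_ne_zero.mp hlead.ne')
      (Polynomial.leadingCoeff_ne_zero.mp h2.ne'), h1, hdeg]
  have hQl : 0 < (QQpoly k).leadingCoeff := by
    rw [QQpoly, Polynomial.leadingCoeff_mul]; exact mul_pos hlead h2
  obtain ⟨h3, h4⟩ := derivative_natDegree_leadingCoeff (P := QQpoly k) (by omega) hQl
  have e1 := (tendsto_eval_atTop (by omega) hQl).eventually_ge_atTop 1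
  have e2 := (tendsto_eval_atTop (by omega) h4).eventually_ge_atTop 0
  obtain ⟨L, hL⟩ := eventually_atTop.mp (e1.and e2)
  refine ⟨L, fun l hl => (hL l hl).1, ?_⟩
  refine monotoneOn_of_deriv_nonneg (convex_Ici L) (QQpoly k).continuous.continuousOn
    (QQpoly k).differentiable.differentiableOn fun l hl => ?_
  rw [interior_Ici] at hl
  rw [Polynomial.deriv]
  exact (hL l (le_of_lt hl)).2

/-- The off-diagonal main term, up to a constant. -/
def mainMass (k : ℕ) (σ Y X N : ℝ) : ℝ :=
  ∫ x in X..N, x * (QQpoly k).eval (Real.log x) * cut σ Y x ^ 2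

theorem continuousOn_cut (σ Y : ℝ) : ContinuousOn (cut σ Y) (Set.Ioi 0) := fun _ hx =>
  (hasDerivAt_cut σ Y hx).continuousAt.continuousWithinAt

theorem continuousOn_cut₁ (σ Y : ℝ) : ContinuousOn (cut₁ σ Y) (Set.Ioi 0) := fun _ hx =>
  (hasDerivAt_cut₁ σ Y hx).continuousAt.continuousWithinAt

theorem continuousOn_eval_log (P : Polynomial ℝ) :
    ContinuousOn (fun x => P.eval (Real.log x)) (Set.Ioi 0) :=
  P.continuous.comp_continuousOn (ContinuousOn.log continuousOn_id fun _ hx => ne_of_gt hx)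

theorem continuousOn_mainMass (k : ℕ) (σ Y : ℝ) :
    ContinuousOn (fun x => x * (QQpoly k).eval (Real.log x) * cut σ Y x ^ 2) (Set.Ioi 0) :=
  (continuousOn_id.mul (continuousOn_eval_log _)).mul ((continuousOn_cut σ Y).pow 2)

/-- The derivative of `(x Q cut)² / 2` is the integrand plus `x Q Q' cut²`, where `Q'` is the
derivative in `log x`. Up to boundary terms the integral is therefore minus a positive quantity, and
the factor `-√π/T` makes the off-diagonal contribution positive. -/
theorem integral_Q_sq_mul_eq (k : ℕ) (hk : 1 ≤ k) (σ Y : ℝ) {X N : ℝ} (hX : 0 < X) (hXN : X ≤ N) :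
    ∫ x in X..N, Q k x 1 ^ 2 * (x * cut σ Y x * (cut σ Y x + x * cut₁ σ Y x)) =
      (N * Q k N 1 * cut σ Y N) ^ 2 / 2 - (X * Q k X 1 * cut σ Y X) ^ 2 / 2 -
        mainMass k σ Y X N := by
  have hsub : Set.uIcc X N ⊆ Set.Ioi 0 := by
    rw [Set.uIcc_of_le hXN]; exact fun x hx => lt_of_lt_of_le hX hx.1
  have hder : ∀ x ∈ Set.uIcc X N, HasDerivAt
      (fun x => (x * (Qpoly k).eval (Real.log x) * cut σ Y x) ^ 2 / 2)
      ((Qpoly k).eval (Real.log x) ^ 2 * (x * cut σ Y x * (cut σ Y x + x * cut₁ σ Y x)) +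
        x * (QQpoly k).eval (Real.log x) * cut σ Y x ^ 2) x := by
    intro x hx
    have hx0 : 0 < x := hsub hx
    have h1 := ((Qpoly k).hasDerivAt (Real.log x)).comp x (Real.hasDerivAt_log hx0.ne')
    have h2 := (((hasDerivAt_id x).mul h1).mul (hasDerivAt_cut σ Y hx0)).pow 2
    refine (h2.div_const 2).congr_deriv ?_
    simp only [Pi.mul_apply, Function.comp_apply, id, QQpoly, Polynomial.eval_mul]
    field_simp
    push_cast
    ring
  have hi1 : IntervalIntegrable (fun x => (Qpoly k).eval (Real.log x) ^ 2 *
      (x * cut σ Y x * (cut σ Y x + x * cut₁ σ Y x))) MeasureTheory.volume X N := by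
    refine ContinuousOn.intervalIntegrable (ContinuousOn.mono ?_ hsub)
    exact ((continuousOn_eval_log _).pow 2).mul ((continuousOn_id.mul (continuousOn_cut σ Y)).mul
      ((continuousOn_cut σ Y).add (continuousOn_id.mul (continuousOn_cut₁ σ Y))))
  have hi2 : IntervalIntegrable (fun x => x * (QQpoly k).eval (Real.log x) * cut σ Y x ^ 2)
      MeasureTheory.volume X N :=
    ((continuousOn_mainMass k σ Y).mono hsub).intervalIntegrable
  have := intervalIntegral.integral_eq_sub_of_hasDerivAt hder (hi1.add hi2)
  rw [intervalIntegral.integral_add hi1 hi2] at this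
  have hcongr : ∫ x in X..N, Q k x 1 ^ 2 * (x * cut σ Y x * (cut σ Y x + x * cut₁ σ Y x)) =
      ∫ x in X..N, (Qpoly k).eval (Real.log x) ^ 2 *
        (x * cut σ Y x * (cut σ Y x + x * cut₁ σ Y x)) :=
    intervalIntegral.integral_congr fun x hx => by
      rw [Q_one_eq k hk (hsub hx)]
  rw [hcongr, Q_one_eq k hk hX, Q_one_eq k hk (hX.trans_le hXN), mainMass]
  linarith

theorem cut_mul (σ : ℝ) {B Y x : ℝ} (hB : 0 < B) (hY : 0 < Y) (hx : 0 < x) :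
    cut σ (B * Y) (B * x) = B ^ (-σ) * cut σ Y x := by
  rw [cut, cut, Real.mul_rpow hB.le hx.le, Real.log_mul hB.ne' hx.ne', Real.log_mul hB.ne' hY.ne',
    add_sub_add_left_eq_sub]
  ring

/-- Substituting `x ↦ B x`, the cutoff is homogeneous and the Jacobian with the factor `x` gives
`B²`. Monotonicity of `QQpoly` and positivity on the extra interval `[X, B X]` only help. -/
theorem mainMass_scale (k : ℕ) (σ : ℝ) {B Y X N L : ℝ} (hB : 1 ≤ B) (hY : 0 < Y) (hX : 0 < X)
    (hXN : X ≤ N) (hL : L ≤ Real.log X) (hpos : ∀ l, L ≤ l → 1 ≤ (QQpoly k).eval l)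
    (hmono : MonotoneOn (fun l => (QQpoly k).eval l) (Set.Ici L)) :
    B ^ (2 - 2 * σ) * mainMass k σ Y X N ≤ mainMass k σ (B * Y) X (B * N) := by
  have hB0 : 0 < B := by linarith
  have hLx : ∀ x, X ≤ x → L ≤ Real.log x := fun x hx => hL.trans (Real.log_le_log hX hx)
  have hint : ∀ a b, 0 < a → a ≤ b → IntervalIntegrable
      (fun x => x * (QQpoly k).eval (Real.log x) * cut σ (B * Y) x ^ 2) MeasureTheory.volume a b :=
    fun a b ha hab => ((continuousOn_mainMass k σ (B * Y)).mono (by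
      rw [Set.uIcc_of_le hab]; exact fun x hx => lt_of_lt_of_le ha hx.1)).intervalIntegrable
  have hXB : X ≤ B * X := le_mul_of_one_le_left hX.le hB
  have hBXN : B * X ≤ B * N := by gcongr
  have h1 : mainMass k σ (B * Y) X (B * N) =
      (∫ x in X..(B * X), x * (QQpoly k).eval (Real.log x) * cut σ (B * Y) x ^ 2) +
      ∫ x in (B * X)..(B * N), x * (QQpoly k).eval (Real.log x) * cut σ (B * Y) x ^ 2 :=
    (intervalIntegral.integral_add_adjacent_intervals (hint _ _ hX hXB)
      (hint _ _ (by positivity) hBXN)).symm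
  have h2 : 0 ≤ ∫ x in X..(B * X), x * (QQpoly k).eval (Real.log x) * cut σ (B * Y) x ^ 2 := by
    refine intervalIntegral.integral_nonneg hXB fun x hx => ?_
    have := hpos _ (hLx x hx.1)
    have : 0 < x := lt_of_lt_of_le hX hx.1
    positivity
  have h3 := intervalIntegral.smul_integral_comp_mul_left (a := X) (b := N)
    (fun x => x * (QQpoly k).eval (Real.log x) * cut σ (B * Y) x ^ 2) B
  rw [h1, ← h3, smul_eq_mul, mainMass, ← intervalIntegral.integral_const_mul,
    ← intervalIntegral.integral_const_mul]
  refine le_add_of_nonneg_of_le h2 (intervalIntegral.integral_mono_on hXN ?_ ?_ fun x hx => ?_)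
  · refine (ContinuousOn.mono ?_ (s := Set.Ioi 0) ?_).intervalIntegrable
    · exact continuousOn_const.mul (continuousOn_mainMass k σ Y)
    · rw [Set.uIcc_of_le hXN]; exact fun x hx => lt_of_lt_of_le hX hx.1
  · refine (ContinuousOn.mono ?_ (s := Set.Ioi 0) ?_).intervalIntegrable
    · exact continuousOn_const.mul ((continuousOn_mainMass k σ (B * Y)).comp
        (continuousOn_const.mul continuousOn_id) fun x hx => mul_pos hB0 hx)
    · rw [Set.uIcc_of_le hXN]; exact fun x hx => lt_of_lt_of_le hX hx.1
  · have hx0 : 0 < x := lt_of_lt_of_le hX hx.1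
    have hxL := hLx x hx.1
    have hxBL : Real.log x ≤ Real.log (B * x) :=
      Real.log_le_log hx0 (le_mul_of_one_le_left hx0.le hB)
    have hm := hmono hxL (hxL.trans hxBL) hxBL
    simp only at hm
    rw [cut_mul σ hB0 hY hx0]
    have hpow : B ^ (2 - 2 * σ) = B * B * (B ^ (-σ)) ^ 2 := by
      rw [← Real.rpow_natCast (B ^ (-σ)), ← Real.rpow_mul hB0.le, sub_eq_add_neg,
        Real.rpow_add hB0]
      congr 1
      · rw [Real.rpow_two, sq]
      · congr 1; push_cast; ring
    rw [hpow]
    calc _ = B * B * (B ^ (-σ)) ^ 2 * x * cut σ Y x ^ 2 * (QQpoly k).eval (Real.log x) := by ring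
      _ ≤ B * B * (B ^ (-σ)) ^ 2 * x * cut σ Y x ^ 2 * (QQpoly k).eval (Real.log (B * x)) := by
          gcongr
      _ = _ := by ring

/-- The lower bound lets error terms that are small multiples of `Y^(2-2σ) / T` be absorbed into the
main term. -/
theorem le_mainMass (k : ℕ) {σ : ℝ} (hσ : 1 / 2 ≤ σ) {Y X N L : ℝ} (hX : 0 < X)
    (hXY : X ≤ Y / 2) (hYN : Y ≤ N) (hL : L ≤ Real.log X)
    (hpos : ∀ l, L ≤ l → 1 ≤ (QQpoly k).eval l) :
    Y ^ (2 - 2 * σ) / 8 ≤ mainMass k σ Y X N := by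
  have hY : 0 < Y := by linarith
  have hLx : ∀ x, X ≤ x → L ≤ Real.log x := fun x hx => hL.trans (Real.log_le_log hX hx)
  have hint : ∀ a b, 0 < a → a ≤ b → IntervalIntegrable
      (fun x => x * (QQpoly k).eval (Real.log x) * cut σ Y x ^ 2) MeasureTheory.volume a b :=
    fun a b ha hab => ((continuousOn_mainMass k σ Y).mono (by
      rw [Set.uIcc_of_le hab]; exact fun x hx => lt_of_lt_of_le ha hx.1)).intervalIntegrable
  have hnn : ∀ a b, X ≤ a → a ≤ b →
      0 ≤ ∫ x in a..b, x * (QQpoly k).eval (Real.log x) * cut σ Y x ^ 2 := fun a b ha hab => by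
    refine intervalIntegral.integral_nonneg hab fun x hx => ?_
    have := hpos _ (hLx x (ha.trans hx.1))
    have : 0 < x := lt_of_lt_of_le hX (ha.trans hx.1)
    positivity
  have hY2 : Y / 2 ≤ Y := by linarith
  have h1 : mainMass k σ Y X N =
      (∫ x in X..(Y / 2), x * (QQpoly k).eval (Real.log x) * cut σ Y x ^ 2) +
      (∫ x in (Y / 2)..Y, x * (QQpoly k).eval (Real.log x) * cut σ Y x ^ 2) +
      ∫ x in Y..N, x * (QQpoly k).eval (Real.log x) * cut σ Y x ^ 2 := by
    rw [intervalIntegral.integral_add_adjacent_intervals (hint _ _ hX hXY)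
      (hint _ _ (by positivity) hY2), intervalIntegral.integral_add_adjacent_intervals
      (hint _ _ hX (by linarith)) (hint _ _ hY hYN), mainMass]
  have h2 : Y ^ (2 - 2 * σ) / 8 ≤
      ∫ x in (Y / 2)..Y, x * (QQpoly k).eval (Real.log x) * cut σ Y x ^ 2 := by
    have h3 : ∫ x in (Y / 2)..Y, Y ^ (1 - 2 * σ) / 4 ≤
        ∫ x in (Y / 2)..Y, x * (QQpoly k).eval (Real.log x) * cut σ Y x ^ 2 := by
      refine intervalIntegral.integral_mono_on hY2 intervalIntegrable_const
        (hint _ _ (by positivity) hY2) fun x hx => ?_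
      have hx0 : 0 < x := lt_of_lt_of_le (by positivity) hx.1
      have hp := hpos _ (hLx x (hXY.trans hx.1))
      have hg : 1 / 2 ≤ gaussTail (Real.log x - Real.log Y) :=
        half_le_gaussTail (sub_nonpos.mpr (Real.log_le_log hx0 hx.2))
      have hcut : x ^ (-σ) * (1 / 2) ≤ cut σ Y x := by
        rw [cut]; gcongr
      have hxp : x * 1 * (x ^ (-σ)) ^ 2 = x ^ (1 - 2 * σ) := by
        rw [← Real.rpow_natCast (x ^ (-σ)), ← Real.rpow_mul hx0.le, mul_one, mul_comm x,
          ← Real.rpow_add_one hx0.ne']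
        congr 1; push_cast; ring
      have hY' : Y ^ (1 - 2 * σ) ≤ x ^ (1 - 2 * σ) :=
        Real.rpow_le_rpow_of_nonpos hx0 hx.2 (by linarith)
      calc Y ^ (1 - 2 * σ) / 4 ≤ x ^ (1 - 2 * σ) / 4 := by gcongr
        _ = x * 1 * (x ^ (-σ) * (1 / 2)) ^ 2 := by rw [← hxp]; ring
        _ ≤ _ := by gcongr
    refine le_trans (le_of_eq ?_) h3
    rw [intervalIntegral.integral_const, smul_eq_mul,
      show 2 - 2 * σ = 1 - 2 * σ + 1 by ring, Real.rpow_add_one hY.ne']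
    ring
  have h4 := hnn X (Y / 2) le_rfl hXY
  have h5 := hnn Y N (by linarith) hYN
  linarith

/-! ### The correlation sum over one dyadic block. -/

theorem div_three_le_log_add_sub_log {x H : ℝ} (hx : 0 < x) (hH0 : 0 ≤ H) (hH : H ≤ 2 * x) :
    H / (3 * x) ≤ Real.log (x + H) - Real.log x := by
  have hxH : 0 < x + H := by linarith
  have h1 := Real.one_sub_inv_le_log_of_pos (div_pos hxH hx)
  rw [Real.log_div hxH.ne' hx.ne'] at h1
  refine le_trans ?_ h1
  rw [inv_div, le_sub_iff_add_le, div_add_div _ _ (by positivity) hxH.ne',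
    div_le_one (by positivity)]
  nlinarith

theorem sum_block_eq (k : ℕ) {M M' : ℝ} (H : ℕ) (W : ℝ → ℝ → ℝ) :
    ∑ h ∈ Finset.Icc 1 H, ∑ n ∈ Finset.Ioc ⌊M⌋₊ ⌊M'⌋₊,
        (dk k n : ℝ) * (dk k (n + h) : ℝ) * W n h =
    ∑ n ∈ Finset.Ioc ⌊M⌋₊ ⌊M'⌋₊, ∑ h ∈ Finset.Icc 1 H,
        (dk k n : ℝ) * (dk k (n + h) : ℝ) * W n h := Finset.sum_comm

-- Three replacements are chained: the arithmetic sum by the singular series (error `Γ`), its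
-- average over `h` by the modulus `q = 1`, and the integral over `h` by its first-order term.
-- Shifts stop at `P M / T`, where the kernel is already of size `exp(-c P²)`.
set_option maxHeartbeats 1000000 in
theorem exists_abs_block_add_le (k : ℕ) (hk : 1 ≤ k) {θ : ℝ} (hθ : 0 < θ) (hθ1 : θ ≤ 1) :
    ∃ C : ℝ, 0 ≤ C ∧ ∀ σ Y T P M M' Γ : ℝ, 1 / 2 ≤ σ → σ ≤ 1 → 1 ≤ T → 1 ≤ P → P ≤ 2 * T →
      1 ≤ M → M ≤ M' → M' ≤ 2 * M → 2 * T ≤ P * M →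
      (∀ x ∈ Set.Icc M M', ∀ t : ℕ, 1 ≤ t → (t : ℝ) ≤ P * M / T → |shiftSum k x t| ≤ Γ) →
      |∑ n ∈ Finset.Ioc ⌊M⌋₊ ⌊M'⌋₊, ∑ h ∈ Finset.Icc 1 ⌊P * M / T⌋₊,
          (dk k n : ℝ) * (dk k (n + h) : ℝ) * pairWeight σ Y T n h +
        √Real.pi / T * ∫ x in M..M', Q k x 1 ^ 2 *
          (x * cut σ Y x * (cut σ Y x + x * cut₁ σ Y x))| ≤
      C * (T * P ^ 2 * (Γ / M) + T * P ^ 2 * M ^ (2 * θ) +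
        M ^ (2 - 2 * σ + θ) * (T⁻¹ ^ 2 + Real.exp (-P ^ 2 / 1152))) := by
  obtain ⟨C₁, hC₁, h₁⟩ := exists_abs_sum_singularSeries_sub_le k hk hθ hθ1
  obtain ⟨C₂, hC₂, h₂⟩ := exists_abs_Q_le k hk (ε := 1) one_pos
  obtain ⟨C₃, hC₃, h₃⟩ := exists_one_add_log_pow_le (2 * k) hθ
  refine ⟨12000 + C₁ * C₃ * 16000 + C₂ ^ 2 * C₃ * 80000, by positivity,
    fun σ Y T P M M' Γ hσ hσ1 hT hP hPT hM hMM hM2 hTM hΓ => ?_⟩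
  have hT0 : 0 < T := by linarith
  have hM0 : 0 < M := by linarith
  have hP0 : 0 < P := by linarith
  set H := ⌊P * M / T⌋₊ with hH
  have hPMT : 2 ≤ P * M / T := by rw [le_div_iff₀ hT0]; exact hTM
  have hHle : (H : ℝ) ≤ P * M / T := Nat.floor_le (by positivity)
  have hHlt : P * M / T < H + 1 := Nat.lt_floor_add_one _
  have hH1 : 1 ≤ H := Nat.le_floor (by push_cast; linarith)
  have hH1' : (1 : ℝ) ≤ H := by exact_mod_cast hH1
  have hH0 : (0 : ℝ) < H := by linarith
  have hTH : T * H ≤ P * M := by rw [le_div_iff₀ hT0] at hHle; linarith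
  have hH2M : (H : ℝ) ≤ 2 * M := by
    have : P * M / T ≤ 2 * M := by rw [div_le_iff₀ hT0]; nlinarith
    linarith
  set B := 2000 * T * P ^ 2 / M with hB
  have hB0 : 0 ≤ B := by positivity
  have hbd : ∀ x ∈ Set.Icc M M', ∀ h ∈ Set.Icc (0 : ℝ) H, _ := fun x hx h hh =>
    pairWeight_bounds hσ hσ1 Y hT hP hM hH0 hTH hx.1 hh.1 hh.2
  have hlip : ∀ x ∈ Set.Icc M M', ∀ u ∈ Set.Icc (0 : ℝ) H, ∀ v ∈ Set.Icc (0 : ℝ) H,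
      |pairWeight σ Y T x u - pairWeight σ Y T x v| ≤ B / H * |u - v| := fun x hx u hu v hv =>
    (convex_Icc (0 : ℝ) H).norm_image_sub_le_of_norm_hasDerivWithin_le
      (f := fun h => pairWeight σ Y T x h)
      (fun w hw => (hasDerivAt_pairWeight_shift σ Y T (hM0.trans_le hx.1) hw.1).hasDerivWithinAt)
      (fun w hw => (hbd x hx w hw).2.2.1) hv hu
  have hlip₁ : ∀ x ∈ Set.Icc M M', ∀ u ∈ Set.Icc (0 : ℝ) H, ∀ v ∈ Set.Icc (0 : ℝ) H,
      |pairWeight₁ σ Y T x u - pairWeight₁ σ Y T x v| ≤ B / M / H * |u - v| := fun x hx u hu v hv =>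
    (convex_Icc (0 : ℝ) H).norm_image_sub_le_of_norm_hasDerivWithin_le
      (f := fun h => pairWeight₁ σ Y T x h)
      (fun w hw => (hasDerivAt_pairWeight₁_shift σ Y T (hM0.trans_le hx.1) hw.1).hasDerivWithinAt)
      (fun w hw => (hbd x hx w hw).2.2.2) hv hu
  have hmemH : ((H : ℕ) : ℝ) ∈ Set.Icc (0 : ℝ) H := ⟨hH0.le, le_rfl⟩
  have hmem : ∀ h : ℕ, h < H → ((h : ℕ) : ℝ) ∈ Set.Icc (0 : ℝ) H ∧
      ((h + 1 : ℕ) : ℝ) ∈ Set.Icc (0 : ℝ) H := fun h hh =>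
    ⟨⟨by positivity, by exact_mod_cast hh.le⟩, ⟨by positivity, by exact_mod_cast hh⟩⟩
  have hxpos : ∀ x ∈ Set.Icc M M', 0 < x := fun x hx => hM0.trans_le hx.1
  have hcontW₁ : ∀ h : ℝ, 0 ≤ h →
      ContinuousOn (fun x => pairWeight₁ σ Y T x h) (Set.Ioi 0) := fun h hh => by
    have hk0 : Continuous ker :=
      continuous_iff_continuousAt.mpr fun v => (hasDerivAt_ker v).continuousAt
    have hk1 : Continuous ker₁ :=
      continuous_iff_continuousAt.mpr fun v => (hasDerivAt_ker₁ v).continuousAt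
    have hm : Set.MapsTo (fun x : ℝ => x + h) (Set.Ioi 0) (Set.Ioi 0) := fun x hx =>
      add_pos_of_pos_of_nonneg hx hh
    have hs : ContinuousOn (fun x : ℝ => x + h) (Set.Ioi 0) := by fun_prop
    have hc0 := (continuousOn_cut σ Y).comp hs hm
    have hc1 := (continuousOn_cut₁ σ Y).comp hs hm
    have hl : ContinuousOn (fun x => T * (Real.log (x + h) - Real.log x)) (Set.Ioi 0) :=
      continuousOn_const.mul ((hs.log fun x hx => (hm hx).ne').sub
        (continuousOn_id.log fun x hx => ne_of_gt hx))
    have hi : ContinuousOn (fun x => T * ((x + h)⁻¹ - x⁻¹)) (Set.Ioi 0) :=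
      continuousOn_const.mul ((hs.inv₀ fun x hx => (hm hx).ne').sub
        (continuousOn_id.inv₀ fun x hx => ne_of_gt hx))
    have hkc0 := hk0.comp_continuousOn hl
    have hkc1 := hk1.comp_continuousOn hl
    exact continuousOn_const.mul (((((continuousOn_cut₁ σ Y).mul hc0).mul hkc0).add
      (((continuousOn_cut σ Y).mul hc1).mul hkc0)).add
      (((continuousOn_cut σ Y).mul hc0).mul (hkc1.mul hi)))
  have hblock := abs_block_sub_le k hk hM0 hMM hM2 hH1 hB0 (Γ := Γ)
    (fun x hx t ht1 ht2 => hΓ x hx t ht1 (le_trans (by exact_mod_cast ht2) hHle))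
    (W := fun x h => pairWeight σ Y T x h) (W₁ := fun x h => pairWeight₁ σ Y T x h)
    (fun h _ _ x hx => hasDerivAt_pairWeight σ Y T (hxpos x hx) (by positivity))
    (fun h _ _ => (hcontW₁ h (by positivity)).mono hxpos)
    (fun x hx => (hbd x hx H hmemH).1)
    (fun x hx h _ hh => by
      have := hlip x hx _ (hmem h hh).2 _ (hmem h hh).1
      simpa using this)
    (fun x hx => (hbd x hx H hmemH).2.1)
    (fun x hx h _ hh => by
      have := hlip₁ x hx _ (hmem h hh).2 _ (hmem h hh).1
      simpa using this)
  rw [sum_block_eq] at hblock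
  have hi1 : ∀ h ∈ Finset.Icc 1 H, IntervalIntegrable
      (fun x => singularSeries k x h * pairWeight σ Y T x h) MeasureTheory.volume M M' := by
    intro h hh
    have hh0 : h ≠ 0 := by have := (Finset.mem_Icc.mp hh).1; omega
    refine ContinuousOn.intervalIntegrable ?_
    rw [Set.uIcc_of_le hMM]
    refine ((continuousOn_singularSeries k hk hh0).mono hxpos).mul fun x hx => ?_
    exact (hasDerivAt_pairWeight σ Y T (hxpos x hx)
      (by positivity)).continuousAt.continuousWithinAt
  rw [← intervalIntegral.integral_finsetSum hi1] at hblock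
  have hi2 : IntervalIntegrable (fun x => Q k x 1 ^ 2 *
      (x * cut σ Y x * (cut σ Y x + x * cut₁ σ Y x))) MeasureTheory.volume M M' := by
    refine ContinuousOn.intervalIntegrable ?_
    rw [Set.uIcc_of_le hMM]
    have h1 := continuousOn_Q k hk one_ne_zero
    exact ContinuousOn.mono ((h1.pow 2).mul ((continuousOn_id.mul (continuousOn_cut σ Y)).mul
      ((continuousOn_cut σ Y).add (continuousOn_id.mul (continuousOn_cut₁ σ Y))))) hxpos
  have hpt : ∀ x ∈ Set.Icc M M',
      |(∑ h ∈ Finset.Icc 1 H, singularSeries k x h * pairWeight σ Y T x h) +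
        √Real.pi / T * (Q k x 1 ^ 2 * (x * cut σ Y x * (cut σ Y x + x * cut₁ σ Y x)))| ≤
      (C₁ * C₃ * 16000 * (T * P ^ 2 * M ^ (2 * θ)) + C₂ ^ 2 * C₃ * 80000 *
        (M ^ (2 - 2 * σ + θ) * (T⁻¹ ^ 2 + Real.exp (-P ^ 2 / 1152)))) / M := by
    intro x hx
    have hx0 := hxpos x hx
    have hx1 : 1 ≤ x := hM.trans hx.1
    have hx2 : x ≤ 2 * M := hx.2.trans hM2
    have hlog : 0 ≤ Real.log x := Real.log_nonneg hx1
    have e1 := h₁ x hx1 H hH1 (fun h => pairWeight σ Y T x h) B (B / H) (by positivity)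
      (fun u hu => (hbd x hx u hu).1) (hlip x hx)
    have e2 := abs_integral_pairWeight_add_le hσ hσ1 Y hT hx0 hH0.le
      (H := H) (by linarith [hx.1])
    have hQ := h₂ 1 one_ne_zero x hx0
    rw [Nat.cast_one, Real.one_rpow, mul_one, abs_of_nonneg hlog] at hQ
    have hlogk : (1 + Real.log x) ^ (2 * k) ≤ C₃ * (2 * M ^ θ) := by
      refine (h₃ x hx1).trans ?_
      gcongr
      calc x ^ θ ≤ (2 * M) ^ θ := by gcongr
        _ = 2 ^ θ * M ^ θ := Real.mul_rpow (by norm_num) hM0.le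
        _ ≤ 2 ^ (1 : ℝ) * M ^ θ := by gcongr; norm_num
        _ = _ := by rw [Real.rpow_one]
    have hQ2 : Q k x 1 ^ 2 ≤ C₂ ^ 2 * (C₃ * (2 * M ^ θ)) := by
      rw [← sq_abs]
      calc |Q k x 1| ^ 2 ≤ (C₂ * (1 + Real.log x) ^ k) ^ 2 := by gcongr
        _ = C₂ ^ 2 * (1 + Real.log x) ^ (2 * k) := by rw [pow_mul']; ring
        _ ≤ _ := by gcongr
    have hHθ : (H : ℝ) ^ θ ≤ 2 * M ^ θ := by
      calc (H : ℝ) ^ θ ≤ (2 * M) ^ θ := by gcongr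
        _ = 2 ^ θ * M ^ θ := Real.mul_rpow (by norm_num) hM0.le
        _ ≤ 2 ^ (1 : ℝ) * M ^ θ := by gcongr; norm_num
        _ = _ := by rw [Real.rpow_one]
    have hexp : Real.exp (-(1 / 8) * (T * (Real.log (x + H) - Real.log x)) ^ 2) ≤
        Real.exp (-P ^ 2 / 1152) := by
      apply Real.exp_le_exp.mpr
      have h4 := div_three_le_log_add_sub_log hx0 hH0.le (by linarith [hx.1] : (H : ℝ) ≤ 2 * x)
      -- With `H ≥ P M / (2T)` and `x ≤ 2M`, the kernel argument is at least `T H / (3x) ≥ P / 12`.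
      -- Since `8 * 12² = 1152`, this is the origin of the constant `1152`.
      have h5 : P / 12 ≤ T * (Real.log (x + H) - Real.log x) := by
        calc P / 12 ≤ T * (H / (3 * x)) := by
              rw [← mul_div_assoc, le_div_iff₀ (by positivity)]
              have h6 : P * M / T ≤ 2 * H := by linarith
              rw [div_le_iff₀ hT0] at h6
              nlinarith
          _ ≤ _ := by gcongr
      nlinarith [mul_self_le_mul_self (by positivity : 0 ≤ P / 12) h5]
    have hxσ : x ^ (1 - 2 * σ) ≤ M ^ (1 - 2 * σ) :=
      Real.rpow_le_rpow_of_nonpos hM0 hx.1 (by linarith)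
    have hMθ : M ^ (2 * θ) = M ^ θ * M ^ θ := by rw [← Real.rpow_add hM0]; ring_nf
    have hMσ : M ^ (2 - 2 * σ + θ) = M * M ^ (1 - 2 * σ) * M ^ θ := by
      rw [mul_comm M, ← Real.rpow_add_one hM0.ne', ← Real.rpow_add hM0]; ring_nf
    have heq : (∑ h ∈ Finset.Icc 1 H, singularSeries k x h * pairWeight σ Y T x h) +
        √Real.pi / T * (Q k x 1 ^ 2 * (x * cut σ Y x * (cut σ Y x + x * cut₁ σ Y x))) =
        (∑ h ∈ Finset.Icc 1 H, singularSeries k x h * pairWeight σ Y T x h -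
          Q k x 1 ^ 2 * ∫ u in (0 : ℝ)..H, pairWeight σ Y T x u) +
        Q k x 1 ^ 2 * ((∫ u in (0 : ℝ)..H, pairWeight σ Y T x u) +
          √Real.pi / T * (x * cut σ Y x * (cut σ Y x + x * cut₁ σ Y x))) := by ring
    rw [heq]
    refine (abs_add_le_of_le e1 (abs_mul_le_of_le (abs_of_nonneg (sq_nonneg _)).le e2)).trans ?_
    calc _ ≤ C₁ * (2 * M ^ θ) * (C₃ * (2 * M ^ θ)) * (B + B / H * H) +
          (C₂ ^ 2 * (C₃ * (2 * M ^ θ))) * (40000 * M ^ (1 - 2 * σ) *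
            (T⁻¹ ^ 2 + Real.exp (-P ^ 2 / 1152))) := by gcongr
      _ = _ := by
          rw [div_mul_cancel₀ _ hH0.ne', hMθ, hMσ, hB]
          field_simp
          ring
  have hmain : |(∫ x in M..M', ∑ h ∈ Finset.Icc 1 H, singularSeries k x h * pairWeight σ Y T x h) +
        √Real.pi / T * ∫ x in M..M', Q k x 1 ^ 2 *
          (x * cut σ Y x * (cut σ Y x + x * cut₁ σ Y x))| ≤
      C₁ * C₃ * 16000 * (T * P ^ 2 * M ^ (2 * θ)) + C₂ ^ 2 * C₃ * 80000 *
        (M ^ (2 - 2 * σ + θ) * (T⁻¹ ^ 2 + Real.exp (-P ^ 2 / 1152))) := by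
    have hsum : IntervalIntegrable (fun x => ∑ h ∈ Finset.Icc 1 H,
        singularSeries k x h * pairWeight σ Y T x h) MeasureTheory.volume M M' := by
      have := IntervalIntegrable.sum _ hi1
      rwa [show (∑ h ∈ Finset.Icc 1 H, fun x : ℝ => singularSeries k x h * pairWeight σ Y T x h) =
        fun x => ∑ h ∈ Finset.Icc 1 H, singularSeries k x h * pairWeight σ Y T x h by
          ext x; simp] at this
    rw [← intervalIntegral.integral_const_mul, ← intervalIntegral.integral_add
      hsum (hi2.const_mul _)]
    have hnorm := intervalIntegral.norm_integral_le_of_norm_le_const (a := M) (b := M')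
      (f := fun x => (∑ h ∈ Finset.Icc 1 H, singularSeries k x h * pairWeight σ Y T x h) +
        √Real.pi / T * (Q k x 1 ^ 2 * (x * cut σ Y x * (cut σ Y x + x * cut₁ σ Y x))))
      (fun x hx => hpt x (Set.Ioc_subset_Icc_self (Set.uIoc_of_le hMM ▸ hx)))
    refine hnorm.trans ?_
    rw [abs_of_nonneg (by linarith), div_mul_eq_mul_div, div_le_iff₀ hM0]
    gcongr
    linarith
  have hfin := abs_add_le_of_le hblock hmain
  have hΓ0 : 0 ≤ Γ := (abs_nonneg _).trans (hΓ M ⟨le_rfl, hMM⟩ 1 le_rfl (by push_cast; linarith))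
  rw [← add_assoc, sub_add_cancel] at hfin
  refine hfin.trans ?_
  calc _ = 12000 * (T * P ^ 2 * (Γ / M)) + C₁ * C₃ * 16000 * (T * P ^ 2 * M ^ (2 * θ)) +
        C₂ ^ 2 * C₃ * 80000 *
        (M ^ (2 - 2 * σ + θ) * (T⁻¹ ^ 2 + Real.exp (-P ^ 2 / 1152))) := by rw [hB]; ring
    _ ≤ _ := by
        have a1 : 0 ≤ T * P ^ 2 * (Γ / M) := by positivity
        have a2 : 0 ≤ T * P ^ 2 * M ^ (2 * θ) := by positivity
        have a3 : 0 ≤ M ^ (2 - 2 * σ + θ) * (T⁻¹ ^ 2 + Real.exp (-P ^ 2 / 1152)) := by positivity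
        have b1 : 0 ≤ C₁ * C₃ * 16000 := by positivity
        have b2 : 0 ≤ C₂ ^ 2 * C₃ * 80000 := by positivity
        nlinarith [mul_nonneg b1 a1, mul_nonneg b1 a3, mul_nonneg b2 a1, mul_nonneg b2 a2]

/-! ### Gaussian Fourier transforms and the expansion of the mean square. -/

theorem integrable_exp_neg_sq : MeasureTheory.Integrable fun t : ℝ => Real.exp (-t ^ 2) := by
  simpa using integrable_exp_neg_mul_sq (b := 1) one_pos

theorem integrable_sq_mul_exp_neg_sq :
    MeasureTheory.Integrable fun t : ℝ => t ^ 2 * Real.exp (-t ^ 2) := by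
  have := integrable_rpow_mul_exp_neg_mul_sq (b := 1) one_pos (s := 2) (by norm_num)
  simpa using this

theorem integrable_mul_exp_neg_sq :
    MeasureTheory.Integrable fun t : ℝ => t * Real.exp (-t ^ 2) := by
  simpa using integrable_mul_exp_neg_mul_sq (b := 1) one_pos

theorem integral_exp_neg_sq_mul_cos (v : ℝ) :
    ∫ t : ℝ, Real.exp (-t ^ 2) * Real.cos (v * t) = √Real.pi * Real.exp (-(1 / 4) * v ^ 2) := by
  have h := fourierIntegral_gaussian (b := 1) (by simp) (v : ℂ)
  have hint : MeasureTheory.Integrable fun x : ℝ =>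
      Complex.exp (Complex.I * v * x) * Complex.exp (-1 * (x : ℂ) ^ 2) := by
    refine integrable_exp_neg_sq.mono' (by fun_prop) (Eventually.of_forall fun x => ?_)
    rw [norm_mul, Complex.norm_exp, Complex.norm_exp]
    norm_cast
    simp
  have h2 := congrArg Complex.re h
  rw [← RCLike.re_eq_complex_re, ← integral_re hint] at h2
  convert h2 using 1
  · congr 1
    ext t
    have e1 : Complex.I * v * t = ((v * t : ℝ) : ℂ) * Complex.I := by push_cast; ring
    have e2 : -1 * (t : ℂ) ^ 2 = ((-t ^ 2 : ℝ) : ℂ) := by push_cast; ring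
    rw [e1, e2, ← Complex.ofReal_exp, RCLike.re_eq_complex_re, Complex.re_mul_ofReal,
      Complex.exp_ofReal_mul_I_re, mul_comm]
  · rw [RCLike.re_eq_complex_re]
    have e2 : -(v : ℂ) ^ 2 / (4 * 1) = ((-(1 / 4) * v ^ 2 : ℝ) : ℂ) := by push_cast; ring
    have e3 : ((Real.pi : ℂ) / 1) ^ (1 / 2 : ℂ) = ((√Real.pi : ℝ) : ℂ) := by
      rw [Real.sqrt_eq_rpow, Complex.ofReal_cpow Real.pi_pos.le]
      simp
    rw [e2, e3, ← Complex.ofReal_exp, ← Complex.ofReal_mul, Complex.ofReal_re]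

theorem integral_sq_mul_exp_neg_sq_mul_cos (v : ℝ) :
    ∫ t : ℝ, t ^ 2 * Real.exp (-t ^ 2) * Real.cos (v * t) = ker v := by
  have i0 : MeasureTheory.Integrable fun t : ℝ => Real.exp (-t ^ 2) * Real.cos (v * t) :=
    integrable_exp_neg_sq.mul_bdd (c := 1) (by fun_prop)
      (Eventually.of_forall fun t => Real.abs_cos_le_one _)
  have i2 : MeasureTheory.Integrable fun t : ℝ => t ^ 2 * Real.exp (-t ^ 2) * Real.cos (v * t) :=
    integrable_sq_mul_exp_neg_sq.mul_bdd (c := 1) (by fun_prop)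
      (Eventually.of_forall fun t => Real.abs_cos_le_one _)
  have i1 : MeasureTheory.Integrable fun t : ℝ => t * Real.exp (-t ^ 2) * Real.cos (v * t) :=
    integrable_mul_exp_neg_sq.mul_bdd (c := 1) (by fun_prop)
      (Eventually.of_forall fun t => Real.abs_cos_le_one _)
  have i0' : MeasureTheory.Integrable fun t : ℝ => Real.exp (-t ^ 2) * Real.sin (v * t) :=
    integrable_exp_neg_sq.mul_bdd (c := 1) (by fun_prop)
      (Eventually.of_forall fun t => Real.abs_sin_le_one _)
  -- The derivative of this function is the wanted integrand minus `1/2 - v²/4` times the integrand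
  -- of `integral_exp_neg_sq_mul_cos`, so integrating it over the line reduces the second moment to
  -- the plain Gaussian.
  have h := MeasureTheory.integral_eq_zero_of_hasDerivAt_of_integrable
    (f := fun t : ℝ => -(1 / 2) * (t * Real.exp (-t ^ 2) * Real.cos (v * t)) +
      v / 4 * (Real.exp (-t ^ 2) * Real.sin (v * t)))
    (f' := fun t : ℝ => t ^ 2 * Real.exp (-t ^ 2) * Real.cos (v * t) -
      (1 / 2 - v ^ 2 / 4) * (Real.exp (-t ^ 2) * Real.cos (v * t)))
    (fun t => by
      have d1 : HasDerivAt (fun t : ℝ => Real.exp (-t ^ 2)) (Real.exp (-t ^ 2) * (-(2 * t))) t := by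
        simpa using ((hasDerivAt_pow 2 t).neg).exp
      have d2 : HasDerivAt (fun t : ℝ => Real.cos (v * t)) (-Real.sin (v * t) * v) t := by
        simpa using ((hasDerivAt_id t).const_mul v).cos
      have d3 : HasDerivAt (fun t : ℝ => Real.sin (v * t)) (Real.cos (v * t) * v) t := by
        simpa using ((hasDerivAt_id t).const_mul v).sin
      refine (((((hasDerivAt_id t).mul d1).mul d2).const_mul (-(1 / 2))).add
        ((d1.mul d3).const_mul (v / 4))).congr_deriv ?_
      simp only [id, Pi.mul_apply]
      ring)
    (i2.sub (i0.const_mul _)) ((i1.const_mul _).add (i0'.const_mul _))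
  rw [MeasureTheory.integral_sub i2 (i0.const_mul _), MeasureTheory.integral_const_mul,
    integral_exp_neg_sq_mul_cos, sub_eq_zero] at h
  rw [h, ker]
  ring

/-- The weight `(t / T)² exp(-(t / T)²)`. -/
def wt (T t : ℝ) : ℝ := (t / T) ^ 2 * Real.exp (-(t / T) ^ 2)

theorem wt_nonneg (T t : ℝ) : 0 ≤ wt T t := by unfold wt; positivity

theorem continuous_wt (T : ℝ) : Continuous (wt T) := by unfold wt; fun_prop

theorem integrable_wt {T : ℝ} (hT : 0 < T) : MeasureTheory.Integrable (wt T) :=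
  integrable_sq_mul_exp_neg_sq.comp_div hT.ne'

theorem integral_wt_mul_cos {T : ℝ} (hT : 0 < T) (u : ℝ) :
    ∫ t, wt T t * Real.cos (t * u) = T * ker (T * u) := by
  have h := MeasureTheory.Measure.integral_comp_div
    (fun t : ℝ => t ^ 2 * Real.exp (-t ^ 2) * Real.cos ((T * u) * t)) T
  rw [integral_sq_mul_exp_neg_sq_mul_cos, abs_of_pos hT, smul_eq_mul] at h
  rw [← h]
  congr 1
  ext t
  rw [wt]
  congr 2
  field_simp

/-- The smoothed Dirichlet polynomial approximating `ζ(σ + it)^k`. -/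
def dirPoly (k : ℕ) (σ Y : ℝ) (N : ℕ) (t : ℝ) : ℂ :=
  ∑ n ∈ Finset.Icc 1 N,
    ((dk k n * cut σ Y n : ℝ) : ℂ) * Complex.exp (((-(t * Real.log n) : ℝ) : ℂ) * Complex.I)

theorem norm_sq_sum_mul_exp (s : Finset ℕ) (a b : ℕ → ℝ) :
    ‖∑ n ∈ s, (a n : ℂ) * Complex.exp ((b n : ℂ) * Complex.I)‖ ^ 2 =
      ∑ m ∈ s, ∑ n ∈ s, a m * a n * Real.cos (b n - b m) := by
  rw [← Complex.normSq_eq_norm_sq, Complex.normSq_apply, Complex.re_sum, Complex.im_sum]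
  simp only [Complex.re_ofReal_mul, Complex.im_ofReal_mul, Complex.exp_ofReal_mul_I_re,
    Complex.exp_ofReal_mul_I_im]
  rw [Finset.sum_mul_sum, Finset.sum_mul_sum, ← Finset.sum_add_distrib]
  refine Finset.sum_congr rfl fun m _ => ?_
  rw [← Finset.sum_add_distrib]
  refine Finset.sum_congr rfl fun n _ => ?_
  rw [Real.cos_sub]
  ring

theorem sum_sum_symm (f : ℕ → ℕ → ℝ) (hf : ∀ m n, f m n = f n m) (N : ℕ) :
    ∑ m ∈ Finset.Icc 1 N, ∑ n ∈ Finset.Icc 1 N, f m n = ∑ n ∈ Finset.Icc 1 N, f n n +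
      2 * ∑ n ∈ Finset.Icc 1 N, ∑ h ∈ Finset.Icc 1 (N - n), f n (n + h) := by
  induction N with
  | zero => simp
  | succ N ih =>
    have e : ∀ n ∈ Finset.Icc 1 N, ∑ h ∈ Finset.Icc 1 (N + 1 - n), f n (n + h) =
        ∑ h ∈ Finset.Icc 1 (N - n), f n (n + h) + f n (N + 1) := by
      intro n hn
      rw [Finset.mem_Icc] at hn
      rw [Nat.sub_add_comm hn.2, Finset.sum_Icc_succ_top (by omega)]
      congr 2
      omega
    have e2 : ∀ m ∈ Finset.Icc 1 N, ∑ n ∈ Finset.Icc 1 (N + 1), f m n =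
        ∑ n ∈ Finset.Icc 1 N, f m n + f m (N + 1) :=
      fun m _ => Finset.sum_Icc_succ_top (by omega) _
    rw [Finset.sum_Icc_succ_top (by omega), Finset.sum_Icc_succ_top (by omega),
      Finset.sum_Icc_succ_top (by omega) (fun n => ∑ h ∈ Finset.Icc 1 (N + 1 - n), f n (n + h)),
      Finset.sum_congr rfl e, Finset.sum_congr rfl e2, Finset.sum_add_distrib,
      Finset.sum_add_distrib, ih, Finset.sum_Icc_succ_top (by omega)]
    simp only [hf (N + 1)]
    simp
    ring

theorem continuous_dirPoly (k : ℕ) (σ Y : ℝ) (N : ℕ) : Continuous (dirPoly k σ Y N) := by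
  unfold dirPoly
  fun_prop

theorem integral_wt_mul_norm_sq_dirPoly (k : ℕ) (σ Y : ℝ) (N : ℕ) {T : ℝ} (hT : 0 < T) :
    ∫ t, wt T t * ‖dirPoly k σ Y N t‖ ^ 2 =
      ∑ n ∈ Finset.Icc 1 N, (dk k n * cut σ Y n) ^ 2 * (T * ker 0) +
      2 * ∑ n ∈ Finset.Icc 1 N, ∑ h ∈ Finset.Icc 1 (N - n),
        (dk k n : ℝ) * dk k (n + h) * pairWeight σ Y T n h := by
  have e : ∀ t, wt T t * ‖dirPoly k σ Y N t‖ ^ 2 = ∑ m ∈ Finset.Icc 1 N, ∑ n ∈ Finset.Icc 1 N,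
      (dk k m * cut σ Y m) * (dk k n * cut σ Y n) *
        (wt T t * Real.cos (t * (Real.log m - Real.log n))) := by
    intro t
    rw [dirPoly, norm_sq_sum_mul_exp, Finset.mul_sum]
    refine Finset.sum_congr rfl fun m _ => ?_
    rw [Finset.mul_sum]
    refine Finset.sum_congr rfl fun n _ => ?_
    rw [show -(t * Real.log n) - -(t * Real.log m) = t * (Real.log m - Real.log n) by ring]
    ring
  have hint : ∀ u, MeasureTheory.Integrable fun t => wt T t * Real.cos (t * u) := fun u =>
    (integrable_wt hT).mul_bdd (c := 1) (by fun_prop)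
      (Eventually.of_forall fun t => Real.abs_cos_le_one _)
  simp_rw [e]
  rw [MeasureTheory.integral_finsetSum _ fun m _ =>
    MeasureTheory.integrable_finsetSum _ fun n _ => (hint _).const_mul _]
  have e2 : ∀ m ∈ Finset.Icc 1 N, ∫ t, ∑ n ∈ Finset.Icc 1 N,
      (dk k m * cut σ Y m) * (dk k n * cut σ Y n) *
        (wt T t * Real.cos (t * (Real.log m - Real.log n))) = ∑ n ∈ Finset.Icc 1 N,
      (dk k m * cut σ Y m) * (dk k n * cut σ Y n) * (T * ker (T * (Real.log m - Real.log n))) := by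
    intro m _
    rw [MeasureTheory.integral_finsetSum _ fun n _ => (hint _).const_mul _]
    refine Finset.sum_congr rfl fun n _ => ?_
    rw [MeasureTheory.integral_const_mul, integral_wt_mul_cos hT]
  rw [Finset.sum_congr rfl e2, sum_sum_symm]
  · congr 1
    · refine Finset.sum_congr rfl fun n _ => ?_
      rw [sub_self, mul_zero, sq]
    · congr 1
      refine Finset.sum_congr rfl fun n _ => Finset.sum_congr rfl fun h _ => ?_
      rw [pairWeight, show T * (Real.log n - Real.log (n + h : ℕ)) =
        -(T * (Real.log (n + h) - Real.log n)) by push_cast; ring]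
      push_cast
      simp only [ker, even_two, Even.neg_pow]
      ring
  · intro m n
    rw [show T * (Real.log m - Real.log n) = -(T * (Real.log n - Real.log m)) by ring]
    simp only [ker, even_two, Even.neg_pow]
    ring

/-! ### Truncation of the shifts and assembly over dyadic blocks. -/

theorem abs_pairWeight_le {σ : ℝ} (hσ : 1 / 2 ≤ σ) (Y : ℝ) {T x h : ℝ} (hT : 0 ≤ T) (hx : 1 ≤ x)
    (hh : 0 ≤ h) :
    |pairWeight σ Y T x h| ≤ 40 * T * x⁻¹ * (gaussTail (Real.log (x + h) - Real.log Y) *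
      Real.exp (-(1 / 8) * (T * (Real.log (x + h) - Real.log x)) ^ 2)) := by
  have hx0 : 0 < x := by linarith
  have e1 : |cut σ Y x| ≤ x ^ (-(1 / 2) : ℝ) :=
    (abs_cut_le σ Y hx0).trans (Real.rpow_le_rpow_of_exponent_le hx (by linarith))
  have e2 : |cut σ Y (x + h)| ≤ x ^ (-(1 / 2) : ℝ) * gaussTail (Real.log (x + h) - Real.log Y) := by
    rw [abs_of_nonneg (cut_nonneg σ Y (by linarith)), cut]
    refine mul_le_mul_of_nonneg_right ?_ (gaussTail_nonneg _)
    exact (Real.rpow_le_rpow_of_nonpos hx0 (by linarith) (by linarith)).trans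
      (Real.rpow_le_rpow_of_exponent_le hx (by linarith))
  have e3 := abs_mul_le_of_le (abs_mul_le_of_le e1 e2)
    (abs_ker_le (T * (Real.log (x + h) - Real.log x)))
  rw [pairWeight, abs_mul, abs_of_nonneg hT]
  refine (mul_le_mul_of_nonneg_left e3 hT).trans (le_of_eq ?_)
  have e4 : x⁻¹ = x ^ (-(1 / 2) : ℝ) * x ^ (-(1 / 2) : ℝ) := by
    rw [← Real.rpow_add hx0, ← Real.rpow_neg_one]; norm_num
  rw [e4]
  ring

theorem abs_sum_Icc_sub_le (f : ℕ → ℝ) {A B K : ℕ} {E : ℝ} (hE : 0 ≤ E) (hA : A ≤ K) (hB : B ≤ K)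
    (h₁ : ∀ h, A < h → h ≤ B → |f h| ≤ E) (h₂ : ∀ h, B < h → h ≤ A → |f h| ≤ E) :
    |∑ h ∈ Finset.Icc 1 A, f h - ∑ h ∈ Finset.Icc 1 B, f h| ≤ K * E := by
  have key : ∀ A B : ℕ, A ≤ B → B ≤ K → (∀ h, A < h → h ≤ B → |f h| ≤ E) →
      |∑ h ∈ Finset.Icc 1 A, f h - ∑ h ∈ Finset.Icc 1 B, f h| ≤ K * E := by
    intro A B hAB hB h
    change |∑ h ∈ Finset.Ioc 0 A, f h - ∑ h ∈ Finset.Ioc 0 B, f h| ≤ K * E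
    rw [← Finset.sum_Ioc_consecutive f (Nat.zero_le A) hAB, sub_add_cancel_left, abs_neg]
    refine (Finset.abs_sum_le_sum_abs _ _).trans ?_
    refine (Finset.sum_le_card_nsmul _ _ E fun i hi => ?_).trans ?_
    · rw [Finset.mem_Ioc] at hi
      exact h i hi.1 hi.2
    · rw [nsmul_eq_mul, Nat.card_Ioc]
      gcongr
      omega
  rcases le_total A B with hAB | hAB
  · exact key A B hAB hB h₁
  · rw [abs_sub_comm]
    exact key B A hAB hA h₂

theorem exists_dk_mul_dk_le (k : ℕ) {θ : ℝ} (hθ : 0 < θ) (hθ1 : θ ≤ 1) :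
    ∃ C : ℝ, 0 ≤ C ∧ ∀ N m n : ℕ, 1 ≤ m → 1 ≤ n → m ≤ 3 * N → n ≤ 3 * N →
      (dk k m : ℝ) * dk k n ≤ C * (N : ℝ) ^ (2 * θ) := by
  obtain ⟨C, hC, h⟩ := dk_le_rpow k hθ
  refine ⟨C * 3 * (C * 3), by positivity, fun N m n hm hn hmN hnN => ?_⟩
  have key : ∀ m : ℕ, 1 ≤ m → m ≤ 3 * N → (dk k m : ℝ) ≤ C * 3 * (N : ℝ) ^ θ := by
    intro m hm hmN
    refine (h m (by omega)).trans ?_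
    have h1 : (m : ℝ) ≤ 3 * N := by exact_mod_cast hmN
    calc C * (m : ℝ) ^ θ ≤ C * (3 * N) ^ θ := by gcongr
      _ = C * 3 ^ θ * (N : ℝ) ^ θ := by
        rw [Real.mul_rpow (by norm_num) (Nat.cast_nonneg _)]; ring
      _ ≤ C * 3 ^ (1 : ℝ) * (N : ℝ) ^ θ := by gcongr; norm_num
      _ = _ := by rw [Real.rpow_one]
  have hN : (0 : ℝ) < N := by exact_mod_cast (by omega : 0 < N)
  calc (dk k m : ℝ) * dk k n ≤ (C * 3 * (N : ℝ) ^ θ) * (C * 3 * (N : ℝ) ^ θ) := by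
        gcongr
        · exact key m hm hmN
        · exact key n hn hnN
    _ = _ := by rw [two_mul, Real.rpow_add hN]; ring

/-- Between the two ranges of `h`, either `n + h` has passed `N`, where the cutoff is small, or `h`
exceeds `H`, where the kernel is small. The `2` in `P * n / (2 * T)` leaves room for an `H` fixed by
the left end of the dyadic block containing `n`. -/
theorem exists_abs_sum_shift_sub_le (k : ℕ) {θ : ℝ} (hθ : 0 < θ) (hθ1 : θ ≤ 1) :
    ∃ C : ℝ, 0 ≤ C ∧ ∀ (σ Y T P : ℝ) (n N H : ℕ), 1 / 2 ≤ σ → 1 ≤ T → 0 ≤ P → P ≤ 2 * T →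
      1 ≤ n → n ≤ N → P * n / (2 * T) ≤ H + 1 → H ≤ 2 * n →
      |∑ h ∈ Finset.Icc 1 (N - n), (dk k n : ℝ) * (dk k (n + h) : ℝ) * pairWeight σ Y T n h -
        ∑ h ∈ Finset.Icc 1 H, (dk k n : ℝ) * (dk k (n + h) : ℝ) * pairWeight σ Y T n h| ≤
      C * ((N : ℝ) ^ (2 * θ) * (N * T * (Real.exp (-P ^ 2 / 1152) +
        gaussTail (Real.log N - Real.log Y)))) := by
  obtain ⟨C, hC, h⟩ := exists_dk_mul_dk_le k hθ hθ1
  refine ⟨2 * (C * 40), by positivity, fun σ Y T P n N H hσ hT hP hPT hn hnN hH hH2 => ?_⟩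
  have hn1 : (1 : ℝ) ≤ n := by exact_mod_cast hn
  have hn0 : (0 : ℝ) < n := by linarith
  have hT0 : 0 < T := by linarith
  have hg := gaussTail_nonneg (Real.log N - Real.log Y)
  have hni : (n : ℝ)⁻¹ ≤ 1 := inv_le_one_of_one_le₀ hn1
  have key : ∀ h : ℕ, 1 ≤ h → n + h ≤ 3 * N →
      gaussTail (Real.log (n + h) - Real.log Y) *
        Real.exp (-(1 / 8) * (T * (Real.log (n + h) - Real.log n)) ^ 2) ≤
        Real.exp (-P ^ 2 / 1152) + gaussTail (Real.log N - Real.log Y) →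
      |(dk k n : ℝ) * (dk k (n + h) : ℝ) * pairWeight σ Y T n h| ≤ C * (N : ℝ) ^ (2 * θ) *
        (40 * T * 1 * (Real.exp (-P ^ 2 / 1152) + gaussTail (Real.log N - Real.log Y))) := by
    intro h' hh' hnh hle
    have hpos := gaussTail_nonneg (Real.log (n + h') - Real.log Y)
    refine abs_mul_le_of_le ?_ ((abs_pairWeight_le hσ Y hT0.le hn1 (Nat.cast_nonneg h')).trans ?_)
    · rw [abs_of_nonneg (by positivity)]
      exact h N n (n + h') hn (by omega) (by omega) hnh
    · gcongr
  have := abs_sum_Icc_sub_le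
    (fun h : ℕ => (dk k n : ℝ) * (dk k (n + h) : ℝ) * pairWeight σ Y T n h) (A := N - n) (B := H)
    (K := 2 * N) (E := C * (N : ℝ) ^ (2 * θ) *
        (40 * T * 1 * (Real.exp (-P ^ 2 / 1152) + gaussTail (Real.log N - Real.log Y))))
    (by positivity) (by omega) (by omega) ?_ ?_
  · refine this.trans (le_of_eq ?_)
    push_cast
    ring
  · intro h' h1 h2
    refine key h' (by omega) (by omega) ?_
    have h3 : (N : ℝ) ≤ n + h' := by exact_mod_cast (by omega : N ≤ n + h')
    have hN0 : (0 : ℝ) < N := by exact_mod_cast (by omega : 0 < N)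
    calc _ ≤ gaussTail (Real.log N - Real.log Y) * 1 := by
          refine mul_le_mul (gaussTail_antitone ?_) (exp_neg_sq_le_one _) (Real.exp_pos _).le hg
          have := Real.log_le_log hN0 h3
          linarith
      _ ≤ _ := by linarith [Real.exp_pos (-P ^ 2 / 1152)]
  · intro h' h1 h2
    refine key h' (by omega) (by omega) ?_
    have h3 : (H : ℝ) + 1 ≤ h' := by exact_mod_cast h1
    have h4 : P * n / (2 * T) ≤ 2 * n := by
      rw [div_le_iff₀ (by positivity)]
      nlinarith
    have h5 := div_three_le_log_add_sub_log hn0 (by positivity : 0 ≤ P * n / (2 * T)) h4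
    have h6 : Real.log (n + P * n / (2 * T)) ≤ Real.log (n + h') :=
      Real.log_le_log (by positivity) (by linarith)
    have h7 : P / 6 ≤ T * (Real.log (n + h') - Real.log n) := by
      calc P / 6 = T * (P * n / (2 * T) / (3 * n)) := by field_simp; ring
        _ ≤ _ := by gcongr; linarith
    calc _ ≤ 1 * Real.exp (-P ^ 2 / 1152) := by
          refine mul_le_mul (gaussTail_le_one _) (Real.exp_le_exp.mpr ?_) (Real.exp_pos _).le
            zero_le_one
          nlinarith [mul_self_le_mul_self (by positivity : 0 ≤ P / 6) h7]
      _ ≤ _ := by linarith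

/-- At most `P n / T` shifts, each of weight `≪ T / n`. This trivial bound handles `n ≤ X`, the
range in which the hypothesis on shifts is not used. -/
theorem exists_abs_sum_shift_le (k : ℕ) {θ : ℝ} (hθ : 0 < θ) (hθ1 : θ ≤ 1) :
    ∃ C : ℝ, 0 ≤ C ∧ ∀ (σ Y T P : ℝ) (n N H : ℕ), 1 / 2 ≤ σ → 1 ≤ T → P ≤ 2 * T →
      1 ≤ n → n ≤ N → H ≤ P * n / T →
      |∑ h ∈ Finset.Icc 1 H, (dk k n : ℝ) * (dk k (n + h) : ℝ) * pairWeight σ Y T n h| ≤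
      C * ((N : ℝ) ^ (2 * θ) * P) := by
  obtain ⟨C, hC, h⟩ := exists_dk_mul_dk_le k hθ hθ1
  refine ⟨C * 40, by positivity, fun σ Y T P n N H hσ hT hPT hn hnN hH => ?_⟩
  have hn1 : (1 : ℝ) ≤ n := by exact_mod_cast hn
  have hn0 : (0 : ℝ) < n := by linarith
  have hT0 : 0 < T := by linarith
  have hH2 : H ≤ 2 * n := by
    have : P * n / T ≤ 2 * n := by rw [div_le_iff₀ hT0]; nlinarith
    exact_mod_cast hH.trans this
  refine (Finset.abs_sum_le_sum_abs _ _).trans ?_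
  refine (Finset.sum_le_card_nsmul _ _ (C * (N : ℝ) ^ (2 * θ) * (40 * T * (n : ℝ)⁻¹ * (1 * 1)))
    fun h' hh' => ?_).trans ?_
  · rw [Finset.mem_Icc] at hh'
    refine abs_mul_le_of_le ?_ ((abs_pairWeight_le hσ Y hT0.le hn1 (Nat.cast_nonneg h')).trans ?_)
    · rw [abs_of_nonneg (by positivity)]
      exact h N n (n + h') hn (by omega) (by omega) (by omega)
    · gcongr
      · exact gaussTail_le_one _
      · exact exp_neg_sq_le_one _
  · rw [nsmul_eq_mul, Nat.card_Icc, Nat.add_sub_cancel]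
    calc (H : ℝ) * (C * (N : ℝ) ^ (2 * θ) * (40 * T * (n : ℝ)⁻¹ * (1 * 1))) ≤
        (P * n / T) * (C * (N : ℝ) ^ (2 * θ) * (40 * T * (n : ℝ)⁻¹ * (1 * 1))) := by gcongr
      _ = _ := by field_simp

/-- The off-diagonal sum attached to `n` in the mean square of `dirPoly`. -/
def shiftedSum (k : ℕ) (σ Y T : ℝ) (N n : ℕ) : ℝ :=
  ∑ h ∈ Finset.Icc 1 (N - n), (dk k n : ℝ) * (dk k (n + h) : ℝ) * pairWeight σ Y T n h

-- Induction on the number of blocks: each contributes the same majorant, so the error is linear in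
-- `i`, and the integrals over the blocks join into one.
set_option maxHeartbeats 1000000 in
theorem exists_abs_sum_Ioc_shiftedSum_add_le (k : ℕ) (hk : 1 ≤ k) {θ : ℝ} (hθ : 0 < θ)
    (hθ1 : θ ≤ 1) :
    ∃ C : ℝ, 0 ≤ C ∧ ∀ (σ Y T P Γ : ℝ) (X J : ℕ), 1 / 2 ≤ σ → σ ≤ 1 → 1 ≤ T → 1 ≤ P →
      P ≤ 2 * T → 2 * T ≤ X → 0 ≤ Γ →
      (∀ j < J, ∀ x ∈ Set.Icc ((2 ^ j * X : ℕ) : ℝ) ((2 ^ (j + 1) * X : ℕ) : ℝ), ∀ t : ℕ, 1 ≤ t →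
        (t : ℝ) ≤ P * (2 ^ j * X : ℕ) / T → |shiftSum k x t| ≤ Γ * (2 ^ j * X : ℕ)) →
      ∀ i ≤ J, |∑ n ∈ Finset.Ioc X (2 ^ i * X), shiftedSum k σ Y T (2 ^ J * X) n +
        √Real.pi / T * ∫ x in (X : ℝ)..(2 ^ i * X : ℕ), Q k x 1 ^ 2 *
          (x * cut σ Y x * (cut σ Y x + x * cut₁ σ Y x))| ≤
      i * (C * ((2 ^ J * X : ℕ) : ℝ) ^ (2 * θ) * (T * P ^ 2 * (1 + Γ) +
        ((2 ^ J * X : ℕ) : ℝ) ^ (2 - 2 * σ) * T⁻¹ ^ 2 +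
        ((2 ^ J * X : ℕ) : ℝ) ^ 2 * T * (Real.exp (-P ^ 2 / 1152) +
          gaussTail (Real.log (2 ^ J * X : ℕ) - Real.log Y)))) := by
  obtain ⟨C₁, hC₁, h₁⟩ := exists_abs_block_add_le k hk hθ hθ1
  obtain ⟨C₂, hC₂, h₂⟩ := exists_abs_sum_shift_sub_le k hθ hθ1
  refine ⟨C₁ + C₂, by positivity, fun σ Y T P Γ X J hσ hσ1 hT hP hPT hTX hΓ hyp => ?_⟩
  have hX1 : (1 : ℝ) ≤ X := by linarith
  have hXn : 1 ≤ X := by exact_mod_cast hX1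
  set N : ℕ := 2 ^ J * X with hN
  have hT0 : 0 < T := by linarith
  have hg := gaussTail_nonneg (Real.log N - Real.log Y)
  set g := gaussTail (Real.log N - Real.log Y) with hgdef
  set e := Real.exp (-P ^ 2 / 1152) with he
  have he0 : 0 < e := Real.exp_pos _
  set q : ℝ → ℝ := fun x => Q k x 1 ^ 2 * (x * cut σ Y x * (cut σ Y x + x * cut₁ σ Y x)) with hq
  have hint : ∀ a b : ℕ, 1 ≤ a → 1 ≤ b → IntervalIntegrable q MeasureTheory.volume a b := by
    intro a b ha hb
    refine ContinuousOn.intervalIntegrable ?_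
    refine ContinuousOn.mono (((continuousOn_Q k hk one_ne_zero).pow 2).mul
      ((continuousOn_id.mul (continuousOn_cut σ Y)).mul
      ((continuousOn_cut σ Y).add (continuousOn_id.mul (continuousOn_cut₁ σ Y))))) fun x hx => ?_
    have h1 : (1 : ℝ) ≤ min (a : ℝ) b := le_min (by exact_mod_cast ha) (by exact_mod_cast hb)
    exact lt_of_lt_of_le one_pos (h1.trans hx.1)
  intro i
  induction i with
  | zero => simp
  | succ j ih =>
    intro hj
    have ihj := ih (by omega)
    set M : ℕ := 2 ^ j * X with hM
    have hMM : 2 ^ (j + 1) * X = 2 * M := by rw [hM, pow_succ]; ring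
    rw [hMM]
    have hXM : X ≤ M := Nat.le_mul_of_pos_left X (by positivity)
    have hMN : 2 * M ≤ N := by
      rw [← hMM, hN]
      exact Nat.mul_le_mul_right X (Nat.pow_le_pow_right (by norm_num) hj)
    have hXM' : (X : ℝ) ≤ M := by exact_mod_cast hXM
    have hMN' : (M : ℝ) ≤ N := by exact_mod_cast (by omega : M ≤ N)
    have hM0 : (0 : ℝ) < M := by linarith
    have hN0 : (0 : ℝ) < N := by linarith
    have hN1 : (1 : ℝ) ≤ N := by linarith
    have hb := h₁ σ Y T P M ((2 * M : ℕ) : ℝ) (Γ * M) hσ hσ1 hT hP hPT (by linarith)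
      (by push_cast; linarith) (by push_cast; linarith) (by nlinarith)
      (fun x hx t ht1 ht2 => by
        refine hyp j (by omega) x ?_ t ht1 ht2
        rw [hMM]
        exact hx)
    rw [Nat.floor_natCast, Nat.floor_natCast] at hb
    have hc : |∑ n ∈ Finset.Ioc M (2 * M), shiftedSum k σ Y T N n -
        ∑ n ∈ Finset.Ioc M (2 * M), ∑ h ∈ Finset.Icc 1 ⌊P * M / T⌋₊,
          (dk k n : ℝ) * (dk k (n + h) : ℝ) * pairWeight σ Y T n h| ≤
        N * (C₂ * ((N : ℝ) ^ (2 * θ) * (N * T * (e + g)))) := by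
      rw [← Finset.sum_sub_distrib]
      refine (Finset.abs_sum_le_sum_abs _ _).trans ?_
      refine (Finset.sum_le_card_nsmul _ _ (C₂ * ((N : ℝ) ^ (2 * θ) * (N * T * (e + g))))
        fun n hn => ?_).trans ?_
      · rw [Finset.mem_Ioc] at hn
        have hn1 : (M : ℝ) ≤ n := by exact_mod_cast hn.1.le
        have hn2 : (n : ℝ) ≤ 2 * M := by exact_mod_cast hn.2
        refine h₂ σ Y T P n N _ hσ hT (by linarith) hPT (by omega) (by omega) ?_ ?_
        · refine le_trans ?_ (Nat.lt_floor_add_one _).le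
          rw [div_le_div_iff₀ (by positivity) hT0]
          have : P * n ≤ P * (2 * M) := by gcongr
          nlinarith
        · rw [← Nat.cast_le (α := ℝ)]
          refine (Nat.floor_le (by positivity)).trans ?_
          rw [div_le_iff₀ hT0]
          push_cast
          have : P * M ≤ 2 * T * n := by gcongr
          linarith
      · rw [nsmul_eq_mul, Nat.card_Ioc]
        gcongr
        omega
    have hsplit : ∑ n ∈ Finset.Ioc X (2 * M), shiftedSum k σ Y T N n =
        ∑ n ∈ Finset.Ioc X M, shiftedSum k σ Y T N n +
        ∑ n ∈ Finset.Ioc M (2 * M), shiftedSum k σ Y T N n :=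
      (Finset.sum_Ioc_consecutive _ hXM (by omega)).symm
    have hsplit2 : ∫ x in (X : ℝ)..(2 * M : ℕ), q x =
        (∫ x in (X : ℝ)..M, q x) + ∫ x in (M : ℝ)..(2 * M : ℕ), q x :=
      (intervalIntegral.integral_add_adjacent_intervals (hint X M hXn (by omega))
        (hint M (2 * M) (by omega) (by omega))).symm
    have hfin := abs_add_le_of_le ihj (abs_add_le_of_le hc hb)
    have hMθ : (M : ℝ) ^ (2 * θ) ≤ N ^ (2 * θ) := by gcongr
    have hMσ : (M : ℝ) ^ (2 - 2 * σ + θ) ≤ N ^ (2 * θ) * N ^ (2 - 2 * σ) := by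
      rw [← Real.rpow_add hN0]
      calc (M : ℝ) ^ (2 - 2 * σ + θ) ≤ N ^ (2 - 2 * σ + θ) := by gcongr; linarith
        _ ≤ _ := Real.rpow_le_rpow_of_exponent_le hN1 (by linarith)
    have hN2 : (N : ℝ) ^ (2 - 2 * σ) ≤ N ^ 2 * T := by
      calc (N : ℝ) ^ (2 - 2 * σ) ≤ N ^ (2 : ℝ) * 1 := by
            rw [mul_one]; exact Real.rpow_le_rpow_of_exponent_le hN1 (by linarith)
        _ ≤ _ := by rw [Real.rpow_two]; gcongr
    have hone : (1 : ℝ) ≤ N ^ (2 * θ) := Real.one_le_rpow hN1 (by positivity)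
    have hΓM : Γ * M / M = Γ := by field_simp
    rw [hΓM] at hb hfin
    have hlast : C₁ * (T * P ^ 2 * Γ + T * P ^ 2 * (M : ℝ) ^ (2 * θ) +
        (M : ℝ) ^ (2 - 2 * σ + θ) * (T⁻¹ ^ 2 + e)) ≤ C₁ * ((N : ℝ) ^ (2 * θ) *
        (T * P ^ 2 * (1 + Γ) + (N : ℝ) ^ (2 - 2 * σ) * T⁻¹ ^ 2 + (N : ℝ) ^ 2 * T * (e + g))) := by
      refine mul_le_mul_of_nonneg_left ?_ hC₁
      have a1 : T * P ^ 2 * Γ ≤ N ^ (2 * θ) * (T * P ^ 2 * Γ) :=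
        le_mul_of_one_le_left (by positivity) hone
      have a2 : T * P ^ 2 * (M : ℝ) ^ (2 * θ) ≤ T * P ^ 2 * (N : ℝ) ^ (2 * θ) := by gcongr
      have a3 : (M : ℝ) ^ (2 - 2 * σ + θ) * (T⁻¹ ^ 2 + e) ≤
          N ^ (2 * θ) * N ^ (2 - 2 * σ) * (T⁻¹ ^ 2 + e) := by gcongr
      have a4 : (N : ℝ) ^ (2 * θ) * ((N : ℝ) ^ (2 - 2 * σ) * e) ≤
          N ^ (2 * θ) * (N ^ 2 * T * e) := by gcongr
      have a5 : 0 ≤ (N : ℝ) ^ (2 * θ) * (N ^ 2 * T * g) := by positivity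
      linarith
    have hsecond : N * (C₂ * ((N : ℝ) ^ (2 * θ) * (N * T * (e + g)))) ≤ C₂ * ((N : ℝ) ^ (2 * θ) *
        (T * P ^ 2 * (1 + Γ) + (N : ℝ) ^ (2 - 2 * σ) * T⁻¹ ^ 2 + (N : ℝ) ^ 2 * T * (e + g))) := by
      have a1 : 0 ≤ T * P ^ 2 * (1 + Γ) + (N : ℝ) ^ (2 - 2 * σ) * T⁻¹ ^ 2 := by positivity
      calc N * (C₂ * ((N : ℝ) ^ (2 * θ) * (N * T * (e + g)))) =
          C₂ * ((N : ℝ) ^ (2 * θ) * ((N : ℝ) ^ 2 * T * (e + g))) := by ring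
        _ ≤ _ := by gcongr; linarith
    rw [hsplit, hsplit2]
    refine le_trans (le_of_eq ?_) (hfin.trans ?_)
    · congr 1
      ring
    · refine (add_le_add_right (add_le_add hsecond hlast) _).trans (le_of_eq ?_)
      push_cast
      ring

theorem exists_abs_sum_Icc_shiftedSum_le (k : ℕ) {θ : ℝ} (hθ : 0 < θ) (hθ1 : θ ≤ 1) :
    ∃ C : ℝ, 0 ≤ C ∧ ∀ (σ Y T P : ℝ) (X N : ℕ), 1 / 2 ≤ σ → 1 ≤ T → 0 ≤ P →
      P ≤ 2 * T → X ≤ N →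
      |∑ n ∈ Finset.Icc 1 X, shiftedSum k σ Y T N n| ≤
      C * (N : ℝ) ^ (2 * θ) * (X * P + (N : ℝ) ^ 2 * T * (Real.exp (-P ^ 2 / 1152) +
          gaussTail (Real.log N - Real.log Y))) := by
  obtain ⟨C₁, hC₁, h₁⟩ := exists_abs_sum_shift_le k hθ hθ1
  obtain ⟨C₂, hC₂, h₂⟩ := exists_abs_sum_shift_sub_le k hθ hθ1
  refine ⟨C₁ + C₂, by positivity, fun σ Y T P X N hσ hT hP hPT hXN => ?_⟩
  have hT0 : 0 < T := by linarith
  have hg := gaussTail_nonneg (Real.log N - Real.log Y)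
  set g := gaussTail (Real.log N - Real.log Y) with hgdef
  set e := Real.exp (-P ^ 2 / 1152) with he
  have he0 : 0 < e := Real.exp_pos _
  refine (Finset.abs_sum_le_sum_abs _ _).trans ?_
  refine (Finset.sum_le_card_nsmul _ _ (C₂ * ((N : ℝ) ^ (2 * θ) * (N * T * (e + g))) +
    C₁ * ((N : ℝ) ^ (2 * θ) * P)) fun n hn => ?_).trans ?_
  · rw [Finset.mem_Icc] at hn
    have hn1 : (1 : ℝ) ≤ n := by exact_mod_cast hn.1
    have hfl : (⌊P * n / T⌋₊ : ℝ) ≤ P * n / T := Nat.floor_le (by positivity)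
    have e1 := h₂ σ Y T P n N ⌊P * n / T⌋₊ hσ hT hP hPT hn.1 (by omega) (by
      refine le_trans ?_ (Nat.lt_floor_add_one _).le
      gcongr
      linarith) (by
      rw [← Nat.cast_le (α := ℝ)]
      refine hfl.trans ?_
      rw [div_le_iff₀ hT0]
      push_cast
      nlinarith)
    have e2 := h₁ σ Y T P n N ⌊P * n / T⌋₊ hσ hT hPT hn.1 (by omega) hfl
    have := abs_add_le_of_le e1 e2
    rwa [sub_add_cancel] at this
  · rw [nsmul_eq_mul, Nat.card_Icc, Nat.add_sub_cancel]
    have hXN' : (X : ℝ) ≤ N := by exact_mod_cast hXN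
    have a1 : (X : ℝ) * (C₂ * ((N : ℝ) ^ (2 * θ) * (N * T * (e + g)))) ≤
        N * (C₂ * ((N : ℝ) ^ (2 * θ) * (N * T * (e + g)))) := by gcongr
    have a2 : 0 ≤ C₂ * ((N : ℝ) ^ (2 * θ) * (X * P)) := by positivity
    have a3 : 0 ≤ C₁ * ((N : ℝ) ^ (2 * θ) * ((N : ℝ) ^ 2 * T * (e + g))) := by positivity
    nlinarith

theorem exists_abs_Q_one_sq_le (k : ℕ) (hk : 1 ≤ k) {θ : ℝ} (hθ : 0 < θ) :
    ∃ C : ℝ, 0 ≤ C ∧ ∀ x : ℝ, 1 ≤ x → Q k x 1 ^ 2 ≤ C * x ^ θ := by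
  obtain ⟨C₂, hC₂, h₂⟩ := exists_abs_Q_le k hk (ε := 1) one_pos
  obtain ⟨C₃, hC₃, h₃⟩ := exists_one_add_log_pow_le (2 * k) hθ
  refine ⟨C₂ ^ 2 * C₃, by positivity, fun x hx => ?_⟩
  have hQ := h₂ 1 one_ne_zero x (by linarith)
  rw [Nat.cast_one, Real.one_rpow, mul_one, abs_of_nonneg (Real.log_nonneg hx)] at hQ
  rw [← sq_abs]
  have hlog := Real.log_nonneg hx
  calc |Q k x 1| ^ 2 ≤ (C₂ * (1 + Real.log x) ^ k) ^ 2 := by gcongr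
    _ = C₂ ^ 2 * (1 + Real.log x) ^ (2 * k) := by rw [pow_mul']; ring
    _ ≤ C₂ ^ 2 * (C₃ * x ^ θ) := by gcongr; exact h₃ x hx
    _ = _ := by ring

theorem exists_sum_sq_dk_mul_cut_le (k : ℕ) {θ : ℝ} (hθ : 0 < θ) (hθ1 : θ ≤ 1) :
    ∃ C : ℝ, 0 ≤ C ∧ ∀ (σ Y : ℝ) (N : ℕ), 1 / 2 ≤ σ → 1 ≤ N →
      ∑ n ∈ Finset.Icc 1 N, (dk k n * cut σ Y n) ^ 2 ≤ C * (N : ℝ) ^ (3 * θ) := by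
  obtain ⟨C, hC, h⟩ := exists_dk_mul_dk_le k hθ hθ1
  obtain ⟨C₃, hC₃, h₃⟩ := exists_one_add_log_pow_le 1 hθ
  refine ⟨C * C₃, by positivity, fun σ Y N hσ hN => ?_⟩
  have hN1 : (1 : ℝ) ≤ N := by exact_mod_cast hN
  have hN0 : (0 : ℝ) < N := by linarith
  have h1 : ∑ n ∈ Finset.Icc 1 N, (n : ℝ)⁻¹ ≤ C₃ * (N : ℝ) ^ θ := by
    refine le_trans ?_ (h₃ N hN1)
    rw [pow_one]
    have := harmonic_le_one_add_log N
    rw [harmonic_eq_sum_Icc] at this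
    push_cast at this
    exact this
  calc ∑ n ∈ Finset.Icc 1 N, (dk k n * cut σ Y n) ^ 2 ≤
      ∑ n ∈ Finset.Icc 1 N, C * (N : ℝ) ^ (2 * θ) * (n : ℝ)⁻¹ := by
        refine Finset.sum_le_sum fun n hn => ?_
        rw [Finset.mem_Icc] at hn
        have hn1 : (1 : ℝ) ≤ n := by exact_mod_cast hn.1
        have hn0 : (0 : ℝ) < n := by linarith
        have e1 : |cut σ Y n| ≤ (n : ℝ) ^ (-(1 / 2) : ℝ) :=
          (abs_cut_le σ Y hn0).trans (Real.rpow_le_rpow_of_exponent_le hn1 (by linarith))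
        have e2 : cut σ Y n ^ 2 ≤ (n : ℝ)⁻¹ := by
          rw [← sq_abs, ← Real.rpow_neg_one]
          calc |cut σ Y n| ^ 2 ≤ ((n : ℝ) ^ (-(1 / 2) : ℝ)) ^ 2 := by gcongr
            _ = _ := by rw [← Real.rpow_natCast, ← Real.rpow_mul hn0.le]; norm_num
        rw [mul_pow, sq (dk k n : ℝ)]
        exact mul_le_mul (h N n n hn.1 hn.1 (by omega) (by omega)) e2 (sq_nonneg _) (by positivity)
    _ ≤ C * (N : ℝ) ^ (2 * θ) * (C₃ * (N : ℝ) ^ θ) := by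
        rw [← Finset.mul_sum]
        gcongr
    _ = _ := by
        rw [show 3 * θ = 2 * θ + θ by ring, Real.rpow_add hN0]
        ring

set_option maxHeartbeats 1000000 in
/-- The smoothed mean square of `dirPoly` equals `2 √π / T · mainMass`, up to the error that the
averaged shift bound leaves. -/
theorem exists_abs_integral_sub_mainMass_le (k : ℕ) (hk : 1 ≤ k) {θ : ℝ} (hθ : 0 < θ)
    (hθ1 : θ ≤ 1) :
    ∃ C : ℝ, 0 ≤ C ∧ ∀ (σ Y T P Γ : ℝ) (X J : ℕ), 1 / 2 ≤ σ → σ ≤ 1 → 1 ≤ T → 1 ≤ P →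
      P ≤ 2 * T → 2 * T ≤ X → 0 ≤ Γ →
      (∀ j < J, ∀ x ∈ Set.Icc ((2 ^ j * X : ℕ) : ℝ) ((2 ^ (j + 1) * X : ℕ) : ℝ), ∀ t : ℕ, 1 ≤ t →
        (t : ℝ) ≤ P * (2 ^ j * X : ℕ) / T → |shiftSum k x t| ≤ Γ * (2 ^ j * X : ℕ)) →
      |(∫ t, wt T t * ‖dirPoly k σ Y (2 ^ J * X) t‖ ^ 2) -
        2 * √Real.pi / T * mainMass k σ Y X (2 ^ J * X : ℕ)| ≤
      C * ((2 ^ J * X : ℕ) : ℝ) ^ (3 * θ) * (X * P + T * P ^ 2 * (1 + Γ) +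
        ((2 ^ J * X : ℕ) : ℝ) ^ (2 - 2 * σ) * T⁻¹ ^ 2 +
        ((2 ^ J * X : ℕ) : ℝ) ^ 2 * T * (Real.exp (-P ^ 2 / 1152) +
          gaussTail (Real.log (2 ^ J * X : ℕ) - Real.log Y))) := by
  obtain ⟨C₁, hC₁, h₁⟩ := exists_abs_sum_Ioc_shiftedSum_add_le k hk hθ hθ1
  obtain ⟨C₂, hC₂, h₂⟩ := exists_abs_sum_Icc_shiftedSum_le k hθ hθ1
  obtain ⟨C₃, hC₃, h₃⟩ := exists_one_add_log_pow_le 1 hθ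
  obtain ⟨C₄, hC₄, h₄⟩ := exists_abs_Q_one_sq_le k hk hθ
  obtain ⟨C₅, hC₅, h₅⟩ := exists_sum_sq_dk_mul_cut_le k hθ hθ1
  refine ⟨C₅ + 2 * (C₂ + 2 * C₃ * C₁) + 2 * C₄, by positivity,
    fun σ Y T P Γ X J hσ hσ1 hT hP hPT hTX hΓ hyp => ?_⟩
  have hX1 : (1 : ℝ) ≤ X := by linarith
  have hXn : 1 ≤ X := by exact_mod_cast hX1
  have hT0 : 0 < T := by linarith
  have hXN : X ≤ 2 ^ J * X := Nat.le_mul_of_pos_left X (by positivity)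
  have e1 := h₁ σ Y T P Γ X J hσ hσ1 hT hP hPT hTX hΓ hyp J le_rfl
  have e2 := h₂ σ Y T P X (2 ^ J * X) hσ hT (by linarith) hPT hXN
  -- The number of blocks is logarithmic in `N`; absorbing it raises the exponent from `2θ` to `3θ`.
  have hJ : (J : ℝ) ≤ 2 * C₃ * ((2 ^ J * X : ℕ) : ℝ) ^ θ := by
    have h6 := h₃ (2 ^ J * X : ℕ) (by exact_mod_cast (by omega : 1 ≤ 2 ^ J * X))
    rw [pow_one] at h6
    have h7 : J * Real.log 2 ≤ Real.log (2 ^ J * X : ℕ) := by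
      push_cast
      rw [Real.log_mul (by positivity) (by positivity), Real.log_pow]
      linarith [Real.log_nonneg hX1]
    nlinarith [Real.log_two_gt_d9, Nat.cast_nonneg (α := ℝ) J]
  set N : ℕ := 2 ^ J * X with hN
  have hXN' : (X : ℝ) ≤ N := by exact_mod_cast hXN
  have hN0 : (0 : ℝ) < N := by linarith
  have hN1 : (1 : ℝ) ≤ N := by linarith
  have hX0 : (0 : ℝ) < X := by linarith
  have e5 := h₅ σ Y N hσ (by omega)
  have hg := gaussTail_nonneg (Real.log N - Real.log Y)
  have hg1 := gaussTail_le_one (Real.log N - Real.log Y)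
  -- The integration by parts leaves two boundary terms. The one at `N` is damped by the cutoff, and
  -- the one at `X` is at most `X` up to the size of `Q_k`.
  have hcutN : (N * cut σ Y N) ^ 2 ≤ N ^ 2 * gaussTail (Real.log N - Real.log Y) := by
    rw [mul_pow, cut, mul_pow]
    have : ((N : ℝ) ^ (-σ)) ^ 2 ≤ 1 := by
      refine pow_le_one₀ (by positivity) ?_
      exact Real.rpow_le_one_of_one_le_of_nonpos hN1 (by linarith)
    have h2 : gaussTail (Real.log N - Real.log Y) ^ 2 ≤ gaussTail (Real.log N - Real.log Y) := by
      rw [sq]; exact mul_le_of_le_one_left hg hg1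
    gcongr
    calc _ ≤ 1 * gaussTail (Real.log N - Real.log Y) := by gcongr
      _ = _ := one_mul _
  have hcutX : (X * cut σ Y X) ^ 2 ≤ X := by
    have e1 : |cut σ Y X| ≤ (X : ℝ) ^ (-(1 / 2) : ℝ) :=
      (abs_cut_le σ Y hX0).trans (Real.rpow_le_rpow_of_exponent_le hX1 (by linarith))
    rw [mul_pow, ← sq_abs (cut σ Y X)]
    calc (X : ℝ) ^ 2 * |cut σ Y X| ^ 2 ≤ (X : ℝ) ^ 2 * ((X : ℝ) ^ (-(1 / 2) : ℝ)) ^ 2 := by gcongr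
      _ = (X : ℝ) ^ 2 * (X : ℝ)⁻¹ := by
          rw [← Real.rpow_natCast _ 2, ← Real.rpow_natCast _ 2, ← Real.rpow_mul hX0.le,
            ← Real.rpow_neg_one]; norm_num
      _ = _ := by field_simp
  set g := gaussTail (Real.log N - Real.log Y) with hgdef
  set e := Real.exp (-P ^ 2 / 1152) with he
  have he0 : 0 < e := Real.exp_pos _
  set ν := (N : ℝ) ^ (2 - 2 * σ) with hν
  have hν0 : 0 < ν := Real.rpow_pos_of_pos hN0 _
  set B := X * P + T * P ^ 2 * (1 + Γ) + ν * T⁻¹ ^ 2 + (N : ℝ) ^ 2 * T * (e + g) with hB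
  have hB1 : T * P ^ 2 * (1 + Γ) + ν * T⁻¹ ^ 2 + (N : ℝ) ^ 2 * T * (e + g) ≤ B := by
    rw [hB]
    have : 0 ≤ X * P := by positivity
    linarith
  have hB2 : X * P + (N : ℝ) ^ 2 * T * (e + g) ≤ B := by
    rw [hB]
    have : 0 ≤ T * P ^ 2 * (1 + Γ) + ν * T⁻¹ ^ 2 := by positivity
    linarith
  have hB3 : T ≤ B := by
    have h1 : 0 ≤ X * P + ν * T⁻¹ ^ 2 + (N : ℝ) ^ 2 * T * (e + g) := by positivity
    have h2 : T * 1 ≤ T * (P ^ 2 * (1 + Γ)) := by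
      gcongr
      nlinarith [one_le_pow₀ hP (n := 2)]
    rw [hB]
    linarith
  have hB0 : 0 ≤ B := by linarith
  have h3θ : (N : ℝ) ^ (2 * θ) * N ^ θ = N ^ (3 * θ) := by rw [← Real.rpow_add hN0]; ring_nf
  have h2θ : (N : ℝ) ^ (2 * θ) ≤ N ^ (3 * θ) :=
    Real.rpow_le_rpow_of_exponent_le hN1 (by linarith)
  have h1θ : (N : ℝ) ^ θ ≤ N ^ (3 * θ) :=
    Real.rpow_le_rpow_of_exponent_le hN1 (by linarith)
  set W := (N : ℝ) ^ (3 * θ) with hW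
  have hW0 : 0 < W := Real.rpow_pos_of_pos hN0 _
  have hsplit : ∑ n ∈ Finset.Icc 1 N, shiftedSum k σ Y T N n =
      ∑ n ∈ Finset.Icc 1 X, shiftedSum k σ Y T N n + ∑ n ∈ Finset.Ioc X N, shiftedSum k σ Y T N n :=
    (Finset.sum_Ioc_consecutive _ (Nat.zero_le X) hXN).symm
  rw [integral_Q_sq_mul_eq k hk σ Y hX0 hXN'] at e1
  have f1 : |∑ n ∈ Finset.Ioc X N, shiftedSum k σ Y T N n + √Real.pi / T *
      ((N * Q k N 1 * cut σ Y N) ^ 2 / 2 - (X * Q k X 1 * cut σ Y X) ^ 2 / 2 -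
        mainMass k σ Y X N)| ≤ 2 * C₃ * C₁ * (W * B) := by
    refine e1.trans ?_
    calc J * (C₁ * (N : ℝ) ^ (2 * θ) * (T * P ^ 2 * (1 + Γ) + ν * T⁻¹ ^ 2 +
          (N : ℝ) ^ 2 * T * (e + g))) ≤
        2 * C₃ * (N : ℝ) ^ θ * (C₁ * (N : ℝ) ^ (2 * θ) * B) := by gcongr
      _ = _ := by rw [← h3θ]; ring
  have f2 : |∑ n ∈ Finset.Icc 1 X, shiftedSum k σ Y T N n| ≤ C₂ * (W * B) := by
    refine e2.trans ?_
    rw [← mul_assoc]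
    gcongr
  have hker : |T * ker 0| ≤ T := by
    rw [ker, abs_of_nonneg (by norm_num; positivity)]
    norm_num
    nlinarith [sqrt_pi_le_two]
  have f3 : |∑ n ∈ Finset.Icc 1 N, (dk k n * cut σ Y n) ^ 2 * (T * ker 0)| ≤ C₅ * (W * B) := by
    rw [← Finset.sum_mul, abs_mul, abs_of_nonneg (Finset.sum_nonneg fun _ _ => sq_nonneg _)]
    calc _ ≤ C₅ * W * T := by gcongr
      _ ≤ C₅ * W * B := by gcongr
      _ = _ := by ring
  -- For the boundary terms the saving `1 / T` is not needed.
  have hsT : √Real.pi / T ≤ 2 := by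
    rw [div_le_iff₀ hT0]
    nlinarith [sqrt_pi_le_two]
  have hb : ∀ x : ℝ, 1 ≤ x → x ≤ N → (x * cut σ Y x) ^ 2 ≤ B →
      √Real.pi / T * (x * Q k x 1 * cut σ Y x) ^ 2 ≤ 2 * C₄ * (W * B) := by
    intro x hx hxN hxB
    calc √Real.pi / T * (x * Q k x 1 * cut σ Y x) ^ 2 =
        √Real.pi / T * (Q k x 1 ^ 2 * (x * cut σ Y x) ^ 2) := by ring
      _ ≤ 2 * ((C₄ * W) * B) := by
          gcongr
          refine (h₄ x hx).trans ?_
          gcongr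
          exact le_trans (by gcongr) h1θ
      _ = _ := by ring
  have f4 := hb N hN1 le_rfl (hcutN.trans (by
    rw [hB]
    have h1 : (N : ℝ) ^ 2 * g * 1 ≤ (N : ℝ) ^ 2 * g * T := by gcongr
    have h2 : 0 ≤ X * P + T * P ^ 2 * (1 + Γ) + ν * T⁻¹ ^ 2 + (N : ℝ) ^ 2 * T * e := by positivity
    linarith))
  have f5 := hb X hX1 hXN' (hcutX.trans (by
    have h1 : (X : ℝ) * 1 ≤ X * P := by gcongr
    have h2 : 0 ≤ (N : ℝ) ^ 2 * T * (e + g) := by positivity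
    linarith))
  have f4' : 0 ≤ √Real.pi / T * (N * Q k N 1 * cut σ Y N) ^ 2 := by positivity
  have f5' : 0 ≤ √Real.pi / T * (X * Q k X 1 * cut σ Y X) ^ 2 := by positivity
  rw [integral_wt_mul_norm_sq_dirPoly k σ Y N hT0]
  change |∑ n ∈ Finset.Icc 1 N, (dk k n * cut σ Y n) ^ 2 * (T * ker 0) +
    2 * ∑ n ∈ Finset.Icc 1 N, shiftedSum k σ Y T N n - _| ≤ _
  rw [hsplit]
  rw [abs_le] at f1 f2 f3 ⊢
  have hid : √Real.pi / T * ((N * Q k N 1 * cut σ Y N) ^ 2 / 2 -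
      (X * Q k X 1 * cut σ Y X) ^ 2 / 2 - mainMass k σ Y X N) =
      (√Real.pi / T * (N * Q k N 1 * cut σ Y N) ^ 2) / 2 -
      (√Real.pi / T * (X * Q k X 1 * cut σ Y X) ^ 2) / 2 - √Real.pi / T * mainMass k σ Y X N := by
    ring
  have hid2 : 2 * √Real.pi / T * mainMass k σ Y X N = 2 * (√Real.pi / T * mainMass k σ Y X N) := by
    ring
  rw [hid] at f1
  rw [hid2]
  have hrhs : (C₅ + 2 * (C₂ + 2 * C₃ * C₁) + 2 * C₄) * W * B = C₅ * (W * B) + 2 * (C₂ * (W * B)) +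
    2 * (2 * C₃ * C₁ * (W * B)) + 2 * C₄ * (W * B) := by ring
  rw [hrhs]
  constructor <;> linarith [f1.1, f1.2, f2.1, f2.2, f3.1, f3.2]

/-! ### Polynomial growth of `ζ` in the half-plane `Re s ≥ 1/4`. -/

/-- The summands of `∑ₙ ((s - 1) n⁻ˢ - (n ^ (1 - s) - (n + 1) ^ (1 - s))) = (s - 1) ζ(s) - 1`. -/
def zetaTerm (s : ℂ) (n : ℕ) : ℂ :=
  (s - 1) * ((n + 1 : ℝ) : ℂ) ^ (-s) + (((n + 2 : ℝ) : ℂ) ^ (1 - s) - ((n + 1 : ℝ) : ℂ) ^ (1 - s))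

/-- Each term is `(s - 1) ∫ (a^(-s) - y^(-s)) dy` over `[a, a + 1]` with `a = n + 1`. The mean value
inequality is applied once to the integrand and once to its primitive. The points `s = 0` and `s =
1` are separated because the power rule degenerates there. -/
theorem norm_zetaTerm_le {s : ℂ} (hs : 0 ≤ s.re) (n : ℕ) :
    ‖zetaTerm s n‖ ≤ ‖s - 1‖ * ‖s‖ * (n + 1 : ℝ) ^ (-s.re - 1) := by
  by_cases h1 : s = 1
  · simp [h1, zetaTerm]
  by_cases h0 : s = 0
  · simp only [h0, zetaTerm]
    simp
    norm_num
  set a : ℝ := n + 1 with ha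
  have ha0 : 0 < a := by positivity
  have hpos : ∀ x ∈ Set.Icc a (a + 1), 0 < x := fun x hx => ha0.trans_le hx.1
  have e1 : ∀ x ∈ Set.Icc a (a + 1), ‖((a : ℝ) : ℂ) ^ (-s) - ((x : ℝ) : ℂ) ^ (-s)‖ ≤
      ‖s‖ * a ^ (-s.re - 1) := by
    intro x hx
    have := Convex.norm_image_sub_le_of_norm_hasDerivWithin_le (𝕜 := ℝ)
      (f := fun y : ℝ => (y : ℂ) ^ (-s)) (f' := fun y : ℝ => -s * (y : ℂ) ^ (-s - 1))
      (s := Set.Icc a (a + 1)) (C := ‖s‖ * a ^ (-s.re - 1))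
      (fun y hy => (hasDerivAt_ofReal_cpow_const (hpos y hy).ne' (by simpa using h0)).hasDerivWithinAt)
      (fun y hy => by
        rw [norm_mul, norm_neg, Complex.norm_cpow_eq_rpow_re_of_pos (hpos y hy)]
        refine mul_le_mul_of_nonneg_left ?_ (norm_nonneg _)
        simp only [Complex.sub_re, Complex.neg_re, Complex.one_re]
        exact Real.rpow_le_rpow_of_nonpos ha0 hy.1 (by linarith))
      (convex_Icc _ _) hx (Set.left_mem_Icc.mpr (by linarith))
    refine this.trans (mul_le_of_le_one_right (by positivity) ?_)
    rw [Real.norm_eq_abs, abs_le]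
    constructor <;> linarith [hx.1, hx.2]
  have e2 := Convex.norm_image_sub_le_of_norm_hasDerivWithin_le (𝕜 := ℝ)
      (f := fun y : ℝ => (s - 1) * (a : ℂ) ^ (-s) * y + (y : ℂ) ^ (1 - s))
      (f' := fun y : ℝ => (s - 1) * ((a : ℂ) ^ (-s) - (y : ℂ) ^ (-s)))
      (s := Set.Icc a (a + 1)) (C := ‖s - 1‖ * (‖s‖ * a ^ (-s.re - 1)))
      (fun y hy => by
        have d1 := hasDerivAt_ofReal_cpow_const (hpos y hy).ne' (sub_ne_zero.mpr (Ne.symm h1))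
        have d2 := ((hasDerivAt_id y).ofReal_comp).const_mul ((s - 1) * (a : ℂ) ^ (-s))
        refine ((d2.add d1).congr_deriv ?_).hasDerivWithinAt
        rw [show 1 - s - 1 = -s by ring]
        push_cast
        ring)
      (fun y hy => by
        rw [norm_mul]
        exact mul_le_mul_of_nonneg_left (e1 y hy) (norm_nonneg _))
      (convex_Icc _ _) (Set.left_mem_Icc.mpr (by linarith))
      (Set.right_mem_Icc.mpr (by linarith : a ≤ a + 1))
  rw [add_sub_cancel_left, norm_one, mul_one, ← mul_assoc] at e2
  refine le_trans (le_of_eq ?_) e2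
  rw [zetaTerm, show (n : ℝ) + 2 = a + 1 by rw [ha]; ring, ← ha]
  congr 1
  push_cast
  ring

theorem summable_add_one_rpow {σ : ℝ} (hσ : 0 < σ) :
    Summable fun n : ℕ => ((n : ℝ) + 1) ^ (-σ - 1) := by
  have := (summable_nat_add_iff 1).mpr (Real.summable_nat_rpow.mpr (by linarith : -σ - 1 < -1))
  simpa using this

theorem summable_zetaTerm {s : ℂ} (hs : 0 < s.re) : Summable (zetaTerm s) :=
  Summable.of_norm_bounded ((summable_add_one_rpow hs).mul_left (‖s - 1‖ * ‖s‖))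
    (norm_zetaTerm_le hs.le)

theorem tsum_zetaTerm_of_one_lt {s : ℂ} (hs : 1 < s.re) :
    ∑' n, zetaTerm s n = riemannZeta₁ s - 1 := by
  have hs1 : s ≠ 1 := fun h => by simp [h] at hs
  have hsum : Summable fun n : ℕ => ((n + 1 : ℝ) : ℂ) ^ (-s) := by
    have := (summable_nat_add_iff 1).mpr (Complex.summable_one_div_nat_cpow.mpr hs)
    refine this.congr fun n => ?_
    rw [Complex.cpow_neg, one_div]
    push_cast
    rfl
  have hz : ∑' n : ℕ, ((n + 1 : ℝ) : ℂ) ^ (-s) = riemannZeta s := by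
    rw [zeta_eq_tsum_one_div_nat_add_one_cpow hs]
    refine tsum_congr fun n => ?_
    rw [Complex.cpow_neg, one_div]
    push_cast
    rfl
  have t1 := (summable_zetaTerm (by linarith : 0 < s.re)).hasSum.tendsto_sum_nat
  have t2 : Tendsto (fun N : ℕ => ∑ n ∈ Finset.range N, zetaTerm s n) atTop
      (𝓝 ((s - 1) * riemannZeta s + (0 - 1))) := by
    have e : ∀ N : ℕ, ∑ n ∈ Finset.range N, zetaTerm s n =
        (s - 1) * ∑ n ∈ Finset.range N, ((n + 1 : ℝ) : ℂ) ^ (-s) +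
        (((N + 1 : ℝ) : ℂ) ^ (1 - s) - 1) := by
      intro N
      simp only [zetaTerm]
      rw [Finset.sum_add_distrib, ← Finset.mul_sum]
      have := Finset.sum_range_sub (fun n : ℕ => ((n + 1 : ℝ) : ℂ) ^ (1 - s)) N
      simp only [Nat.cast_add, Nat.cast_one] at this
      congr 1
      rw [show (((0 : ℕ) : ℝ) + 1 : ℝ) = 1 by simp, Complex.ofReal_one, Complex.one_cpow] at this
      rw [← this]
      refine Finset.sum_congr rfl fun n _ => ?_
      rw [show (n : ℝ) + 1 + 1 = n + 2 by ring]
    simp_rw [e]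
    refine ((hz ▸ hsum.hasSum.tendsto_sum_nat).const_mul _).add (Tendsto.sub_const ?_ _)
    rw [tendsto_zero_iff_norm_tendsto_zero]
    have e3 : ∀ N : ℕ, ‖((N + 1 : ℝ) : ℂ) ^ (1 - s)‖ = ((N : ℝ) + 1) ^ (-(s.re - 1)) := by
      intro N
      rw [Complex.norm_cpow_eq_rpow_re_of_pos (by positivity)]
      simp
    simp_rw [e3]
    exact (tendsto_rpow_neg_atTop (by linarith : 0 < s.re - 1)).comp
      (tendsto_atTop_add_const_right _ _ tendsto_natCast_atTop_atTop)
  rw [tendsto_nhds_unique t1 t2, riemannZeta_eq_inv_sub_mul hs1, ← mul_assoc,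
    mul_inv_cancel₀ (sub_ne_zero.mpr hs1)]
  ring

theorem differentiableOn_tsum_zetaTerm :
    DifferentiableOn ℂ (fun s => ∑' n, zetaTerm s n) {s | 1 / 8 < s.re} := by
  intro s hs
  have hs' : 1 / 8 < s.re := hs
  -- The majorant contains `‖s - 1‖ * ‖s‖`, so uniform convergence holds only on bounded pieces of
  -- the half-plane.
  set U : Set ℂ := {s | 1 / 8 < s.re} ∩ Metric.ball 0 (‖s‖ + 1) with hU
  have hUo : IsOpen U :=
    (isOpen_lt continuous_const Complex.continuous_re).inter Metric.isOpen_ball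
  have hsU : s ∈ U := ⟨hs, by simp⟩
  have h := Complex.differentiableOn_tsum_of_summable_norm (F := fun n s => zetaTerm s n)
    (u := fun n : ℕ => (‖s‖ + 2) * (‖s‖ + 1) * ((n : ℝ) + 1) ^ (-(1 / 8 : ℝ) - 1)) (U := U)
    ((summable_add_one_rpow (by norm_num)).mul_left _)
    (fun n => by
      have h1 : ((n + 1 : ℝ) : ℂ) ≠ 0 := by exact_mod_cast Nat.succ_ne_zero n
      have h2 : ((n + 2 : ℝ) : ℂ) ≠ 0 := by exact_mod_cast Nat.succ_ne_zero (n + 1)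
      unfold zetaTerm
      refine Differentiable.differentiableOn ?_
      refine ((differentiable_id.sub_const 1).mul ?_).add (Differentiable.sub ?_ ?_)
      · exact differentiable_id.neg.const_cpow (Or.inl h1)
      · exact (differentiable_id.const_sub 1).const_cpow (Or.inl h2)
      · exact (differentiable_id.const_sub 1).const_cpow (Or.inl h1))
    hUo
    (fun n w hw => by
      have hw1 : 1 / 8 < w.re := hw.1
      have hw2 : ‖w‖ < ‖s‖ + 1 := by simpa using hw.2
      refine (norm_zetaTerm_le (by linarith) n).trans ?_
      have hw3 : ‖w - 1‖ ≤ ‖s‖ + 2 := (norm_sub_le _ _).trans (by rw [norm_one]; linarith)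
      gcongr
      linarith)
  exact (h.differentiableAt (hUo.mem_nhds hsU)).differentiableWithinAt

/-- Both sides are analytic on a convex half-plane and agree for `Re s > 1`. -/
theorem tsum_zetaTerm {s : ℂ} (hs : 1 / 8 < s.re) :
    ∑' n, zetaTerm s n = riemannZeta₁ s - 1 := by
  have hUo : IsOpen {s : ℂ | 1 / 8 < s.re} := isOpen_lt continuous_const Complex.continuous_re
  have h1 : AnalyticOnNhd ℂ (fun s => ∑' n, zetaTerm s n) {s | 1 / 8 < s.re} :=
    differentiableOn_tsum_zetaTerm.analyticOnNhd hUo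
  have h2 : AnalyticOnNhd ℂ (fun s => riemannZeta₁ s - 1) {s | 1 / 8 < s.re} :=
    ((differentiable_riemannZeta₁.sub_const 1).differentiableOn).analyticOnNhd hUo
  have hc : IsPreconnected {s : ℂ | 1 / 8 < s.re} := (convex_halfSpace_re_gt _).isPreconnected
  refine h1.eqOn_of_preconnected_of_eventuallyEq h2 hc (z₀ := 2) (by norm_num) ?_ hs
  have : {s : ℂ | 1 < s.re} ∈ 𝓝 (2 : ℂ) :=
    (isOpen_lt continuous_const Complex.continuous_re).mem_nhds (by norm_num)
  filter_upwards [this] with z hz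
  exact tsum_zetaTerm_of_one_lt hz

theorem exists_norm_riemannZeta₁_le :
    ∃ C : ℝ, 1 ≤ C ∧ ∀ s : ℂ, 1 / 4 ≤ s.re → ‖riemannZeta₁ s‖ ≤ C * (1 + ‖s - 1‖ * ‖s‖) := by
  set S := ∑' n : ℕ, ((n : ℝ) + 1) ^ (-(1 / 4 : ℝ) - 1) with hS
  have hS0 : 0 ≤ S := tsum_nonneg fun n => by positivity
  refine ⟨1 + S, by linarith, fun s hs => ?_⟩
  have h := tsum_zetaTerm (s := s) (by linarith)
  have h2 : ‖∑' n, zetaTerm s n‖ ≤ ‖s - 1‖ * ‖s‖ * S := by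
    refine tsum_of_norm_bounded
      (((summable_add_one_rpow (σ := 1 / 4) (by norm_num)).hasSum).mul_left _) fun n => ?_
    refine (norm_zetaTerm_le (by linarith) n).trans ?_
    gcongr
    linarith
  have h3 : riemannZeta₁ s = 1 + ∑' n, zetaTerm s n := by rw [h]; ring
  rw [h3]
  refine (norm_add_le _ _).trans ?_
  rw [norm_one]
  have : 0 ≤ ‖s - 1‖ * ‖s‖ := by positivity
  nlinarith

/-- Linear growth of `ζ` away from its pole. -/
theorem exists_norm_riemannZeta_le :
    ∃ C : ℝ, 1 ≤ C ∧ ∀ s : ℂ, 1 / 4 ≤ s.re → ∀ r : ℝ, 0 < r → r ≤ 1 → r ≤ ‖s - 1‖ →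
      ‖riemannZeta s‖ ≤ C / r * (1 + ‖s‖) := by
  obtain ⟨C, hC, h⟩ := exists_norm_riemannZeta₁_le
  refine ⟨C, hC, fun s hs r hr hr1 hrs => ?_⟩
  have h0 : 0 < ‖s - 1‖ := hr.trans_le hrs
  have hs1 : s ≠ 1 := fun hh => by simp [hh] at h0
  rw [riemannZeta_eq_inv_sub_mul hs1, norm_mul, norm_inv]
  have hC0 : 0 < C := by linarith
  calc ‖s - 1‖⁻¹ * ‖riemannZeta₁ s‖ ≤ ‖s - 1‖⁻¹ * (C * (1 + ‖s - 1‖ * ‖s‖)) := by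
        gcongr; exact h s hs
    _ = C * (‖s - 1‖⁻¹ + ‖s‖) := by field_simp
    _ ≤ C * (r⁻¹ + r⁻¹ * ‖s‖) := by
        gcongr
        exact le_mul_of_one_le_left (norm_nonneg _) ((one_le_inv₀ hr).mpr hr1)
    _ = _ := by rw [div_eq_mul_inv]; ring

/-! ### Stirling's bound in a strip and the functional equation. -/

/-- On this line `1 - s` is the conjugate of `s`, so the reflection formula evaluates `|Γ(s)|²`
exactly as `π / cosh(πt)`. -/
theorem norm_Gamma_half_add_le (t : ℝ) :
    ‖Complex.Gamma (1 / 2 + t * Complex.I)‖ ≤ 3 * Real.exp (-(Real.pi / 2 * |t|)) := by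
  have h := Complex.Gamma_mul_Gamma_one_sub (1 / 2 + t * Complex.I)
  have e1 : (1 : ℂ) - (1 / 2 + t * Complex.I) =
      (starRingEnd ℂ) (1 / 2 + t * Complex.I) := by
    simp only [map_add, map_mul, Complex.conj_ofReal, Complex.conj_I, map_div₀, map_one,
      Complex.conj_ofNat]
    ring
  have e2 : Complex.sin (Real.pi * (1 / 2 + t * Complex.I)) = ((Real.cosh (Real.pi * t) : ℝ) : ℂ) := by
    rw [show (Real.pi : ℂ) * (1 / 2 + t * Complex.I) =
      Real.pi * t * Complex.I + Real.pi / 2 by ring, Complex.sin_add_pi_div_two, Complex.cos_mul_I]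
    push_cast
    rfl
  rw [e1, Complex.Gamma_conj, Complex.mul_conj, e2, ← Complex.ofReal_div] at h
  have h2 : Complex.normSq (Complex.Gamma (1 / 2 + t * Complex.I)) =
      Real.pi / Real.cosh (Real.pi * t) := by exact_mod_cast h
  rw [Complex.normSq_eq_norm_sq] at h2
  have h3 : Real.exp (Real.pi * |t|) / 2 ≤ Real.cosh (Real.pi * t) := by
    rw [← Real.cosh_abs, abs_mul, abs_of_pos Real.pi_pos, Real.cosh_eq]
    linarith [Real.exp_pos (-(Real.pi * |t|))]
  refine abs_le_of_sq_le_sq' ?_ (by positivity) |>.2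
  rw [h2, mul_pow, ← Real.exp_nat_mul, div_le_iff₀ (Real.cosh_pos _)]
  have h4 : Real.exp ((2 : ℕ) * -(Real.pi / 2 * |t|)) * Real.exp (Real.pi * |t|) = 1 := by
    rw [← Real.exp_add]
    push_cast
    ring_nf
    exact Real.exp_zero
  have h5 : 0 < Real.exp ((2 : ℕ) * -(Real.pi / 2 * |t|)) := Real.exp_pos _
  calc Real.pi ≤ 3 ^ 2 * (Real.exp ((2 : ℕ) * -(Real.pi / 2 * |t|)) *
        Real.exp (Real.pi * |t|)) / 2 := by rw [h4]; linarith [Real.pi_lt_four]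
    _ = 3 ^ 2 * Real.exp ((2 : ℕ) * -(Real.pi / 2 * |t|)) * (Real.exp (Real.pi * |t|) / 2) := by ring
    _ ≤ _ := by gcongr

theorem im_mul_arg_add_one {s : ℂ} : s.im * (s + 1).arg = |s.im| * |(s + 1).arg| := by
  rcases le_or_gt 0 s.im with h | h
  · have : 0 ≤ (s + 1).arg := Complex.arg_nonneg_iff.mpr (by simpa using h)
    rw [abs_of_nonneg h, abs_of_nonneg this]
  · have : (s + 1).arg < 0 := Complex.arg_neg_iff.mpr (by simpa using h)
    rw [abs_of_neg h, abs_of_neg this]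
    ring

theorem abs_arg_add_one_le {s : ℂ} (hs : 0 ≤ s.re) : |(s + 1).arg| ≤ Real.pi / 2 :=
  Complex.abs_arg_le_pi_div_two_iff.mpr (by simp; linarith)

theorem one_le_norm_add_one {s : ℂ} (hs : 0 ≤ s.re) : 1 ≤ ‖s + 1‖ := by
  refine le_trans ?_ ((le_abs_self _).trans (Complex.abs_re_le_norm _))
  simp
  linarith

/-- Jordan's inequality for the complementary angle: `(2/π)(π/2 - |arg|) ≤ cos arg = (Re s + 1) / ‖s
+ 1‖`. Multiplied by `|Im s| ≤ ‖s + 1‖`, the deficit stays bounded. -/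
theorem im_mul_arg_add_one_ge {s : ℂ} (hs : 0 ≤ s.re) :
    Real.pi / 2 * |s.im| - Real.pi / 2 * (s.re + 1) ≤ s.im * (s + 1).arg := by
  rw [im_mul_arg_add_one]
  have h1 := one_le_norm_add_one hs
  have h2 := abs_arg_add_one_le hs
  have h0 : s + 1 ≠ 0 := fun h => by rw [h, norm_zero] at h1; linarith
  have h3 := Real.mul_le_sin (sub_nonneg.mpr h2) (by linarith [abs_nonneg (s + 1).arg])
  rw [Real.sin_pi_div_two_sub, Real.cos_abs, Complex.cos_arg h0, le_div_iff₀ (by linarith)] at h3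
  have h4 : |s.im| ≤ ‖s + 1‖ := by simpa using Complex.abs_im_le_norm (s + 1)
  simp only [Complex.add_re, Complex.one_re] at h3
  have hpi := Real.pi_pos
  have h5 : 0 ≤ Real.pi / 2 - |(s + 1).arg| := by linarith
  have h6 : (Real.pi / 2 - |(s + 1).arg|) * ‖s + 1‖ ≤ Real.pi / 2 * (s.re + 1) := by
    calc _ = Real.pi / 2 * (2 / Real.pi * (Real.pi / 2 - |(s + 1).arg|) * ‖s + 1‖) := by field_simp
      _ ≤ _ := by gcongr
  nlinarith [mul_le_mul_of_nonneg_left h4 h5]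

/-- The quotient of `Γ(s)` by its Stirling majorant. -/
def stirlingQuot (s : ℂ) : ℂ :=
  Complex.Gamma s * Complex.exp (-((s - 1 / 2) * Complex.log (s + 1)))

theorem norm_stirlingQuot (s : ℂ) : ‖stirlingQuot s‖ =
    ‖Complex.Gamma s‖ * Real.exp (-((s.re - 1 / 2) * Real.log ‖s + 1‖) + s.im * (s + 1).arg) := by
  rw [stirlingQuot, norm_mul, Complex.norm_exp]
  congr 2
  rw [Complex.neg_re, Complex.mul_re, Complex.log_re, Complex.log_im]
  have e1 : (s - 1 / 2).re = s.re - 1 / 2 := by simp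
  have e2 : (s - 1 / 2).im = s.im := by simp
  rw [e1, e2]
  ring

theorem differentiableOn_stirlingQuot : DifferentiableOn ℂ stirlingQuot {s | 0 < s.re} := by
  intro s hs
  have hs' : 0 < s.re := hs
  refine DifferentiableAt.differentiableWithinAt ?_
  unfold stirlingQuot
  refine (Complex.differentiableAt_Gamma s fun m h => ?_).mul ?_
  · rw [h] at hs'
    simp at hs'
    linarith [Nat.cast_nonneg (α := ℝ) m]
  · refine ((differentiableAt_id.sub_const _).mul ?_).neg.cexp
    refine (differentiableAt_id.add_const 1).clog ?_
    exact Or.inl (by simp; linarith)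

theorem norm_Gamma_le {s : ℂ} (hs : 0 < s.re) : ‖Complex.Gamma s‖ ≤ Real.Gamma s.re := by
  rw [Complex.Gamma_eq_integral hs, Complex.GammaIntegral, Real.Gamma_eq_integral hs]
  refine (MeasureTheory.norm_integral_le_integral_norm _).trans (le_of_eq ?_)
  refine MeasureTheory.setIntegral_congr_fun measurableSet_Ioi fun x hx => ?_
  have hx0 : 0 < x := hx
  simp only [norm_mul, Complex.norm_real, Complex.norm_cpow_eq_rpow_re_of_pos hx0]
  simp [abs_of_pos (Real.exp_pos _)]

/-- Phragmén–Lindelöf in the strip `1/2 ≤ Re s ≤ 3/2`: the reflection formula gives the left edge,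
and `Γ(z) = (z - 1) Γ(z - 1)` carries it to the right edge. -/
theorem norm_stirlingQuot_le {s : ℂ} (h₁ : 1 / 2 ≤ s.re) (h₂ : s.re ≤ 3 / 2) :
    ‖stirlingQuot s‖ ≤ 3 := by
  have hexp : ∀ z : ℂ, 1 / 2 ≤ z.re →
      Real.exp (-((z.re - 1 / 2) * Real.log ‖z + 1‖) + z.im * (z + 1).arg) ≤
        Real.exp (-((z.re - 1 / 2) * Real.log ‖z + 1‖)) * Real.exp (Real.pi / 2 * |z.im|) := by
    intro z hz
    rw [← Real.exp_add]
    refine Real.exp_le_exp.mpr (add_le_add_right ?_ _)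
    rw [im_mul_arg_add_one, mul_comm]
    exact mul_le_mul_of_nonneg_right (abs_arg_add_one_le (by linarith)) (abs_nonneg _)
  have hcancel : ∀ t : ℝ, Real.exp (-(Real.pi / 2 * |t|)) * Real.exp (Real.pi / 2 * |t|) = 1 := by
    intro t
    rw [← Real.exp_add, neg_add_cancel, Real.exp_zero]
  refine PhragmenLindelof.vertical_strip (a := 1 / 2) (b := 3 / 2) ?_ ?_ ?_ ?_ h₁ h₂
  · refine DifferentiableOn.diffContOnCl (differentiableOn_stirlingQuot.mono ?_)
    have : closure (Complex.re ⁻¹' Set.Ioo (1 / 2) (3 / 2)) ⊆ {s : ℂ | 1 / 2 ≤ s.re} :=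
      closure_minimal (fun z hz => hz.1.le) (isClosed_le continuous_const Complex.continuous_re)
    exact this.trans fun z (hz : 1 / 2 ≤ z.re) => show 0 < z.re by linarith
  -- The strip has width `1`, so growth `exp(B exp(c|t|))` with `c < π` is admissible. The quotient
  -- grows at most like `exp(π|t|/2)`, for which `c = 1` and `B = 2` suffice.
  · refine ⟨1, by rw [lt_div_iff₀ (by norm_num)]; linarith [Real.pi_gt_three], 2, ?_⟩
    obtain ⟨K, hK⟩ := (isCompact_Icc (a := (1 / 2 : ℝ)) (b := 3 / 2)).exists_bound_of_continuousOn
      (f := Real.Gamma) (fun x hx => (Real.differentiableAt_Gamma (fun m h => by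
        have := hx.1
        linarith [Nat.cast_nonneg (α := ℝ) m])).continuousAt.continuousWithinAt)
    refine IsBigO.of_bound K ?_
    rw [eventually_inf_principal]
    refine Eventually.of_forall fun z hz => ?_
    have hz1 : 1 / 2 < z.re := hz.1
    have hz2 : z.re < 3 / 2 := hz.2
    have hlog := Real.log_nonneg (one_le_norm_add_one (s := z) (by linarith))
    have hG : ‖Complex.Gamma z‖ ≤ K :=
      (norm_Gamma_le (by linarith)).trans ((le_abs_self _).trans (hK _ ⟨hz1.le, hz2.le⟩))
    rw [norm_stirlingQuot, Real.norm_eq_abs, abs_of_pos (Real.exp_pos _)]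
    refine mul_le_mul hG ((hexp z hz1.le).trans ?_) (Real.exp_pos _).le
      ((norm_nonneg _).trans hG)
    rw [← Real.exp_add]
    refine Real.exp_le_exp.mpr ?_
    have h5 : |z.im| + 1 ≤ Real.exp (1 * |z.im|) := by rw [one_mul]; exact Real.add_one_le_exp _
    have h6 : 0 ≤ (z.re - 1 / 2) * Real.log ‖z + 1‖ := mul_nonneg (by linarith) hlog
    nlinarith [Real.pi_lt_four, abs_nonneg z.im]
  · intro z hz
    rw [norm_stirlingQuot]
    have e1 : z = 1 / 2 + z.im * Complex.I := by
      rw [← Complex.re_add_im z, hz]; simp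
    have hG := norm_Gamma_half_add_le z.im
    rw [← e1] at hG
    calc _ ≤ 3 * Real.exp (-(Real.pi / 2 * |z.im|)) *
          (Real.exp (-((z.re - 1 / 2) * Real.log ‖z + 1‖)) * Real.exp (Real.pi / 2 * |z.im|)) := by
          gcongr
          exact hexp z hz.ge
      _ = 3 := by
          rw [hz, sub_self, zero_mul, neg_zero, Real.exp_zero, one_mul, mul_assoc, hcancel, mul_one]
  · intro z hz
    rw [norm_stirlingQuot]
    have e1 : z - 1 = 1 / 2 + z.im * Complex.I := by
      apply Complex.ext
      · simp [hz]; norm_num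
      · simp
    have hz1 : z - 1 ≠ 0 := fun h => by
      have := congrArg Complex.re h
      simp [hz] at this
      norm_num at this
    have hG := norm_Gamma_half_add_le z.im
    rw [← e1] at hG
    have hG2 : Complex.Gamma z = (z - 1) * Complex.Gamma (z - 1) := by
      rw [← Complex.Gamma_add_one _ hz1, sub_add_cancel]
    have hn : ‖z - 1‖ ≤ ‖z + 1‖ := by
      refine abs_le_of_sq_le_sq' ?_ (norm_nonneg _) |>.2
      rw [← Complex.normSq_eq_norm_sq, ← Complex.normSq_eq_norm_sq, Complex.normSq_apply,
        Complex.normSq_apply]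
      simp [hz]
      norm_num
    have hpos : 0 < ‖z + 1‖ := by linarith [one_le_norm_add_one (s := z) (by linarith)]
    calc _ ≤ (‖z + 1‖ * (3 * Real.exp (-(Real.pi / 2 * |z.im|)))) *
          (Real.exp (-((z.re - 1 / 2) * Real.log ‖z + 1‖)) * Real.exp (Real.pi / 2 * |z.im|)) := by
          rw [hG2, norm_mul]
          gcongr
          exact hexp z (by rw [hz]; norm_num)
      _ = (‖z + 1‖ * Real.exp (-Real.log ‖z + 1‖)) * 3 *
          (Real.exp (-(Real.pi / 2 * |z.im|)) * Real.exp (Real.pi / 2 * |z.im|)) := by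
          rw [hz]
          ring_nf
      _ = 3 := by
          rw [hcancel, Real.exp_neg, Real.exp_log hpos, mul_inv_cancel₀ hpos.ne']
          norm_num

theorem norm_Gamma_le_stirling {s : ℂ} (h₁ : 1 / 2 ≤ s.re) (h₂ : s.re ≤ 3 / 2) :
    ‖Complex.Gamma s‖ ≤
      3 * Real.exp 5 * ‖s + 1‖ ^ (s.re - 1 / 2) * Real.exp (-(Real.pi / 2 * |s.im|)) := by
  have h := norm_stirlingQuot_le h₁ h₂
  have h0 := one_le_norm_add_one (s := s) (by linarith)
  have ha := im_mul_arg_add_one_ge (s := s) (by linarith)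
  rw [norm_stirlingQuot] at h
  have hE := Real.exp_pos (-((s.re - 1 / 2) * Real.log ‖s + 1‖) + s.im * (s + 1).arg)
  rw [← le_div_iff₀ hE, div_eq_mul_inv, ← Real.exp_neg] at h
  refine h.trans ?_
  rw [mul_assoc, mul_assoc]
  refine mul_le_mul_of_nonneg_left ?_ (by norm_num)
  rw [Real.rpow_def_of_pos (by linarith), ← Real.exp_add, ← Real.exp_add]
  refine Real.exp_le_exp.mpr ?_
  have : Real.pi / 2 * (s.re + 1) ≤ 5 := by nlinarith [Real.pi_lt_d2, Real.pi_pos]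
  linarith

theorem norm_cos_le (z : ℂ) : ‖Complex.cos z‖ ≤ Real.exp |z.im| := by
  rw [Complex.cos, norm_div]
  have h1 := norm_add_le (Complex.exp (z * Complex.I)) (Complex.exp (-z * Complex.I))
  rw [Complex.norm_exp, Complex.norm_exp] at h1
  have h2 : Real.exp (z * Complex.I).re ≤ Real.exp |z.im| :=
    Real.exp_le_exp.mpr (by simpa using neg_le_abs z.im)
  have h3 : Real.exp (-z * Complex.I).re ≤ Real.exp |z.im| :=
    Real.exp_le_exp.mpr (by simpa using le_abs_self z.im)
  rw [Complex.norm_ofNat, div_le_iff₀ (by norm_num)]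
  linarith

/-- The functional equation as a bound for `ζ` to the left of the critical line. -/
theorem exists_norm_riemannZeta_left_le :
    ∃ C : ℝ, 1 ≤ C ∧ ∀ δ : ℝ, 0 < δ → δ < 1 / 2 → ∀ t : ℝ,
      ‖riemannZeta (((1 / 2 - δ : ℝ) : ℂ) + t * Complex.I)‖ ≤
        C * (1 + |t|) ^ δ * ‖riemannZeta (((1 / 2 + δ : ℝ) : ℂ) + t * Complex.I)‖ := by
  refine ⟨2 * (3 * Real.exp 5 * 3), by linarith [Real.one_le_exp (by norm_num : (0 : ℝ) ≤ 5)],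
    fun δ hδ hδ' t => ?_⟩
  set s : ℂ := ((1 / 2 + δ : ℝ) : ℂ) + (-t : ℝ) * Complex.I with hs
  have hre : s.re = 1 / 2 + δ := by rw [hs]; simp
  have him : s.im = -t := by rw [hs]; simp
  have e1 : ((1 / 2 - δ : ℝ) : ℂ) + t * Complex.I = 1 - s := by
    rw [hs]; push_cast; ring
  have e2 : ((1 / 2 + δ : ℝ) : ℂ) + t * Complex.I = (starRingEnd ℂ) s := by
    rw [hs]
    simp only [map_add, map_mul, Complex.conj_ofReal, Complex.conj_I]
    push_cast
    ring
  rw [e1, e2, riemannZeta_conj, Complex.norm_conj, riemannZeta_one_sub (fun n h => by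
    have := congrArg Complex.re h
    rw [hre] at this
    simp at this
    linarith [Nat.cast_nonneg (α := ℝ) n]) (fun h => by
    have := congrArg Complex.re h
    rw [hre] at this
    simp at this
    linarith)]
  rw [norm_mul, norm_mul, norm_mul, norm_mul, Complex.norm_ofNat]
  refine mul_le_mul_of_nonneg_right ?_ (norm_nonneg _)
  have h1 : ‖(2 * (Real.pi : ℂ)) ^ (-s)‖ ≤ 1 := by
    rw [show (2 * (Real.pi : ℂ)) = ((2 * Real.pi : ℝ) : ℂ) by push_cast; rfl,
      Complex.norm_cpow_eq_rpow_re_of_pos (by positivity), Complex.neg_re, hre]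
    exact Real.rpow_le_one_of_one_le_of_nonpos (by linarith [Real.pi_gt_three]) (by linarith)
  have h2 := norm_Gamma_le_stirling (s := s) (by linarith) (by linarith)
  have h3 : ‖Complex.cos (Real.pi * s / 2)‖ ≤ Real.exp (Real.pi / 2 * |t|) := by
    refine (norm_cos_le _).trans (le_of_eq ?_)
    have : (Real.pi * s / 2 : ℂ) = ((Real.pi / 2 : ℝ) : ℂ) * s := by push_cast; ring
    rw [this, Complex.im_ofReal_mul, him, abs_mul, abs_neg, abs_of_pos (by positivity)]
  have h4 : ‖s + 1‖ ^ (s.re - 1 / 2) ≤ 3 * (1 + |t|) ^ δ := by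
    rw [hre, add_sub_cancel_left]
    have h5 : ‖s + 1‖ ≤ 3 * (1 + |t|) := by
      refine (Complex.norm_le_abs_re_add_abs_im _).trans ?_
      simp only [Complex.add_re, Complex.add_im, Complex.one_re, Complex.one_im, hre, him,
        add_zero, abs_neg]
      rw [abs_of_pos (by linarith)]
      linarith [abs_nonneg t]
    calc ‖s + 1‖ ^ δ ≤ (3 * (1 + |t|)) ^ δ := by gcongr
      _ = 3 ^ δ * (1 + |t|) ^ δ := Real.mul_rpow (by norm_num) (by positivity)
      _ ≤ 3 ^ (1 : ℝ) * (1 + |t|) ^ δ := by gcongr <;> linarith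
      _ = _ := by rw [Real.rpow_one]
  rw [him, abs_neg] at h2
  -- The decay `exp(-π|t|/2)` of the Gamma factor cancels the growth of the cosine, and only `(1 +
  -- |t|)^δ` remains.
  calc _ ≤ 2 * 1 * (3 * Real.exp 5 * (3 * (1 + |t|) ^ δ) * Real.exp (-(Real.pi / 2 * |t|))) *
        Real.exp (Real.pi / 2 * |t|) := by
        gcongr
        refine h2.trans ?_
        gcongr
    _ = 2 * (3 * Real.exp 5 * 3) * (1 + |t|) ^ δ *
        (Real.exp (-(Real.pi / 2 * |t|)) * Real.exp (Real.pi / 2 * |t|)) := by ring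
    _ = _ := by rw [← Real.exp_add, neg_add_cancel, Real.exp_zero, mul_one]

/-! ### The contour kernel `exp(w²)/w`. -/

theorem norm_cexp_sq (c y : ℝ) :
    ‖Complex.exp (((c : ℂ) + y * Complex.I) ^ 2)‖ = Real.exp (c ^ 2) * Real.exp (-y ^ 2) := by
  rw [Complex.norm_exp, ← Real.exp_add]
  congr 1
  simp [sq]
  ring

/-- The kernel `exp(w²) / w` on the line `w = c + iy`. -/
def gaussKernel (c y : ℝ) : ℂ :=
  Complex.exp (((c : ℂ) + y * Complex.I) ^ 2) / ((c : ℂ) + y * Complex.I)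

theorem line_ne_zero {c : ℝ} (hc : c ≠ 0) (y : ℝ) : (c : ℂ) + y * Complex.I ≠ 0 := fun h => by
  have := congrArg Complex.re h
  simp at this
  exact hc this

theorem continuous_gaussKernel {c : ℝ} (hc : c ≠ 0) : Continuous (gaussKernel c) := by
  unfold gaussKernel
  exact Continuous.div (by fun_prop) (by fun_prop) (line_ne_zero hc)

theorem norm_gaussKernel_le_div {c : ℝ} (hc : c ≠ 0) (hc1 : |c| ≤ 1) (y : ℝ) :
    ‖gaussKernel c y‖ ≤ 3 / |c| * Real.exp (-y ^ 2) := by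
  rw [gaussKernel, norm_div, norm_cexp_sq]
  have h1 : |c| ≤ ‖(c : ℂ) + y * Complex.I‖ := by
    simpa using Complex.abs_re_le_norm ((c : ℂ) + y * Complex.I)
  have h2 : Real.exp (c ^ 2) ≤ 3 := by
    have : c ^ 2 ≤ 1 := by rw [← sq_abs]; exact pow_le_one₀ (abs_nonneg _) hc1
    linarith [Real.exp_le_exp.mpr this, Real.exp_one_lt_three]
  have hc0 : 0 < |c| := abs_pos.mpr hc
  rw [div_mul_eq_mul_div]
  gcongr

theorem norm_gaussKernel_le {c : ℝ} (hc1 : |c| ≤ 1) {y : ℝ} (hy : 1 ≤ |y|) :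
    ‖gaussKernel c y‖ ≤ 3 * Real.exp (-y ^ 2) := by
  rw [gaussKernel, norm_div, norm_cexp_sq]
  have h1 : |y| ≤ ‖(c : ℂ) + y * Complex.I‖ := by
    simpa using Complex.abs_im_le_norm ((c : ℂ) + y * Complex.I)
  have h2 : Real.exp (c ^ 2) ≤ 3 := by
    have : c ^ 2 ≤ 1 := by rw [← sq_abs]; exact pow_le_one₀ (abs_nonneg _) hc1
    linarith [Real.exp_le_exp.mpr this, Real.exp_one_lt_three]
  refine (div_le_self (by positivity) (hy.trans h1)).trans ?_
  gcongr

theorem integrable_gaussKernel {c : ℝ} (hc : c ≠ 0) (hc1 : |c| ≤ 1) :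
    MeasureTheory.Integrable (gaussKernel c) :=
  (integrable_exp_neg_sq.const_mul (3 / |c|)).mono' (continuous_gaussKernel hc).aestronglyMeasurable
    (Eventually.of_forall fun y => norm_gaussKernel_le_div hc hc1 y)

/-- A Gaussian integral along a vertical line does not depend on the abscissa; its value is the
cutoff density, which is why this kernel belongs to `gaussTail`. -/
theorem integral_cexp_sq_sub (c τ : ℝ) :
    ∫ y : ℝ, Complex.exp (((c : ℂ) + y * Complex.I) ^ 2 - τ * ((c : ℂ) + y * Complex.I)) =
      ((2 * Real.pi * gaussDens τ : ℝ) : ℂ) := by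
  have h := integral_cexp_quadratic (b := -1) (by simp) ((2 * c - τ) * Complex.I)
    ((c : ℂ) ^ 2 - τ * c)
  have e3 : ((Real.pi : ℂ) / - -1) ^ (1 / 2 : ℂ) = ((√Real.pi : ℝ) : ℂ) := by
    rw [Real.sqrt_eq_rpow, Complex.ofReal_cpow Real.pi_pos.le]
    simp
  rw [e3] at h
  calc _ = ∫ y : ℝ, Complex.exp (-1 * (y : ℂ) ^ 2 + (2 * c - τ) * Complex.I * y +
        ((c : ℂ) ^ 2 - τ * c)) := by
        congr 1
        ext y
        congr 1
        have := Complex.I_sq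
        linear_combination (y : ℂ) ^ 2 * this
    _ = _ := h
    _ = _ := by
        have e4 : (c : ℂ) ^ 2 - τ * c - ((2 * c - τ) * Complex.I) ^ 2 / (4 * -1) =
            ((-(1 / 4) * τ ^ 2 : ℝ) : ℂ) := by
          push_cast
          have := Complex.I_sq
          linear_combination (2 * (c : ℂ) - τ) ^ 2 / 4 * this
        rw [e4, ← Complex.ofReal_exp, ← Complex.ofReal_mul, gaussDens]
        congr 1
        have h1 : √Real.pi ≠ 0 := by positivity
        have h2 : Real.pi = √Real.pi * √Real.pi := (Real.mul_self_sqrt Real.pi_pos.le).symm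
        nth_rewrite 2 [h2]
        field_simp

/-- The Mellin–Barnes representation of `gaussTail`. -/
theorem integral_gaussKernel_mul {c : ℝ} (hc : 0 < c) (l : ℝ) :
    ∫ y : ℝ, gaussKernel c y * Complex.exp (-l * ((c : ℂ) + y * Complex.I)) =
      ((2 * Real.pi * gaussTail l : ℝ) : ℂ) := by
  have e1 : ∀ y : ℝ, gaussKernel c y * Complex.exp (-l * ((c : ℂ) + y * Complex.I)) =
      ∫ τ in Set.Ioi l,
        Complex.exp (((c : ℂ) + y * Complex.I) ^ 2 - τ * ((c : ℂ) + y * Complex.I)) := by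
    intro y
    have h1 := integral_exp_mul_complex_Ioi (a := -((c : ℂ) + y * Complex.I)) (by simpa using hc) l
    have h2 : ∀ τ : ℝ, Complex.exp (((c : ℂ) + y * Complex.I) ^ 2 - τ * ((c : ℂ) + y * Complex.I)) =
        Complex.exp (((c : ℂ) + y * Complex.I) ^ 2) *
          Complex.exp (-((c : ℂ) + y * Complex.I) * τ) := by
      intro τ
      rw [← Complex.exp_add]
      congr 1
      ring
    simp_rw [h2]
    rw [MeasureTheory.integral_const_mul, h1, gaussKernel, neg_div_neg_eq,
      show -((c : ℂ) + y * Complex.I) * l = -l * ((c : ℂ) + y * Complex.I) by ring]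
    ring
  simp_rw [e1]
  rw [MeasureTheory.integral_integral_swap]
  · simp_rw [integral_cexp_sq_sub]
    rw [integral_complex_ofReal, MeasureTheory.integral_const_mul]
    rfl
  · have hi1 : MeasureTheory.Integrable fun y : ℝ => Real.exp (c ^ 2) * Real.exp (-y ^ 2) :=
      integrable_exp_neg_sq.const_mul _
    have hi2 : MeasureTheory.Integrable (fun τ : ℝ => Real.exp (-c * τ))
        (MeasureTheory.volume.restrict (Set.Ioi l)) := exp_neg_integrableOn_Ioi l hc
    refine (hi1.mul_prod hi2).mono' (Continuous.aestronglyMeasurable (by fun_prop))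
      (Eventually.of_forall fun z => le_of_eq ?_)
    simp only [Function.uncurry]
    rw [Complex.exp_sub, norm_div, norm_cexp_sq, Complex.norm_exp, div_eq_mul_inv, ← Real.exp_neg]
    congr 2
    simp
    ring

theorem integral_gaussKernel_of_pos {c : ℝ} (hc : 0 < c) : ∫ y : ℝ, gaussKernel c y = Real.pi := by
  have h := integral_gaussKernel_mul hc 0
  rw [gaussTail_zero] at h
  simp only [Complex.ofReal_zero, neg_zero, zero_mul, Complex.exp_zero, mul_one] at h
  rw [h]
  push_cast
  ring

/-- The kernel is odd, so the reflection `w ↦ -w` exchanges the lines `Re w = ±c` with a change of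
sign. The jump `2π` between them plays the part of the residue at `0`. -/
theorem integral_gaussKernel_of_neg {c : ℝ} (hc : c < 0) :
    ∫ y : ℝ, gaussKernel c y = -Real.pi := by
  have h := integral_gaussKernel_of_pos (neg_pos.mpr hc)
  rw [← MeasureTheory.integral_neg_eq_self] at h
  rw [← h, ← MeasureTheory.integral_neg]
  congr 1
  ext y
  rw [gaussKernel, gaussKernel,
    show ((-c : ℝ) : ℂ) + ((-y : ℝ) : ℂ) * Complex.I = -((c : ℂ) + y * Complex.I) by push_cast; ring,
    neg_sq, div_neg, neg_neg]

theorem norm_integral_sub_truncated_le {F : ℝ → ℂ} (hF : MeasureTheory.Integrable F) {B H : ℝ}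
    (hB : 0 ≤ B) (hH : 0 ≤ H) (h : ∀ y, H ≤ |y| → ‖F y‖ ≤ B * Real.exp (-y ^ 2)) :
    ‖(∫ y, F y) - ∫ y in (-H)..H, F y‖ ≤ 4 * B * Real.exp (-H ^ 2 / 2) := by
  have hi : MeasureTheory.Integrable fun y : ℝ => Real.exp (-(1 / 2) * y ^ 2) :=
    integrable_exp_neg_mul_sq (by norm_num)
  rw [intervalIntegral.integral_of_le (by linarith),
    ← MeasureTheory.integral_add_compl measurableSet_Ioc hF, add_sub_cancel_left]
  have h1 : ∀ y ∈ (Set.Ioc (-H) H)ᶜ, ‖F y‖ ≤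
      B * Real.exp (-H ^ 2 / 2) * Real.exp (-(1 / 2) * y ^ 2) := by
    intro y hy
    have hy2 : H ≤ |y| := by
      by_contra hlt
      rw [not_le, abs_lt] at hlt
      exact hy ⟨hlt.1, hlt.2.le⟩
    refine (h y hy2).trans ?_
    rw [mul_assoc, ← Real.exp_add]
    refine mul_le_mul_of_nonneg_left (Real.exp_le_exp.mpr ?_) hB
    have : H ^ 2 ≤ y ^ 2 := by rw [← sq_abs y]; gcongr
    linarith
  calc ‖∫ y in (Set.Ioc (-H) H)ᶜ, F y‖ ≤
      ∫ y in (Set.Ioc (-H) H)ᶜ, B * Real.exp (-H ^ 2 / 2) * Real.exp (-(1 / 2) * y ^ 2) := by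
        refine MeasureTheory.norm_integral_le_of_norm_le (hi.const_mul _).integrableOn ?_
        exact (MeasureTheory.ae_restrict_iff' measurableSet_Ioc.compl).mpr (Eventually.of_forall h1)
    _ ≤ ∫ y, B * Real.exp (-H ^ 2 / 2) * Real.exp (-(1 / 2) * y ^ 2) :=
        MeasureTheory.setIntegral_le_integral (hi.const_mul _)
          (Eventually.of_forall fun y => by positivity)
    _ = B * Real.exp (-H ^ 2 / 2) * √(Real.pi / (1 / 2)) := by
        rw [MeasureTheory.integral_const_mul, integral_gaussian]
    _ ≤ B * Real.exp (-H ^ 2 / 2) * 4 := by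
        gcongr
        rw [Real.sqrt_le_left (by norm_num)]
        linarith [Real.pi_lt_four]
    _ = _ := by ring

/-- A residue formula on a finite rectangle, with Gaussian errors from the horizontal sides and the
truncation. No pole is met: Cauchy's theorem is applied to `exp(w²) (g(w) - g(0)) / w`, and `2π
g(0)` is recovered from the exact integrals of the kernel alone. -/
theorem norm_contour_le {c₁ c₂ H G : ℝ} {g : ℂ → ℂ} (h₁ : c₁ < 0) (h₁' : -1 ≤ c₁) (h₂ : 0 < c₂)
    (h₂' : c₂ ≤ 1) (hH : 1 ≤ H)
    (hg : DifferentiableOn ℂ g (Set.Icc c₁ c₂ ×ℂ Set.Icc (-H) H))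
    (hG : ∀ w ∈ Set.Icc c₁ c₂ ×ℂ Set.Icc (-H) H, ‖g w‖ ≤ G) :
    ‖2 * Real.pi * g 0 -
      ((∫ y in (-H)..H, gaussKernel c₂ y * g (c₂ + y * Complex.I)) -
        ∫ y in (-H)..H, gaussKernel c₁ y * g (c₁ + y * Complex.I))‖ ≤
      60 * G * Real.exp (-H ^ 2 / 2) := by
  set R : Set ℂ := Set.Icc c₁ c₂ ×ℂ Set.Icc (-H) H with hR
  have h0R : (0 : ℂ) ∈ R := ⟨⟨h₁.le, h₂.le⟩, ⟨by simp; linarith, by simp; linarith⟩⟩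
  have hG0 : 0 ≤ G := (norm_nonneg _).trans (hG 0 h0R)
  have hnhds : R ∈ 𝓝 (0 : ℂ) := by
    have hpre : Complex.re ⁻¹' Set.Ioo c₁ c₂ ∩ Complex.im ⁻¹' Set.Ioo (-H) H ∈ 𝓝 (0 : ℂ) := by
      refine IsOpen.mem_nhds ?_ ⟨⟨h₁, h₂⟩, ⟨by simp; linarith, by simp; linarith⟩⟩
      exact (isOpen_Ioo.preimage Complex.continuous_re).inter
        (isOpen_Ioo.preimage Complex.continuous_im)
    filter_upwards [hpre] with w hw
    exact ⟨Set.Ioo_subset_Icc_self hw.1, Set.Ioo_subset_Icc_self hw.2⟩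
  set F : ℂ → ℂ := fun w => Complex.exp (w ^ 2) * dslope g 0 w with hF
  have hFd : DifferentiableOn ℂ F R :=
    (Differentiable.differentiableOn (by fun_prop)).mul
      ((Complex.differentiableOn_dslope hnhds).mpr hg)
  have hFeq : ∀ w, w ≠ 0 → F w = Complex.exp (w ^ 2) / w * (g w - g 0) := by
    intro w hw
    rw [hF]
    simp only
    rw [dslope_of_ne _ hw, slope_def_field, sub_zero]
    ring
  have hrect := Complex.integral_boundary_rect_eq_zero_of_differentiableOn F
    ((c₁ : ℂ) + (-H : ℝ) * Complex.I) ((c₂ : ℂ) + H * Complex.I) (by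
      simp only [Complex.add_re, Complex.ofReal_re, Complex.mul_re, Complex.I_re, mul_zero,
        Complex.ofReal_im, Complex.I_im, mul_one, sub_self, add_zero, Complex.add_im,
        Complex.mul_im, zero_add]
      rw [Set.uIcc_of_le (by linarith), Set.uIcc_of_le (by linarith)]
      exact hFd)
  simp only [Complex.add_re, Complex.ofReal_re, Complex.mul_re, Complex.I_re, mul_zero,
        Complex.ofReal_im, Complex.I_im, mul_one, sub_self, add_zero, Complex.add_im,
        Complex.mul_im, zero_add] at hrect
  have hexp : Real.exp (-H ^ 2) ≤ Real.exp (-H ^ 2 / 2) :=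
    Real.exp_le_exp.mpr (by nlinarith [sq_nonneg H])
  have hhor : ∀ η : ℝ, |η| = H → ‖∫ x in c₁..c₂, F (x + η * Complex.I)‖ ≤
      12 * G * Real.exp (-H ^ 2 / 2) := by
    intro η hη
    have hb : ∀ x ∈ Set.uIoc c₁ c₂, ‖F (x + η * Complex.I)‖ ≤
        3 * Real.exp (-H ^ 2 / 2) * (G + G) := by
      intro x hx
      rw [Set.uIoc_of_le (by linarith)] at hx
      have hne : (x : ℂ) + η * Complex.I ≠ 0 := fun h => by
        have := congrArg Complex.im h
        simp at this
        rw [this, abs_zero] at hη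
        linarith
      rw [hFeq _ hne, norm_mul]
      have hx1 : |x| ≤ 1 := abs_le.mpr ⟨by linarith [hx.1], by linarith [hx.2]⟩
      have hk : ‖gaussKernel x η‖ ≤ 3 * Real.exp (-η ^ 2) := norm_gaussKernel_le hx1 (hη ▸ hH)
      have hη2 : η ^ 2 = H ^ 2 := by rw [← sq_abs, hη]
      rw [hη2] at hk
      have hmem : (x : ℂ) + η * Complex.I ∈ R := by
        refine ⟨⟨?_, ?_⟩, ⟨?_, ?_⟩⟩
        · simpa using hx.1.le
        · simpa using hx.2
        · simpa using (abs_le.mp hη.le).1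
        · simpa using (abs_le.mp hη.le).2
      refine mul_le_mul (hk.trans (by gcongr)) ?_ (norm_nonneg _) (by positivity)
      exact (norm_sub_le _ _).trans (add_le_add (hG _ hmem) (hG 0 h0R))
    refine (intervalIntegral.norm_integral_le_of_norm_le_const hb).trans ?_
    rw [abs_of_pos (by linarith)]
    calc _ ≤ 3 * Real.exp (-H ^ 2 / 2) * (G + G) * 2 := by gcongr; linarith
      _ = _ := by ring
  have hvert : ∀ c : ℝ, c ≠ 0 → |c| ≤ 1 → c ∈ Set.Icc c₁ c₂ →
      ∫ y in (-H)..H, F (c + y * Complex.I) =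
        (∫ y in (-H)..H, gaussKernel c y * g (c + y * Complex.I)) -
          (∫ y in (-H)..H, gaussKernel c y) * g 0 := by
    intro c hc hc1 hcm
    rw [← intervalIntegral.integral_mul_const, ← intervalIntegral.integral_sub]
    · refine intervalIntegral.integral_congr fun y _ => ?_
      rw [hFeq _ (line_ne_zero hc y), gaussKernel]
      ring
    · refine ContinuousOn.intervalIntegrable ?_
      refine (continuous_gaussKernel hc).continuousOn.mul ?_
      refine hg.continuousOn.comp (by fun_prop) fun y hy => ?_
      rw [Set.uIcc_of_le (by linarith)] at hy
      exact ⟨by simpa using hcm, by simpa using hy⟩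
    · exact ((continuous_gaussKernel hc).mul continuous_const).intervalIntegrable _ _
  have hc2a : |c₂| ≤ 1 := by rw [abs_of_pos h₂]; exact h₂'
  have hc1a : |c₁| ≤ 1 := by rw [abs_of_neg h₁]; linarith
  rw [hvert c₂ h₂.ne' hc2a ⟨by linarith, le_rfl⟩, hvert c₁ h₁.ne hc1a ⟨le_rfl, by linarith⟩] at hrect
  have t2 := norm_integral_sub_truncated_le (integrable_gaussKernel h₂.ne' hc2a) (B := 3)
    (by norm_num) (by linarith : 0 ≤ H) fun y hy => norm_gaussKernel_le hc2a (hH.trans hy)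
  have t1 := norm_integral_sub_truncated_le (integrable_gaussKernel h₁.ne hc1a) (B := 3)
    (by norm_num) (by linarith : 0 ≤ H) fun y hy => norm_gaussKernel_le hc1a (hH.trans hy)
  rw [integral_gaussKernel_of_pos h₂] at t2
  rw [integral_gaussKernel_of_neg h₁] at t1
  set A₁ := ∫ y in (-H)..H, gaussKernel c₁ y * g (c₁ + y * Complex.I)
  set A₂ := ∫ y in (-H)..H, gaussKernel c₂ y * g (c₂ + y * Complex.I)
  set K₁ := ∫ y in (-H)..H, gaussKernel c₁ y
  set K₂ := ∫ y in (-H)..H, gaussKernel c₂ y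
  have n1 := hhor (-H) (by rw [abs_neg, abs_of_nonneg (by linarith)])
  have n2 := hhor H (abs_of_nonneg (by linarith))
  set B₁ := ∫ x in c₁..c₂, F (x + (-H : ℝ) * Complex.I)
  set B₂ := ∫ x in c₁..c₂, F (x + H * Complex.I)
  have hid : 2 * Real.pi * g 0 - (A₂ - A₁) =
      ((Real.pi - K₂) - (-Real.pi - K₁)) * g 0 - Complex.I * (B₁ - B₂) := by
    simp only [smul_eq_mul] at hrect
    have hI := Complex.I_mul_I
    linear_combination Complex.I * hrect - ((A₂ - A₁) - (K₂ - K₁) * g 0) * hI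
  rw [hid]
  refine (norm_sub_le _ _).trans ?_
  rw [norm_mul, norm_mul, Complex.norm_I, one_mul]
  have hb := norm_sub_le B₁ B₂
  have hk := norm_sub_le ((Real.pi : ℂ) - K₂) (-Real.pi - K₁)
  have hg0 := hG 0 h0R
  have hE := Real.exp_pos (-H ^ 2 / 2)
  calc _ ≤ (4 * 3 * Real.exp (-H ^ 2 / 2) + 4 * 3 * Real.exp (-H ^ 2 / 2)) * G +
        (12 * G * Real.exp (-H ^ 2 / 2) + 12 * G * Real.exp (-H ^ 2 / 2)) := by
        gcongr
        · linarith
        · linarith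
    _ ≤ _ := by nlinarith [mul_nonneg hG0 hE.le]

/-! ### Approximation of `ζ(s)^k` by the smoothed Dirichlet polynomial. -/

/-- The Dirichlet series coefficient `d_k(n) n ^ (-(σ + it))`. -/
def dirCoeff (k : ℕ) (σ t : ℝ) (n : ℕ) : ℂ :=
  dk k n * Complex.exp (-(Real.log n : ℂ) * ((σ : ℂ) + t * Complex.I))

theorem norm_dirCoeff (k : ℕ) (σ t : ℝ) {n : ℕ} (hn : n ≠ 0) :
    ‖dirCoeff k σ t n‖ = dk k n * (n : ℝ) ^ (-σ) := by
  have hn0 : (0 : ℝ) < n := by exact_mod_cast Nat.pos_of_ne_zero hn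
  rw [dirCoeff, norm_mul, Complex.norm_natCast, Complex.norm_exp, Real.rpow_def_of_pos hn0]
  congr 2
  rw [← Complex.ofReal_neg, Complex.re_ofReal_mul]
  simp

theorem dirCoeff_zero (k : ℕ) (σ t : ℝ) : dirCoeff k σ t 0 = 0 := by
  simp [dirCoeff, dk_zero_right]

theorem dirPoly_eq_sum (k : ℕ) (σ Y : ℝ) (N : ℕ) (t : ℝ) :
    dirPoly k σ Y N t =
      ∑ n ∈ Finset.Icc 1 N, dirCoeff k σ t n * (gaussTail (Real.log n - Real.log Y) : ℂ) := by
  refine Finset.sum_congr rfl fun n hn => ?_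
  rw [Finset.mem_Icc] at hn
  have hn0 : (0 : ℝ) < n := by exact_mod_cast hn.1
  rw [dirCoeff, cut, Real.rpow_def_of_pos hn0]
  push_cast
  rw [mul_add, Complex.exp_add, show Complex.exp (-(Complex.log n) * (t * Complex.I)) =
    Complex.exp (-(t * (Complex.log n)) * Complex.I) by congr 1; ring,
    show Complex.exp (-(Complex.log n) * (σ : ℂ)) = Complex.exp (Complex.log n * -(σ : ℂ)) by
      congr 1; ring]
  ring

theorem hasSum_dirCoeff_mul (k : ℕ) {σ t : ℝ} {w : ℂ} (h : 1 < σ + w.re) :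
    HasSum (fun n => dirCoeff k σ t n * Complex.exp (-(Real.log n : ℂ) * w))
      (riemannZeta (σ + t * Complex.I + w) ^ k) := by
  have hs : 1 < ((σ : ℂ) + t * Complex.I + w).re := by simpa using h
  refine (LSeriesHasSum_dk k hs).congr_fun ?_
  intro n
  rcases eq_or_ne n 0 with rfl | hn
  · simp [dirCoeff_zero]
  · rw [LSeries.term_of_ne_zero hn, Complex.cpow_def_of_ne_zero (by exact_mod_cast hn), dirCoeff,
      mul_assoc, ← Complex.exp_add, div_eq_mul_inv, ← Complex.exp_neg, Complex.natCast_log]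
    congr 2
    ring

theorem exists_dk_mul_rpow_le (k : ℕ) :
    ∃ C : ℝ, 1 ≤ C ∧ Summable (fun n : ℕ => (dk k n : ℝ) * (n : ℝ) ^ (-(3 / 2) : ℝ)) ∧
      ∑' n : ℕ, (dk k n : ℝ) * (n : ℝ) ^ (-(3 / 2) : ℝ) ≤ C := by
  obtain ⟨C, hC, h⟩ := dk_le_rpow k (ε := 1 / 4) (by norm_num)
  have hs : Summable fun n : ℕ => C * (n : ℝ) ^ (-(5 / 4) : ℝ) :=
    (Real.summable_nat_rpow.mpr (by norm_num)).mul_left C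
  have hle : ∀ n : ℕ, (dk k n : ℝ) * (n : ℝ) ^ (-(3 / 2) : ℝ) ≤ C * (n : ℝ) ^ (-(5 / 4) : ℝ) := by
    intro n
    rcases eq_or_ne n 0 with rfl | hn
    · simp [dk_zero_right]
    · have hn0 : (0 : ℝ) < n := by exact_mod_cast Nat.pos_of_ne_zero hn
      calc _ ≤ C * (n : ℝ) ^ (1 / 4 : ℝ) * (n : ℝ) ^ (-(3 / 2) : ℝ) := by
            gcongr; exact h n hn
        _ = _ := by rw [mul_assoc, ← Real.rpow_add hn0]; norm_num
  have hsum := Summable.of_nonneg_of_le (fun n => by positivity) hle hs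
  exact ⟨max 1 _, le_max_left _ _, hsum, le_max_right _ _⟩

theorem norm_dirCoeff_mul_exp_le (k : ℕ) {σ t : ℝ} (hσ : 1 / 2 ≤ σ) (y : ℝ) (n : ℕ) :
    ‖dirCoeff k σ t n * Complex.exp (-(Real.log n : ℂ) * (((1 : ℝ) : ℂ) + y * Complex.I))‖ ≤
      (dk k n : ℝ) * (n : ℝ) ^ (-(3 / 2) : ℝ) := by
  rcases eq_or_ne n 0 with rfl | hn
  · simp [dirCoeff_zero, dk_zero_right]
  · have hn1 : (1 : ℝ) ≤ n := by exact_mod_cast Nat.one_le_iff_ne_zero.mpr hn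
    have hn0 : (0 : ℝ) < n := by linarith
    rw [norm_mul, norm_dirCoeff k σ t hn, Complex.norm_exp, mul_assoc]
    refine mul_le_mul_of_nonneg_left ?_ (Nat.cast_nonneg _)
    have : (-(Real.log n : ℂ) * (((1 : ℝ) : ℂ) + y * Complex.I)).re = Real.log n * (-1) := by
      rw [← Complex.ofReal_neg, Complex.re_ofReal_mul]; simp
    rw [this, ← Real.rpow_def_of_pos hn0, ← Real.rpow_add hn0]
    exact Real.rpow_le_rpow_of_exponent_le hn1 (by linarith)

theorem exists_norm_zeta_pow_right_le (k : ℕ) :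
    ∃ C : ℝ, 1 ≤ C ∧ ∀ σ t y : ℝ, 1 / 2 < σ →
      ‖riemannZeta (σ + t * Complex.I + (((1 : ℝ) : ℂ) + y * Complex.I)) ^ k‖ ≤ C := by
  obtain ⟨C, hC, hs, hle⟩ := exists_dk_mul_rpow_le k
  refine ⟨C, hC, fun σ t y hσ => ?_⟩
  have h := hasSum_dirCoeff_mul k (σ := σ) (t := t) (w := ((1 : ℝ) : ℂ) + y * Complex.I)
    (by simp; linarith)
  rw [← h.tsum_eq]
  exact (tsum_of_norm_bounded hs.hasSum fun n => norm_dirCoeff_mul_exp_le k hσ.le y n).trans hle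

/-- On `Re w = 1` the Dirichlet series converges absolutely, uniformly in `w`, so it may be
integrated termwise against the kernel; each term yields the Gaussian cutoff at `n / Y`. -/
theorem hasSum_integral_gaussKernel_mul_zeta (k : ℕ) {σ t Y : ℝ} (hσ : 1 / 2 < σ) (hY : 0 < Y) :
    HasSum (fun n => dirCoeff k σ t n *
        ((2 * Real.pi * gaussTail (Real.log n - Real.log Y) : ℝ) : ℂ))
      (∫ y : ℝ, gaussKernel 1 y *
        (riemannZeta (σ + t * Complex.I + (((1 : ℝ) : ℂ) + y * Complex.I)) ^ k *
          Complex.exp (Real.log Y * (((1 : ℝ) : ℂ) + y * Complex.I)))) := by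
  obtain ⟨C, hC, hs, hle⟩ := exists_dk_mul_rpow_le k
  have hcont : Continuous (gaussKernel 1) := continuous_gaussKernel one_ne_zero
  have hexpY : ∀ y : ℝ, ‖Complex.exp (Real.log Y * (((1 : ℝ) : ℂ) + y * Complex.I))‖ = Y := by
    intro y
    rw [Complex.norm_exp, Complex.re_ofReal_mul]
    simp [Real.exp_log hY]
  set F : ℕ → ℝ → ℂ := fun n y => gaussKernel 1 y *
    ((dirCoeff k σ t n * Complex.exp (-(Real.log n : ℂ) * (((1 : ℝ) : ℂ) + y * Complex.I))) *
      Complex.exp (Real.log Y * (((1 : ℝ) : ℂ) + y * Complex.I))) with hF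
  have hbd : ∀ n y, ‖F n y‖ ≤
      (3 * Real.exp (-y ^ 2)) * ((dk k n : ℝ) * (n : ℝ) ^ (-(3 / 2) : ℝ) * Y) := by
    intro n y
    rw [hF]
    simp only
    rw [norm_mul, norm_mul, hexpY]
    have := norm_gaussKernel_le_div one_ne_zero (by simp) y
    rw [abs_one, div_one] at this
    have h2 := norm_dirCoeff_mul_exp_le k hσ.le y n (t := t)
    gcongr
  have hint : ∀ n, MeasureTheory.Integrable (F n) := fun n =>
    ((integrable_exp_neg_sq.const_mul 3).mul_const _).mono'
      (Continuous.aestronglyMeasurable (by rw [hF]; fun_prop)) (Eventually.of_forall (hbd n))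
  have hsum : Summable fun n => ∫ y, ‖F n y‖ := by
    refine Summable.of_nonneg_of_le (fun n => MeasureTheory.integral_nonneg fun y => norm_nonneg _)
      (fun n => MeasureTheory.integral_mono (hint n).norm
        ((integrable_exp_neg_sq.const_mul 3).mul_const _) (hbd n)) ?_
    simp_rw [MeasureTheory.integral_mul_const]
    exact ((hs.mul_right Y).mul_left _)
  have h := MeasureTheory.hasSum_integral_of_summable_integral_norm hint hsum
  have e1 : ∀ n, ∫ y, F n y = dirCoeff k σ t n *
      ((2 * Real.pi * gaussTail (Real.log n - Real.log Y) : ℝ) : ℂ) := by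
    intro n
    rw [← integral_gaussKernel_mul one_pos, ← MeasureTheory.integral_const_mul]
    congr 1
    ext y
    rw [hF]
    simp only
    have : Complex.exp (-((Real.log n - Real.log Y : ℝ) : ℂ) * (((1 : ℝ) : ℂ) + y * Complex.I)) =
        Complex.exp (-(Real.log n : ℂ) * (((1 : ℝ) : ℂ) + y * Complex.I)) *
          Complex.exp (Real.log Y * (((1 : ℝ) : ℂ) + y * Complex.I)) := by
      rw [← Complex.exp_add]
      congr 1
      push_cast
      ring
    rw [this]
    ring
  have e2 : ∀ y : ℝ, ∑' n, F n y = gaussKernel 1 y *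
      (riemannZeta (σ + t * Complex.I + (((1 : ℝ) : ℂ) + y * Complex.I)) ^ k *
        Complex.exp (Real.log Y * (((1 : ℝ) : ℂ) + y * Complex.I))) := by
    intro y
    exact (((hasSum_dirCoeff_mul k (σ := σ) (t := t) (w := ((1 : ℝ) : ℂ) + y * Complex.I)
      (by simp; linarith)).mul_right _).mul_left _).tsum_eq
  simp_rw [e1, e2] at h
  exact h

/-- For `n > N ≥ Y Z` the tail bound with parameter `A + 3` gives `(Y/n)^(A + 3) ≤ Z^(-A) Y³ n^(-3)`
up to a constant: `A` powers become the saving in `Z`, and the other three contribute the factor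
`Y³`. -/
theorem exists_norm_sub_dirPoly_le (k : ℕ) {A : ℝ} (hA : 0 ≤ A) :
    ∃ C : ℝ, 0 ≤ C ∧ ∀ (σ t Y Z : ℝ) (N : ℕ), 1 / 2 < σ → 1 ≤ Y → 1 ≤ Z → Y * Z ≤ N →
      ‖(∫ y : ℝ, gaussKernel 1 y *
        (riemannZeta (σ + t * Complex.I + (((1 : ℝ) : ℂ) + y * Complex.I)) ^ k *
          Complex.exp (Real.log Y * (((1 : ℝ) : ℂ) + y * Complex.I)))) -
        2 * Real.pi * dirPoly k σ Y N t‖ ≤ C * (Y ^ 3 * Z ^ (-A)) := by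
  obtain ⟨C, hC, hs, hle⟩ := exists_dk_mul_rpow_le k
  refine ⟨C * (2 * Real.pi * Real.exp ((A + 3) ^ 2)), by positivity,
    fun σ t Y Z N hσ hY hZ hN => ?_⟩
  have hY0 : 0 < Y := by linarith
  have hZ0 : 0 < Z := by linarith
  have h := hasSum_integral_gaussKernel_mul_zeta k (t := t) hσ hY0
  set f : ℕ → ℂ := fun n => dirCoeff k σ t n *
        ((2 * Real.pi * gaussTail (Real.log n - Real.log Y) : ℝ) : ℂ) with hf
  have e1 : 2 * Real.pi * dirPoly k σ Y N t = ∑ n ∈ Finset.Icc 1 N, f n := by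
    rw [dirPoly_eq_sum, Finset.mul_sum]
    refine Finset.sum_congr rfl fun n _ => ?_
    rw [hf]
    push_cast
    ring
  rw [e1, ← h.tsum_eq, ← h.summable.sum_add_tsum_compl (s := Finset.Icc 1 N), add_sub_cancel_left]
  set D : ℝ := 2 * Real.pi * Real.exp ((A + 3) ^ 2) * (Y ^ 3 * Z ^ (-A)) with hD
  have hD0 : 0 ≤ D := by positivity
  set g : ℕ → ℝ := fun n => (dk k n : ℝ) * (n : ℝ) ^ (-(3 / 2) : ℝ) * D with hg
  have hgs : Summable g := hs.mul_right D
  have hfg : ∀ n : ℕ, n ∉ Finset.Icc 1 N → ‖f n‖ ≤ g n := by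
    intro n hn
    rcases eq_or_ne n 0 with rfl | hn0
    · simp [hf, hg, dirCoeff_zero, dk_zero_right]
    · have hnN : N < n := by
        rw [Finset.mem_Icc] at hn
        omega
      have hn1 : (1 : ℝ) ≤ n := by exact_mod_cast Nat.one_le_iff_ne_zero.mpr hn0
      have hnpos : (0 : ℝ) < n := by linarith
      have hYZ : Y * Z ≤ n := hN.trans (by exact_mod_cast hnN.le)
      have hgt := gaussTail_nonneg (Real.log n - Real.log Y)
      have hl : Real.log Y + Real.log Z ≤ Real.log n := by
        rw [← Real.log_mul hY0.ne' hZ0.ne']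
        exact Real.log_le_log (by positivity) hYZ
      have hgt2 : gaussTail (Real.log n - Real.log Y) ≤
          Real.exp ((A + 3) ^ 2) * (Y ^ 3 * Z ^ (-A)) * (n : ℝ) ^ (-3 : ℝ) := by
        refine (gaussTail_le_exp (by linarith : 0 ≤ A + 3) _).trans ?_
        rw [← Real.rpow_natCast Y 3, Real.rpow_def_of_pos hY0, Real.rpow_def_of_pos hZ0,
          Real.rpow_def_of_pos hnpos, ← Real.exp_add, ← Real.exp_add, ← Real.exp_add]
        refine Real.exp_le_exp.mpr ?_
        push_cast
        nlinarith
      rw [hf, hg]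
      simp only
      rw [norm_mul, norm_dirCoeff k σ t hn0, Complex.norm_real, Real.norm_eq_abs,
        abs_of_nonneg (by positivity)]
      have h1 : (n : ℝ) ^ (-σ) * (n : ℝ) ^ (-3 : ℝ) ≤ (n : ℝ) ^ (-(3 / 2) : ℝ) := by
        rw [← Real.rpow_add hnpos]
        exact Real.rpow_le_rpow_of_exponent_le hn1 (by linarith)
      calc _ ≤ (dk k n : ℝ) * (n : ℝ) ^ (-σ) * (2 * Real.pi *
            (Real.exp ((A + 3) ^ 2) * (Y ^ 3 * Z ^ (-A)) * (n : ℝ) ^ (-3 : ℝ))) := by gcongr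
        _ = (dk k n : ℝ) * ((n : ℝ) ^ (-σ) * (n : ℝ) ^ (-3 : ℝ)) * D := by rw [hD]; ring
        _ ≤ _ := by gcongr
  have hsub := (hgs.subtype ((Finset.Icc 1 N : Set ℕ)ᶜ)).hasSum
  refine (tsum_of_norm_bounded hsub fun x => hfg x (fun h => x.2 h)).trans ?_
  refine (hgs.tsum_subtype_le g _ (fun n => by positivity)).trans ?_
  rw [hg, tsum_mul_right]
  calc _ ≤ C * D := by gcongr
    _ = _ := by rw [hD]; ring

/-- `|ζ(σ + it)|`. -/
def zetaNorm (σ t : ℝ) : ℝ := ‖riemannZeta ((σ : ℂ) + t * Complex.I)‖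

theorem zetaNorm_nonneg (σ t : ℝ) : 0 ≤ zetaNorm σ t := norm_nonneg _

theorem continuous_zetaNorm {σ : ℝ} (hσ : σ ≠ 1) : Continuous (zetaNorm σ) := by
  refine continuous_iff_continuousAt.mpr fun t => ?_
  have h : (σ : ℂ) + t * Complex.I ≠ 1 := fun h => hσ (by simpa using congrArg Complex.re h)
  have hc : ContinuousAt (fun t : ℝ => (σ : ℂ) + t * Complex.I) t := by fun_prop
  exact ((differentiableAt_riemannZeta h).continuousAt.comp
    (f := fun t : ℝ => (σ : ℂ) + t * Complex.I) hc).norm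

/-- Cauchy–Schwarz for the measure `exp(-y²) dy`, read off from the non-negative integral of `(W ψ -
S)²`. The total mass is at most `√π ≤ 2`. -/
theorem sq_integral_exp_mul_le {ψ : ℝ → ℝ} (hψ : Continuous ψ) {H : ℝ} (hH : 0 < H) :
    (∫ y in (-H)..H, Real.exp (-y ^ 2) * ψ y) ^ 2 ≤
      2 * ∫ y in (-H)..H, Real.exp (-y ^ 2) * ψ y ^ 2 := by
  have hii : ∀ f : ℝ → ℝ, Continuous f → IntervalIntegrable f MeasureTheory.volume (-H) H :=
    fun f hf => hf.intervalIntegrable _ _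
  set S := ∫ y in (-H)..H, Real.exp (-y ^ 2) * ψ y with hS
  set S₂ := ∫ y in (-H)..H, Real.exp (-y ^ 2) * ψ y ^ 2 with hS₂
  set W := ∫ y in (-H)..H, Real.exp (-y ^ 2) with hW
  have hWpos : 0 < W := intervalIntegral.intervalIntegral_pos_of_pos
    (hii _ (by fun_prop)) (fun y => Real.exp_pos _) (by linarith)
  have hW2 : W ≤ 2 := by
    rw [hW, intervalIntegral.integral_of_le (by linarith)]
    refine (MeasureTheory.setIntegral_le_integral integrable_exp_neg_sq
      (Eventually.of_forall fun y => (Real.exp_pos _).le)).trans ?_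
    have := integral_gaussian 1
    simp only [neg_mul, one_mul, div_one] at this
    rw [this]
    exact sqrt_pi_le_two
  have h0 : 0 ≤ ∫ y in (-H)..H, Real.exp (-y ^ 2) * (W * ψ y - S) ^ 2 :=
    intervalIntegral.integral_nonneg (by linarith) fun y _ => by positivity
  have e : ∀ a b : ℝ, ∫ y in (-H)..H, Real.exp (-y ^ 2) * (a * ψ y - b) ^ 2 =
      a ^ 2 * S₂ - 2 * a * b * S + b ^ 2 * W := by
    intro a b
    rw [hS₂, hS, hW, ← intervalIntegral.integral_const_mul, ← intervalIntegral.integral_const_mul,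
      ← intervalIntegral.integral_const_mul, ← intervalIntegral.integral_sub
        (hii _ (by fun_prop)) (hii _ (by fun_prop)), ← intervalIntegral.integral_add
        (hii _ (by fun_prop)) (hii _ (by fun_prop))]
    refine intervalIntegral.integral_congr fun y _ => ?_
    ring
  rw [e] at h0
  have h1 : 0 ≤ W * (W * S₂ - S ^ 2) := by linarith
  have h2 : S ^ 2 ≤ W * S₂ := by
    have := (mul_nonneg_iff_of_pos_left hWpos).mp h1
    linarith
  have h3 : 0 ≤ S₂ := intervalIntegral.integral_nonneg (by linarith) fun y _ => by positivity
  nlinarith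

-- The contour moves from `Re w = 1` to `Re w = -2δ`, that is, to the line `1/2 - δ`. Reflection
-- returns it to `1/2 + δ`, the line of departure, so the error is expressed by the same function
-- whose moment is sought.
set_option maxHeartbeats 1000000 in
theorem exists_norm_zeta_pow_sub_dirPoly_sq_le (k : ℕ) {δ : ℝ} (hδ : 0 < δ) (hδ' : δ ≤ 1 / 4)
    {A : ℝ} (hA : 0 ≤ A) :
    ∃ C : ℝ, 0 ≤ C ∧ ∀ (Y Z : ℝ) (N : ℕ), 1 ≤ Y → 1 ≤ Z → Y * Z ≤ N → ∀ t : ℝ, 2 ≤ |t| →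
      ‖riemannZeta (((1 / 2 + δ : ℝ) : ℂ) + t * Complex.I) ^ k -
        dirPoly k (1 / 2 + δ) Y N t‖ ^ 2 ≤
      C * (Y ^ (-(4 * δ)) * (1 + |t|) ^ (2 * k * δ) *
        (∫ y in (-(|t| / 2))..(|t| / 2),
          Real.exp (-y ^ 2) * zetaNorm (1 / 2 + δ) (t + y) ^ (2 * k)) +
        Y ^ 6 * Z ^ (-(2 * A)) + Y ^ 2 * (1 + |t|) ^ (2 * k) * Real.exp (-t ^ 2 / 4)) := by
  obtain ⟨C₀, hC₀, h₀⟩ := exists_norm_riemannZeta_left_le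
  obtain ⟨C₁, hC₁, h₁⟩ := exists_norm_riemannZeta_le
  obtain ⟨C₂, hC₂, h₂⟩ := exists_norm_zeta_pow_right_le k
  obtain ⟨C₃, hC₃, h₃⟩ := exists_norm_sub_dirPoly_le k hA
  set K₁ : ℝ := 60 * (4 * C₁) ^ k + 12 * C₂ with hK₁
  set K₂ : ℝ := 3 / (2 * δ) * (C₀ * 2) ^ k with hK₂
  refine ⟨3 * (K₁ ^ 2 + K₂ ^ 2 * 2 + C₃ ^ 2), by positivity, fun Y Z N hY hZ hN t ht => ?_⟩
  set σ : ℝ := 1 / 2 + δ with hσ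
  -- At this height `|Im (s + w)| ≥ |t| / 2 ≥ 1` on the rectangle, which keeps the pole of `ζ`
  -- outside.
  set H := |t| / 2 with hH
  have hH1 : 1 ≤ H := by linarith
  have hY0 : 0 < Y := by linarith
  set s : ℂ := (σ : ℂ) + t * Complex.I with hs
  set g : ℂ → ℂ := fun w => riemannZeta (s + w) ^ k * Complex.exp (Real.log Y * w) with hg
  have hrectIm : ∀ w : ℂ, w ∈ Set.Icc (-(2 * δ)) 1 ×ℂ Set.Icc (-H) H → 1 ≤ ‖s + w - 1‖ := by
    intro w hw
    have h1 : |(s + w - 1).im| ≤ ‖s + w - 1‖ := Complex.abs_im_le_norm _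
    have h2 : (s + w - 1).im = t + w.im := by simp [hs]
    have h3 : |w.im| ≤ H := abs_le.mpr hw.2
    have h4 : |t| ≤ |t + w.im| + |w.im| := by
      have := abs_sub (t + w.im) w.im
      rwa [add_sub_cancel_right] at this
    rw [h2] at h1
    linarith
  have hne : ∀ w : ℂ, w ∈ Set.Icc (-(2 * δ)) 1 ×ℂ Set.Icc (-H) H → s + w ≠ 1 := by
    intro w hw h
    have := hrectIm w hw
    rw [h, sub_self, norm_zero] at this
    linarith
  have hgd : DifferentiableOn ℂ g (Set.Icc (-(2 * δ)) 1 ×ℂ Set.Icc (-H) H) := by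
    intro w hw
    refine DifferentiableAt.differentiableWithinAt ?_
    refine DifferentiableAt.mul (DifferentiableAt.pow ?_ k) (by fun_prop)
    exact (differentiableAt_riemannZeta (hne w hw)).comp w (by fun_prop)
  have hexpn : ∀ w : ℂ, ‖Complex.exp (Real.log Y * w)‖ = Y ^ w.re := by
    intro w
    rw [Complex.norm_exp, Complex.re_ofReal_mul, Real.rpow_def_of_pos hY0]
  have hgG : ∀ w ∈ Set.Icc (-(2 * δ)) 1 ×ℂ Set.Icc (-H) H,
      ‖g w‖ ≤ (4 * C₁) ^ k * (Y * (1 + |t|) ^ k) := by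
    intro w hw
    have hw1 : -(2 * δ) ≤ w.re := hw.1.1
    have hw2 : w.re ≤ 1 := hw.1.2
    have hre : (s + w).re = σ + w.re := by simp [hs]
    have him : (s + w).im = t + w.im := by simp [hs]
    have hz := h₁ (s + w) (by rw [hre]; linarith) 1 one_pos le_rfl (hrectIm w hw)
    have hn : ‖s + w‖ ≤ 3 + 2 * |t| := by
      refine (Complex.norm_le_abs_re_add_abs_im _).trans ?_
      rw [hre, him, abs_of_nonneg (by linarith)]
      have h3 : |w.im| ≤ H := abs_le.mpr hw.2
      have := abs_add_le t w.im
      linarith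
    rw [hg]
    simp only
    rw [norm_mul, norm_pow, hexpn]
    calc _ ≤ (4 * C₁ * (1 + |t|)) ^ k * Y ^ (1 : ℝ) := by
          gcongr
          · rw [div_one] at hz
            refine hz.trans ?_
            nlinarith [abs_nonneg t]
      _ = _ := by rw [Real.rpow_one, mul_pow]; ring
  have hcon := norm_contour_le (by linarith : -(2 * δ) < 0) (by linarith) one_pos le_rfl hH1 hgd hgG
  have hg0 : g 0 = riemannZeta s ^ k := by simp [hg]
  rw [hg0] at hcon
  have hright : ∀ y : ℝ, ‖g (((1 : ℝ) : ℂ) + y * Complex.I)‖ ≤ C₂ * Y := by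
    intro y
    rw [hg]
    simp only
    rw [norm_mul, hexpn]
    have := h₂ σ t y (by linarith)
    have e : (((1 : ℝ) : ℂ) + y * Complex.I).re = 1 := by simp
    rw [e, Real.rpow_one]
    gcongr
  have hgcont : Continuous fun y : ℝ => g (((1 : ℝ) : ℂ) + y * Complex.I) := by
    rw [hg]
    refine Continuous.mul (Continuous.pow ?_ k) (by fun_prop)
    refine continuous_iff_continuousAt.mpr fun y => ?_
    have hne1 : s + (((1 : ℝ) : ℂ) + y * Complex.I) ≠ 1 := fun h => by
      have := congrArg Complex.re h
      simp [hs] at this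
      linarith
    have hc : ContinuousAt (fun y : ℝ => s + (((1 : ℝ) : ℂ) + y * Complex.I)) y := by fun_prop
    exact (differentiableAt_riemannZeta hne1).continuousAt.comp
      (f := fun y : ℝ => s + (((1 : ℝ) : ℂ) + y * Complex.I)) hc
  have hintR : MeasureTheory.Integrable fun y : ℝ =>
      gaussKernel 1 y * g (((1 : ℝ) : ℂ) + y * Complex.I) :=
    (integrable_gaussKernel one_ne_zero (by simp)).mul_bdd (c := C₂ * Y)
      hgcont.aestronglyMeasurable (Eventually.of_forall hright)
  have htr := norm_integral_sub_truncated_le hintR (B := 3 * (C₂ * Y)) (by positivity)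
    (by linarith : 0 ≤ H) fun y hy => by
      rw [norm_mul]
      calc _ ≤ 3 * Real.exp (-y ^ 2) * (C₂ * Y) := by
            gcongr
            · exact norm_gaussKernel_le (by simp) (hH1.trans hy)
            · exact hright y
        _ = _ := by ring
  have hdir := h₃ σ t Y Z N (by linarith) hY hZ hN
  set S := ∫ y in (-H)..H, Real.exp (-y ^ 2) * zetaNorm σ (t + y) ^ k with hS
  have hψc : Continuous fun y => zetaNorm σ (t + y) ^ k :=
    ((continuous_zetaNorm (show σ ≠ 1 by rw [hσ]; intro h; linarith)).comp
      (continuous_const.add continuous_id)).pow k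
  -- The shifted line carries the gain `Y^(-2δ)` and the loss `(1 + |t|)^(kδ)` from `k` uses of the
  -- functional equation.
  have hleft : ‖∫ y in (-H)..H, gaussKernel (-(2 * δ)) y * g ((-(2 * δ) : ℝ) + y * Complex.I)‖ ≤
      K₂ * (Y ^ (-(2 * δ)) * (1 + |t|) ^ (k * δ) * S) := by
    rw [hS, ← intervalIntegral.integral_const_mul, ← intervalIntegral.integral_const_mul]
    refine intervalIntegral.norm_integral_le_of_norm_le (by linarith)
      (Eventually.of_forall fun y hy => ?_) (Continuous.intervalIntegrable (by fun_prop) _ _)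
    have hy1 : |y| ≤ H := abs_le.mpr ⟨hy.1.le, hy.2⟩
    have hk := norm_gaussKernel_le_div (c := -(2 * δ)) (by linarith) (by
      rw [abs_neg, abs_of_pos (by linarith)]; linarith) y
    rw [abs_neg, abs_of_pos (by linarith : 0 < 2 * δ)] at hk
    have e1 : s + (((-(2 * δ) : ℝ) : ℂ) + y * Complex.I) =
        ((1 / 2 - δ : ℝ) : ℂ) + ((t + y : ℝ) : ℂ) * Complex.I := by
      rw [hs, hσ]; push_cast; ring
    have hz := h₀ δ hδ (by linarith) (t + y)
    have hty : (1 + |t + y|) ^ δ ≤ 2 * (1 + |t|) ^ δ := by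
      have h5 : 1 + |t + y| ≤ 2 * (1 + |t|) := by
        have := abs_add_le t y
        linarith [abs_nonneg t]
      calc (1 + |t + y|) ^ δ ≤ (2 * (1 + |t|)) ^ δ := by gcongr
        _ = 2 ^ δ * (1 + |t|) ^ δ := Real.mul_rpow (by norm_num) (by positivity)
        _ ≤ 2 ^ (1 : ℝ) * (1 + |t|) ^ δ := by gcongr <;> linarith
        _ = _ := by rw [Real.rpow_one]
    have hzn : ‖riemannZeta (((1 / 2 - δ : ℝ) : ℂ) + ((t + y : ℝ) : ℂ) * Complex.I)‖ ≤
        C₀ * (2 * (1 + |t|) ^ δ) * zetaNorm σ (t + y) := by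
      refine hz.trans ?_
      rw [zetaNorm]
      gcongr
    rw [hg]
    simp only
    rw [norm_mul, norm_mul, norm_pow, hexpn, e1]
    have e2 : (((-(2 * δ) : ℝ) : ℂ) + y * Complex.I).re = -(2 * δ) := by simp
    rw [e2]
    calc _ ≤ 3 / (2 * δ) * Real.exp (-y ^ 2) *
          ((C₀ * (2 * (1 + |t|) ^ δ) * zetaNorm σ (t + y)) ^ k * Y ^ (-(2 * δ))) := by gcongr
      _ = _ := by
          rw [hK₂, mul_comm (k : ℝ) δ, Real.rpow_mul (by positivity), Real.rpow_natCast]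
          rw [mul_pow, ← mul_assoc C₀, mul_pow]
          ring
  have hS2 : S ^ 2 ≤ 2 * ∫ y in (-H)..H, Real.exp (-y ^ 2) * zetaNorm σ (t + y) ^ (2 * k) := by
    have := sq_integral_exp_mul_le hψc (by linarith : 0 < H)
    simp_rw [← pow_mul, mul_comm k 2] at this
    exact this
  set D := dirPoly k σ Y N t
  set IR := ∫ y : ℝ, gaussKernel 1 y * g (((1 : ℝ) : ℂ) + y * Complex.I) with hIR
  set IH := ∫ y in (-H)..H, gaussKernel 1 y * g (((1 : ℝ) : ℂ) + y * Complex.I)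
  set IL := ∫ y in (-H)..H, gaussKernel (-(2 * δ)) y * g ((-(2 * δ) : ℝ) + y * Complex.I)
  have hdir' : ‖IR - 2 * Real.pi * D‖ ≤ C₃ * (Y ^ 3 * Z ^ (-A)) := hdir
  have hE := Real.exp_pos (-H ^ 2 / 2)
  have h1t : (1 : ℝ) ≤ (1 + |t|) ^ k := one_le_pow₀ (by linarith [abs_nonneg t])
  have htot : ‖riemannZeta s ^ k - D‖ ≤ K₁ * (Y * (1 + |t|) ^ k * Real.exp (-H ^ 2 / 2)) +
      K₂ * (Y ^ (-(2 * δ)) * (1 + |t|) ^ (k * δ) * S) + C₃ * (Y ^ 3 * Z ^ (-A)) := by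
    have e : (2 * Real.pi : ℂ) * (riemannZeta s ^ k - D) =
        (2 * Real.pi * riemannZeta s ^ k - (IH - IL)) - (IR - IH) - IL + (IR - 2 * Real.pi * D) := by
      ring
    have hn := congrArg norm e
    rw [norm_mul] at hn
    have hpi : ‖(2 * Real.pi : ℂ)‖ = 2 * Real.pi := by
      rw [show (2 * Real.pi : ℂ) = ((2 * Real.pi : ℝ) : ℂ) by push_cast; rfl, Complex.norm_real,
        Real.norm_eq_abs, abs_of_pos (by positivity)]
    have h6 : ‖riemannZeta s ^ k - D‖ ≤ ‖(2 * Real.pi : ℂ)‖ * ‖riemannZeta s ^ k - D‖ :=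
      le_mul_of_one_le_left (norm_nonneg _) (by rw [hpi]; linarith [Real.pi_gt_three])
    rw [hn] at h6
    have h7 := (norm_add_le ((2 * Real.pi * riemannZeta s ^ k - (IH - IL)) - (IR - IH) - IL)
      (IR - 2 * Real.pi * D))
    have h8 := norm_sub_le ((2 * Real.pi * riemannZeta s ^ k - (IH - IL)) - (IR - IH)) IL
    have h9 := norm_sub_le (2 * Real.pi * riemannZeta s ^ k - (IH - IL)) (IR - IH)
    have h10 : 12 * C₂ * (Y * 1 * Real.exp (-H ^ 2 / 2)) ≤
        12 * C₂ * (Y * (1 + |t|) ^ k * Real.exp (-H ^ 2 / 2)) := by gcongr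
    rw [hK₁]
    linarith
  have hS0 : 0 ≤ S := intervalIntegral.integral_nonneg (by linarith) fun y _ =>
    mul_nonneg (Real.exp_pos _).le (pow_nonneg (zetaNorm_nonneg _ _) k)
  set J := ∫ y in (-H)..H, Real.exp (-y ^ 2) * zetaNorm σ (t + y) ^ (2 * k) with hJ
  have hJ0 : 0 ≤ J := intervalIntegral.integral_nonneg (by linarith) fun y _ =>
    mul_nonneg (Real.exp_pos _).le (pow_nonneg (zetaNorm_nonneg _ _) _)
  have q1 : (Y * (1 + |t|) ^ k * Real.exp (-H ^ 2 / 2)) ^ 2 =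
      Y ^ 2 * (1 + |t|) ^ (2 * k) * Real.exp (-t ^ 2 / 4) := by
    rw [mul_pow, mul_pow, ← pow_mul, mul_comm k 2, ← Real.exp_nat_mul]
    congr 2
    rw [hH, div_pow, sq_abs]
    push_cast
    ring
  have q2 : (Y ^ (-(2 * δ)) * (1 + |t|) ^ (k * δ) * S) ^ 2 ≤
      2 * (Y ^ (-(4 * δ)) * (1 + |t|) ^ (2 * k * δ) * J) := by
    have e1 : (Y ^ (-(2 * δ))) ^ 2 = Y ^ (-(4 * δ)) := by
      rw [← Real.rpow_natCast, ← Real.rpow_mul hY0.le]; congr 1; push_cast; ring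
    have e2 : ((1 + |t|) ^ (k * δ)) ^ 2 = (1 + |t|) ^ (2 * k * δ) := by
      rw [← Real.rpow_natCast, ← Real.rpow_mul (by positivity)]; congr 1; push_cast; ring
    rw [mul_pow, mul_pow, e1, e2]
    calc _ ≤ Y ^ (-(4 * δ)) * (1 + |t|) ^ (2 * k * δ) * (2 * J) := by gcongr
      _ = _ := by ring
  have q3 : (Y ^ 3 * Z ^ (-A)) ^ 2 = Y ^ 6 * Z ^ (-(2 * A)) := by
    rw [mul_pow, ← pow_mul, ← Real.rpow_natCast (Z ^ (-A)), ← Real.rpow_mul (by linarith)]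
    congr 2
    push_cast
    ring
  set a := Y * (1 + |t|) ^ k * Real.exp (-H ^ 2 / 2)
  set b := Y ^ (-(2 * δ)) * (1 + |t|) ^ (k * δ) * S
  set c := Y ^ 3 * Z ^ (-A)
  set b' := Y ^ (-(4 * δ)) * (1 + |t|) ^ (2 * k * δ) * J with hb'
  have hb'0 : 0 ≤ b' := by positivity
  rw [← q1, ← q3]
  calc ‖riemannZeta s ^ k - D‖ ^ 2 ≤ (K₁ * a + K₂ * b + C₃ * c) ^ 2 := by gcongr
    _ ≤ 3 * (K₁ ^ 2 * a ^ 2 + K₂ ^ 2 * b ^ 2 + C₃ ^ 2 * c ^ 2) := by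
        nlinarith [sq_nonneg (K₁ * a - K₂ * b), sq_nonneg (K₁ * a - C₃ * c),
          sq_nonneg (K₂ * b - C₃ * c)]
    _ ≤ 3 * (K₁ ^ 2 * a ^ 2 + K₂ ^ 2 * (2 * b') + C₃ ^ 2 * c ^ 2) := by gcongr
    _ ≤ _ := by
        have p1 : 0 ≤ K₁ ^ 2 * (b' + c ^ 2) := by positivity
        have p2 : 0 ≤ K₂ ^ 2 * 2 * (a ^ 2 + c ^ 2) := by positivity
        have p3 : 0 ≤ C₃ ^ 2 * (a ^ 2 + b') := by positivity
        linarith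

/-! ### Passing between sharp moments and Gaussian-weighted moments. -/

theorem exists_one_add_pow_mul_exp_le (m : ℕ) {a : ℝ} (ha : 0 < a) :
    ∃ C : ℝ, 0 ≤ C ∧ ∀ x : ℝ, 0 ≤ x →
      (1 + x) ^ m * Real.exp (-a * x ^ 2) ≤ C * Real.exp (-(a / 2) * x ^ 2) := by
  refine ⟨m.factorial * Real.exp (1 + 1 / (2 * a)), by positivity, fun x hx => ?_⟩
  have h1 : (1 + x) ^ m ≤ m.factorial * Real.exp (1 + x) := by
    have := Real.pow_div_factorial_le_exp (1 + x) (by linarith) m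
    rwa [div_le_iff₀ (by positivity), mul_comm] at this
  have h2 : x - a / 2 * x ^ 2 ≤ 1 / (2 * a) := by
    rw [le_div_iff₀ (by positivity)]
    nlinarith [sq_nonneg (a * x - 1)]
  calc _ ≤ m.factorial * Real.exp (1 + x) * Real.exp (-a * x ^ 2) := by gcongr
    _ = m.factorial * Real.exp (1 + x + -a * x ^ 2) := by rw [mul_assoc, ← Real.exp_add]
    _ ≤ m.factorial * Real.exp (1 + 1 / (2 * a) + -(a / 2) * x ^ 2) := by
        gcongr m.factorial * Real.exp ?_
        linarith
    _ = _ := by rw [Real.exp_add _ (-(a / 2) * x ^ 2), mul_assoc]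

theorem integrable_of_le_one_add_pow_mul_exp {h : ℝ → ℝ} (hc : Continuous h) {K a : ℝ} (ha : 0 < a)
    (m : ℕ) (hK : 0 ≤ K) (hb : ∀ t, |h t| ≤ K * ((1 + |t|) ^ m * Real.exp (-a * t ^ 2))) :
    MeasureTheory.Integrable h := by
  obtain ⟨C, hC, h'⟩ := exists_one_add_pow_mul_exp_le m ha
  refine ((integrable_exp_neg_mul_sq (half_pos ha)).const_mul (K * C)).mono'
    hc.aestronglyMeasurable (Eventually.of_forall fun t => ?_)
  have := h' |t| (abs_nonneg t)
  rw [sq_abs] at this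
  calc ‖h t‖ ≤ K * ((1 + |t|) ^ m * Real.exp (-a * t ^ 2)) := hb t
    _ ≤ K * (C * Real.exp (-(a / 2) * t ^ 2)) := by gcongr
    _ = _ := by ring

theorem integrable_wt_mul {h : ℝ → ℝ} (hc : Continuous h) {K T : ℝ} (hT : 0 < T)
    (m : ℕ) (hK : 0 ≤ K) (hb : ∀ t, |h t| ≤ K * (1 + |t|) ^ m) :
    MeasureTheory.Integrable fun t => wt T t * h t := by
  refine integrable_of_le_one_add_pow_mul_exp ((continuous_wt T).mul hc) (K := K / T ^ 2)
    (a := 1 / T ^ 2) (by positivity) (m + 2) (by positivity) fun t => ?_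
  rw [abs_mul, abs_of_nonneg (wt_nonneg T t), wt]
  have h1 : t ^ 2 ≤ (1 + |t|) ^ 2 := by
    rw [← sq_abs t]; gcongr; linarith
  calc (t / T) ^ 2 * Real.exp (-(t / T) ^ 2) * |h t| ≤
      ((1 + |t|) ^ 2 / T ^ 2) * Real.exp (-(t / T) ^ 2) * (K * (1 + |t|) ^ m) := by
        gcongr
        · rw [div_pow]; gcongr
        · exact hb t
    _ = _ := by
        rw [show -(1 / T ^ 2) * t ^ 2 = -(t / T) ^ 2 by ring]
        ring

/-- Polynomial growth `≪ T ^ θ` of the integral of `f` over `[-T, T]`. -/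
def HasMoment (f : ℝ → ℝ) (θ : ℝ) : Prop :=
  ∃ C : ℝ, 0 ≤ C ∧ ∀ T : ℝ, 1 ≤ T → (∫ t in (-T)..T, f t) ≤ C * T ^ θ

/-- The line is cut into shells `j T ≤ |u| < (j + 1) T`. The moment over a shell grows polynomially
in `j`, which the Gaussian factor dominates. -/
theorem HasMoment.exists_lintegral_le {f : ℝ → ℝ} (hf : Continuous f) (hf0 : ∀ t, 0 ≤ f t) {θ : ℝ}
    (h : HasMoment f θ) :
    ∃ C : ℝ, 0 ≤ C ∧ ∀ T : ℝ, 1 ≤ T →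
      ∫⁻ u, ENNReal.ofReal (Real.exp (-(1 / 4) * (u / T) ^ 2) * f u) ≤
        ENNReal.ofReal (C * T ^ θ) := by
  obtain ⟨C, hC, hM⟩ := h
  obtain ⟨K, hK, hKb⟩ := exists_one_add_pow_mul_exp_le ⌈θ⌉₊ (a := 1 / 4) (by norm_num)
  have hsum : Summable fun j : ℕ => (1 + (j : ℝ)) ^ θ * Real.exp (-(1 / 4) * (j : ℝ) ^ 2) := by
    have hg : Summable fun j : ℕ => K * Real.exp (j * (-(1 / 8))) :=
      (Real.summable_exp_nat_mul_iff.mpr (by norm_num)).mul_left K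
    refine Summable.of_nonneg_of_le (fun j => by positivity) (fun j => ?_) hg
    have h1 : (1 + (j : ℝ)) ^ θ ≤ (1 + (j : ℝ)) ^ ⌈θ⌉₊ := by
      rw [← Real.rpow_natCast]
      exact Real.rpow_le_rpow_of_exponent_le (by linarith [Nat.cast_nonneg (α := ℝ) j])
        (Nat.le_ceil θ)
    calc _ ≤ (1 + (j : ℝ)) ^ ⌈θ⌉₊ * Real.exp (-(1 / 4) * (j : ℝ) ^ 2) := by gcongr
      _ ≤ K * Real.exp (-(1 / 4 / 2) * (j : ℝ) ^ 2) := hKb j (Nat.cast_nonneg j)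
      _ ≤ _ := by
          refine mul_le_mul_of_nonneg_left (Real.exp_le_exp.mpr ?_) hK
          have : (j : ℝ) ≤ (j : ℝ) ^ 2 := by exact_mod_cast Nat.le_self_pow two_ne_zero j
          linarith
  set S := ∑' j : ℕ, (1 + (j : ℝ)) ^ θ * Real.exp (-(1 / 4) * (j : ℝ) ^ 2) with hS
  have hS0 : 0 ≤ S := tsum_nonneg fun j => by positivity
  refine ⟨C * S, by positivity, fun T hT => ?_⟩
  have hT0 : 0 < T := by linarith
  set I : ℕ → Set ℝ := fun j => Set.Ioc (-((1 + j) * T)) ((1 + j) * T) with hI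
  have hpt : ∀ u, ENNReal.ofReal (Real.exp (-(1 / 4) * (u / T) ^ 2) * f u) ≤
      ∑' j : ℕ, (I j).indicator
        (fun u => ENNReal.ofReal (Real.exp (-(1 / 4) * (j : ℝ) ^ 2)) * ENNReal.ofReal (f u)) u := by
    intro u
    set j := ⌊|u| / T⌋₊ with hj
    have hj1 : (j : ℝ) ≤ |u| / T := Nat.floor_le (by positivity)
    have hj2 : |u| / T < j + 1 := Nat.lt_floor_add_one _
    have hmem : u ∈ I j := by
      rw [div_lt_iff₀ hT0] at hj2
      have := abs_lt.mp hj2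
      exact ⟨by linarith [this.1], by linarith [this.2]⟩
    refine le_trans ?_ (ENNReal.le_tsum j)
    rw [Set.indicator_of_mem hmem, ← ENNReal.ofReal_mul (Real.exp_pos _).le]
    refine ENNReal.ofReal_le_ofReal (mul_le_mul_of_nonneg_right (Real.exp_le_exp.mpr ?_) (hf0 u))
    have : (j : ℝ) ^ 2 ≤ (u / T) ^ 2 := by
      rw [← sq_abs (u / T), abs_div, abs_of_pos hT0]
      gcongr
    linarith
  have hmeas : Measurable fun u => ENNReal.ofReal (f u) := hf.measurable.ennreal_ofReal
  calc _ ≤ ∫⁻ u, ∑' j : ℕ, (I j).indicator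
        (fun u => ENNReal.ofReal (Real.exp (-(1 / 4) * (j : ℝ) ^ 2)) * ENNReal.ofReal (f u)) u :=
        MeasureTheory.lintegral_mono hpt
    _ = ∑' j : ℕ, ENNReal.ofReal (Real.exp (-(1 / 4) * (j : ℝ) ^ 2)) *
          ∫⁻ u in I j, ENNReal.ofReal (f u) := by
        rw [MeasureTheory.lintegral_tsum fun j =>
          ((hmeas.const_mul _).indicator measurableSet_Ioc).aemeasurable]
        refine tsum_congr fun j => ?_
        rw [MeasureTheory.lintegral_indicator measurableSet_Ioc,
          MeasureTheory.lintegral_const_mul _ hmeas]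
    _ ≤ ∑' j : ℕ, ENNReal.ofReal
          (C * T ^ θ * ((1 + (j : ℝ)) ^ θ * Real.exp (-(1 / 4) * (j : ℝ) ^ 2))) := by
        refine ENNReal.tsum_le_tsum fun j => ?_
        have hj1 : 1 ≤ (1 + (j : ℝ)) * T := by nlinarith [Nat.cast_nonneg (α := ℝ) j]
        have h1 := hM _ hj1
        rw [intervalIntegral.integral_of_le (by linarith)] at h1
        rw [← MeasureTheory.ofReal_integral_eq_lintegral_ofReal
          (hf.integrableOn_Ioc) (Eventually.of_forall hf0),
          ← ENNReal.ofReal_mul (Real.exp_pos _).le]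
        refine ENNReal.ofReal_le_ofReal ?_
        calc _ ≤ Real.exp (-(1 / 4) * (j : ℝ) ^ 2) * (C * ((1 + (j : ℝ)) * T) ^ θ) := by gcongr
          _ = _ := by rw [Real.mul_rpow (by positivity) hT0.le]; ring
    _ = ENNReal.ofReal (C * T ^ θ * S) := by
        rw [← ENNReal.ofReal_tsum_of_nonneg (fun j => by positivity) (hsum.mul_left _),
          tsum_mul_left]
    _ = _ := by ring_nf

/-- The inner average over `y` lives at unit scale while the weight varies at scale `T ≥ 1`, so it
costs only a constant. Integrating first in `t` leaves a weighted moment of `f`; non-negative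
integrals make the exchange of order free of integrability conditions. -/
theorem HasMoment.exists_lintegral_wt_le {f : ℝ → ℝ} (hf : Continuous f) (hf0 : ∀ t, 0 ≤ f t)
    {θ ρ : ℝ} (hρ : 0 ≤ ρ) (hρ1 : ρ ≤ 1) (h : HasMoment f θ) :
    ∃ C : ℝ, 0 ≤ C ∧ ∀ T : ℝ, 1 ≤ T →
      ∫⁻ t, ENNReal.ofReal (wt T t * (1 + |t|) ^ ρ *
        ∫ y in (-(|t| / 2))..(|t| / 2), Real.exp (-y ^ 2) * f (t + y)) ≤
        ENNReal.ofReal (C * T ^ (ρ + θ)) := by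
  obtain ⟨C, hC, hM⟩ := h.exists_lintegral_le hf hf0
  obtain ⟨K, hK, hKb⟩ := exists_one_add_pow_mul_exp_le 3 (a := 1) (by norm_num)
  refine ⟨K * (√(2 * Real.pi) * C), by positivity, fun T hT => ?_⟩
  have hT0 : 0 < T := by linarith
  have hw : ∀ t, wt T t * (1 + |t|) ^ ρ ≤ K * T ^ ρ * Real.exp (-(1 / 2) * (t / T) ^ 2) := by
    intro t
    set x := |t| / T with hx
    have hx0 : 0 ≤ x := by positivity
    have hx2 : (t / T) ^ 2 = x ^ 2 := by rw [hx, ← sq_abs (t / T), abs_div, abs_of_pos hT0]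
    have h1 : (1 + |t|) ^ ρ ≤ T ^ ρ * (1 + x) := by
      have h2 : 1 + |t| ≤ T * (1 + x) := by
        rw [hx, mul_add, mul_div_cancel₀ _ hT0.ne']; linarith
      calc (1 + |t|) ^ ρ ≤ (T * (1 + x)) ^ ρ := by gcongr
        _ = T ^ ρ * (1 + x) ^ ρ := Real.mul_rpow hT0.le (by positivity)
        _ ≤ T ^ ρ * (1 + x) ^ (1 : ℝ) := by
            gcongr; linarith
        _ = _ := by rw [Real.rpow_one]
    have h3 := hKb x hx0
    rw [wt, hx2]
    have h4 : x ^ 2 ≤ (1 + x) ^ 2 := by gcongr; linarith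
    calc x ^ 2 * Real.exp (-x ^ 2) * (1 + |t|) ^ ρ ≤
        (1 + x) ^ 2 * Real.exp (-x ^ 2) * (T ^ ρ * (1 + x)) := by gcongr
      _ = T ^ ρ * ((1 + x) ^ 3 * Real.exp (-1 * x ^ 2)) := by rw [neg_one_mul]; ring
      _ ≤ T ^ ρ * (K * Real.exp (-(1 / 2) * x ^ 2)) := by gcongr
      _ = _ := by ring
  have hinner : ∀ t, ENNReal.ofReal (∫ y in (-(|t| / 2))..(|t| / 2), Real.exp (-y ^ 2) * f (t + y)) ≤
      ∫⁻ u, ENNReal.ofReal (Real.exp (-(u - t) ^ 2) * f u) := by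
    intro t
    have hle : -(|t| / 2) ≤ |t| / 2 := by linarith [abs_nonneg t]
    rw [intervalIntegral.integral_of_le hle, MeasureTheory.ofReal_integral_eq_lintegral_ofReal
      (Continuous.integrableOn_Ioc (by fun_prop))
      (Eventually.of_forall fun y => mul_nonneg (Real.exp_pos _).le (hf0 _))]
    refine (MeasureTheory.setLIntegral_le_lintegral _ _).trans (le_of_eq ?_)
    rw [← MeasureTheory.lintegral_add_left_eq_self
      (fun u => ENNReal.ofReal (Real.exp (-(u - t) ^ 2) * f u)) t]
    refine MeasureTheory.lintegral_congr fun y => ?_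
    rw [add_sub_cancel_left]
  have hgauss : ∀ u : ℝ, ∫⁻ t, ENNReal.ofReal (Real.exp (-(1 / 2) * (u - t) ^ 2)) =
      ENNReal.ofReal √(2 * Real.pi) := by
    intro u
    rw [MeasureTheory.lintegral_sub_left_eq_self
      (fun t => ENNReal.ofReal (Real.exp (-(1 / 2) * t ^ 2))) u,
      ← MeasureTheory.ofReal_integral_eq_lintegral_ofReal
      (integrable_exp_neg_mul_sq (by norm_num)) (Eventually.of_forall fun y => (Real.exp_pos _).le),
      integral_gaussian]
    congr 2
    ring
  calc _ ≤ ∫⁻ t, ∫⁻ u, ENNReal.ofReal (K * T ^ ρ) *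
        (ENNReal.ofReal (Real.exp (-(1 / 2) * (u - t) ^ 2)) *
          ENNReal.ofReal (Real.exp (-(1 / 4) * (u / T) ^ 2) * f u)) := by
        refine MeasureTheory.lintegral_mono fun t => ?_
        simp only
        rw [ENNReal.ofReal_mul (mul_nonneg (wt_nonneg _ _) (by positivity))]
        refine (mul_le_mul' (ENNReal.ofReal_le_ofReal (hw t)) (hinner t)).trans ?_
        rw [← MeasureTheory.lintegral_const_mul _ (by fun_prop)]
        refine MeasureTheory.lintegral_mono fun u => ?_
        simp only
        rw [← ENNReal.ofReal_mul (by positivity), ← ENNReal.ofReal_mul (by positivity),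
          ← ENNReal.ofReal_mul (by positivity)]
        refine ENNReal.ofReal_le_ofReal ?_
        -- From `u = t + (u - t)` one has `(u/T)² ≤ 2 (t/T)² + 2 ((u - t)/T)²`, and `T ≥ 1` lets
        -- half of the unit-scale Gaussian pay for the last term.
        have h1 : Real.exp (-(1 / 2) * (t / T) ^ 2) * Real.exp (-(u - t) ^ 2) ≤
            Real.exp (-(1 / 2) * (u - t) ^ 2) * Real.exp (-(1 / 4) * (u / T) ^ 2) := by
          rw [← Real.exp_add, ← Real.exp_add]
          refine Real.exp_le_exp.mpr ?_
          have h2 : ((u - t) / T) ^ 2 ≤ (u - t) ^ 2 := by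
            rw [div_pow]
            exact div_le_self (sq_nonneg _) (one_le_pow₀ hT)
          have h3 : u / T = t / T + (u - t) / T := by ring
          rw [h3]
          nlinarith [sq_nonneg (t / T - (u - t) / T)]
        have h5 : 0 ≤ K * T ^ ρ * f u := by have := hf0 u; positivity
        nlinarith [mul_le_mul_of_nonneg_left h1 h5]
    _ = ∫⁻ u, ∫⁻ t, ENNReal.ofReal (K * T ^ ρ) *
        (ENNReal.ofReal (Real.exp (-(1 / 2) * (u - t) ^ 2)) *
          ENNReal.ofReal (Real.exp (-(1 / 4) * (u / T) ^ 2) * f u)) :=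
        MeasureTheory.lintegral_lintegral_swap (Measurable.aemeasurable (by fun_prop))
    _ = ∫⁻ u, ENNReal.ofReal (K * T ^ ρ) * (ENNReal.ofReal √(2 * Real.pi) *
          ENNReal.ofReal (Real.exp (-(1 / 4) * (u / T) ^ 2) * f u)) := by
        refine MeasureTheory.lintegral_congr fun u => ?_
        rw [MeasureTheory.lintegral_const_mul _ (by fun_prop),
          MeasureTheory.lintegral_mul_const _ (by fun_prop), hgauss]
    _ = ENNReal.ofReal (K * T ^ ρ) * (ENNReal.ofReal √(2 * Real.pi) *
          ∫⁻ u, ENNReal.ofReal (Real.exp (-(1 / 4) * (u / T) ^ 2) * f u)) := by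
        rw [MeasureTheory.lintegral_const_mul _ (by fun_prop),
          MeasureTheory.lintegral_const_mul _ (by fun_prop)]
    _ ≤ ENNReal.ofReal (K * T ^ ρ) * (ENNReal.ofReal √(2 * Real.pi) *
          ENNReal.ofReal (C * T ^ θ)) := by gcongr; exact hM T hT
    _ = _ := by
        rw [← ENNReal.ofReal_mul (by positivity), ← ENNReal.ofReal_mul (by positivity),
          Real.rpow_add hT0]
        congr 1
        ring

theorem exists_zetaNorm_le : ∃ C : ℝ, 1 ≤ C ∧ ∀ σ t : ℝ, 1 / 4 ≤ σ → σ ≤ 3 / 4 →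
    zetaNorm σ t ≤ C * (1 + |t|) := by
  obtain ⟨C, hC, h⟩ := exists_norm_riemannZeta_le
  refine ⟨C * 8, by linarith, fun σ t h1 h2 => ?_⟩
  have hre : ((σ : ℂ) + t * Complex.I).re = σ := by simp
  have him : ((σ : ℂ) + t * Complex.I).im = t := by simp
  have hr : 1 / 4 ≤ ‖(σ : ℂ) + t * Complex.I - 1‖ := by
    have := Complex.abs_re_le_norm ((σ : ℂ) + t * Complex.I - 1)
    rw [Complex.sub_re, hre, Complex.one_re, abs_of_neg (by linarith)] at this
    linarith
  have hz := h ((σ : ℂ) + t * Complex.I) (by rw [hre]; exact h1) (1 / 4) (by norm_num)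
    (by norm_num) hr
  have hn := Complex.norm_le_abs_re_add_abs_im ((σ : ℂ) + t * Complex.I)
  rw [hre, him, abs_of_pos (by linarith)] at hn
  rw [zetaNorm]
  refine hz.trans ?_
  have : 0 ≤ |t| := abs_nonneg t
  rw [div_eq_mul_inv]
  norm_num
  nlinarith

theorem integral_wt_le {T : ℝ} (hT : 0 < T) : ∫ t, wt T t ≤ T := by
  have h := integral_wt_mul_cos hT 0
  simp only [mul_zero, Real.cos_zero, mul_one] at h
  rw [h, ker]
  norm_num
  nlinarith [sqrt_pi_le_two]

theorem wt_le_sq_div (T t : ℝ) : wt T t ≤ (t / T) ^ 2 := by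
  rw [wt]
  refine mul_le_of_le_one_right (sq_nonneg _) (Real.exp_le_one_iff.mpr ?_)
  linarith [sq_nonneg (t / T)]

theorem exists_norm_dirPoly_sq_le (k : ℕ) {θ : ℝ} (hθ : 0 < θ) (hθ1 : θ ≤ 1) :
    ∃ C : ℝ, 0 ≤ C ∧ ∀ (σ Y : ℝ) (N : ℕ) (t : ℝ), 1 / 2 ≤ σ → 1 ≤ N →
      ‖dirPoly k σ Y N t‖ ^ 2 ≤ C * (N : ℝ) ^ (1 + 3 * θ) := by
  obtain ⟨C, hC, h⟩ := exists_sum_sq_dk_mul_cut_le k hθ hθ1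
  refine ⟨C, hC, fun σ Y N t hσ hN => ?_⟩
  have hN0 : (0 : ℝ) < N := by exact_mod_cast hN
  have h1 : ‖dirPoly k σ Y N t‖ ≤ ∑ n ∈ Finset.Icc 1 N, dk k n * cut σ Y n := by
    refine (norm_sum_le _ _).trans (Finset.sum_le_sum fun n hn => ?_)
    rw [Finset.mem_Icc] at hn
    have hn0 : (0 : ℝ) < n := by exact_mod_cast hn.1
    rw [norm_mul, Complex.norm_exp_ofReal_mul_I, mul_one, Complex.norm_real, Real.norm_eq_abs,
      abs_of_nonneg (mul_nonneg (Nat.cast_nonneg _) (cut_nonneg σ Y hn0))]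
  calc ‖dirPoly k σ Y N t‖ ^ 2 ≤ (∑ n ∈ Finset.Icc 1 N, dk k n * cut σ Y n) ^ 2 := by gcongr
    _ ≤ (Finset.Icc 1 N).card * ∑ n ∈ Finset.Icc 1 N, (dk k n * cut σ Y n) ^ 2 :=
        sq_sum_le_card_mul_sum_sq
    _ ≤ N * (C * (N : ℝ) ^ (3 * θ)) := by
        rw [Nat.card_Icc, Nat.add_sub_cancel]
        gcongr
        exact h σ Y N hσ hN
    _ = _ := by rw [Real.rpow_add hN0, Real.rpow_one]; ring

theorem continuous_zeta_pow_sub_dirPoly (k : ℕ) {σ : ℝ} (hσ : σ ≠ 1) (Y : ℝ) (N : ℕ) :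
    Continuous fun t : ℝ => ‖riemannZeta ((σ : ℂ) + t * Complex.I) ^ k - dirPoly k σ Y N t‖ ^ 2 := by
  refine ((Continuous.sub (Continuous.pow ?_ k) (continuous_dirPoly k σ Y N)).norm).pow 2
  refine continuous_iff_continuousAt.mpr fun t => ?_
  have h : (σ : ℂ) + t * Complex.I ≠ 1 := fun h => hσ (by simpa using congrArg Complex.re h)
  have hc : ContinuousAt (fun t : ℝ => (σ : ℂ) + t * Complex.I) t := by fun_prop
  exact (differentiableAt_riemannZeta h).continuousAt.comp
    (f := fun t : ℝ => (σ : ℂ) + t * Complex.I) hc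

theorem norm_sub_sq_le (a b : ℂ) : ‖a - b‖ ^ 2 ≤ 2 * ‖a‖ ^ 2 + 2 * ‖b‖ ^ 2 := by
  have := norm_sub_le a b
  nlinarith [norm_nonneg (a - b), sq_nonneg (‖a‖ - ‖b‖), norm_nonneg a, norm_nonneg b]

theorem norm_zeta_pow_sq (k : ℕ) (σ t : ℝ) :
    ‖riemannZeta ((σ : ℂ) + t * Complex.I) ^ k‖ ^ 2 = zetaNorm σ t ^ (2 * k) := by
  rw [norm_pow, ← pow_mul, mul_comm k 2, zetaNorm]

theorem integrable_wt_mul_norm_sub_sq (k : ℕ) {σ : ℝ} (h1 : 1 / 2 ≤ σ) (h2 : σ ≤ 3 / 4) (Y : ℝ)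
    {N : ℕ} (hN : 1 ≤ N) {T : ℝ} (hT : 0 < T) :
    MeasureTheory.Integrable fun t => wt T t *
      ‖riemannZeta ((σ : ℂ) + t * Complex.I) ^ k - dirPoly k σ Y N t‖ ^ 2 := by
  obtain ⟨C, hC, h⟩ := exists_zetaNorm_le
  obtain ⟨C', hC', h'⟩ := exists_norm_dirPoly_sq_le k (θ := 1) one_pos le_rfl
  refine integrable_wt_mul (continuous_zeta_pow_sub_dirPoly k (by linarith) Y N)
    (K := 2 * C ^ (2 * k) + 2 * (C' * (N : ℝ) ^ (1 + 3 * (1 : ℝ)))) hT (2 * k) (by positivity)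
    fun t => ?_
  rw [abs_of_nonneg (sq_nonneg _)]
  refine (norm_sub_sq_le _ _).trans ?_
  rw [norm_zeta_pow_sq, add_mul]
  have h3 : (1 : ℝ) ≤ (1 + |t|) ^ (2 * k) := one_le_pow₀ (by linarith [abs_nonneg t])
  have h4 : zetaNorm σ t ^ (2 * k) ≤ C ^ (2 * k) * (1 + |t|) ^ (2 * k) := by
    rw [← mul_pow]
    exact pow_le_pow_left₀ (zetaNorm_nonneg _ _) (h σ t (by linarith) h2) _
  have h5 := h' σ Y N t h1 hN
  have h6 : 2 * (C' * (N : ℝ) ^ (1 + 3 * (1 : ℝ))) * 1 ≤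
      2 * (C' * (N : ℝ) ^ (1 + 3 * (1 : ℝ))) * (1 + |t|) ^ (2 * k) := by gcongr
  linarith

/-- For `|t| ≥ Z` the contour estimate applies. For `|t| < Z` nothing is known beyond trivial
bounds, but there the weight is at most `(Z/T)²`; this is a second use of its double zero at `t =
0`. -/
theorem exists_integral_norm_sub_sq_le (k : ℕ) {δ : ℝ} (hδ : 0 < δ) (hδ' : δ ≤ 1 / 4)
    (hkδ : 2 * k * δ ≤ 1) {A : ℝ} (hA : 0 ≤ A) {θ : ℝ} (hθ : 0 < θ) (hθ1 : θ ≤ 1) {μ : ℝ}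
    (hμ : HasMoment (fun t => zetaNorm (1 / 2 + δ) t ^ (2 * k)) μ) :
    ∃ C : ℝ, 0 ≤ C ∧ ∀ (Y Z T : ℝ) (N : ℕ), 1 ≤ Y → 2 ≤ Z → Y * Z ≤ N → 1 ≤ T →
      (∫ t, wt T t * ‖riemannZeta (((1 / 2 + δ : ℝ) : ℂ) + t * Complex.I) ^ k -
        dirPoly k (1 / 2 + δ) Y N t‖ ^ 2) ≤
      C * (Y ^ (-(4 * δ)) * T ^ (2 * k * δ + μ) +
        T * (Y ^ 6 * Z ^ (-(2 * A)) + Y ^ 2 * Real.exp (-Z ^ 2 / 8)) +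
        Z ^ 3 / T ^ 2 * (Z ^ (2 * k) + (N : ℝ) ^ (1 + 3 * θ))) := by
  obtain ⟨C₁, hC₁, h₁⟩ := exists_norm_zeta_pow_sub_dirPoly_sq_le k hδ hδ' hA
  obtain ⟨C₂, hC₂, h₂⟩ := exists_zetaNorm_le
  obtain ⟨C₃, hC₃, h₃⟩ := exists_norm_dirPoly_sq_le k hθ hθ1
  obtain ⟨K, hK, hKb⟩ := exists_one_add_pow_mul_exp_le (2 * k) (a := 1 / 4) (by norm_num)
  have hσ1 : (1 / 2 + δ : ℝ) ≠ 1 := fun h => by linarith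
  have hfc : Continuous fun t => zetaNorm (1 / 2 + δ) t ^ (2 * k) :=
    (continuous_zetaNorm hσ1).pow _
  have hf0 : ∀ t, 0 ≤ zetaNorm (1 / 2 + δ) t ^ (2 * k) := fun t => pow_nonneg (zetaNorm_nonneg _ _) _
  obtain ⟨C₄, hC₄, h₄⟩ := hμ.exists_lintegral_wt_le hfc hf0 (ρ := 2 * k * δ) (by positivity) hkδ
  set B : ℝ := 2 * (C₂ * 2) ^ (2 * k) + 2 * C₃ with hB
  refine ⟨C₁ * C₄ + C₁ * (1 + K) + 2 * B, by positivity, fun Y Z T N hY hZ hN hT => ?_⟩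
  have hY0 : 0 < Y := by linarith
  have hZ0 : 0 < Z := by linarith
  have hT0 : 0 < T := by linarith
  have hN0 : (0 : ℝ) < N := lt_of_lt_of_le (by positivity) hN
  have hN1 : 1 ≤ N := Nat.one_le_iff_ne_zero.mpr fun h => by simp [h] at hN0
  set σ : ℝ := 1 / 2 + δ with hσ
  set J : ℝ → ℝ := fun t => ∫ y in (-(|t| / 2))..(|t| / 2),
    Real.exp (-y ^ 2) * zetaNorm σ (t + y) ^ (2 * k) with hJ
  have hJ0 : ∀ t, 0 ≤ J t := fun t =>
    intervalIntegral.integral_nonneg (by linarith [abs_nonneg t]) fun y _ =>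
      mul_nonneg (Real.exp_pos _).le (hf0 _)
  set E : ℝ := C₁ * (Y ^ 6 * Z ^ (-(2 * A)) + Y ^ 2 * (K * Real.exp (-Z ^ 2 / 8))) with hE
  have hE0 : 0 ≤ E := by positivity
  set G : ℝ := (Z / T) ^ 2 * (B * (Z ^ (2 * k) + (N : ℝ) ^ (1 + 3 * θ))) with hG
  have hG0 : 0 ≤ G := by positivity
  set a : ℝ → ℝ := fun t => wt T t * (1 + |t|) ^ (2 * k * δ) * J t with ha
  have ha0 : ∀ t, 0 ≤ a t := fun t =>
    mul_nonneg (mul_nonneg (wt_nonneg _ _) (by positivity)) (hJ0 t)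
  have hpt : ∀ t, wt T t * ‖riemannZeta ((σ : ℂ) + t * Complex.I) ^ k - dirPoly k σ Y N t‖ ^ 2 ≤
      C₁ * Y ^ (-(4 * δ)) * a t + (wt T t * E + (Set.Ioc (-Z) Z).indicator (fun _ => G) t) := by
    intro t
    have hw := wt_nonneg T t
    rcases le_or_gt Z |t| with hZt | hZt
    · have h5 := h₁ Y Z N hY (by linarith) hN t (by linarith)
      have hgauss : (1 + |t|) ^ (2 * k) * Real.exp (-t ^ 2 / 4) ≤ K * Real.exp (-Z ^ 2 / 8) := by
        have h6 := hKb |t| (abs_nonneg t)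
        rw [sq_abs] at h6
        calc _ = (1 + |t|) ^ (2 * k) * Real.exp (-(1 / 4) * t ^ 2) := by congr 2; ring
          _ ≤ K * Real.exp (-(1 / 4 / 2) * t ^ 2) := h6
          _ ≤ _ := by
              refine mul_le_mul_of_nonneg_left (Real.exp_le_exp.mpr ?_) hK
              have : Z ^ 2 ≤ t ^ 2 := by rw [← sq_abs t]; gcongr
              linarith
      have hind : 0 ≤ (Set.Ioc (-Z) Z).indicator (fun _ => G) t :=
        Set.indicator_nonneg (fun _ _ => hG0) t
      calc _ ≤ wt T t * (C₁ * (Y ^ (-(4 * δ)) * (1 + |t|) ^ (2 * k * δ) * J t +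
            Y ^ 6 * Z ^ (-(2 * A)) + Y ^ 2 * (1 + |t|) ^ (2 * k) * Real.exp (-t ^ 2 / 4))) := by
            gcongr
        _ ≤ wt T t * (C₁ * (Y ^ (-(4 * δ)) * (1 + |t|) ^ (2 * k * δ) * J t +
            Y ^ 6 * Z ^ (-(2 * A)) + Y ^ 2 * (K * Real.exp (-Z ^ 2 / 8)))) := by
            rw [mul_assoc (Y ^ 2)]
            gcongr
        _ = C₁ * Y ^ (-(4 * δ)) * a t + wt T t * E := by rw [ha, hE]; ring
        _ ≤ _ := by linarith
    · have hmem : t ∈ Set.Ioc (-Z) Z := ⟨(abs_lt.mp hZt).1, (abs_lt.mp hZt).2.le⟩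
      rw [Set.indicator_of_mem hmem]
      have h6 : wt T t ≤ (Z / T) ^ 2 := by
        refine (wt_le_sq_div T t).trans ?_
        rw [← sq_abs (t / T), abs_div, abs_of_pos hT0]
        gcongr
      have h7 : ‖riemannZeta ((σ : ℂ) + t * Complex.I) ^ k - dirPoly k σ Y N t‖ ^ 2 ≤
          B * (Z ^ (2 * k) + (N : ℝ) ^ (1 + 3 * θ)) := by
        refine (norm_sub_sq_le _ _).trans ?_
        rw [norm_zeta_pow_sq]
        have h8 : zetaNorm σ t ^ (2 * k) ≤ (C₂ * 2) ^ (2 * k) * Z ^ (2 * k) := by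
          rw [← mul_pow]
          refine pow_le_pow_left₀ (zetaNorm_nonneg _ _) ((h₂ σ t (by linarith) (by linarith)).trans ?_) _
          rw [mul_assoc]
          gcongr
          linarith
        have h9 := h₃ σ Y N t (by linarith) hN1
        have p1 : 0 ≤ (C₂ * 2) ^ (2 * k) * (N : ℝ) ^ (1 + 3 * θ) := by positivity
        have p2 : 0 ≤ C₃ * Z ^ (2 * k) := by positivity
        rw [hB]
        linarith
      have h10 : wt T t * ‖riemannZeta ((σ : ℂ) + t * Complex.I) ^ k - dirPoly k σ Y N t‖ ^ 2 ≤
          G := by rw [hG]; gcongr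
      have p1 : 0 ≤ C₁ * Y ^ (-(4 * δ)) * a t := mul_nonneg (by positivity) (ha0 t)
      have p2 : 0 ≤ wt T t * E := by positivity
      linarith
  have hint := integrable_wt_mul_norm_sub_sq k (σ := σ) (by linarith) (by linarith) Y hN1 hT0
  have hmeas : Measurable fun t => wt T t * E + (Set.Ioc (-Z) Z).indicator (fun _ => G) t :=
    ((continuous_wt T).measurable.mul_const E).add
      (measurable_const.indicator measurableSet_Ioc)
  have hrest0 : ∀ t, 0 ≤ wt T t * E + (Set.Ioc (-Z) Z).indicator (fun _ => G) t := fun t =>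
    add_nonneg (mul_nonneg (wt_nonneg _ _) hE0) (Set.indicator_nonneg (fun _ _ => hG0) t)
  have hi1 : MeasureTheory.Integrable fun t => wt T t * E := (integrable_wt hT0).mul_const E
  have hi2 : MeasureTheory.Integrable ((Set.Ioc (-Z) Z).indicator fun _ => G) :=
    (MeasureTheory.integrable_indicator_iff measurableSet_Ioc).mpr
      (MeasureTheory.integrableOn_const (by simp))
  have hrest : ∫⁻ t, ENNReal.ofReal (wt T t * E + (Set.Ioc (-Z) Z).indicator (fun _ => G) t) ≤
      ENNReal.ofReal (T * E + 2 * Z * G) := by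
    have hi3 : MeasureTheory.Integrable fun t =>
      wt T t * E + (Set.Ioc (-Z) Z).indicator (fun _ => G) t := hi1.add hi2
    rw [← MeasureTheory.ofReal_integral_eq_lintegral_ofReal hi3 (Eventually.of_forall hrest0)]
    refine ENNReal.ofReal_le_ofReal ?_
    rw [MeasureTheory.integral_add hi1 hi2, MeasureTheory.integral_mul_const,
      MeasureTheory.integral_indicator measurableSet_Ioc, MeasureTheory.setIntegral_const]
    have := integral_wt_le hT0
    simp only [Real.volume_real_Ioc, smul_eq_mul]
    rw [max_eq_left (by linarith)]
    have h11 : (∫ t, wt T t) * E ≤ T * E := by gcongr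
    linarith
  have hfin : ENNReal.ofReal (∫ t, wt T t *
      ‖riemannZeta ((σ : ℂ) + t * Complex.I) ^ k - dirPoly k σ Y N t‖ ^ 2) ≤
      ENNReal.ofReal (C₁ * Y ^ (-(4 * δ)) * (C₄ * T ^ (2 * k * δ + μ)) + (T * E + 2 * Z * G)) := by
    rw [MeasureTheory.ofReal_integral_eq_lintegral_ofReal hint
      (Eventually.of_forall fun t => mul_nonneg (wt_nonneg _ _) (sq_nonneg _))]
    calc _ ≤ ∫⁻ t, (ENNReal.ofReal (C₁ * Y ^ (-(4 * δ))) * ENNReal.ofReal (a t) +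
          ENNReal.ofReal (wt T t * E + (Set.Ioc (-Z) Z).indicator (fun _ => G) t)) := by
          refine MeasureTheory.lintegral_mono fun t => ?_
          simp only
          rw [← ENNReal.ofReal_mul (by positivity), ← ENNReal.ofReal_add
            (mul_nonneg (by positivity) (ha0 t)) (hrest0 t)]
          exact ENNReal.ofReal_le_ofReal (hpt t)
      _ = ENNReal.ofReal (C₁ * Y ^ (-(4 * δ))) * (∫⁻ t, ENNReal.ofReal (a t)) +
          ∫⁻ t, ENNReal.ofReal (wt T t * E + (Set.Ioc (-Z) Z).indicator (fun _ => G) t) := by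
          rw [MeasureTheory.lintegral_add_right _ hmeas.ennreal_ofReal,
            MeasureTheory.lintegral_const_mul' _ _ ENNReal.ofReal_ne_top]
      _ ≤ ENNReal.ofReal (C₁ * Y ^ (-(4 * δ))) * ENNReal.ofReal (C₄ * T ^ (2 * k * δ + μ)) +
          ENNReal.ofReal (T * E + 2 * Z * G) := by
          gcongr
          exact h₄ T hT
      _ = _ := by
          rw [← ENNReal.ofReal_mul (by positivity), ← ENNReal.ofReal_add (by positivity)
            (by positivity)]
  rw [ENNReal.ofReal_le_ofReal_iff (by positivity)] at hfin
  refine hfin.trans ?_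
  set u := Y ^ (-(4 * δ)) * T ^ (2 * k * δ + μ) with hu
  set v₁ := T * (Y ^ 6 * Z ^ (-(2 * A))) with hv₁
  set v₂ := T * (Y ^ 2 * Real.exp (-Z ^ 2 / 8)) with hv₂
  set w := Z ^ 3 / T ^ 2 * (Z ^ (2 * k) + (N : ℝ) ^ (1 + 3 * θ)) with hw
  have hu0 : 0 ≤ u := by positivity
  have hv₁0 : 0 ≤ v₁ := by positivity
  have hv₂0 : 0 ≤ v₂ := by positivity
  have hw0 : 0 ≤ w := by positivity
  have e1 : C₁ * Y ^ (-(4 * δ)) * (C₄ * T ^ (2 * k * δ + μ)) = C₁ * C₄ * u := by rw [hu]; ring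
  have e2 : T * E = C₁ * v₁ + C₁ * K * v₂ := by rw [hE, hv₁, hv₂]; ring
  have e3 : 2 * Z * G = 2 * B * w := by rw [hG, hw]; ring
  have e4 : T * (Y ^ 6 * Z ^ (-(2 * A)) + Y ^ 2 * Real.exp (-Z ^ 2 / 8)) = v₁ + v₂ := by
    rw [hv₁, hv₂]; ring
  rw [e1, e2, e3, e4]
  have hB0 : 0 ≤ B := by positivity
  have p1 : 0 ≤ C₁ * C₄ * (v₁ + v₂ + w) := by positivity
  have p2 : 0 ≤ C₁ * (u + w + v₂) := by positivity
  have p3 : 0 ≤ C₁ * K * (u + w + v₁) := by positivity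
  have p4 : 0 ≤ 2 * B * (u + v₁ + v₂) := by positivity
  linarith

/-! ### Choice of parameters under the shift hypothesis. -/

theorem eventually_mul_rpow_le (c : ℝ) {a b : ℝ} (hab : a < b) :
    ∀ᶠ T : ℝ in atTop, c * T ^ a ≤ T ^ b := by
  filter_upwards [(tendsto_rpow_atTop (sub_pos.mpr hab)).eventually_ge_atTop c,
    eventually_gt_atTop 0] with T hT hT0
  calc c * T ^ a ≤ T ^ (b - a) * T ^ a := by gcongr
    _ = T ^ b := by rw [← Real.rpow_add hT0]; ring_nf

theorem eventually_rpow_mul_exp_le (s : ℝ) {r c : ℝ} (hr : 0 < r) (hc : 0 < c) :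
    ∀ᶠ T : ℝ in atTop, T ^ s * Real.exp (-c * T ^ r) ≤ 1 := by
  have h := (tendsto_rpow_mul_exp_neg_mul_atTop_nhds_zero (s / r) c hc).comp (tendsto_rpow_atTop hr)
  filter_upwards [h.eventually_le_const one_pos, eventually_gt_atTop 0] with T hT hT0
  rw [Function.comp_apply, ← Real.rpow_mul hT0.le, mul_div_cancel₀ _ hr.ne'] at hT
  exact hT

theorem ShiftBound.exists_abs_shiftSum_le {k : ℕ} (h : ShiftBound k 0 1) {ε : ℝ} (hε : 0 < ε) :
    ∃ η : ℝ, 0 < η ∧ η ≤ ε ∧ ∃ C : ℝ, 0 ≤ C ∧ ∀ᶠ T : ℝ in atTop, ∀ M : ℝ, T ^ (1 + η) ≤ M →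
      M ≤ T ^ ((k : ℝ) / 2) → ∀ x ∈ Set.Icc M (2 * M), ∀ t ∈ Set.Icc (1 : ℝ) (M ^ (1 + η) / T),
        |shiftSum k x t| ≤ C * T ^ ε * M ^ (1 + ε) := by
  obtain ⟨η, hη, hηε, h⟩ := h ε hε
  obtain ⟨C, h⟩ := h 1 one_pos
  refine ⟨η, hη, hηε, max C 0, le_max_right _ _, ?_⟩
  filter_upwards [h, eventually_gt_atTop 0] with T hT hT0 M hM hM2 x hx t ht
  have hM0 : 0 < M := (Real.rpow_pos_of_pos hT0 _).trans_le hM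
  have h1 := hT M (2 * M) hM (by rw [one_mul]; exact hM2) (by linarith) le_rfl
  have h2 : ENNReal.ofReal |shiftSum k x t| ≤ G k η M (2 * M) T := by
    unfold G
    exact le_iSup₂_of_le x hx (le_iSup₂_of_le t ht le_rfl)
  have h3 : ENNReal.ofReal |shiftSum k x t| ≤
      ENNReal.ofReal (max C 0 * T ^ ε * M ^ (1 + ε)) := by
    refine (h2.trans h1).trans (ENNReal.ofReal_le_ofReal ?_)
    rw [zero_add]
    gcongr
    exact le_max_left _ _
  rwa [ENNReal.ofReal_le_ofReal_iff (by positivity)] at h3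

-- The same error holds for all dilates `2^i Y`, `i ≤ 5`, with a common `X`; only `i = 0` and `i =
-- 5` will be compared. The last error term is a quarter of `Y^(1-2δ)/T`, small enough to be
-- absorbed by `le_mainMass`.
set_option maxHeartbeats 2000000 in
theorem exists_mean_square_bound {k : ℕ} (hk : 3 ≤ k) (hS : ShiftBound k 0 1) {δ ε : ℝ}
    (hδ : 0 < δ) (hδ' : δ ≤ 1 / 4) (hε : 0 < ε) (hε' : ε ≤ 1 / 100) :
    ∃ η : ℝ, 0 < η ∧ η ≤ ε ∧ ∃ K : ℝ, 0 ≤ K ∧ ∀ L : ℝ, ∀ᶠ T : ℝ in atTop, ∃ X J : ℕ,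
      L ≤ Real.log X ∧ 0 < X ∧ (X : ℝ) ≤ T ^ ((k : ℝ) / 2 + η / 8) / 2 ∧
      T ^ ((k : ℝ) / 2 + η / 4) ≤ (2 ^ J * X : ℕ) ∧
      ((2 ^ J * X : ℕ) : ℝ) ≤ 2 * T ^ ((k : ℝ) / 2 + η / 4) ∧
      ∀ i ≤ 5, |(∫ t, wt T t * ‖dirPoly k (1 / 2 + δ) (2 ^ i * T ^ ((k : ℝ) / 2 + η / 8))
          (2 ^ (J + i) * X) t‖ ^ 2) - 2 * √Real.pi / T *
          mainMass k (1 / 2 + δ) (2 ^ i * T ^ ((k : ℝ) / 2 + η / 8)) X (2 ^ (J + i) * X : ℕ)| ≤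
        K * T ^ (1 + (k + 5) * ε) + T ^ (((k : ℝ) / 2 + η / 8) * (1 - 2 * δ) - 1) / 4 := by
  obtain ⟨η, hη, hηε, C, hC, hshift⟩ := hS.exists_abs_shiftSum_le hε
  have hk0 : (3 : ℝ) ≤ k := by exact_mod_cast hk
  obtain ⟨C', hC', hms⟩ := exists_abs_integral_sub_mainMass_le k (by omega) (θ := ε / (3 * k))
    (by positivity) (by rw [div_le_one (by positivity)]; linarith)
  -- At `N`, which exceeds the dilated cutoff by at least `T^(η/8)`, the tail is then `≪
  -- T^(-(2k+1))`, which cancels `N² T ≤ T^(2k+1)`.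
  set A : ℝ := 8 * (2 * k + 1) / η with hA
  have hA0 : 0 ≤ A := by positivity
  refine ⟨η, hη, hηε, C' * (3 + 1 + C + 1 + Real.exp (A ^ 2)), by positivity, fun L => ?_⟩
  -- The hypothesis is used with `T^(1 + η/4)` in place of `T`. This admits blocks `M` slightly
  -- beyond `T^(k/2)`, as `k ≥ 3` makes `ηk/8` exceed `η/4`. The shorter range of shifts still
  -- contains `P M / T`, because `P T^(η/4) = T^(η/2) ≤ M^η`.
  have htend : Tendsto (fun T : ℝ => T ^ (1 + η / 4)) atTop atTop :=
    tendsto_rpow_atTop (by linarith)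
  filter_upwards [htend.eventually hshift,
    eventually_mul_rpow_le 64 (by linarith : (k : ℝ) / 2 + η / 4 < k),
    eventually_mul_rpow_le 32 (by nlinarith : (k : ℝ) / 2 + η / 4 < (1 + η / 4) * ((k : ℝ) / 2)),
    eventually_rpow_mul_exp_le (2 * k + 1) (by linarith : 0 < η / 2) (by norm_num : 0 < (1 / 1152 : ℝ)),
    eventually_mul_rpow_le (256 * C') (by linarith : ε + η / 8 - 1 < 0),
    eventually_mul_rpow_le 2 (by nlinarith : 1 < (1 + η / 4) * (1 + η)),
    eventually_mul_rpow_le 4 (by nlinarith : (1 + η / 4) * (1 + η) < (k : ℝ) / 2 + η / 8),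
    Real.tendsto_log_atTop.eventually_ge_atTop L, eventually_ge_atTop 1]
    with T h1 h2 h3 h4 h5 h6 h7 h8 hT
  have hT0 : 0 < T := by linarith
  have hmono : ∀ {a b : ℝ}, a ≤ b → T ^ a ≤ T ^ b := fun h =>
    Real.rpow_le_rpow_of_exponent_le hT h
  have hone : ∀ {a : ℝ}, 0 ≤ a → 1 ≤ T ^ a := fun h => Real.one_le_rpow hT h
  have hXexp : (T ^ (1 + η / 4)) ^ (1 + η) = T ^ ((1 + η / 4) * (1 + η)) := by
    rw [← Real.rpow_mul hT0.le]
  -- The least block length that the hypothesis allows at the enlarged parameter; everything below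
  -- it is estimated trivially.
  obtain ⟨X, hXge, hXle⟩ : ∃ X : ℕ, T ^ ((1 + η / 4) * (1 + η)) ≤ X ∧
      (X : ℝ) ≤ 2 * T ^ ((1 + η / 4) * (1 + η)) := by
    refine ⟨_, Nat.le_ceil _, ?_⟩
    have h := Nat.ceil_lt_add_one (a := T ^ ((1 + η / 4) * (1 + η))) (by positivity)
    have h' := hone (a := (1 + η / 4) * (1 + η)) (by positivity)
    linarith only [h, h']
  have hX2T : 2 * T ≤ X := by
    rw [Real.rpow_one] at h6
    linarith
  have hXpos : (0 : ℝ) < X := by linarith only [hX2T, hT0]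
  set y : ℝ := (k : ℝ) / 2 + η / 8 with hy
  have hyz : T ^ y * T ^ (η / 8) = T ^ ((k : ℝ) / 2 + η / 4) := by
    rw [← Real.rpow_add hT0, hy]; ring_nf
  have hXY : (X : ℝ) ≤ T ^ y / 2 := by linarith
  have hYpos : 0 < T ^ y := by positivity
  -- The exponent `n + 1` is the first for which the dyadic endpoint passes `T^(k/2 + η/4)`, so that
  -- endpoint lies within a factor `2` of it.
  obtain ⟨n, hn1, hn2⟩ := exists_nat_pow_near (x := T ^ ((k : ℝ) / 2 + η / 4) / X) (y := 2)
    (by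
      rw [one_le_div hXpos, ← hyz]
      have := le_mul_of_one_le_right hYpos.le (hone (a := η / 8) (by positivity))
      linarith only [this, hXY, hYpos]) one_lt_two
  rw [le_div_iff₀ hXpos] at hn1
  rw [div_lt_iff₀ hXpos] at hn2
  have hNc : ((2 ^ (n + 1) * X : ℕ) : ℝ) = 2 ^ (n + 1) * X := by push_cast; ring
  refine ⟨X, n + 1, h8.trans (Real.log_le_log hT0 (by linarith only [hX2T, hT0])), by exact_mod_cast hXpos, hXY,
    by rw [hNc]; exact hn2.le, by rw [hNc, pow_succ]; linarith, fun i hi => ?_⟩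
  have hi32 : (2 : ℝ) ^ i ≤ 32 := by
    calc (2 : ℝ) ^ i ≤ 2 ^ 5 := pow_le_pow_right₀ one_le_two hi
      _ = 32 := by norm_num
  have hi1 : (1 : ℝ) ≤ 2 ^ i := one_le_pow₀ one_le_two
  set P : ℝ := T ^ (η / 4) with hP
  set Γ : ℝ := C * T ^ ((k + 2) * ε) with hΓ
  have hP1 : 1 ≤ P := hone (by positivity)
  have hPT : P ≤ 2 * T := by
    have := hmono (a := η / 4) (b := 1) (by linarith)
    rw [Real.rpow_one] at this
    linarith
  have hΓ0 : 0 ≤ Γ := by positivity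
  have hmain := hms (1 / 2 + δ) (2 ^ i * T ^ y) T P Γ X (n + 1 + i) (by linarith) (by linarith) hT
    hP1 hPT hX2T hΓ0 (by
      intro j hj x hx t ht1 ht2
      obtain ⟨M, hM⟩ : ∃ M : ℝ, M = ((2 ^ j * X : ℕ) : ℝ) := ⟨_, rfl⟩
      rw [← hM] at ht2 ⊢
      have hMe : M = 2 ^ j * X := by rw [hM, Nat.cast_mul, Nat.cast_pow, Nat.cast_ofNat]
      have hM2 : ((2 ^ (j + 1) * X : ℕ) : ℝ) = 2 * M := by rw [hMe]; push_cast; ring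
      rw [hM2, ← hM] at hx
      have hXM : (X : ℝ) ≤ M := by
        rw [hMe]; exact le_mul_of_one_le_left hXpos.le (one_le_pow₀ one_le_two)
      have hM0 : 0 < M := hXpos.trans_le hXM
      have hMle : M ≤ 32 * T ^ ((k : ℝ) / 2 + η / 4) := by
        have : (2 : ℝ) ^ j ≤ 2 ^ (n + 5) := pow_le_pow_right₀ one_le_two (by omega)
        calc M = 2 ^ j * X := hMe
          _ ≤ 2 ^ (n + 5) * X := by gcongr
          _ = 32 * (2 ^ n * X) := by ring
          _ ≤ _ := by gcongr
      have hMk : M ≤ (T ^ (1 + η / 4)) ^ ((k : ℝ) / 2) := by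
        rw [← Real.rpow_mul hT0.le]; linarith
      have hTM : T ≤ M := by linarith only [hX2T, hXM, hT0]
      have hs := h1 M (by rw [hXexp]; linarith) hMk x hx t ⟨by exact_mod_cast ht1, by
        refine ht2.trans ?_
        rw [div_le_div_iff₀ hT0 (by positivity), Real.rpow_add hM0, Real.rpow_one]
        have e1 : P * T ^ (1 + η / 4) = T ^ (η / 2) * T := by
          rw [hP, ← Real.rpow_add hT0, ← Real.rpow_add_one hT0.ne']; ring_nf
        have e2 : T ^ (η / 2) ≤ M ^ η :=
          (hmono (by linarith : η / 2 ≤ η)).trans (Real.rpow_le_rpow hT0.le hTM hη.le)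
        calc P * M * T ^ (1 + η / 4) = M * T * T ^ (η / 2) := by
              rw [mul_right_comm, e1]; ring
          _ ≤ M * T * M ^ η := by gcongr
          _ = _ := by ring⟩
      refine hs.trans ?_
      rw [Real.rpow_add hM0, Real.rpow_one, hΓ]
      have e3 : M ^ ε ≤ T ^ ((1 + η / 4) * ((k : ℝ) / 2) * ε) := by
        rw [Real.rpow_mul hT0.le, Real.rpow_mul hT0.le]
        exact Real.rpow_le_rpow hM0.le hMk hε.le
      have e4 : (T ^ (1 + η / 4)) ^ ε * T ^ ((1 + η / 4) * ((k : ℝ) / 2) * ε) ≤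
          T ^ ((k + 2) * ε) := by
        rw [← Real.rpow_mul hT0.le, ← Real.rpow_add hT0]
        refine hmono ?_
        have : (1 + η / 4) * (1 + (k : ℝ) / 2) ≤ k + 2 := by
          nlinarith only [mul_nonneg (by linarith : 0 ≤ 1 - η / 4) (by linarith : (0 : ℝ) ≤ k + 2)]
        linarith only [mul_le_mul_of_nonneg_right this hε.le]
      calc _ ≤ C * (T ^ (1 + η / 4)) ^ ε * (M * T ^ ((1 + η / 4) * ((k : ℝ) / 2) * ε)) := by gcongr
        _ = C * ((T ^ (1 + η / 4)) ^ ε * T ^ ((1 + η / 4) * ((k : ℝ) / 2) * ε)) * M := by ring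
        _ ≤ _ := by gcongr)
  refine hmain.trans ?_
  obtain ⟨N, hN⟩ : ∃ N : ℝ, N = ((2 ^ (n + 1 + i) * X : ℕ) : ℝ) := ⟨_, rfl⟩
  rw [← hN]
  have hNe : N = 2 ^ i * (2 ^ (n + 1) * X) := by rw [hN]; push_cast; ring
  have hNge : 2 ^ i * T ^ ((k : ℝ) / 2 + η / 4) ≤ N := by rw [hNe]; gcongr
  have hNle : N ≤ 64 * T ^ ((k : ℝ) / 2 + η / 4) := by
    rw [hNe, pow_succ]
    calc (2 : ℝ) ^ i * (2 ^ n * 2 * X) ≤ 32 * (2 * (2 ^ n * X)) := by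
          rw [mul_right_comm, mul_comm _ (2 : ℝ)]; gcongr
      _ ≤ 32 * (2 * T ^ ((k : ℝ) / 2 + η / 4)) := by gcongr
      _ = _ := by ring
  have hN0 : 0 < N := lt_of_lt_of_le (by positivity) hNge
  have hN1 : 1 ≤ N := by
    exact (one_le_mul_of_one_le_of_one_le hi1 (hone (by positivity))).trans hNge
  have hNk : N ≤ T ^ (k : ℝ) := by linarith
  have hNθ : N ^ (3 * (ε / (3 * k))) ≤ T ^ ε := by
    calc _ ≤ (T ^ (k : ℝ)) ^ (3 * (ε / (3 * k))) := by gcongr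
      _ = T ^ ε := by rw [← Real.rpow_mul hT0.le]; congr 1; field_simp
  have t1 : X * P ≤ 2 * T ^ (1 + 3 * ε) := by
    calc X * P ≤ 2 * T ^ ((1 + η / 4) * (1 + η)) * T ^ (η / 4) := by gcongr
      _ = 2 * T ^ ((1 + η / 4) * (1 + η) + η / 4) := by rw [mul_assoc, ← Real.rpow_add hT0]
      _ ≤ _ := by
          have := hmono (a := (1 + η / 4) * (1 + η) + η / 4) (b := 1 + 3 * ε) (by nlinarith only [hη, hηε, hε'])
          linarith
  have t2 : T * P ^ 2 * (1 + Γ) ≤ (1 + C) * T ^ (1 + (k + 3) * ε) := by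
    have e1 : T * P ^ 2 = T ^ (1 + η / 2) := by
      rw [hP, ← Real.rpow_natCast, ← Real.rpow_mul hT0.le, Real.rpow_add hT0, Real.rpow_one]
      congr 2
      push_cast
      ring
    have e2 : 1 + Γ ≤ (1 + C) * T ^ ((k + 2) * ε) := by
      have := hone (a := (k + 2) * ε) (by positivity)
      rw [hΓ]; linarith
    calc T * P ^ 2 * (1 + Γ) ≤ T ^ (1 + η / 2) * ((1 + C) * T ^ ((k + 2) * ε)) := by
          rw [e1]; gcongr
      _ = (1 + C) * T ^ (1 + η / 2 + (k + 2) * ε) := by rw [Real.rpow_add hT0 (1 + η / 2)]; ring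
      _ ≤ _ := mul_le_mul_of_nonneg_left (hmono (by linarith)) (by positivity)
  have hg : gaussTail (Real.log N - Real.log (2 ^ i * T ^ y)) ≤
      Real.exp (A ^ 2) * T ^ (-(2 * k + 1) : ℝ) := by
    have e1 : η / 8 * Real.log T ≤ Real.log N - Real.log (2 ^ i * T ^ y) := by
      rw [← Real.log_rpow hT0, le_sub_iff_add_le, ← Real.log_mul (by positivity) (by positivity)]
      refine Real.log_le_log (by positivity) ?_
      calc T ^ (η / 8) * (2 ^ i * T ^ y) = 2 ^ i * (T ^ y * T ^ (η / 8)) := by ring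
        _ ≤ N := by rw [hyz]; exact hNge
    refine (gaussTail_antitone e1).trans ((gaussTail_le_exp hA0 _).trans (le_of_eq ?_))
    rw [Real.rpow_def_of_pos hT0, ← Real.exp_add]
    congr 1
    rw [hA]
    field_simp
    ring
  have t4 : N ^ 2 * T * (Real.exp (-P ^ 2 / 1152) +
      gaussTail (Real.log N - Real.log (2 ^ i * T ^ y))) ≤ 1 + Real.exp (A ^ 2) := by
    have e1 : N ^ 2 * T ≤ T ^ (2 * k + 1 : ℝ) := by
      calc N ^ 2 * T ≤ (T ^ (k : ℝ)) ^ 2 * T := by gcongr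
        _ = _ := by
          rw [← Real.rpow_natCast, ← Real.rpow_mul hT0.le, ← Real.rpow_add_one hT0.ne']
          congr 1
          push_cast
          ring
    have e2 : Real.exp (-P ^ 2 / 1152) = Real.exp (-(1 / 1152) * T ^ (η / 2)) := by
      rw [hP, ← Real.rpow_natCast, ← Real.rpow_mul hT0.le]
      congr 1
      rw [show η / 4 * ((2 : ℕ) : ℝ) = η / 2 by push_cast; ring]
      ring
    have e3 : T ^ (2 * k + 1 : ℝ) * (Real.exp (A ^ 2) * T ^ (-(2 * k + 1) : ℝ)) =
        Real.exp (A ^ 2) := by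
      rw [mul_left_comm, ← Real.rpow_add hT0, add_neg_cancel, Real.rpow_zero, mul_one]
    have hgn := gaussTail_nonneg (Real.log N - Real.log (2 ^ i * T ^ y))
    calc _ ≤ T ^ (2 * k + 1 : ℝ) * (Real.exp (-(1 / 1152) * T ^ (η / 2)) +
          Real.exp (A ^ 2) * T ^ (-(2 * k + 1) : ℝ)) := by
          rw [e2]; gcongr
      _ = T ^ (2 * k + 1 : ℝ) * Real.exp (-(1 / 1152) * T ^ (η / 2)) + Real.exp (A ^ 2) := by
          rw [mul_add, e3]
      _ ≤ _ := by linarith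
  -- The Taylor remainder has one more power of `1 / T` than the main term, so it is a vanishing
  -- multiple of `q`.
  have t3 : N ^ (2 - 2 * (1 / 2 + δ)) * T⁻¹ ^ 2 ≤
      64 * T ^ (η / 8 - 1) * T ^ (y * (1 - 2 * δ) - 1) := by
    rw [show 2 - 2 * (1 / 2 + δ) = 1 - 2 * δ by ring]
    calc N ^ (1 - 2 * δ) * T⁻¹ ^ 2 ≤ (64 * (T ^ y * T ^ (η / 8))) ^ (1 - 2 * δ) * T⁻¹ ^ 2 := by
          rw [hyz]; gcongr; linarith
      _ = (64 * T ^ (η / 8)) ^ (1 - 2 * δ) * T ^ (y * (1 - 2 * δ)) * T⁻¹ ^ 2 := by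
          rw [show 64 * (T ^ y * T ^ (η / 8)) = (64 * T ^ (η / 8)) * T ^ y by ring,
            Real.mul_rpow (by positivity) (by positivity), ← Real.rpow_mul hT0.le]
      _ ≤ (64 * T ^ (η / 8)) ^ (1 : ℝ) * T ^ (y * (1 - 2 * δ)) * T⁻¹ ^ 2 := by
          gcongr
          · have := hone (a := η / 8) (by positivity)
            linarith
          · linarith
      _ = _ := by
          rw [Real.rpow_one, Real.rpow_sub_one hT0.ne', Real.rpow_sub_one hT0.ne']
          field_simp
  have hq : 0 < T ^ (y * (1 - 2 * δ) - 1) := by positivity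
  set q := T ^ (y * (1 - 2 * δ) - 1)
  have t3' : C' * T ^ ε * (64 * T ^ (η / 8 - 1) * q) ≤ q / 4 := by
    rw [Real.rpow_zero] at h5
    have e : T ^ ε * T ^ (η / 8 - 1) = T ^ (ε + η / 8 - 1) := by
      rw [← Real.rpow_add hT0]; ring_nf
    calc C' * T ^ ε * (64 * T ^ (η / 8 - 1) * q) =
        (256 * C' * (T ^ ε * T ^ (η / 8 - 1))) * q / 4 := by ring
      _ ≤ 1 * q / 4 := by rw [e]; gcongr
      _ = _ := by ring
  have hgn := gaussTail_nonneg (Real.log N - Real.log (2 ^ i * T ^ y))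
  have hbig : ∀ a : ℝ, a ≤ 1 + (k + 4) * ε → T ^ ε * T ^ a ≤ T ^ (1 + (k + 5) * ε) := by
    intro a ha
    rw [← Real.rpow_add hT0]
    exact hmono (by linarith)
  have b1 := hbig (1 + 3 * ε) (by nlinarith only [hk0, hε])
  have b2 := hbig (1 + (k + 3) * ε) (by linarith only [hε])
  have b3 := hbig 0 (by positivity)
  rw [Real.rpow_zero, mul_one] at b3
  calc _ ≤ C' * T ^ ε * (2 * T ^ (1 + 3 * ε) + (1 + C) * T ^ (1 + (k + 3) * ε) +
        64 * T ^ (η / 8 - 1) * q + (1 + Real.exp (A ^ 2))) := by gcongr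
    _ = C' * (2 * (T ^ ε * T ^ (1 + 3 * ε)) + (1 + C) * (T ^ ε * T ^ (1 + (k + 3) * ε)) +
        (1 + Real.exp (A ^ 2)) * T ^ ε) + C' * T ^ ε * (64 * T ^ (η / 8 - 1) * q) := by ring
    _ ≤ C' * (2 * T ^ (1 + (k + 5) * ε) + (1 + C) * T ^ (1 + (k + 5) * ε) +
        (1 + Real.exp (A ^ 2)) * T ^ (1 + (k + 5) * ε)) + q / 4 := by gcongr
    _ ≤ _ := by
        have : 0 ≤ C' * T ^ (1 + (k + 5) * ε) := by positivity
        linarith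

theorem exists_eventually_integral_norm_sub_sq_le {k : ℕ} (hk : 3 ≤ k) {δ η μ : ℝ} (hδ : 0 < δ)
    (hkδ : 8 * k * δ ≤ 1) (hη : 0 < η) (hη' : η ≤ 1 / 100) (hkη : k * η ≤ 1)
    (hμ : HasMoment (fun t => zetaNorm (1 / 2 + δ) t ^ (2 * k)) μ) :
    ∃ K : ℝ, 0 ≤ K ∧ ∀ᶠ T : ℝ in atTop, ∀ i ≤ 5, ∀ N : ℕ,
      2 ^ i * T ^ ((k : ℝ) / 2 + η / 4) ≤ N → (N : ℝ) ≤ 64 * T ^ ((k : ℝ) / 2 + η / 4) →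
      (∫ t, wt T t * ‖riemannZeta (((1 / 2 + δ : ℝ) : ℂ) + t * Complex.I) ^ k -
        dirPoly k (1 / 2 + δ) (2 ^ i * T ^ ((k : ℝ) / 2 + η / 8)) N t‖ ^ 2) ≤
      K * (T + T ^ (μ - δ * η / 2)) + T ^ (((k : ℝ) / 2 + η / 8) * (1 - 2 * δ) - 1) / 4 := by
  have hk0 : (3 : ℝ) ≤ k := by exact_mod_cast hk
  have hδ4 : δ ≤ 1 / 4 := by
    nlinarith only [hkδ, mul_le_mul_of_nonneg_right hk0 hδ.le]
  -- With `Z = T^(η/8)`, the choice of `A` gives `Z^(-2A) = T^(-6k)`, which balances `Y^6`; the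
  -- choice of `θ` gives `N^(3θ) ≤ T^η`.
  obtain ⟨C, hC, hmain⟩ := exists_integral_norm_sub_sq_le k hδ hδ4 (by linarith)
    (A := 24 * k / η) (by positivity) (θ := η / (3 * k)) (by positivity)
    (by rw [div_le_one (by positivity)]; linarith) hμ
  refine ⟨C * 3, by positivity, ?_⟩
  filter_upwards [eventually_mul_rpow_le 64 (by linarith : (k : ℝ) / 2 + η / 4 < k),
    eventually_rpow_mul_exp_le (2 * k) (by linarith : 0 < η / 4) (by norm_num : 0 < (1 / 8 : ℝ)),
    eventually_mul_rpow_le (256 * C) (by linarith : η / 2 + η - 3 / 4 < 0),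
    eventually_mul_rpow_le 2 (by linarith : 0 < η / 8), eventually_ge_atTop 1]
    with T h1 h2 h3 h4 hT i hi N hN1 hN2
  have hT0 : 0 < T := by linarith only [hT]
  have hmono : ∀ {a b : ℝ}, a ≤ b → T ^ a ≤ T ^ b := fun h =>
    Real.rpow_le_rpow_of_exponent_le hT h
  have hone : ∀ {a : ℝ}, 0 ≤ a → 1 ≤ T ^ a := fun h => Real.one_le_rpow hT h
  have hi1 : (1 : ℝ) ≤ 2 ^ i := one_le_pow₀ one_le_two
  obtain ⟨y, hy⟩ : ∃ y : ℝ, y = (k : ℝ) / 2 + η / 8 := ⟨_, rfl⟩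
  obtain ⟨Z, hZ⟩ : ∃ Z : ℝ, Z = T ^ (η / 8) := ⟨_, rfl⟩
  obtain ⟨Y, hYdef⟩ : ∃ Y : ℝ, Y = 2 ^ i * T ^ y := ⟨_, rfl⟩
  have hyz : T ^ y * Z = T ^ ((k : ℝ) / 2 + η / 4) := by
    rw [hZ, ← Real.rpow_add hT0, hy]; ring_nf
  rw [← hy, ← hYdef]
  have hy0 : 0 ≤ y := by rw [hy]; positivity
  have hY1 : T ^ y ≤ Y := by rw [hYdef]; exact le_mul_of_one_le_left (by positivity) hi1
  have hY2 : 1 ≤ Y := (hone hy0).trans hY1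
  have hZ2 : 2 ≤ Z := by rw [Real.rpow_zero] at h4; linarith only [h4, hZ]
  have hYZ : Y * Z ≤ N := by rw [hYdef, mul_assoc, hyz]; exact hN1
  have hNk : (N : ℝ) ≤ T ^ (k : ℝ) := hN2.trans h1
  have hYk : Y ≤ T ^ (k : ℝ) :=
    (le_mul_of_one_le_right (by linarith only [hY2]) (by linarith only [hZ2])).trans
      (hYZ.trans hNk)
  refine (hmain Y Z T N hY2 hZ2 hYZ hT).trans ?_
  -- The exponent `-4δ (k/2 + η/8) + 2kδ` equals `-δη/2`: the excess of `Y` over `T^(k/2)` is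
  -- exactly what produces the gain.
  have t1 : Y ^ (-(4 * δ)) * T ^ (2 * k * δ + μ) ≤ T ^ (μ - δ * η / 2) := by
    calc Y ^ (-(4 * δ)) * T ^ (2 * k * δ + μ) ≤ (T ^ y) ^ (-(4 * δ)) * T ^ (2 * k * δ + μ) := by
          refine mul_le_mul_of_nonneg_right ?_ (by positivity)
          exact Real.rpow_le_rpow_of_nonpos (by positivity) hY1 (by linarith only [hδ])
      _ = _ := by
          rw [← Real.rpow_mul hT0.le, ← Real.rpow_add hT0, hy]
          ring_nf
  have t2 : Y ^ 6 * Z ^ (-(2 * (24 * k / η))) ≤ 1 := by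
    calc Y ^ 6 * Z ^ (-(2 * (24 * k / η))) ≤
        (T ^ (k : ℝ)) ^ 6 * Z ^ (-(2 * (24 * k / η))) := by gcongr
      _ = T ^ (k * 6 + η / 8 * (-(2 * (24 * k / η)))) := by
          rw [hZ, ← Real.rpow_mul hT0.le, ← Real.rpow_natCast, ← Real.rpow_mul hT0.le,
            ← Real.rpow_add hT0]
          norm_num
      _ = 1 := by
          rw [show k * 6 + η / 8 * (-(2 * (24 * k / η))) = 0 by field_simp; ring, Real.rpow_zero]
  have t3 : Y ^ 2 * Real.exp (-Z ^ 2 / 8) ≤ 1 := by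
    refine le_trans ?_ h2
    have e1 : Real.exp (-Z ^ 2 / 8) = Real.exp (-(1 / 8) * T ^ (η / 4)) := by
      rw [hZ, ← Real.rpow_natCast, ← Real.rpow_mul hT0.le,
        show η / 8 * ((2 : ℕ) : ℝ) = η / 4 by push_cast; ring]
      ring_nf
    rw [e1]
    refine mul_le_mul_of_nonneg_right ?_ (Real.exp_pos _).le
    calc Y ^ 2 ≤ (T ^ (k : ℝ)) ^ 2 := by gcongr
      _ = _ := by
          rw [← Real.rpow_natCast, ← Real.rpow_mul hT0.le]
          congr 1
          push_cast
          ring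
  have t4 : Z ^ 3 / T ^ 2 * Z ^ (2 * k) ≤ T := by
    rw [div_mul_eq_mul_div, div_le_iff₀ (by positivity), ← pow_add, hZ, ← Real.rpow_natCast,
      ← Real.rpow_mul hT0.le]
    calc T ^ (η / 8 * ((3 + 2 * k : ℕ) : ℝ)) ≤ T ^ ((3 : ℕ) : ℝ) := by
          refine hmono ?_
          push_cast
          linarith only [hkη, hη', hη]
      _ = T * T ^ 2 := by rw [Real.rpow_natCast]; ring
  obtain ⟨q, hq⟩ : ∃ q : ℝ, q = T ^ (y * (1 - 2 * δ) - 1) := ⟨_, rfl⟩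
  have hq0 : 0 < q := by rw [hq]; positivity
  have t5 : Z ^ 3 / T ^ 2 * (N : ℝ) ^ (1 + 3 * (η / (3 * k))) ≤
      64 * T ^ (η / 2 + η - 3 / 4) * q := by
    have hN0 : (0 : ℝ) < N := lt_of_lt_of_le (by positivity) hN1
    have e1 : (N : ℝ) ^ (3 * (η / (3 * k))) ≤ T ^ η := by
      calc _ ≤ (T ^ (k : ℝ)) ^ (3 * (η / (3 * k))) := by gcongr
        _ = T ^ η := by rw [← Real.rpow_mul hT0.le]; congr 1; field_simp
    -- As `8kδ ≤ 1`, the factor `T^(2δy)` separating `T^y` from `q T` is at most `T^(1/4)`, so a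
    -- power of `T` is still saved against `q`.
    have e2 : T ^ y ≤ T ^ (1 / 4 : ℝ) * (q * T) := by
      rw [hq, ← Real.rpow_add_one hT0.ne', ← Real.rpow_add hT0]
      refine hmono ?_
      rw [hy]
      nlinarith only [hkδ, mul_le_mul hδ4 hη' hη.le (by norm_num)]
    calc _ ≤ Z ^ 3 / T ^ 2 * (64 * (T ^ (1 / 4 : ℝ) * (q * T) * Z) * T ^ η) := by
          rw [Real.rpow_add hN0, Real.rpow_one]
          gcongr
          refine hN2.trans ?_
          rw [← hyz]
          gcongr
      _ = 64 * (Z ^ 4 * T ^ η * T ^ (1 / 4 : ℝ) / T) * q := by field_simp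
      _ = _ := by
          rw [hZ, ← Real.rpow_natCast, ← Real.rpow_mul hT0.le, ← Real.rpow_add hT0,
            ← Real.rpow_add hT0, ← Real.rpow_sub_one hT0.ne']
          congr 3
          push_cast
          ring
  rw [← hq]
  have t6 : C * (64 * T ^ (η / 2 + η - 3 / 4) * q) ≤ q / 4 := by
    rw [Real.rpow_zero] at h3
    calc C * (64 * T ^ (η / 2 + η - 3 / 4) * q) =
          256 * C * T ^ (η / 2 + η - 3 / 4) * q / 4 := by ring
      _ ≤ 1 * q / 4 := by gcongr
      _ = _ := by ring
  have t7 : T * (Y ^ 6 * Z ^ (-(2 * (24 * k / η))) + Y ^ 2 * Real.exp (-Z ^ 2 / 8)) ≤ T * 2 :=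
    mul_le_mul_of_nonneg_left (by linarith only [t2, t3]) hT0.le
  calc _ ≤ C * (T ^ (μ - δ * η / 2) + T * 2 + (T + 64 * T ^ (η / 2 + η - 3 / 4) * q)) := by
        refine mul_le_mul_of_nonneg_left ?_ hC
        rw [mul_add (Z ^ 3 / T ^ 2)]
        exact add_le_add (add_le_add t1 t7) (add_le_add t4 t5)
    _ = C * (T ^ (μ - δ * η / 2) + 3 * T) + C * (64 * T ^ (η / 2 + η - 3 / 4) * q) := by ring
    _ ≤ C * (T ^ (μ - δ * η / 2) + 3 * T) + q / 4 := by gcongr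
    _ ≤ _ := by
        have : 0 ≤ C * T ^ (μ - δ * η / 2) := by positivity
        linarith only [this]

/-! ### Comparison of two lengths and the self-improving bound. -/

theorem integrable_wt_mul_zetaNorm_pow (k : ℕ) {σ : ℝ} (h1 : 1 / 2 ≤ σ) (h2 : σ ≤ 3 / 4) {T : ℝ}
    (hT : 0 < T) : MeasureTheory.Integrable fun t => wt T t * zetaNorm σ t ^ (2 * k) := by
  obtain ⟨C, hC, h⟩ := exists_zetaNorm_le
  refine integrable_wt_mul ((continuous_zetaNorm (by linarith)).pow _) (K := C ^ (2 * k)) hT (2 * k)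
    (by positivity) fun t => ?_
  change |zetaNorm σ t ^ (2 * k)| ≤ _
  rw [abs_of_nonneg (pow_nonneg (zetaNorm_nonneg _ _) _), ← mul_pow]
  exact pow_le_pow_left₀ (zetaNorm_nonneg _ _) (h σ t (by linarith) h2) _

theorem integrable_wt_mul_norm_sq_dirPoly (k : ℕ) {σ : ℝ} (h1 : 1 / 2 ≤ σ) (Y : ℝ) {N : ℕ}
    (hN : 1 ≤ N) {T : ℝ} (hT : 0 < T) :
    MeasureTheory.Integrable fun t => wt T t * ‖dirPoly k σ Y N t‖ ^ 2 := by
  obtain ⟨C, hC, h⟩ := exists_norm_dirPoly_sq_le k (θ := 1) one_pos le_rfl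
  refine integrable_wt_mul ((continuous_dirPoly k σ Y N).norm.pow 2)
    (K := C * (N : ℝ) ^ (1 + 3 * (1 : ℝ))) hT 0 (by positivity) fun t => ?_
  rw [abs_of_nonneg (sq_nonneg _), pow_zero, mul_one]
  exact h σ Y N t h1 hN

theorem integral_wt_mul_zetaNorm_pow_le (k : ℕ) {σ : ℝ} (h1 : 1 / 2 ≤ σ) (h2 : σ ≤ 3 / 4) (Y : ℝ)
    {N : ℕ} (hN : 1 ≤ N) {T : ℝ} (hT : 0 < T) :
    (∫ t, wt T t * zetaNorm σ t ^ (2 * k)) ≤ 2 * (∫ t, wt T t * ‖dirPoly k σ Y N t‖ ^ 2) +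
      2 * ∫ t, wt T t * ‖riemannZeta ((σ : ℂ) + t * Complex.I) ^ k - dirPoly k σ Y N t‖ ^ 2 := by
  have i2 := (integrable_wt_mul_norm_sq_dirPoly k h1 Y hN hT).const_mul 2
  have i3 := (integrable_wt_mul_norm_sub_sq k h1 h2 Y hN hT).const_mul 2
  rw [← MeasureTheory.integral_const_mul, ← MeasureTheory.integral_const_mul,
    ← MeasureTheory.integral_add i2 i3]
  refine MeasureTheory.integral_mono (integrable_wt_mul_zetaNorm_pow k h1 h2 hT) (i2.add i3)
    fun t => ?_
  have h := norm_sub_sq_le (riemannZeta ((σ : ℂ) + t * Complex.I) ^ k - dirPoly k σ Y N t)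
    (-dirPoly k σ Y N t)
  rw [sub_neg_eq_add, sub_add_cancel, norm_neg, norm_zeta_pow_sq] at h
  have := mul_le_mul_of_nonneg_left h (wt_nonneg T t)
  linarith

theorem integral_wt_mul_norm_sq_dirPoly_le (k : ℕ) {σ : ℝ} (h1 : 1 / 2 ≤ σ) (h2 : σ ≤ 3 / 4)
    (Y : ℝ) {N : ℕ} (hN : 1 ≤ N) {T : ℝ} (hT : 0 < T) :
    (∫ t, wt T t * ‖dirPoly k σ Y N t‖ ^ 2) ≤ 2 * (∫ t, wt T t * zetaNorm σ t ^ (2 * k)) +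
      2 * ∫ t, wt T t * ‖riemannZeta ((σ : ℂ) + t * Complex.I) ^ k - dirPoly k σ Y N t‖ ^ 2 := by
  have i2 := (integrable_wt_mul_zetaNorm_pow k h1 h2 hT).const_mul 2
  have i3 := (integrable_wt_mul_norm_sub_sq k h1 h2 Y hN hT).const_mul 2
  rw [← MeasureTheory.integral_const_mul, ← MeasureTheory.integral_const_mul,
    ← MeasureTheory.integral_add i2 i3]
  refine MeasureTheory.integral_mono (integrable_wt_mul_norm_sq_dirPoly k h1 Y hN hT) (i2.add i3)
    fun t => ?_
  have h := norm_sub_sq_le (riemannZeta ((σ : ℂ) + t * Complex.I) ^ k)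
    (riemannZeta ((σ : ℂ) + t * Complex.I) ^ k - dirPoly k σ Y N t)
  rw [sub_sub_cancel, norm_zeta_pow_sq] at h
  have := mul_le_mul_of_nonneg_left h (wt_nonneg T t)
  linarith

/-- The weight is at least `1/(4e)` on `T/2 ≤ |t| ≤ T`, and `T` is halved repeatedly. Since `θ ≥ 1`,
the contributions form a geometric series of ratio at most `1/2`, which explains the factor `2 * C`.
-/
theorem hasMoment_of_integral_wt_le {f : ℝ → ℝ} (hf : Continuous f) (hf0 : ∀ t, 0 ≤ f t)
    (hint : ∀ T, 0 < T → MeasureTheory.Integrable fun t => wt T t * f t) {θ K : ℝ} (hθ : 1 ≤ θ)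
    (hK : 0 ≤ K) (h : ∀ᶠ T : ℝ in atTop, (∫ t, wt T t * f t) ≤ K * T ^ θ) : HasMoment f θ := by
  obtain ⟨T₁, hT₁⟩ := eventually_atTop.mp (h.and (eventually_ge_atTop 1))
  have hii : ∀ a b, IntervalIntegrable f MeasureTheory.volume a b := hf.intervalIntegrable
  have hT₁0 : 0 < T₁ := by linarith [(hT₁ T₁ le_rfl).2]
  obtain ⟨C, hC⟩ : ∃ C : ℝ, C = 4 * Real.exp 1 * K := ⟨_, rfl⟩
  have hC0 : 0 ≤ C := by rw [hC]; positivity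
  have hstep : ∀ T, T₁ ≤ T →
      (∫ t in (-T)..T, f t) ≤ (∫ t in (-(T / 2))..(T / 2), f t) + C * T ^ θ := by
    intro T hT
    have hT0 : 0 < T := hT₁0.trans_le hT
    have hc : Continuous fun t => 4 * Real.exp 1 * (wt T t * f t) :=
      continuous_const.mul ((continuous_wt T).mul hf)
    have hi := fun a b => hc.intervalIntegrable (μ := MeasureTheory.volume) a b
    have hnn : ∀ t, 0 ≤ 4 * Real.exp 1 * (wt T t * f t) := fun t =>
      mul_nonneg (by positivity) (mul_nonneg (wt_nonneg _ _) (hf0 t))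
    have hpt : ∀ t, T / 2 ≤ |t| → |t| ≤ T → f t ≤ 4 * Real.exp 1 * (wt T t * f t) := by
      intro t h1 h2
      have e : (t / T) ^ 2 = (|t| / T) ^ 2 := by rw [div_pow, div_pow, sq_abs]
      have a1 : 1 / 2 ≤ |t| / T := by rw [le_div_iff₀ hT0]; linarith
      have a2 : |t| / T ≤ 1 := by rw [div_le_one hT0]; exact h2
      have a3 : 1 / 4 ≤ (|t| / T) ^ 2 := by nlinarith
      have a4 : (|t| / T) ^ 2 ≤ 1 := pow_le_one₀ (by positivity) a2
      have a5 : 1 ≤ 4 * Real.exp 1 * wt T t := by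
        rw [wt, e]
        have : 1 ≤ Real.exp 1 * Real.exp (-(|t| / T) ^ 2) := by
          rw [← Real.exp_add]; exact Real.one_le_exp (by linarith)
        nlinarith
      calc f t = 1 * f t := (one_mul _).symm
        _ ≤ 4 * Real.exp 1 * wt T t * f t := mul_le_mul_of_nonneg_right a5 (hf0 t)
        _ = _ := by ring
    have p1 : (∫ t in (-T)..(-(T / 2)), f t) ≤
        ∫ t in (-T)..(-(T / 2)), 4 * Real.exp 1 * (wt T t * f t) :=
      intervalIntegral.integral_mono_on (by linarith) (hii _ _) (hi _ _) fun t ht =>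
        hpt t (by rw [abs_of_nonpos (by linarith [ht.2])]; linarith [ht.2])
          (by rw [abs_of_nonpos (by linarith [ht.2])]; linarith [ht.1])
    have p2 : (∫ t in (T / 2)..T, f t) ≤ ∫ t in (T / 2)..T, 4 * Real.exp 1 * (wt T t * f t) :=
      intervalIntegral.integral_mono_on (by linarith) (hii _ _) (hi _ _) fun t ht =>
        hpt t (by rw [abs_of_nonneg (by linarith [ht.1])]; exact ht.1)
          (by rw [abs_of_nonneg (by linarith [ht.1])]; exact ht.2)
    have p3 : 0 ≤ ∫ t in (-(T / 2))..(T / 2), 4 * Real.exp 1 * (wt T t * f t) :=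
      intervalIntegral.integral_nonneg (by linarith) fun t _ => hnn t
    have p4 : (∫ t in (-T)..T, 4 * Real.exp 1 * (wt T t * f t)) ≤ C * T ^ θ := by
      rw [intervalIntegral.integral_of_le (by linarith)]
      refine (MeasureTheory.setIntegral_le_integral ((hint T hT0).const_mul _)
        (Eventually.of_forall hnn)).trans ?_
      rw [MeasureTheory.integral_const_mul, hC, mul_assoc _ K]
      exact mul_le_mul_of_nonneg_left (hT₁ T hT).1 (by positivity)
    have s1 := intervalIntegral.integral_add_adjacent_intervals (hii (-T) (-(T / 2)))
      (hii (-(T / 2)) (T / 2))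
    have s2 := intervalIntegral.integral_add_adjacent_intervals (hii (-T) (T / 2)) (hii (T / 2) T)
    have s3 := intervalIntegral.integral_add_adjacent_intervals (hi (-T) (-(T / 2)))
      (hi (-(T / 2)) (T / 2))
    have s4 := intervalIntegral.integral_add_adjacent_intervals (hi (-T) (T / 2)) (hi (T / 2) T)
    linarith
  obtain ⟨B, hB⟩ : ∃ B : ℝ, B = ∫ t in (-T₁)..T₁, f t := ⟨_, rfl⟩
  have hB0 : 0 ≤ B := by
    rw [hB]; exact intervalIntegral.integral_nonneg (by linarith) fun t _ => hf0 t
  have hind : ∀ (n : ℕ) (T : ℝ), 0 < T → T ≤ 2 ^ n * T₁ →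
      (∫ t in (-T)..T, f t) ≤ B + 2 * C * T ^ θ := by
    intro n
    have hsmall : ∀ T : ℝ, 0 < T → T ≤ T₁ → (∫ t in (-T)..T, f t) ≤ B + 2 * C * T ^ θ := by
      intro T hT0 hT
      have : (∫ t in (-T)..T, f t) ≤ B := by
        rw [hB]
        exact intervalIntegral.integral_mono_interval (by linarith) (by linarith) hT
          (Eventually.of_forall hf0) (hii _ _)
      have : 0 ≤ 2 * C * T ^ θ := by positivity
      linarith
    induction n with
    | zero => intro T hT0 hT; exact hsmall T hT0 (by simpa using hT)
    | succ n ih =>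
      intro T hT0 hT
      rcases le_total T T₁ with h1 | h1
      · exact hsmall T hT0 h1
      · have h2 := ih (T / 2) (by linarith) (by rw [pow_succ] at hT; linarith)
        have h3 : (T / 2) ^ θ ≤ T ^ θ / 2 := by
          rw [Real.div_rpow hT0.le (by norm_num)]
          have : (2 : ℝ) ≤ 2 ^ θ := by
            calc (2 : ℝ) = 2 ^ (1 : ℝ) := (Real.rpow_one _).symm
              _ ≤ _ := Real.rpow_le_rpow_of_exponent_le one_le_two hθ
          gcongr
        have h4 := hstep T h1
        have h5 := mul_le_mul_of_nonneg_left h3 hC0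
        linarith
  refine ⟨B + 2 * C, by positivity, fun T hT => ?_⟩
  obtain ⟨n, hn⟩ := pow_unbounded_of_one_lt (T / T₁) (one_lt_two (α := ℝ))
  have h1 := hind n T (by linarith) (by rw [div_lt_iff₀ hT₁0] at hn; exact hn.le)
  have h2 : 1 ≤ T ^ θ := Real.one_le_rpow hT (by linarith)
  have := mul_le_mul_of_nonneg_left h2 hB0
  linarith

-- Write `m₀`, `m₅` for the main terms at lengths `Y`, `32Y`. Passing from `m₅` through the moment
-- of `ζ` to `m₀` gives `m₅ ≤ 4 m₀ + errors`, while scaling gives `m₅ ≥ 16 m₀`. Hence `m₀` is an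
-- error term, and so is the moment.
set_option maxHeartbeats 1000000 in
theorem ShiftBound.exists_hasMoment_max {k : ℕ} (hk : 3 ≤ k) (hS : ShiftBound k 0 1) {δ ε : ℝ}
    (hδ : 0 < δ) (hkδ : 8 * k * δ ≤ 1) (hε : 0 < ε) (hε' : ε ≤ 1 / 100) (hkε : k * ε ≤ 1) :
    ∃ η : ℝ, 0 < η ∧ ∀ μ : ℝ, HasMoment (fun t => zetaNorm (1 / 2 + δ) t ^ (2 * k)) μ →
      HasMoment (fun t => zetaNorm (1 / 2 + δ) t ^ (2 * k))
        (max (1 + (k + 5) * ε) (μ - δ * η / 2)) := by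
  have hk0 : (3 : ℝ) ≤ k := by exact_mod_cast hk
  have hδ10 : δ ≤ 1 / 10 := by
    nlinarith only [hkδ, mul_le_mul_of_nonneg_right hk0 hδ.le]
  obtain ⟨η, hη, hηε, K₁, hK₁, hmean⟩ := exists_mean_square_bound hk hS hδ (by linarith) hε hε'
  refine ⟨η, hη, fun μ hμ => ?_⟩
  obtain ⟨K₂, hK₂, happ⟩ := exists_eventually_integral_norm_sub_sq_le hk hδ hkδ hη (by linarith)
    (by nlinarith) hμ
  obtain ⟨L, hpos, hmono⟩ := exists_QQpoly_monotoneOn k hk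
  have h12 : 1 / 2 ≤ 1 / 2 + δ := by linarith
  have h34 : 1 / 2 + δ ≤ 3 / 4 := by linarith
  refine hasMoment_of_integral_wt_le ((continuous_zetaNorm (by linarith)).pow _)
    (fun t => pow_nonneg (zetaNorm_nonneg _ _) _)
    (fun T hT => integrable_wt_mul_zetaNorm_pow k h12 h34 hT) (K := 70 * (K₁ + 2 * K₂))
    (le_max_of_le_left (by nlinarith)) (by positivity) ?_
  filter_upwards [hmean L, happ, eventually_ge_atTop 1] with T h1 h2 hT
  have hT0 : 0 < T := by linarith only [hT]
  obtain ⟨X, J, hLX, hX0, hXY, hN1, hN2, hE⟩ := h1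
  obtain ⟨y, hy⟩ : ∃ y : ℝ, y = (k : ℝ) / 2 + η / 8 := ⟨_, rfl⟩
  obtain ⟨q, hq⟩ : ∃ q : ℝ, q = T ^ (y * (1 - 2 * δ) - 1) := ⟨_, rfl⟩
  rw [← hy] at h2 hE hXY
  rw [← hq] at h2 hE
  have hX0' : (0 : ℝ) < X := by exact_mod_cast hX0
  have hN0 : 1 ≤ 2 ^ J * X := Nat.succ_le_of_lt (by positivity)
  have hN5 : 1 ≤ 2 ^ (J + 5) * X := Nat.succ_le_of_lt (by positivity)
  have hNc : ((2 ^ (J + 5) * X : ℕ) : ℝ) = 2 ^ 5 * ((2 ^ J * X : ℕ) : ℝ) := by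
    push_cast; ring
  have hYN : T ^ y ≤ ((2 ^ J * X : ℕ) : ℝ) := by
    refine le_trans (Real.rpow_le_rpow_of_exponent_le hT ?_) hN1
    rw [hy]; linarith only [hη]
  have hpw : 0 ≤ T ^ ((k : ℝ) / 2 + η / 4) := by positivity
  have E0 := abs_le.mp (hE 0 (by norm_num))
  have E5 := abs_le.mp (hE 5 le_rfl)
  have e0 := h2 0 (by norm_num) (2 ^ J * X) (by rw [pow_zero, one_mul]; exact hN1)
    (by linarith only [hN2, hpw])
  have e5 := h2 5 le_rfl (2 ^ (J + 5) * X) (by rw [hNc]; linarith only [hN1])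
    (by rw [hNc]; linarith only [hN2])
  rw [add_zero, pow_zero, one_mul] at E0
  rw [pow_zero, one_mul] at e0
  have A0 := integral_wt_mul_zetaNorm_pow_le k h12 h34 (T ^ y) hN0 hT0
  have A5 := integral_wt_mul_norm_sq_dirPoly_le k h12 h34 (2 ^ 5 * T ^ y) hN5 hT0
  have hm := le_mainMass k h12 hX0' hXY hYN hLX hpos
  have hXN : (X : ℝ) ≤ ((2 ^ J * X : ℕ) : ℝ) := by
    linarith only [hXY, hYN, hX0']
  have hsc := mainMass_scale k (1 / 2 + δ) (B := 2 ^ 5) (by norm_num)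
    (Real.rpow_pos_of_pos hT0 y) hX0' hXN hLX hpos hmono
  rw [← hNc, show 2 - 2 * (1 / 2 + δ) = 1 - 2 * δ by ring] at hsc
  rw [show 2 - 2 * (1 / 2 + δ) = 1 - 2 * δ by ring, ← Real.rpow_mul hT0.le] at hm
  -- Five doublings suffice because `δ ≤ 1/10` makes `5 (1 - 2δ) ≥ 4`.
  have hc : (16 : ℝ) ≤ (2 ^ 5) ^ (1 - 2 * δ) := by
    calc (16 : ℝ) = 2 ^ (4 : ℝ) := by norm_num
      _ ≤ 2 ^ (5 * (1 - 2 * δ)) :=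
          Real.rpow_le_rpow_of_exponent_le one_le_two (by linarith only [hδ10])
      _ = _ := by rw [Real.rpow_mul (by norm_num)]; norm_num
  have hqT : T ^ (y * (1 - 2 * δ)) = q * T := by
    rw [hq, ← Real.rpow_add_one hT0.ne', sub_add_cancel]
  rw [hqT] at hm
  have hpi := one_le_sqrt_pi
  have hq0 : 0 < q := by rw [hq]; positivity
  obtain ⟨m₀, hm₀⟩ : ∃ m₀ : ℝ, m₀ = 2 * √Real.pi / T *
    mainMass k (1 / 2 + δ) (T ^ y) X (2 ^ J * X : ℕ) := ⟨_, rfl⟩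
  obtain ⟨m₅, hm₅⟩ : ∃ m₅ : ℝ, m₅ = 2 * √Real.pi / T *
    mainMass k (1 / 2 + δ) (2 ^ 5 * T ^ y) X (2 ^ (J + 5) * X : ℕ) := ⟨_, rfl⟩
  rw [← hm₀] at E0
  rw [← hm₅] at E5
  have hmm0 : 0 ≤ mainMass k (1 / 2 + δ) (T ^ y) X (2 ^ J * X : ℕ) :=
    le_trans (by positivity) hm
  -- The errors contain `11q/4` in all, hence at most `11 m₀`. Against `16 m₀ - 4 m₀ = 12 m₀` this
  -- still leaves one `m₀`.
  have r1 : q / 4 ≤ m₀ := by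
    calc q / 4 ≤ √Real.pi * q / 4 := by gcongr; exact le_mul_of_one_le_left hq0.le hpi
      _ = 2 * √Real.pi / T * (q * T / 8) := by field_simp; ring
      _ ≤ _ := by rw [hm₀]; gcongr
  have r2 : 16 * m₀ ≤ m₅ := by
    rw [hm₀, hm₅, mul_left_comm]
    gcongr
    exact le_trans (by gcongr) hsc
  obtain ⟨M, hM⟩ : ∃ M : ℝ, M = max (1 + (k + 5) * ε) (μ - δ * η / 2) := ⟨_, rfl⟩
  rw [← hM]
  have u1 : T ^ (1 + (k + 5) * ε) ≤ T ^ M :=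
    Real.rpow_le_rpow_of_exponent_le hT (hM ▸ le_max_left _ _)
  have u2 : T ^ (μ - δ * η / 2) ≤ T ^ M :=
    Real.rpow_le_rpow_of_exponent_le hT (hM ▸ le_max_right _ _)
  have u3 : T ≤ T ^ M := by
    refine le_trans ?_ u1
    calc T = T ^ (1 : ℝ) := (Real.rpow_one T).symm
      _ ≤ _ := Real.rpow_le_rpow_of_exponent_le hT (le_add_of_nonneg_right (by positivity))
  have v1 := mul_le_mul_of_nonneg_left u1 hK₁
  have v2 := mul_le_mul_of_nonneg_left (add_le_add u3 u2) hK₂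
  change (∫ t, wt T t * zetaNorm (1 / 2 + δ) t ^ (2 * k)) ≤ _
  linarith only [E0.1, E0.2, E5.1, E5.2, e0, e5, A0, A5, r1, r2, v1, v2, hq0,
    mul_nonneg hK₁ (Real.rpow_nonneg hT0.le M), mul_nonneg hK₂ (Real.rpow_nonneg hT0.le M)]

/-! ### Iteration to the exponent `1 + O(ε)`. -/

theorem hasMoment_zetaNorm_pow (k : ℕ) {σ : ℝ} (h1 : 1 / 4 ≤ σ) (h2 : σ ≤ 3 / 4) :
    HasMoment (fun t => zetaNorm σ t ^ (2 * k)) (2 * k + 1) := by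
  obtain ⟨C, hC, h⟩ := exists_zetaNorm_le
  refine ⟨2 * (C * 2) ^ (2 * k), by positivity, fun T hT => ?_⟩
  have hT0 : 0 < T := by linarith
  calc (∫ t in (-T)..T, zetaNorm σ t ^ (2 * k)) ≤ ∫ t in (-T)..T, (C * 2 * T) ^ (2 * k) := by
        refine intervalIntegral.integral_mono_on (by linarith)
          (((continuous_zetaNorm (by linarith)).pow _).intervalIntegrable _ _)
          intervalIntegrable_const fun t ht => ?_
        refine pow_le_pow_left₀ (zetaNorm_nonneg _ _) ((h σ t h1 h2).trans ?_) _
        have : |t| ≤ T := abs_le.mpr ht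
        rw [mul_assoc]
        gcongr
        linarith
    _ = 2 * (C * 2) ^ (2 * k) * T ^ (2 * k + 1 : ℝ) := by
        rw [intervalIntegral.integral_const, smul_eq_mul, mul_pow _ T, Real.rpow_add_one hT0.ne',
          ← Nat.cast_ofNat, ← Nat.cast_mul, Real.rpow_natCast]
        ring

/-- The gain `δη/2` does not depend on the current exponent, so finitely many rounds bring the
trivial exponent down to the floor `1 + (k + 5) ε`. -/
theorem ShiftBound.hasMoment {k : ℕ} (hk : 3 ≤ k) (hS : ShiftBound k 0 1) {δ ε : ℝ}
    (hδ : 0 < δ) (hkδ : 8 * k * δ ≤ 1) (hε : 0 < ε) (hε' : ε ≤ 1 / 100) (hkε : k * ε ≤ 1) :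
    HasMoment (fun t => zetaNorm (1 / 2 + δ) t ^ (2 * k)) (1 + (k + 5) * ε) := by
  have hk0 : (3 : ℝ) ≤ k := by exact_mod_cast hk
  have hδ10 : δ ≤ 1 / 10 := by
    nlinarith only [hkδ, mul_le_mul_of_nonneg_right hk0 hδ.le]
  obtain ⟨η, hη, hstep⟩ := hS.exists_hasMoment_max hk hδ hkδ hε hε' hkε
  have hind : ∀ n : ℕ, HasMoment (fun t => zetaNorm (1 / 2 + δ) t ^ (2 * k))
      (max (1 + (k + 5) * ε) (2 * k + 1 - n * (δ * η / 2))) := by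
    intro n
    have hmax : ∀ μ ν : ℝ, μ ≤ ν → HasMoment (fun t => zetaNorm (1 / 2 + δ) t ^ (2 * k)) μ →
        HasMoment (fun t => zetaNorm (1 / 2 + δ) t ^ (2 * k)) ν := by
      rintro μ ν hμν ⟨C, hC, h⟩
      refine ⟨C, hC, fun T hT => (h T hT).trans ?_⟩
      gcongr
    induction n with
    | zero =>
      refine hmax _ _ ?_ (hasMoment_zetaNorm_pow k (by linarith) (by linarith))
      simp
    | succ n ih =>
      refine hmax _ _ ?_ (hstep _ ih)
      push_cast
      refine max_le (le_max_left _ _) ?_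
      have : 0 < δ * η / 2 := by positivity
      rcases max_cases (1 + (k + 5) * ε) (2 * k + 1 - n * (δ * η / 2)) with h | h
      · rw [h.1]; exact le_max_of_le_left (by linarith)
      · rw [h.1]; exact le_max_of_le_right (by linarith)
  obtain ⟨n, hn⟩ := exists_nat_ge (2 * k / (δ * η / 2))
  have h := hind n
  rw [div_le_iff₀ (by positivity)] at hn
  rwa [max_eq_left (by nlinarith)] at h

/-! ### From the line `1/2 + δ` to the critical line. -/

-- The contour formula is centred on the critical line with sides `Re w = ±δ`; the functional
-- equation carries the left side to the right one at the cost `(1 + t)^(kδ)`. Both sides are then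
-- local averages of `|ζ|^k` on `1/2 + δ`.
set_option maxHeartbeats 1000000 in
theorem exists_zetaNorm_half_pow_le (k : ℕ) {δ : ℝ} (hδ : 0 < δ) (hδ' : δ ≤ 1 / 4) :
    ∃ C : ℝ, 0 ≤ C ∧ ∀ t : ℝ, 2 ≤ t → zetaNorm (1 / 2) t ^ (2 * k) ≤
      C * (1 + t) ^ (2 * k * δ) *
        (∫ y in (-(t / 2))..(t / 2), Real.exp (-y ^ 2) * zetaNorm (1 / 2 + δ) (t + y) ^ (2 * k)) +
      C := by
  obtain ⟨C₀, hC₀, h₀⟩ := exists_norm_riemannZeta_left_le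
  obtain ⟨C₁, hC₁, h₁⟩ := exists_zetaNorm_le
  obtain ⟨C₂, hC₂, h₂⟩ := exists_one_add_pow_mul_exp_le k (by norm_num : (0 : ℝ) < 1 / 8)
  obtain ⟨K₁, hK₁⟩ : ∃ K₁ : ℝ, K₁ = 60 * (2 * C₁) ^ k * C₂ := ⟨_, rfl⟩
  obtain ⟨K₂, hK₂⟩ : ∃ K₂ : ℝ, K₂ = 3 / δ * (1 + (C₀ * 2) ^ k) := ⟨_, rfl⟩
  have hK₁0 : 0 ≤ K₁ := by rw [hK₁]; positivity
  have hK₂0 : 0 ≤ K₂ := by rw [hK₂]; positivity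
  refine ⟨2 * K₁ ^ 2 + 4 * K₂ ^ 2, by positivity, fun t ht => ?_⟩
  obtain ⟨σ, hσ⟩ : ∃ σ : ℝ, σ = 1 / 2 + δ := ⟨_, rfl⟩
  obtain ⟨H, hH⟩ : ∃ H : ℝ, H = t / 2 := ⟨_, rfl⟩
  rw [← hσ, ← hH]
  have hH1 : 1 ≤ H := by linarith
  have hzn : ∀ w : ℂ, riemannZeta (((1 / 2 : ℝ) : ℂ) + t * Complex.I + w) =
      riemannZeta (((1 / 2 + w.re : ℝ) : ℂ) + ((t + w.im : ℝ) : ℂ) * Complex.I) := by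
    intro w
    congr 1
    apply Complex.ext <;> simp
  have hcon := norm_contour_le (g := fun w => riemannZeta (((1 / 2 : ℝ) : ℂ) + t * Complex.I + w) ^ k)
    (G := (2 * C₁) ^ k * (1 + t) ^ k) (by linarith : -δ < 0) (by linarith) hδ (by linarith) hH1
    (by
      intro w hw
      refine DifferentiableAt.differentiableWithinAt (DifferentiableAt.pow ?_ k)
      refine (differentiableAt_riemannZeta ?_).comp w (by fun_prop)
      intro h
      have h' := congrArg Complex.re h
      simp at h'
      linarith [hw.1.2])
    (by
      intro w hw
      have hw1 : -δ ≤ w.re := hw.1.1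
      have hw2 : w.re ≤ δ := hw.1.2
      have hw3 : |w.im| ≤ H := abs_le.mpr hw.2
      rw [norm_pow, hzn, ← mul_pow]
      have := h₁ (1 / 2 + w.re) (t + w.im) (by linarith) (by linarith)
      rw [zetaNorm] at this
      refine pow_le_pow_left₀ (norm_nonneg _) (this.trans ?_) k
      have := abs_add_le t w.im
      rw [abs_of_nonneg (by linarith : 0 ≤ t)] at this
      rw [mul_comm 2, mul_assoc]
      gcongr
      linarith)
  obtain ⟨S, hS⟩ : ∃ S : ℝ, S = ∫ y in (-H)..H, Real.exp (-y ^ 2) * zetaNorm σ (t + y) ^ k :=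
    ⟨_, rfl⟩
  have hψc : Continuous fun y => zetaNorm σ (t + y) ^ k :=
    ((continuous_zetaNorm (show σ ≠ 1 by rw [hσ]; intro h; linarith)).comp
      (continuous_const.add continuous_id)).pow k
  obtain ⟨V, hV⟩ : ∃ V : ℝ, V = (1 + t) ^ (k * δ) := ⟨_, rfl⟩
  have hV1 : 1 ≤ V := by rw [hV]; exact Real.one_le_rpow (by linarith) (by positivity)
  have hright : ‖∫ y in (-H)..H, gaussKernel δ y *
      riemannZeta (((1 / 2 : ℝ) : ℂ) + t * Complex.I + (δ + y * Complex.I)) ^ k‖ ≤ 3 / δ * S := by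
    rw [hS, ← intervalIntegral.integral_const_mul]
    refine intervalIntegral.norm_integral_le_of_norm_le (by linarith)
      (Eventually.of_forall fun y _ => ?_) (Continuous.intervalIntegrable (by fun_prop) _ _)
    have hk := norm_gaussKernel_le_div (c := δ) hδ.ne' (by rw [abs_of_pos hδ]; linarith) y
    rw [abs_of_pos hδ] at hk
    rw [norm_mul, norm_pow, hzn, ← mul_assoc]
    simp only [Complex.add_re, Complex.ofReal_re, Complex.re_ofReal_mul, Complex.I_re, mul_zero,
      add_zero, Complex.add_im, Complex.ofReal_im, Complex.im_ofReal_mul, Complex.I_im, mul_one,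
      zero_add, ← hσ]
    rw [zetaNorm]
    gcongr
  have hleft : ‖∫ y in (-H)..H, gaussKernel (-δ) y *
      riemannZeta (((1 / 2 : ℝ) : ℂ) + t * Complex.I + ((-δ : ℝ) + y * Complex.I)) ^ k‖ ≤
      3 / δ * (C₀ * 2) ^ k * V * S := by
    rw [hS, ← intervalIntegral.integral_const_mul]
    refine intervalIntegral.norm_integral_le_of_norm_le (by linarith)
      (Eventually.of_forall fun y hy => ?_) (Continuous.intervalIntegrable (by fun_prop) _ _)
    have hy1 : |y| ≤ H := abs_le.mpr ⟨hy.1.le, hy.2⟩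
    have hk := norm_gaussKernel_le_div (c := -δ) (by linarith) (by
      rw [abs_neg, abs_of_pos hδ]; linarith) y
    rw [abs_neg, abs_of_pos hδ] at hk
    have hz := h₀ δ hδ (by linarith) (t + y)
    have hty : (1 + |t + y|) ^ δ ≤ 2 * (1 + t) ^ δ := by
      have h5 : 1 + |t + y| ≤ 2 * (1 + t) := by
        have := abs_add_le t y
        rw [abs_of_nonneg (by linarith : 0 ≤ t)] at this
        linarith
      calc (1 + |t + y|) ^ δ ≤ (2 * (1 + t)) ^ δ := by gcongr
        _ = 2 ^ δ * (1 + t) ^ δ := Real.mul_rpow (by norm_num) (by linarith)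
        _ ≤ 2 ^ (1 : ℝ) * (1 + t) ^ δ := by
            refine mul_le_mul_of_nonneg_right ?_ (Real.rpow_nonneg (by linarith) _)
            exact Real.rpow_le_rpow_of_exponent_le one_le_two (by linarith)
        _ = _ := by rw [Real.rpow_one]
    have hzz : ‖riemannZeta (((1 / 2 - δ : ℝ) : ℂ) + ((t + y : ℝ) : ℂ) * Complex.I)‖ ≤
        C₀ * (2 * (1 + t) ^ δ) * zetaNorm σ (t + y) := by
      refine hz.trans ?_
      rw [zetaNorm, hσ]
      gcongr
    rw [norm_mul, norm_pow, hzn]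
    simp only [Complex.add_re, Complex.ofReal_re, Complex.re_ofReal_mul, Complex.I_re, mul_zero,
      add_zero, Complex.add_im, Complex.ofReal_im, Complex.im_ofReal_mul, Complex.I_im, mul_one,
      zero_add, ← sub_eq_add_neg]
    calc _ ≤ 3 / δ * Real.exp (-y ^ 2) *
          (C₀ * (2 * (1 + t) ^ δ) * zetaNorm σ (t + y)) ^ k := by gcongr
      _ = _ := by
          rw [hV, mul_comm (k : ℝ) δ, Real.rpow_mul (by linarith), Real.rpow_natCast]
          rw [mul_pow, ← mul_assoc C₀, mul_pow]
          ring
  have hS0 : 0 ≤ S := by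
    rw [hS]
    exact intervalIntegral.integral_nonneg (by linarith) fun y _ =>
      mul_nonneg (Real.exp_pos _).le (pow_nonneg (zetaNorm_nonneg _ _) k)
  have hS2 : S ^ 2 ≤ 2 * ∫ y in (-H)..H, Real.exp (-y ^ 2) * zetaNorm σ (t + y) ^ (2 * k) := by
    have := sq_integral_exp_mul_le hψc (by linarith : 0 < H)
    simp_rw [← pow_mul, mul_comm k 2] at this
    rwa [hS]
  have hexp : (1 + t) ^ k * Real.exp (-H ^ 2 / 2) ≤ C₂ := by
    have h := h₂ t (by linarith)
    rw [show -H ^ 2 / 2 = -(1 / 8) * t ^ 2 by rw [hH]; ring]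
    refine h.trans (mul_le_of_le_one_right hC₂ (Real.exp_le_one_iff.mpr ?_))
    nlinarith
  have htot : zetaNorm (1 / 2) t ^ k ≤ K₁ + K₂ * (V * S) := by
    simp only [add_zero] at hcon
    have hpi : ‖(2 * Real.pi : ℂ)‖ = 2 * Real.pi := by
      rw [show (2 * Real.pi : ℂ) = ((2 * Real.pi : ℝ) : ℂ) by push_cast; rfl, Complex.norm_real,
        Real.norm_eq_abs, abs_of_pos (by positivity)]
    have h6 : zetaNorm (1 / 2) t ^ k ≤
        ‖2 * Real.pi * riemannZeta (((1 / 2 : ℝ) : ℂ) + t * Complex.I) ^ k‖ := by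
      rw [norm_mul, hpi, norm_pow]
      exact le_mul_of_one_le_left (pow_nonneg (zetaNorm_nonneg _ _) k)
        (by linarith [Real.pi_gt_three])
    have h7 := norm_sub_norm_le (2 * Real.pi * riemannZeta (((1 / 2 : ℝ) : ℂ) + t * Complex.I) ^ k)
      ((∫ y in (-H)..H, gaussKernel δ y *
        riemannZeta (((1 / 2 : ℝ) : ℂ) + t * Complex.I + (δ + y * Complex.I)) ^ k) -
      ∫ y in (-H)..H, gaussKernel (-δ) y *
        riemannZeta (((1 / 2 : ℝ) : ℂ) + t * Complex.I + ((-δ : ℝ) + y * Complex.I)) ^ k)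
    have h8 := norm_sub_le (∫ y in (-H)..H, gaussKernel δ y *
        riemannZeta (((1 / 2 : ℝ) : ℂ) + t * Complex.I + (δ + y * Complex.I)) ^ k)
      (∫ y in (-H)..H, gaussKernel (-δ) y *
        riemannZeta (((1 / 2 : ℝ) : ℂ) + t * Complex.I + ((-δ : ℝ) + y * Complex.I)) ^ k)
    have h9 : 60 * ((2 * C₁) ^ k * (1 + t) ^ k) * Real.exp (-H ^ 2 / 2) ≤ K₁ := by
      rw [hK₁]
      calc _ = 60 * (2 * C₁) ^ k * ((1 + t) ^ k * Real.exp (-H ^ 2 / 2)) := by ring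
        _ ≤ _ := by gcongr
    have h10 : 3 / δ * S ≤ 3 / δ * (V * S) := by
      gcongr
      exact le_mul_of_one_le_left hS0 hV1
    rw [hK₂]
    linarith
  obtain ⟨J, hJ⟩ : ∃ J : ℝ, J = ∫ y in (-H)..H, Real.exp (-y ^ 2) * zetaNorm σ (t + y) ^ (2 * k) :=
    ⟨_, rfl⟩
  rw [← hJ] at hS2 ⊢
  have hV2 : V ^ 2 = (1 + t) ^ (2 * k * δ) := by
    rw [hV, ← Real.rpow_natCast, ← Real.rpow_mul (by linarith)]; congr 1; push_cast; ring
  rw [← hV2]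
  have hVS : (V * S) ^ 2 ≤ V ^ 2 * (2 * J) := by rw [mul_pow]; gcongr
  have hJ0 : 0 ≤ J := by nlinarith [sq_nonneg S]
  calc zetaNorm (1 / 2) t ^ (2 * k) = (zetaNorm (1 / 2) t ^ k) ^ 2 := by rw [← pow_mul, mul_comm]
    _ ≤ (K₁ + K₂ * (V * S)) ^ 2 :=
        pow_le_pow_left₀ (pow_nonneg (zetaNorm_nonneg _ _) k) htot 2
    _ ≤ 2 * K₁ ^ 2 + 2 * K₂ ^ 2 * (V * S) ^ 2 := by nlinarith [sq_nonneg (K₁ - K₂ * (V * S))]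
    _ ≤ 2 * K₁ ^ 2 + 2 * K₂ ^ 2 * (V ^ 2 * (2 * J)) := by gcongr
    _ ≤ _ := by
        have a1 : 0 ≤ K₁ ^ 2 * (V ^ 2 * J) := by positivity
        have a2 : 0 ≤ K₂ ^ 2 := by positivity
        linarith

/-- After exchanging the integrals, each translate of `[0, T]` by `|y| ≤ T` lies in `[-2T, 2T]`, and
the Gaussian has mass at most `2`. -/
theorem integral_integral_exp_mul_le {f : ℝ → ℝ} (hf : Continuous f) (hf0 : ∀ t, 0 ≤ f t) {T : ℝ}
    (hT : 0 ≤ T) :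
    (∫ t in (0 : ℝ)..T, ∫ y in (-T)..T, Real.exp (-y ^ 2) * f (t + y)) ≤
      2 * ∫ t in (-(2 * T))..(2 * T), f t := by
  have hF0 : 0 ≤ ∫ t in (-(2 * T))..(2 * T), f t :=
    intervalIntegral.integral_nonneg (by linarith) fun t _ => hf0 t
  have hc : Continuous (Function.uncurry fun t y => Real.exp (-y ^ 2) * f (t + y)) := by
    simp only [Function.uncurry_def]; fun_prop
  rw [MeasureTheory.intervalIntegral_intervalIntegral_swap
    ((hc.continuousOn.integrableOn_compact (isCompact_uIcc.prod isCompact_uIcc)).mono_set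
      (Set.prod_mono Set.uIoc_subset_uIcc Set.uIoc_subset_uIcc))]
  calc (∫ y in (-T)..T, ∫ t in (0 : ℝ)..T, Real.exp (-y ^ 2) * f (t + y)) ≤
      ∫ y in (-T)..T, Real.exp (-y ^ 2) * ∫ t in (-(2 * T))..(2 * T), f t := by
        refine intervalIntegral.integral_mono_on (by linarith) ?_
          (Continuous.intervalIntegrable (by fun_prop) _ _) fun y hy => ?_
        · refine Continuous.intervalIntegrable ?_ _ _
          exact intervalIntegral.continuous_parametric_intervalIntegral_of_continuous'
            (f := fun y t => Real.exp (-y ^ 2) * f (t + y))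
            (by simp only [Function.uncurry_def]; fun_prop) 0 T
        · rw [intervalIntegral.integral_const_mul]
          refine mul_le_mul_of_nonneg_left ?_ (Real.exp_pos _).le
          rw [intervalIntegral.integral_comp_add_right]
          exact intervalIntegral.integral_mono_interval (by linarith [hy.1]) (by linarith)
            (by linarith [hy.2]) (Eventually.of_forall hf0) (hf.intervalIntegrable _ _)
    _ = (∫ y in (-T)..T, Real.exp (-y ^ 2)) * ∫ t in (-(2 * T))..(2 * T), f t := by
        rw [intervalIntegral.integral_mul_const]
    _ ≤ _ := by
        refine mul_le_mul_of_nonneg_right ?_ hF0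
        rw [intervalIntegral.integral_of_le (by linarith)]
        refine (MeasureTheory.setIntegral_le_integral integrable_exp_neg_sq
          (Eventually.of_forall fun y => (Real.exp_pos _).le)).trans ?_
        have := integral_gaussian 1
        simp only [neg_mul, one_mul, div_one] at this
        rw [this]
        exact sqrt_pi_le_two

theorem HasMoment.exists_integral_half_le {k : ℕ} {δ θ : ℝ} (hδ : 0 < δ) (hδ' : δ ≤ 1 / 4)
    (hθ : 1 ≤ θ) (h : HasMoment (fun t => zetaNorm (1 / 2 + δ) t ^ (2 * k)) θ) :
    ∃ C : ℝ, ∀ T : ℝ, 2 ≤ T →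
      (∫ t in (0 : ℝ)..T, zetaNorm (1 / 2) t ^ (2 * k)) ≤ C * T ^ (2 * k * δ + θ) := by
  obtain ⟨C₁, hC₁, h₁⟩ := h
  obtain ⟨C₂, hC₂, h₂⟩ := exists_zetaNorm_half_pow_le k hδ hδ'
  obtain ⟨C₃, hC₃, h₃⟩ := exists_zetaNorm_le
  obtain ⟨B, hB⟩ : ∃ B : ℝ, B = (C₃ * 3) ^ (2 * k) := ⟨_, rfl⟩
  have hB0 : 0 ≤ B := by rw [hB]; positivity
  refine ⟨C₂ * 2 ^ (2 * k * δ) * (2 * (C₁ * 2 ^ θ)) + (C₂ + B), fun T hT => ?_⟩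
  have hT0 : 0 < T := by linarith
  have hf : Continuous fun t => zetaNorm (1 / 2 + δ) t ^ (2 * k) :=
    (continuous_zetaNorm (by linarith)).pow _
  have hf0 : ∀ t, 0 ≤ zetaNorm (1 / 2 + δ) t ^ (2 * k) := fun t =>
    pow_nonneg (zetaNorm_nonneg _ _) _
  obtain ⟨I, hI⟩ : ∃ I : ℝ → ℝ, I = fun t => ∫ y in (-T)..T,
    Real.exp (-y ^ 2) * zetaNorm (1 / 2 + δ) (t + y) ^ (2 * k) := ⟨_, rfl⟩
  have hIc : Continuous I := by
    rw [hI]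
    exact intervalIntegral.continuous_parametric_intervalIntegral_of_continuous'
      (f := fun t y => Real.exp (-y ^ 2) * zetaNorm (1 / 2 + δ) (t + y) ^ (2 * k))
      (by
        have : Continuous fun p : ℝ × ℝ => zetaNorm (1 / 2 + δ) (p.1 + p.2) ^ (2 * k) :=
          hf.comp (continuous_fst.add continuous_snd)
        simp only [Function.uncurry_def]; fun_prop) _ _
  have hI0 : ∀ t, 0 ≤ I t := fun t => by
    rw [hI]
    exact intervalIntegral.integral_nonneg (by linarith) fun y _ =>
      mul_nonneg (Real.exp_pos _).le (hf0 _)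
  obtain ⟨V, hV⟩ : ∃ V : ℝ, V = C₂ * (2 * T) ^ (2 * k * δ) := ⟨_, rfl⟩
  have hV0 : 0 ≤ V := by rw [hV]; positivity
  have hpt : ∀ t ∈ Set.Icc 0 T, zetaNorm (1 / 2) t ^ (2 * k) ≤ V * I t + (C₂ + B) := by
    intro t ht
    have hVI : 0 ≤ V * I t := mul_nonneg hV0 (hI0 t)
    rcases le_total t 2 with ht2 | ht2
    -- The contour bound needs `t ≥ 2`; on `[0, 2]` the function is bounded outright.
    · have : zetaNorm (1 / 2) t ^ (2 * k) ≤ B := by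
        rw [hB]
        refine pow_le_pow_left₀ (zetaNorm_nonneg _ _)
          ((h₃ _ t (by norm_num) (by norm_num)).trans ?_) _
        rw [abs_of_nonneg ht.1]
        gcongr
        linarith
      linarith
    · refine (h₂ t ht2).trans ?_
      have a1 : (∫ y in (-(t / 2))..(t / 2),
          Real.exp (-y ^ 2) * zetaNorm (1 / 2 + δ) (t + y) ^ (2 * k)) ≤ I t := by
        rw [hI]
        refine intervalIntegral.integral_mono_interval (by linarith [ht.2]) (by linarith)
          (by linarith [ht.2]) (Eventually.of_forall fun y =>
            mul_nonneg (Real.exp_pos _).le (hf0 _)) ?_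
        exact Continuous.intervalIntegrable
          ((by fun_prop : Continuous fun y : ℝ => Real.exp (-y ^ 2)).mul
            (hf.comp (continuous_const.add continuous_id))) _ _
      have a2 : C₂ * (1 + t) ^ (2 * k * δ) ≤ V := by
        rw [hV]
        gcongr
        linarith [ht.2]
      have := mul_le_mul a2 a1 (intervalIntegral.integral_nonneg (by linarith) fun y _ =>
        mul_nonneg (Real.exp_pos _).le (hf0 _)) hV0
      linarith
  have hsum : (∫ t in (0 : ℝ)..T, zetaNorm (1 / 2) t ^ (2 * k)) ≤
      V * (∫ t in (0 : ℝ)..T, I t) + (C₂ + B) * T := by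
    calc _ ≤ ∫ t in (0 : ℝ)..T, (V * I t + (C₂ + B)) :=
          intervalIntegral.integral_mono_on hT0.le
            (((continuous_zetaNorm (by norm_num)).pow _).intervalIntegrable _ _)
            (Continuous.intervalIntegrable (by fun_prop) _ _) hpt
      _ = _ := by
          rw [intervalIntegral.integral_add (Continuous.intervalIntegrable (by fun_prop) _ _)
            intervalIntegrable_const, intervalIntegral.integral_const_mul,
            intervalIntegral.integral_const]
          simp [mul_comm]
  have hIle : (∫ t in (0 : ℝ)..T, I t) ≤ 2 * (C₁ * (2 * T) ^ θ) := by
    rw [hI]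
    refine (integral_integral_exp_mul_le hf hf0 hT0.le).trans ?_
    exact mul_le_mul_of_nonneg_left (h₁ (2 * T) (by linarith)) zero_le_two
  have hTle : T ≤ T ^ (2 * k * δ + θ) := by
    calc T = T ^ (1 : ℝ) := (Real.rpow_one T).symm
      _ ≤ _ := Real.rpow_le_rpow_of_exponent_le (by linarith) (by
        have : 0 ≤ 2 * k * δ := by positivity
        linarith)
  calc _ ≤ V * (2 * (C₁ * (2 * T) ^ θ)) + (C₂ + B) * T ^ (2 * k * δ + θ) := by
        refine hsum.trans ?_
        gcongr
    _ = _ := by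
        rw [hV, Real.mul_rpow zero_le_two hT0.le, Real.mul_rpow zero_le_two hT0.le,
          Real.rpow_add hT0]
        ring

/-! ### The two parts of the theorem. -/

theorem ShiftBound.momentBound {k : ℕ} (hk : 3 ≤ k) (hS : ShiftBound k 0 1) : MomentBound k := by
  intro ε hε
  have hk0 : (3 : ℝ) ≤ k := by exact_mod_cast hk
  -- With `δ = ε = r` the total exponent is `1 + (3k + 5) r`; the factor `100 k` in the denominator
  -- brings it below `1 + ε` and meets all smallness conditions.
  obtain ⟨r, hr⟩ : ∃ r : ℝ, r = min ε 1 / (100 * k) := ⟨_, rfl⟩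
  have hm0 : 0 < min ε 1 := lt_min hε one_pos
  have hr0 : 0 < r := by rw [hr]; positivity
  have hkr : 100 * (k * r) = min ε 1 := by rw [hr]; field_simp
  have hm1 := min_le_left ε 1
  have hm2 := min_le_right ε 1
  have h3r : 3 * r ≤ k * r := by gcongr
  obtain ⟨C, hC⟩ := (hS.hasMoment hk (δ := r) (ε := r) hr0 (by linarith) hr0 (by linarith)
    (by linarith)).exists_integral_half_le hr0 (by linarith)
      (le_add_of_nonneg_right (by positivity))
  refine IsBigO.of_bound |C| ?_
  filter_upwards [eventually_ge_atTop 2] with T hT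
  have hT0 : 0 < T := by linarith
  have hz : ∀ t : ℝ, ‖riemannZeta (1 / 2 + (t : ℂ) * Complex.I)‖ = zetaNorm (1 / 2) t := by
    intro t
    rw [zetaNorm]
    norm_num
  simp_rw [hz]
  rw [Real.norm_of_nonneg (intervalIntegral.integral_nonneg hT0.le fun t _ =>
    pow_nonneg (zetaNorm_nonneg _ _) _), Real.norm_of_nonneg (by positivity)]
  refine (hC T hT).trans ?_
  refine mul_le_mul (le_abs_self C) ?_ (by positivity) (abs_nonneg C)
  exact Real.rpow_le_rpow_of_exponent_le (by linarith) (by linarith)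

/-- For `k = 3` the range `M ≪ T^(3/2)` means `1/T ≪ M^(-2/3)`, so the shifts stay below `M^(1/3 +
η)` up to a constant. This is inside the range of the conjecture, whose bound `H x^(2/3 + ε/2)`
becomes `M^(1 + η + ε/2)`. -/
theorem TernaryShiftConjecture.shiftBound (h : TernaryShiftConjecture) : ShiftBound 3 0 1 := by
  obtain ⟨δ, hδ, h⟩ := h
  intro ε hε
  obtain ⟨η, hη⟩ : ∃ η : ℝ, η = min (ε / 2) (min (δ / 2) 1) := ⟨_, rfl⟩
  have hη0 : 0 < η := by rw [hη]; positivity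
  have hηε : η ≤ ε / 2 := by rw [hη]; exact min_le_left _ _
  have hηδ : η ≤ δ / 2 := by rw [hη]; exact (min_le_right _ _).trans (min_le_left _ _)
  have hη1 : η ≤ 1 := by rw [hη]; exact (min_le_right _ _).trans (min_le_right _ _)
  refine ⟨η, hη0, by linarith, fun A hA => ?_⟩
  obtain ⟨C, hC⟩ := h (ε / 2) (by positivity)
  obtain ⟨x₀, hx₀⟩ := eventually_atTop.mp hC
  obtain ⟨B, hB⟩ : ∃ B : ℝ, B = A ^ (2 / 3 : ℝ) := ⟨_, rfl⟩
  have hB0 : 0 < B := by rw [hB]; positivity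
  obtain ⟨D, hD⟩ : ∃ D : ℝ, D = B * 2 ^ (2 / 3 + ε / 2) := ⟨_, rfl⟩
  have hD0 : 0 < D := by rw [hD]; positivity
  refine ⟨|C| * D, ?_⟩
  filter_upwards [eventually_ge_atTop (max x₀ 1),
    eventually_mul_rpow_le B (by linarith : 0 < δ / 2)] with T hT hTB M M' hM1 hM2 hMM hM'
  have hT1 : 1 ≤ T := (le_max_right _ _).trans hT
  have hT0 : 0 < T := by linarith
  have hTM : T ≤ M := by
    refine le_trans ?_ hM1
    calc T = T ^ (1 : ℝ) := (Real.rpow_one T).symm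
      _ ≤ _ := Real.rpow_le_rpow_of_exponent_le hT1 (by linarith)
  have hM0 : 0 < M := by linarith
  have hMB : M ^ (2 / 3 : ℝ) ≤ B * T := by
    calc M ^ (2 / 3 : ℝ) ≤ (A * T ^ (((3 : ℕ) : ℝ) / 2)) ^ (2 / 3 : ℝ) := by gcongr
      _ = B * T := by
          rw [hB, Real.mul_rpow hA.le (by positivity), ← Real.rpow_mul hT0.le]
          norm_num
  have hinv : M ^ (1 + η) / T ≤ B * M ^ (1 / 3 + η) := by
    rw [div_le_iff₀ hT0]
    calc M ^ (1 + η) = M ^ (1 / 3 + η) * M ^ (2 / 3 : ℝ) := by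
          rw [← Real.rpow_add hM0]; ring_nf
      _ ≤ M ^ (1 / 3 + η) * (B * T) := by gcongr
      _ = _ := by ring
  -- The constant from `M ≪ T^(3/2)` is absorbed into half of the spare exponent `δ`; the other half
  -- accommodates `η`.
  have hBM : B ≤ M ^ (δ / 2) := by
    rw [Real.rpow_zero, mul_one] at hTB
    exact hTB.trans (Real.rpow_le_rpow hT0.le hTM (by linarith))
  have hlen : M ^ (1 + η) / T ≤ M ^ (1 / 3 + δ) := by
    calc _ ≤ M ^ (δ / 2) * M ^ (1 / 3 + η) := hinv.trans (by gcongr)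
      _ = M ^ (δ / 2 + (1 / 3 + η)) := by rw [← Real.rpow_add hM0]
      _ ≤ _ := Real.rpow_le_rpow_of_exponent_le (by linarith) (by linarith)
  refine iSup₂_le fun x hx => iSup₂_le fun t ht => ENNReal.ofReal_le_ofReal ?_
  have hMx : M ≤ x := hx.1
  have hx2 : x ≤ 2 * M := hx.2.trans hM'
  have hx0 : 0 < x := by linarith
  refine (hx₀ x ((le_max_left _ _).trans (hT.trans (hTM.trans hMx))) t ht.1
    ((ht.2.trans hlen).trans (Real.rpow_le_rpow hM0.le hMx (by linarith)))).trans ?_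
  have hTε : 1 ≤ T ^ (0 + ε) := Real.one_le_rpow hT1 (by linarith)
  calc C * t * x ^ (2 / 3 + ε / 2) ≤
        |C| * (B * M ^ (1 / 3 + η)) * (2 * M) ^ (2 / 3 + ε / 2) := by
        have := ht.1
        gcongr
        · exact le_abs_self C
        · exact ht.2.trans hinv
    _ = |C| * D * 1 * M ^ (1 / 3 + η + (2 / 3 + ε / 2)) := by
        rw [hD, Real.mul_rpow zero_le_two hM0.le, Real.rpow_add hM0 (1 / 3 + η)]
        ring
    _ ≤ _ :=
        mul_le_mul (mul_le_mul_of_nonneg_left hTε (by positivity))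
          (Real.rpow_le_rpow_of_exponent_le (by linarith) (by linarith)) (by positivity)
          (by positivity)

end DivisorMoment

end

theorem corollary2 :
    (∀ k : ℕ, 3 ≤ k → DivisorMoment.ShiftBound k 0 1 → DivisorMoment.MomentBound k) ∧
      (DivisorMoment.TernaryShiftConjecture → DivisorMoment.MomentBound 3) :=
  ⟨fun _ hk h => h.momentBound hk, fun h => h.shiftBound.momentBound le_rfl⟩
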